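/- **Setting.** A partially dynamic graph is an unweighted undirected simple graph $G$ on a fixed set of $n\ge 2$ vertices that undergoes either only edge insertions (incremental) or only edge deletions (decremental) and is connected at all times. Let $m$ be the maximum number of edges over the update sequence, let $R=\min_v\max_u d(v,u)$ be the radius of the current graph, and let $R_0$ and $R_f$ be its initial and final values. The model is the randomized word RAM with words of $\Theta(\log(n+q))$ bits, where the accuracy is given as a rational number $\epsilon=p/q$ with $0<\epsilon<1$. *Black box.* Let $\mathcal A$ be an incremental (resp., decremental) truncated approximate SSSP algorithm for undirected graphs: started on any partially dynamic graph (not necessarily connected) with a source $u$, a bound $k\in\mathbb N$ and a rational accuracy $0<\delta<1$, it maintains an estimate $d'(u,v)\in\mathbb N$ for every vertex $v$ such that, whenever $d(u,v)\le k$, $(1-\delta)d(u,v)\le d'(u,v)\le d(u,v)$, and after every update it outputs all vertices whose estimate has changed. Let $T(n,m,k,\delta)$ be a bound on its total time, including reading its input and writing its output, over the start and all updates, on graphs with $n$ vertices and never more than $m$ edges. Assume that $T$ is nondecreasing in $n,m,k,1/\delta$ and grows at most polynomially: $T(2n,2m,2k,\delta/2)\le K\cdot T(n,m,k,\delta)$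 for a constant $K$. **Theorem.** There is a Las Vegas randomized incremental (resp., decremental) algorithm, which uses $\mathcal A$ only as a black box and does not depend on $\mathcal A$ or $T$, that given a partially dynamic graph and $\epsilon$ maintains an estimate $\hat R$ such that, always, at the beginning and after every update, $$R\le \hat R\le (1+\epsilon)\left(\tfrac32 R+\tfrac12\right),$$ and whose total time, including the time of all runs of $\mathcal A$, is with high probability $$\tilde O\left(\max_{R'}\ T(n,m,2R',\epsilon)\,\frac{\sqrt{n/R'}}{\epsilon^2}\right),$$ where the maximum is over the integers $R'$ with $R_f\le R'\le R_0$ (resp., $R_0\le R'\le R_f$). The incremental algorithm works against an oblivious adversary, the decremental one against an adaptive adversary, who sees the estimates $\hat R$. Here "$\tilde O(f)$ with high probability" means: there is an exponent $d$ such that for every constant $c$ there is a constant $C$, depending only on $c$ and $K$, such that the total time is at most $C(\log n)^d f$ with probability at least $1-1/n^c$. -/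

import Mathlib

open MeasureTheory

/-! ## Partially dynamic graphs

An undirected simple graph on the vertices `0, …, n - 1` is presented to algorithms as the list of
its edges, each edge `{u, v}` being written once, as the pair `(u, v)` with `u < v`. -/

/-- An edge `{u, v}`, written with its smaller endpoint first. -/
abbrev Edge := ℕ × ℕ

/-- `(u, v)` is a possible edge of a graph on `0, …, n - 1`. -/
def IsEdge (n : ℕ) (e : Edge) : Prop := e.1 < e.2 ∧ e.2 < n

/-- `l` lists the edges of a graph on `0, …, n - 1` without repetition. -/
def IsEdgeList (n : ℕ) (l : List Edge) : Prop := l.Nodup ∧ ∀ e ∈ l, IsEdge n e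

/-- The unweighted undirected graph with edge list `l`. -/
def graphOf (n : ℕ) (l : List Edge) : SimpleGraph (Fin n) :=
  SimpleGraph.fromRel fun u v => ((u : ℕ), (v : ℕ)) ∈ l

/-- Edges are only inserted, or only deleted. -/
inductive UpdateMode
  | incremental
  | decremental

/-- The edge list after an update at the edge `e`. -/
def applyUpdate : UpdateMode → List Edge → Edge → List Edge
  | .incremental, l, e => l ++ [e]
  | .decremental, l, e => l.erase e

/-- Only absent edges are inserted, only present edges are deleted. -/
def LegalUpdate : UpdateMode → ℕ → List Edge → Edge → Prop
  | .incremental, n, l, e => IsEdge n e ∧ e ∉ l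
  | .decremental, _, l, e => e ∈ l

/-- The edge list after a sequence of updates. -/
def afterUpdates (mode : UpdateMode) (l : List Edge) (us : List Edge) : List Edge :=
  us.foldl (applyUpdate mode) l

/-- Every update of the sequence `us`, started from the edge list `l`, is legal. -/
def LegalSeq (mode : UpdateMode) (n : ℕ) : List Edge → List Edge → Prop
  | _, [] => True
  | l, e :: us => LegalUpdate mode n l e ∧ LegalSeq mode n (applyUpdate mode l e) us

/-- The graph is connected (its diameter is finite) at the beginning and after every update. -/
def AlwaysConnected (mode : UpdateMode) (n : ℕ) (l us : List Edge) : Prop :=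
  ∀ us', us' <+: us → (graphOf n (afterUpdates mode l us')).Connected

/-- The largest number of edges over a legal update sequence: the final number for insertions, the
initial number for deletions. -/
def maxEdges : UpdateMode → List Edge → List Edge → ℕ
  | .incremental, l, us => l.length + us.length
  | .decremental, l, _ => l.length

/-- The radius (of a connected graph, where it is finite). -/
noncomputable def radiusAfter (mode : UpdateMode) (n : ℕ) (l us : List Edge) : ℕ :=
  (graphOf n (afterUpdates mode l us)).radius.toNat

/-! ## Black-box truncated SSSP -/

/-- What a truncated SSSP algorithm is started on: the graph with vertices `0, …, n - 1` and the
given edges, the source `src`, the distance bound `k`, and the accuracy `δ = num / den`. -/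
structure SSSPInput where
  n : ℕ
  edges : List Edge
  src : ℕ
  k : ℕ
  num : ℕ
  den : ℕ

/-- The accuracy parameter. -/
noncomputable def SSSPInput.delta (I : SSSPInput) : ℝ := (I.num : ℝ) / I.den

def SSSPInput.Valid (I : SSSPInput) : Prop :=
  IsEdgeList I.n I.edges ∧ I.src < I.n ∧ 0 < I.num ∧ I.num < I.den

/-- A black-box dynamic single source algorithm, given by its observable behaviour. It may be run
many times; runs are distinguished by their number `id` (different runs need not behave alike, for
instance because they use different random choices). `est id I us v` is the distance estimate for
the vertex `v` that run number `id`, started on `I`, holds after the updates `us`; `changed id I us`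
is the list of vertices that it outputs after the last operation (the start, if `us` is empty, and
otherwise the last update of `us`), and `time id I us` is the time it spends on that operation. -/
structure BlackBox where
  est : ℕ → SSSPInput → List Edge → ℕ → ℕ
  changed : ℕ → SSSPInput → List Edge → List ℕ
  time : ℕ → SSSPInput → List Edge → ℕ

/-- The black box is an incremental (decremental) algorithm for truncated approximate SSSP. Nothing
is required of the estimates of vertices at distance more than `k` from the source. The time of
an operation includes reading its input and writing its output. -/
structure IsTruncatedSSSP (mode : UpdateMode) (B : BlackBox) : Prop where
  accurate : ∀ id I us, I.Valid → LegalSeq mode I.n I.edges us → ∀ s v : Fin I.n, (s : ℕ) = I.src →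
    (graphOf I.n (afterUpdates mode I.edges us)).edist s v ≤ I.k →
      (1 - I.delta) * ((graphOf I.n (afterUpdates mode I.edges us)).dist s v : ℝ) ≤ B.est id I us v ∧
      B.est id I us v ≤ (graphOf I.n (afterUpdates mode I.edges us)).dist s v
  changed_lt : ∀ id I us, I.Valid → LegalSeq mode I.n I.edges us →
    ∀ v ∈ B.changed id I us, v < I.n
  mem_changed_start : ∀ id I, I.Valid → ∀ v < I.n, v ∈ B.changed id I []
  mem_changed_update : ∀ id I us e, I.Valid → LegalSeq mode I.n I.edges (us ++ [e]) →
    ∀ v < I.n, B.est id I (us ++ [e]) v ≠ B.est id I us v → v ∈ B.changed id I (us ++ [e])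
  time_start : ∀ id I, I.Valid → I.n + I.edges.length + (B.changed id I []).length ≤ B.time id I []
  time_update : ∀ id I us e, I.Valid → LegalSeq mode I.n I.edges (us ++ [e]) →
    1 + (B.changed id I (us ++ [e])).length ≤ B.time id I (us ++ [e])

/-- `T n m k δ` bounds the total time of every run of the black box, over its start and all updates,
on graphs with `n` vertices and never more than `m` edges. -/
def RunsInTotalTime (mode : UpdateMode) (B : BlackBox) (T : ℕ → ℕ → ℕ → ℝ → ℝ) : Prop :=
  ∀ id I us, I.Valid → LegalSeq mode I.n I.edges us →
    ((∑ i ∈ Finset.range (us.length + 1), B.time id I (us.take i) : ℕ) : ℝ)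
      ≤ T I.n (maxEdges mode I.edges us) I.k I.delta

/-- `T(n, m, k, δ)` is nondecreasing and grows at most polynomially in `n`, `m`, `k`, `1/δ`. -/
structure PolyGrowth (K : ℝ) (T : ℕ → ℕ → ℕ → ℝ → ℝ) : Prop where
  mono : ∀ n n' m m' k k' δ δ', n ≤ n' → m ≤ m' → k ≤ k' → 0 < δ' → δ' ≤ δ → δ < 1 →
    T n m k δ ≤ T n' m' k' δ'
  doubling : ∀ n m k δ, 0 < δ → δ < 1 → T (2 * n) (2 * m) (2 * k) (δ / 2) ≤ K * T n m k δ

/-! ## A randomized word RAM with calls to a black box -/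

/-- Word operations; subtraction is truncated at zero and division is integer division. -/
inductive WordOp
  | add | sub | mul | div

def WordOp.eval : WordOp → ℕ → ℕ → ℕ
  | .add, a, b => a + b
  | .sub, a, b => a - b
  | .mul, a, b => a * b
  | .div, a, b => a / b

/-- Machine instructions. The arguments are numbers of registers, except for the constant `c`.
* `const x c`: put `c` into register `x`;
* `arith x o y z`: put the result of the operation `o` on the registers `y`, `z` into `x`;
* `load x a`, `store a x`: copy the memory cell whose address is in `a` to `x`, or `x` to that cell;
* `input x`: read the next input word into `x`;
* `random x`: put a uniformly random word into `x`;
* `create x n src k num den addr len`: start a new run of the black box on the graph whose `len`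
  edges are in memory from address `addr` on, and put the number of the run into `x`;
* `tell i u v`: pass an update at the edge `(u, v)` to the run number `i`;
* `nextChange x i`: fetch the next unread output of the run `i`, that is put `v + 1` into `x` if the
  next vertex that it has output is `v`, and `0` if there is none;
* `estimate x i v`: put the current estimate of the run `i` for the vertex `v` into `x`. -/
inductive Instr
  | const (x c : ℕ)
  | arith (x : ℕ) (o : WordOp) (y z : ℕ)
  | load (x a : ℕ)
  | store (a x : ℕ)
  | input (x : ℕ)
  | random (x : ℕ)
  | create (x n src k num den addr len : ℕ)
  | tell (i u v : ℕ)
  | nextChange (x i : ℕ)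
  | estimate (x i v : ℕ)

/-- Structured programs: `cond x P Q` runs `P` if register `x` is nonzero and `Q` otherwise;
`loop x P` repeats `P` as long as register `x` is nonzero. -/
inductive Code
  | instr (i : Instr)
  | seq (P Q : Code)
  | cond (x : ℕ) (P Q : Code)
  | loop (x : ℕ) (P : Code)

/-- A run of the black box: its start data, the updates passed to it so far, and the vertices that
it has output and that have not been fetched yet. -/
structure Session where
  start : SSSPInput
  updates : List Edge
  unread : List ℕ

/-- Machine configurations: registers, memory, remaining input, number of random words used so far,
runs of the black box, and the time spent so far. -/
structure State where
  reg : ℕ → ℕ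
  mem : ℕ → ℕ
  inp : List ℕ
  used : ℕ
  sessions : List Session
  time : ℕ

/-- What a computation depends on besides the program: the black box and the kind of updates that it
accepts, the word length in bits, and the sequence of random words. -/
structure Env where
  mode : UpdateMode
  box : BlackBox
  w : ℕ
  coins : ℕ → Fin (2 ^ w)

/-- Put the word `v` into register `x`, in one time unit. -/
def State.put (s : State) (w x v : ℕ) : State :=
  { s with reg := Function.update s.reg x (v % 2 ^ w), time := s.time + 1 }

open Classical in
/-- One instruction. It takes one time unit; starting the black box and passing an update to it take
in addition the time that the black box spends. A call with arguments that the black box is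
not made for is an error. -/
noncomputable def Instr.step (E : Env) (s : State) : Instr → Option State
  | .const x c => some (s.put E.w x c)
  | .arith x o y z => some (s.put E.w x (o.eval (s.reg y) (s.reg z)))
  | .load x a => some (s.put E.w x (s.mem (s.reg a)))
  | .store a x => some
      { s with mem := Function.update s.mem (s.reg a) (s.reg x), time := s.time + 1 }
  | .input x => some { s.put E.w x (s.inp.headD 0) with inp := s.inp.tail }
  | .random x => some { s.put E.w x (E.coins s.used) with used := s.used + 1 }
  | .create x n src k num den addr len =>
      let id := s.sessions.length
      let I : SSSPInput :=
        { n := s.reg n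
          edges := (List.range (s.reg len)).map fun i =>
            (s.mem (s.reg addr + 2 * i), s.mem (s.reg addr + 2 * i + 1))
          src := s.reg src
          k := s.reg k
          num := s.reg num
          den := s.reg den }
      if I.Valid then
        some { s.put E.w x id with
          sessions := s.sessions ++ [⟨I, [], E.box.changed id I []⟩]
          time := s.time + 1 + E.box.time id I [] }
      else none
  | .tell i u v =>
      let id := s.reg i
      let e : Edge := (s.reg u, s.reg v)
      match s.sessions[id]? with
      | none => none
      | some c =>
        if LegalUpdate E.mode c.start.n (afterUpdates E.mode c.start.edges c.updates) e then
          let us := c.updates ++ [e]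
          some { s with
            sessions := s.sessions.set id ⟨c.start, us, c.unread ++ E.box.changed id c.start us⟩
            time := s.time + 1 + E.box.time id c.start us }
        else none
  | .nextChange x i =>
      match s.sessions[s.reg i]? with
      | none => none
      | some c =>
        match c.unread with
        | [] => some (s.put E.w x 0)
        | v :: rest => some { s.put E.w x (v + 1) with
            sessions := s.sessions.set (s.reg i) { c with unread := rest } }
  | .estimate x i v =>
      match s.sessions[s.reg i]? with
      | none => none
      | some c => some (s.put E.w x (E.box.est (s.reg i) c.start c.updates (s.reg v)))

/-- One time unit, for testing a register. -/
def State.tick (s : State) : State := { s with time := s.time + 1 }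

/-- `Exec E P s s'`: the program `P`, started in the configuration `s`, halts in `s'`. -/
inductive Exec (E : Env) : Code → State → State → Prop
  | instr {i s s'} : Instr.step E s i = some s' → Exec E (.instr i) s s'
  | seq {P Q s s' s''} : Exec E P s s' → Exec E Q s' s'' → Exec E (.seq P Q) s s''
  | condTrue {x P Q s s'} : s.reg x ≠ 0 → Exec E P s.tick s' → Exec E (.cond x P Q) s s'
  | condFalse {x P Q s s'} : s.reg x = 0 → Exec E Q s.tick s' → Exec E (.cond x P Q) s s'
  | loopDone {x P s} : s.reg x = 0 → Exec E (.loop x P) s s.tick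
  | loopStep {x P s s' s''} : s.reg x ≠ 0 → Exec E P s.tick s' → Exec E (.loop x P) s' s'' →
      Exec E (.loop x P) s s''

/-! ## Dynamic algorithms -/

/-- A dynamic algorithm: a program for the start, a program for an update, and the constant `c` of
the word length `c · O(log)`. -/
structure DynAlg where
  setup : Code
  update : Code
  wordConst : ℕ

/-- The number of bits of a word, for graphs with `n` vertices and accuracy `p / q`: a constant
multiple of `log (n + q)`. -/
def DynAlg.wordLength (A : DynAlg) (n q : ℕ) : ℕ := A.wordConst * Nat.size (n + q)

/-- The configuration before the start: the input consists of `n`, the accuracy `p / q`, the number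
of edges, and the edges. -/
def startState (n p q : ℕ) (l : List Edge) : State where
  reg := fun _ => 0
  mem := fun _ => 0
  inp := [n, p, q, l.length] ++ l.flatMap fun e => [e.1, e.2]
  used := 0
  sessions := []
  time := 0

/-- `A.Run E n p q l us outs s`: started on the graph with edge list `l` and given the updates `us`
one after the other, the algorithm `A` halts each time, finally in `s`, and `outs` are the values
that it shows (in register `0`) after the start and after each update. -/
inductive DynAlg.Run (A : DynAlg) (E : Env) (n p q : ℕ) (l : List Edge) :
    List Edge → List ℕ → State → Prop
  | start {s} : Exec E A.setup (startState n p q l) s → A.Run E n p q l [] [s.reg 0] s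
  | update {us outs s s'} (e : Edge) : A.Run E n p q l us outs s →
      Exec E A.update { s with inp := [e.1, e.2] } s' →
      A.Run E n p q l (us ++ [e]) (outs ++ [s'.reg 0]) s'

/-- An adversary chooses the next update (or none, to end the sequence) from the values shown by the
algorithm so far. -/
abbrev Adversary := List ℕ → Option Edge

/-- The updates `us` are those of the adversary when the algorithm shows the values `outs`. -/
def Adversary.Plays (adv : Adversary) (us : List Edge) (outs : List ℕ) : Prop :=
  outs.length = us.length + 1 ∧ ∀ i < us.length, adv (outs.take (i + 1)) = us[i]?

/-- An oblivious adversary fixes its updates in advance: they do not depend on the values shown. -/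
def Adversary.IsOblivious (adv : Adversary) : Prop :=
  ∀ outs outs' : List ℕ, outs.length = outs'.length → adv outs = adv outs'

/-- The adversary makes only legal updates and keeps the graph connected. -/
def Adversary.IsLegal (adv : Adversary) (mode : UpdateMode) (n : ℕ) (l : List Edge) : Prop :=
  ∀ us outs, adv.Plays us outs → LegalSeq mode n l us ∧ AlwaysConnected mode n l us

/-- The law of an infinite sequence of independent uniformly random words of `w` bits. -/
noncomputable def coinLaw (w : ℕ) : Measure (ℕ → Fin (2 ^ w)) :=
  Measure.infinitePi fun _ => (PMF.uniformOfFintype (Fin (2 ^ w))).toMeasure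

/-- The maximum of `T(n, m, 2R', ε) · √(n / R') / ε²` over all values `R'` between the initial and
the final radius. -/
noncomputable def radiusTimeBound (mode : UpdateMode) (T : ℕ → ℕ → ℕ → ℝ → ℝ) (n : ℕ)
    (l us : List Edge) (ε : ℝ) : ℝ :=
  (Finset.uIcc (radiusAfter mode n l []) (radiusAfter mode n l us)).sup' Finset.nonempty_uIcc
    fun R' => T n (maxEdges mode l us) (2 * R') ε * Real.sqrt ((n : ℝ) / R') / ε ^ 2

/-- Las Vegas correctness: with every correct black box and for every outcome of the random choices,
whenever the algorithm shows a value `R̂`, then `R ≤ R̂ ≤ (1 + ε) (3/2 · R + 1/2)`, with `ε = p / q`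
and `R` the radius of the current graph. -/
def DynAlg.MaintainsRadius (A : DynAlg) (mode : UpdateMode) : Prop :=
  ∀ (B : BlackBox), IsTruncatedSSSP mode B →
    ∀ (n p q : ℕ) (l : List Edge), 2 ≤ n → 0 < p → p < q → IsEdgeList n l →
    ∀ us, LegalSeq mode n l us → AlwaysConnected mode n l us →
    ∀ (coins : ℕ → Fin (2 ^ A.wordLength n q)) (outs : List ℕ) (s : State),
      A.Run ⟨mode, B, A.wordLength n q, coins⟩ n p q l us outs s →
        (radiusAfter mode n l us : ℝ) ≤ s.reg 0 ∧
        (s.reg 0 : ℝ) ≤ (1 + (p : ℝ) / q) * (3 / 2 * radiusAfter mode n l us + 1 / 2)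

/-- The set of random choices for which the algorithm, run against the adversary with the black box
`B`, answers all the updates in total time (including that of the black box) at most `bound us`,
where `us` is the update sequence that results. -/
def DynAlg.FinishesWithin (A : DynAlg) (mode : UpdateMode) (B : BlackBox) (n p q : ℕ)
    (l : List Edge) (adv : Adversary) (bound : List Edge → ℝ) :
    Set (ℕ → Fin (2 ^ A.wordLength n q)) :=
  {coins | ∃ us outs s, A.Run ⟨mode, B, A.wordLength n q, coins⟩ n p q l us outs s ∧
    adv.Plays us outs ∧ adv outs = none ∧ (s.time : ℝ) ≤ bound us}

set_option linter.constructorNameAsVariable false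
set_option linter.unusedSimpArgs false
set_option linter.unusedTactic false
set_option linter.unreachableTactic false

/-! ## A small structured language on top of the machine

Programs are written with named variables and arrays, compiled to machine code, and verified by
computing weakest preconditions. -/

/-! Both algorithms guess the radius `R` up to a factor `1 + O(ε)`. For a guess `r`, runs of the
black box with accuracy `ε / 256` are good up to an additive error `σ = slack p q r ≤ ε r / 16` at
distances at most `16 r`. A source whose estimates are all at most `threshold p q r = r + ⌈r/2⌉ +
4σ` gives an upper bound on `R`. The core is the converse: if every source that has been tried
fails, then `R > r`, although only about `√(n/r) / ε` sources are used, up to logarithms.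

The sources are found in two layers. First come about `√(n/r)` random vertices. Assume that there is
a centre with eccentricity at most `r`. If it is within about `r/2` of a random vertex, then that
vertex has eccentricity at most the threshold. Otherwise take a vertex `w` that is farther than
`r/2` from all random vertices. A shortest path from `w` to the centre contains a vertex `y` at
distance `r/2 - 2σ` from `w` (or the centre itself is closer), so every source within `2σ` of `y`
has eccentricity at most the threshold. It suffices to try sources near `w` that are more than `σ`
apart. Their balls of radius `σ/2` are disjoint, have more than `σ/2` vertices each, and lie in the
ball of radius `r/2` around `w`; as that ball is not hit by the sample, with high probability it has
only `O(√(n r) log n)` vertices (`measure_miss_ballBound`). So there are `O(√(n/r) log n / ε)` such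
sources. There are `O(log n / ε)` guesses, and doubling the arguments of `T` eight times absorbs the
constants (`bound_le`, `cost_le`).

Deletions: distances and `R` only grow, so a source that has failed never has to be tried again for
the same guess and the guesses increase. One source is watched at a time; `Stage` records what the
failures have proved, and `Stage.next_zero`, `Stage.next_one`, `Stage.next_two` either give another
source or show `R > r`. The shown value depends on the guess only, so it is constant during a guess.
Hence the graphs that even an adaptive adversary produces during a guess are determined by earlier
random words and the number of updates, and the fresh sample is independent of them
(`hits_of_notMem`, `measure_delMiss_le`).

Insertions: distances and `R` only decrease, the guesses decrease, and all sources of the current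
guess are kept up to date until one of them is accepted. The vertex `w` may come close to the sample
and then has to be replaced. It is chosen at random among the vertices not yet reached; as an
oblivious adversary fixes the order in which they are reached, a choice leaves at most two thirds of
them on average (`sum_choice_le`), so `O(log n)` choices suffice with high probability
(`measure_remains_le`). That no accepted source means `R > r` is `Settled.lt_grad`.

Correctness never uses the random events: the trivial bounds `n` on balls and on replacements always
hold, which makes the algorithms Las Vegas. The time is amortized against the black box: every
operation of a run takes at least as long as its input and output, so processing a change, passing
on an update or passing over all vertices after a start is paid by a constant multiple of the time
of the runs (`credit`, `credit_le`). What remains is constant per update. All this is proved for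
concrete machine code through a calculus of preconditions, `Cmd.WP`, and its soundness, `Cmd.sound`.
-/

/-- Program variables; each of them lives in a register of its own. -/
inductive Var
  | out | n | p | q | m | den | U | r | N | hS | hA | sg | thr | k | x | cur | i | j | e | y | a1 | a2
  | st | c | go | bad | vb | w | a | b | cnt | cand | acc | idx | z | t
  deriving DecidableEq

/-- The register of a variable. -/
def Var.reg (x : Var) : ℕ := x.ctorIdx

theorem Var.reg_lt (x : Var) : x.reg < 99 := by cases x <;> decide

theorem Var.reg_injective : Function.Injective Var.reg := by
  intro x y h
  cases x <;> cases y <;> first | rfl | (exact absurd h (by decide))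

/-- Expressions: variables, constants, word operations, array cells and distance estimates. -/
inductive Expr
  | var (x : Var)
  | const (c : ℕ)
  | bin (o : WordOp) (a b : Expr)
  | arr (j : ℕ) (a : Expr)
  | est (i a : Expr)

instance : Add Expr := ⟨Expr.bin .add⟩
instance : Sub Expr := ⟨Expr.bin .sub⟩
instance : Mul Expr := ⟨Expr.bin .mul⟩
instance : Div Expr := ⟨Expr.bin .div⟩
instance (k : ℕ) : OfNat Expr k := ⟨Expr.const k⟩

prefix:max "↟" => Expr.var

/-- The total time of a run of the black box so far. -/
def Session.boxTime (B : BlackBox) (id : ℕ) (c : Session) : ℕ := ∑ t ∈ Finset.range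
  (c.updates.length + 1), B.time id c.start (c.updates.take t)

/-- The amount that a run of the black box may have paid so far: a multiple of its time, except for
the part that is reserved for fetching the unread output. -/
def Session.credit (B : BlackBox) (id : ℕ) (c : Session) : ℤ := 10001 * (c.boxTime B id :
  ℤ) - 10000 * (c.unread.length : ℤ)

/-- The amount that all runs of the black box may have paid so far. -/
def credit (B : BlackBox) (L : List Session) : ℤ := ∑ i ∈ Finset.range L.length, (L[i]?).elim 0
  (Session.credit B i)

theorem credit_append (B : BlackBox) (L : List Session) (c : Session) : credit B (L ++ [c]) = credit
    B L + c.credit B L.length := by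
  unfold credit
  rw [List.length_append, List.length_singleton, Finset.sum_range_succ]
  congr 1
  · refine Finset.sum_congr rfl fun i hi => ?_
    rw [List.getElem?_append_left (Finset.mem_range.1 hi)]
  · simp

theorem credit_set (B : BlackBox) (L : List Session) (i : ℕ) (c c' : Session) (h : L[i]? = some c) :
    credit B (L.set i c') = credit B L + (c'.credit B i - c.credit B i) := by
  have hi : i < L.length := (List.getElem?_eq_some_iff.1 h).1
  unfold credit
  rw [List.length_set, ← Finset.add_sum_erase _ _ (Finset.mem_range.2 hi), ← Finset.add_sum_erase
    (Finset.range L.length) (fun i => (L[i]?).elim 0 (Session.credit B i)) (Finset.mem_range.2 hi)]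
  have : ∑ x ∈ (Finset.range L.length).erase i, ((L.set i c')[x]?).elim 0 (Session.credit B x) = ∑ x
      ∈ (Finset.range L.length).erase i, (L[x]?).elim 0 (Session.credit B x) := by
    refine Finset.sum_congr rfl fun x hx => ?_
    rw [List.getElem?_set_ne (Finset.ne_of_mem_erase hx).symm]
  have h' : L[i] = c := (List.getElem?_eq_some_iff.1 h).2
  rw [this]
  simp only [List.getElem?_set_self hi, h, Option.elim_some]
  ring

/-- What a program sees of a machine configuration, and a bound on the time that has been spent
beyond what the runs of the black box have paid for. -/
structure View where
  var : Var → ℕ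
  arr : ℕ → ℕ → ℕ
  low : ℕ → ℕ
  inp : List ℕ
  used : ℕ
  sess : List Session
  vt : ℤ

/-- The machine configuration `s` looks like `v`; the arrays are interleaved in the memory from
address `b` on. -/
structure SeenAs (E : Env) (b : ℕ) (s : State) (v : View) : Prop where
  base : s.reg 99 = b
  var : ∀ x : Var, s.reg x.reg = v.var x
  regLt : ∀ x, s.reg x < 2 ^ E.w
  memLt : ∀ a, s.mem a < 2 ^ E.w
  low : ∀ a < b, s.mem a = v.low a
  arr : ∀ j < 8, ∀ i, s.mem (b + 8 * i + j) = v.arr j i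
  inp : s.inp = v.inp
  used : s.used = v.used
  sess : s.sessions = v.sess
  time : (s.time : ℤ) ≤ v.vt + credit E.box v.sess

/-- The view after some more time units. -/
def View.pay (v : View) (c : ℤ) : View := { v with vt := v.vt + c }

/-- Registers from 100 on are scratch space: a view only sees the registers of the variables, which
are below 99, and the base address in register 99. So evaluating an expression changes nothing but
the time. -/
theorem SeenAs.temps {E : Env} {b : ℕ} {s : State} {v : View} (h : SeenAs E b s v) {ρ : ℕ → ℕ}
    (h1 : ∀ x < 100, ρ x = s.reg x) (h2 : ∀ x, ρ x < 2 ^ E.w) (t : ℕ) (c : ℤ)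
    (ht : (t : ℤ) ≤ s.time + c) : SeenAs E b { s with reg := ρ, time := t } (v.pay c) :=
  { h with
    base := (h1 _ (by omega)).trans h.base
    var := fun z => (h1 _ (by have := z.reg_lt; omega)).trans (h.var z)
    regLt := h2
    time := by have := h.time; simp only [View.pay]; omega }

namespace Expr

def eval (E : Env) (v : View) : Expr → ℕ
  | var x => v.var x
  | const c => c
  | bin o a b => o.eval (a.eval E v) (b.eval E v)
  | arr j a => v.arr j (a.eval E v)
  | est i a => (v.sess[i.eval E v]?).elim 0 fun c =>
      E.box.est (i.eval E v) c.start c.updates (a.eval E v) % 2 ^ E.w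

/-- No overflow, and no access to an undefined run, occurs in the evaluation of an expression. -/
def ok (E : Env) (b : ℕ) (v : View) : Expr → Prop
  | var _ => True
  | const c => c < 2 ^ E.w
  | bin .add x y => x.ok E b v ∧ y.ok E b v ∧ x.eval E v + y.eval E v < 2 ^ E.w
  | bin .mul x y => x.ok E b v ∧ y.ok E b v ∧ x.eval E v * y.eval E v < 2 ^ E.w
  | bin .sub x y => x.ok E b v ∧ y.ok E b v
  | bin .div x y => x.ok E b v ∧ y.ok E b v
  | arr j x => x.ok E b v ∧ j < 8 ∧ b + 8 * x.eval E v + 8 < 2 ^ E.w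
  | est i x => i.ok E b v ∧ x.ok E b v ∧ i.eval E v < v.sess.length

def cost : Expr → ℕ
  | var _ => 2
  | const _ => 1
  | bin _ a b => a.cost + b.cost + 1
  | arr _ a => a.cost + 6
  | est i a => i.cost + a.cost + 1

/-- Code that puts the value into register `100 + d`, without changing the registers before it. -/
def code (d : ℕ) : Expr → Code
  | var x => .seq (.instr (.const (100 + d) 0)) (.instr (.arith (100 + d) .add x.reg (100 + d)))
  | const c => .instr (.const (100 + d) c)
  | bin o a b => .seq (a.code d) (.seq (b.code (d + 1)) (.instr (.arith (100 + d) o (100 + d) (100 +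
      (d + 1)))))
  | arr j a => .seq (a.code d) (.seq (.instr (.const (100 + (d + 1)) 8)) (.seq (.instr (.arith (100
      + d) .mul (100 + d) (100 + (d + 1)))) (.seq (.instr (.arith (100 + d) .add 99 (100 + d)))
      (.seq (.instr (.const (100 + (d + 1)) j)) (.seq (.instr (.arith (100 + d) .add (100 + d) (100
      + (d + 1)))) (.instr (.load (100 + d) (100 + d))))))))
  | est i a => .seq (i.code d) (.seq (a.code (d + 1)) (.instr (.estimate (100 + d) (100 + d) (100 +
      (d + 1)))))

theorem eval_est (E : Env) (v : View) (x y : Expr) : (est x y).eval E v = (v.sess[x.eval E v]?).elim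
    0 fun c =>
      E.box.est (x.eval E v) c.start c.updates (y.eval E v) % 2 ^ E.w := rfl

/-- The rules for the evaluation of expressions. -/
@[simp] theorem rules : (∀ E v, (∀ z : Var, (var z).eval E v = v.var z) ∧ (∀ k, (ofNat(k) :
    Expr).eval E v = k) ∧ (∀ j x, (arr j x).eval E v = v.arr j (x.eval E v)) ∧ ∀ x y : Expr,
    (x + y).eval E v = x.eval E v + y.eval E v ∧ (x - y).eval E v = x.eval E v - y.eval E v ∧
    (x * y).eval E v = x.eval E v * y.eval E v ∧ (x / y).eval E v = x.eval E v / y.eval E v) ∧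
    (∀ E b v, (∀ z : Var, (var z).ok E b v ↔ True) ∧ (∀ k, (ofNat(k) : Expr).ok E b v ↔ k < 2 ^ E.w)
    ∧ (∀ j x, (arr j x).ok E b v ↔ x.ok E b v ∧ j < 8 ∧ b + 8 * x.eval E v + 8 < 2 ^ E.w) ∧ ∀ x y :
    Expr, ((x + y).ok E b v ↔ x.ok E b v ∧ y.ok E b v ∧ x.eval E v + y.eval E v < 2 ^ E.w) ∧
    ((x * y).ok E b v ↔ x.ok E b v ∧ y.ok E b v ∧ x.eval E v * y.eval E v < 2 ^ E.w) ∧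
    ((x - y).ok E b v ↔ x.ok E b v ∧ y.ok E b v) ∧ ((x / y).ok E b v ↔ x.ok E b v ∧ y.ok E b v) ∧
    ((est x y).ok E b v ↔ x.ok E b v ∧ y.ok E b v ∧ x.eval E v < v.sess.length)) ∧ (∀ z : Var,
    (var z).cost = 2) ∧ (∀ k, (ofNat(k) : Expr).cost = 1) ∧ (∀ j x, (arr j x).cost = x.cost + 6) ∧
    ∀ x y : Expr, (x + y).cost = x.cost + y.cost + 1 ∧ (x - y).cost = x.cost + y.cost + 1 ∧
    (x * y).cost = x.cost + y.cost + 1 ∧ (x / y).cost = x.cost + y.cost + 1 ∧ (est x y).cost =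
    x.cost + y.cost + 1 := by
  and_intros <;> intros <;> and_intros <;> intros <;> and_intros <;> rfl

theorem eval_vt {E : Env} (e : Expr) (v : View) (t : ℤ) : e.eval E { v with vt := t } = e.eval E
    v := by
  induction e with
  | var x => rfl
  | const c => rfl
  | bin o x y hx hy => simp only [eval, hx, hy]
  | arr j x hx => simp only [eval, hx]
  | est x y hx hy => simp only [eval, hx, hy]

theorem ok_vt {E : Env} {b : ℕ} (e : Expr) (v : View) (t : ℤ) : e.ok E b { v with vt := t } ↔ e.ok E
    b v := by
  induction e with
  | var x => exact Iff.rfl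
  | const c => exact Iff.rfl
  | bin o x y hx hy => cases o <;> simp only [ok, hx, hy, eval_vt]
  | arr j x hx => simp only [ok, hx, eval_vt]
  | est x y hx hy => simp only [ok, hx, hy, eval_vt]

/-- Scratch registers form a stack: the code at depth `d` leaves registers below `100 + d` alone, so
a left operand in `100 + d` survives the evaluation of the right one at depth `d + 1`. That register
contents fit into words is carried along, because some overflow conditions follow from it. -/
theorem exec_code (E : Env) (b : ℕ) (e : Expr) : ∀ (d : ℕ) (s : State) (v : View), SeenAs E b s v →
    e.ok E b v → ∃ ρ : ℕ → ℕ, Exec E (e.code d) s { s with reg := ρ, time := s.time + e.cost } ∧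
    ρ (100 + d) = e.eval E v ∧ (∀ x < 100 + d, ρ x = s.reg x) ∧ ∀ x, ρ x < 2 ^ E.w := by
  have upd : ∀ (s : State) (z a : ℕ), (∀ x, s.reg x < 2 ^ E.w) → ∀ x, Function.update s.reg z (a % 2
      ^ E.w) x < 2 ^ E.w := by
    intro s z a hs x
    rw [Function.update_apply]
    split_ifs
    · exact Nat.mod_lt _ (by positivity)
    · exact hs x
  induction e with
  | var x =>
    intro d s v h _
    have hx := x.reg_lt
    refine ⟨Function.update (Function.update s.reg (100 + d) 0) (100 + d) (s.reg x.reg), ?_, ?_, ?_,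
      ?_⟩
    · refine Exec.seq (Exec.instr rfl) (Exec.instr ?_)
      have : (Function.update s.reg (100 + d) 0 x.reg) = s.reg x.reg := Function.update_of_ne
        (by omega) _ _
      simp [Instr.step, State.put, WordOp.eval, this, Nat.mod_eq_of_lt (h.regLt _), cost]
    · simp [eval, h.var]
    · grind
    · intro z
      simp only [Function.update_apply]
      split_ifs
      exacts [h.regLt _, h.regLt _]
  | const c =>
    intro d s v h hc
    refine ⟨Function.update s.reg (100 + d) (c % 2 ^ E.w), Exec.instr rfl, ?_, ?_, ?_⟩
    · simp [eval, Nat.mod_eq_of_lt hc]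
    · grind
    · exact upd _ _ _ h.regLt
  | bin o x y hx hy =>
    intro d s v h hok
    -- For subtraction and division no bound on the result is demanded; it follows from a bound on
    -- the left operand. The second alternative, an oversized left operand, is refuted below, since
    -- the operand has been computed into a register.
    have hok' : x.ok E b v ∧ y.ok E b v ∧ o.eval (x.eval E v) (y.eval E v) < 2 ^ E.w ∨ ¬ x.eval E v
        < 2 ^ E.w ∧ x.ok E b v ∧ y.ok E b v := by
      by_cases hl : x.eval E v < 2 ^ E.w
      · left
        cases o
        · exact ⟨hok.1, hok.2.1, hok.2.2⟩
        · exact ⟨hok.1, hok.2, lt_of_le_of_lt (Nat.sub_le _ _) hl⟩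
        · exact ⟨hok.1, hok.2.1, hok.2.2⟩
        · exact ⟨hok.1, hok.2, lt_of_le_of_lt (Nat.div_le_self _ _) hl⟩
      · right
        refine ⟨hl, ?_⟩
        cases o <;> first | exact ⟨hok.1, hok.2.1⟩ | exact ⟨hok.1, hok.2⟩
    obtain ⟨ρ, e1, e2, e3, e4⟩ := hx d s v h (by rcases hok' with h | h; exacts [h.1, h.2.1])
    have h' := h.temps (fun z hz => e3 z (by omega)) e4 (s.time + x.cost) x.cost (by simp)
    obtain ⟨ρ', f1, f2, f3, f4⟩ := hy (d + 1) _ _ h' ((ok_vt _ _ _).2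
      (by rcases hok' with h | h; exacts [h.2.1, h.2.2]))
    replace f2 := f2.trans (eval_vt y v _)
    have hx2 : ρ' (100 + d) = x.eval E v := by grind
    have hr : o.eval (x.eval E v) (y.eval E v) < 2 ^ E.w := by grind
    refine ⟨Function.update ρ' (100 + d) (o.eval (x.eval E v) (y.eval E v)), ?_, ?_, ?_, ?_⟩
    · refine Exec.seq e1 (Exec.seq f1 (Exec.instr ?_))
      simp only [Instr.step, State.put, hx2, f2, Nat.mod_eq_of_lt hr, cost]
      congr 2
      omega
    · simp [eval]
    · grind
    · grind
  | arr j x hx =>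
    intro d s v h hok
    obtain ⟨ρ, e1, e2, e3, e4⟩ := hx d s v h hok.1
    have hj := hok.2.1
    have hb := hok.2.2
    have hbase : ρ 99 = b := by rw [e3 _ (by omega), h.base]
    have h8 : 8 % 2 ^ E.w = 8 := Nat.mod_eq_of_lt (by omega)
    have hjm : j % 2 ^ E.w = j := Nat.mod_eq_of_lt (by omega)
    have hmem : s.mem (b + 8 * x.eval E v + j) = v.arr j (x.eval E v) := h.arr j hj _
    refine ⟨Function.update (Function.update ρ (100 + (d + 1)) j) (100 + d) (v.arr j (x.eval E v)),
      ?_, ?_, ?_, ?_⟩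
    · refine Exec.seq e1 (Exec.seq (Exec.instr rfl) (Exec.seq (Exec.instr rfl) (Exec.seq (Exec.instr
        rfl) (Exec.seq (Exec.instr rfl) (Exec.seq (Exec.instr rfl) (Exec.instr ?_))))))
      have a1 : x.eval E v * 8 % 2 ^ E.w = 8 * x.eval E v := by
        rw [Nat.mod_eq_of_lt (by omega)]; omega
      have a2 : (b + 8 * x.eval E v) % 2 ^ E.w = b + 8 * x.eval E v := Nat.mod_eq_of_lt (by omega)
      have a3 : (b + 8 * x.eval E v + j) % 2 ^ E.w = b + 8 * x.eval E v + j := Nat.mod_eq_of_lt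
        (by omega)
      have a4 : v.arr j (x.eval E v) % 2 ^ E.w = v.arr j (x.eval E v) := Nat.mod_eq_of_lt (hmem ▸
        h.memLt _)
      simp only [Instr.step, State.put, WordOp.eval, h8, hjm]
      have n1 : (100 + d) ≠ 100 + (d + 1) := by omega
      have n2 : (99 : ℕ) ≠ 100 + (d + 1) := by omega
      have n3 : (99 : ℕ) ≠ 100 + d := by omega
      simp only [Function.update_self, Function.update_of_ne n1, Function.update_of_ne n2,
        Function.update_of_ne n3, hbase, e2, a1, a2, a3, hmem, a4, cost]
      congr 2
      funext z
      simp only [Function.update_apply]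
      split_ifs <;> rfl
    · simp [eval]
    · grind
    · intro z
      simp only [Function.update_apply]
      split_ifs
      · exact hmem ▸ h.memLt _
      · omega
      · exact e4 z
  | est x y hx hy =>
    intro d s v h hok
    obtain ⟨ρ, e1, e2, e3, e4⟩ := hx d s v h hok.1
    have h' := h.temps (fun z hz => e3 z (by omega)) e4 (s.time + x.cost) x.cost (by simp)
    obtain ⟨ρ', f1, f2, f3, f4⟩ := hy (d + 1) _ _ h' ((ok_vt _ _ _).2 hok.2.1)
    replace f2 := f2.trans (eval_vt y v _)
    have hx2 : ρ' (100 + d) = x.eval E v := by grind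
    have hl := hok.2.2
    refine ⟨Function.update ρ' (100 + d) ((est x y).eval E v), ?_, ?_, ?_, ?_⟩
    · refine Exec.seq e1 (Exec.seq f1 (Exec.instr ?_))
      simp only [Instr.step, State.put, hx2, f2, h.sess, eval, cost, List.getElem?_eq_getElem hl,
        Option.elim_some]
      congr 2
      omega
    · simp [eval]
    · grind
    · intro z
      rw [Function.update_apply]
      split_ifs
      · simp only [eval, List.getElem?_eq_getElem hl, Option.elim_some]
        exact Nat.mod_lt _ (by positivity)
      · exact f4 z

end Expr

/-- Commands: assignments to variables, array cells and cells of the edge list, reading the input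
and random words, calls of the black box, and control structures. -/
inductive Cmd
  | skip
  | set (x : Var) (e : Expr)
  | aset (j : ℕ) (i e : Expr)
  | lowset (i e : Expr)
  | inp (x : Var)
  | rnd (x : Var)
  | create (x n src k num den len : Var)
  | tell (i u v : Var)
  | next (x i : Var)
  | seq (P Q : Cmd)
  | ite (e : Expr) (P Q : Cmd)
  | whil (e : Expr) (P : Cmd)

infixr:60 " ;; " => Cmd.seq

/-- The view after an assignment. -/
def View.assign (v : View) (x : Var) (a : ℕ) (c : ℤ) :
  View := { v with var := Function.update v.var x a, vt := v.vt + c }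

namespace Cmd

def code : Cmd → Code
  | skip => .instr (.const 100 0)
  | set x e => .seq (e.code 0) (.seq (.instr (.const 101 0)) (.instr (.arith x.reg .add 100 101)))
  | aset j i e => .seq (i.code 0) (.seq (e.code 1) (.seq (.instr (.const 102 8)) (.seq (.instr
      (.arith 100 .mul 100 102)) (.seq (.instr (.arith 100 .add 99 100)) (.seq (.instr (.const 102
      j)) (.seq (.instr (.arith 100 .add 100 102)) (.instr (.store 100 101))))))))
  | lowset i e => .seq (i.code 0) (.seq (e.code 1) (.instr (.store 100 101)))
  | inp x => .instr (.input x.reg)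
  | rnd x => .instr (.random x.reg)
  | create x n src k num den len => .seq (.instr (.const 100 0)) (.instr (.create x.reg n.reg
      src.reg k.reg num.reg den.reg 100 len.reg))
  | tell i u v => .instr (.tell i.reg u.reg v.reg)
  | next x i => .instr (.nextChange x.reg i.reg)
  | seq P Q => .seq P.code Q.code
  | ite e P Q => .seq (e.code 0) (.cond 100 P.code Q.code)
  | whil e P => .seq (e.code 0) (.loop 100 (.seq P.code (e.code 0)))

/-- What a run of the black box created from the given variables is started on. -/
def startOf (v : View) (n src k num den len : Var) : SSSPInput where
  n := v.var n
  edges := (List.range (v.var len)).map fun i => (v.low (2 * i), v.low (2 * i + 1))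
  src := v.var src
  k := v.var k
  num := v.var num
  den := v.var den

/-- A precondition which guarantees that the command terminates in a view with property `Q`; the
loop rule asks for an invariant and a variant. -/
def WP (E : Env) (b : ℕ) : Cmd → (View → Prop) → View → Prop
  | skip, Q, v => Q (v.pay 1)
  | set x e, Q, v => e.ok E b v ∧ Q (v.assign x (e.eval E v) (e.cost + 2))
  | aset j i e, Q, v => i.ok E b v ∧ e.ok E b v ∧ j < 8 ∧ b + 8 * i.eval E v + 8 < 2 ^ E.w ∧
      Q { v with
        arr := Function.update v.arr j (Function.update (v.arr j) (i.eval E v) (e.eval E v))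
        vt := v.vt + (i.cost + e.cost + 6) }
  | lowset i e, Q, v => i.ok E b v ∧ e.ok E b v ∧ i.eval E v < b ∧
      Q { v with
        low := Function.update v.low (i.eval E v) (e.eval E v)
        vt := v.vt + (i.cost + e.cost + 1) }
  | inp x, Q, v => Q { v.assign x (v.inp.headD 0 % 2 ^ E.w) 1 with inp := v.inp.tail }
  | rnd x, Q, v => Q { v.assign x (E.coins v.used) 1 with used := v.used + 1 }
  | create x n src k num den len, Q, v =>
      let I := startOf v n src k num den len
      2 * v.var len ≤ b ∧ I.Valid ∧ v.sess.length < 2 ^ E.w ∧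
      Q { v.assign x v.sess.length (2 - 10000 * ((I.n : ℤ) + I.edges.length)) with
        sess := v.sess ++ [⟨I, [], E.box.changed v.sess.length I []⟩] }
  | tell i x y, Q, v =>
      let e : Edge := (v.var x, v.var y)
      ∃ c, v.sess[v.var i]? = some c ∧ c.start.Valid ∧
        LegalSeq E.mode c.start.n c.start.edges (c.updates ++ [e]) ∧
        LegalUpdate E.mode c.start.n (afterUpdates E.mode c.start.edges c.updates) e ∧
        Q { v with
          sess := v.sess.set (v.var i) ⟨c.start, c.updates ++ [e],
            c.unread ++ E.box.changed (v.var i) c.start (c.updates ++ [e])⟩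
          vt := v.vt + (1 - 10000) }
  | next x i, Q, v => ∃ c, v.sess[v.var i]? = some c ∧
      (c.unread = [] → Q (v.assign x 0 1)) ∧
      ∀ a L, c.unread = a :: L → a + 1 < 2 ^ E.w ∧
        Q { v.assign x (a + 1) (1 - 10000) with
          sess := v.sess.set (v.var i) { c with unread := L } }
  | seq P Q, R, v => P.WP E b (Q.WP E b R) v
  | ite e P Q, R, v => e.ok E b v ∧ (e.eval E v ≠ 0 → P.WP E b R (v.pay (e.cost + 1))) ∧
      (e.eval E v = 0 → Q.WP E b R (v.pay (e.cost + 1)))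
  | whil e P, Q, v => ∃ (I : View → Prop) (f : View → ℕ), I v ∧ ∀ u, I u → e.ok E b u ∧
      (e.eval E u ≠ 0 → P.WP E b (fun u' => I u' ∧ f u' < f u) (u.pay (e.cost + 1))) ∧
      (e.eval E u = 0 → Q (u.pay (e.cost + 1)))

theorem WP.mono {E : Env} {b : ℕ} {c : Cmd} {Q Q' : View → Prop} {v : View} (h : c.WP E b Q v) (hQ :
    ∀ u, Q u → Q' u) : c.WP E b Q' v := by
  induction c generalizing Q Q' v with
  | seq P R hP hR => exact hP h fun u hu => hR hu hQ
  | ite e P R hP hR => exact ⟨h.1, fun h0 => hP (h.2.1 h0) hQ, fun h0 => hR (h.2.2 h0) hQ⟩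
  | whil e P hP =>
    obtain ⟨I, f, h1, h2⟩ := h
    exact ⟨I, f, h1, fun u hu => ⟨(h2 u hu).1, (h2 u hu).2.1, fun h0 => hQ _ ((h2 u hu).2.2 h0)⟩⟩
  | skip => exact hQ _ h
  | set x e => exact ⟨h.1, hQ _ h.2⟩
  | aset j i e => exact ⟨h.1, h.2.1, h.2.2.1, h.2.2.2.1, hQ _ h.2.2.2.2⟩
  | lowset i e => exact ⟨h.1, h.2.1, h.2.2.1, hQ _ h.2.2.2⟩
  | inp x => exact hQ _ h
  | rnd x => exact hQ _ h
  | create x n src k num den len => exact ⟨h.1, h.2.1, h.2.2.1, hQ _ h.2.2.2⟩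
  | tell i x y =>
    obtain ⟨c, h1, h2, h3, h4, h5⟩ := h
    exact ⟨c, h1, h2, h3, h4, hQ _ h5⟩
  | next x i =>
    obtain ⟨c, h1, h2, h3⟩ := h
    exact ⟨c, h1, fun h0 => hQ _ (h2 h0), fun a L h0 => ⟨(h3 a L h0).1, hQ _ (h3 a L h0).2⟩⟩

end Cmd

/-! ### Soundness of the precondition calculus and the amortized time -/

section soundness

variable {E : Env} {b : ℕ} {s : State} {v : View}

theorem SeenAs.update_reg (h : SeenAs E b s v) (x : Var) {a : ℕ} (ha : a < 2 ^ E.w) (t : ℕ)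
    (c : ℤ) (ht : (t : ℤ) ≤ s.time + c) :
    SeenAs E b { s with reg := Function.update s.reg x.reg a, time := t } (v.assign x a c) :=
  { h with
    base := by
      have := x.reg_lt
      simpa [Function.update_of_ne (show 99 ≠ x.reg by omega)] using h.base
    var := fun z => by
      by_cases hz : z = x
      · subst hz; simp [View.assign]
      · simp [View.assign, Function.update_of_ne hz, Function.update_of_ne (fun h => hz
          (Var.reg_injective h)), h.var]
    regLt := fun z => by
      simp only [Function.update_apply]
      split_ifs
      exacts [ha, h.regLt z]
    time := by
      have := h.time
      simp only [View.assign]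
      omega }

/-- A run of the black box may be replaced by a later state of it. -/
theorem SeenAs.set_sess (h : SeenAs E b s v) {i : ℕ} {c c' : Session} (hc : v.sess[i]? = some c)
    (t : ℕ) (a : ℤ)
    (ht : (t : ℤ) + c.credit E.box i ≤ s.time + a + c'.credit E.box i) :
    SeenAs E b { s with sessions := s.sessions.set i c', time := t }
      { v with sess := v.sess.set i c', vt := v.vt + a } :=
  { h with
    sess := by simp only [h.sess]
    time := by have := h.time; simp only [credit_set _ _ _ _ _ hc]; omega }

/-- Total correctness by induction on the command. Apart from the calls of the black box every
clause just adds the true cost. Starting a run, passing an update and fetching an output raise the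
credit of the run by more than its own time, namely by 10000 for each word of input or output
accounted for; this surplus is what `WP` subtracts from the virtual time `vt`, which may become
negative. -/
theorem Cmd.sound (hbox : IsTruncatedSSSP E.mode E.box) (c : Cmd) : ∀ (Q : View → Prop) (s :
    State) (v : View), SeenAs E b s v → c.WP E b Q v → ∃ s' v', Exec E c.code s s' ∧
    SeenAs E b s' v' ∧ Q v' := by
  have hexpr : ∀ (e : Expr) (s : State) (v : View), SeenAs E b s v → e.ok E b v →
      ∃ ρ : ℕ → ℕ, Exec E (e.code 0) s { s with reg := ρ, time := s.time + e.cost } ∧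
      ρ 100 = e.eval E v ∧ (∀ x < 100, ρ x = s.reg x) ∧ ∀ x, ρ x < 2 ^ E.w :=
    fun e s v h ho => e.exec_code E b 0 s v h ho
  induction c with
  | skip =>
    intro Q s v h hQ
    refine ⟨_, _, Exec.instr rfl, ?_, hQ⟩
    refine h.temps (fun x hx => Function.update_of_ne (by omega) _ _) (fun x => ?_) (s.time + 1) 1
      (by simp)
    rw [Function.update_apply]
    split_ifs
    exacts [Nat.mod_lt _ (by positivity), h.regLt x]
  | set x e =>
    intro Q s v h ⟨ho, hQ⟩
    obtain ⟨ρ, h1, h2, h3, h4⟩ := hexpr e s v h ho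
    have hx := x.reg_lt
    have he : e.eval E v < 2 ^ E.w := h2 ▸ h4 100
    have h' := h.temps (ρ := Function.update ρ 101 0) (fun z hz =>
      by rw [Function.update_of_ne (by omega), h3 z hz]) (fun z =>
      by rw [Function.update_apply]; split_ifs; exacts [by positivity, h4 z]) (s.time + e.cost)
      e.cost (by simp)
    have h'' := h'.update_reg x he (s.time + e.cost + 2) 2 (by simp)
    refine ⟨_, _, Exec.seq h1 (Exec.seq (Exec.instr rfl) (Exec.instr ?_)), h'', ?_⟩
    · simp [Instr.step, State.put, WordOp.eval, h2, Nat.mod_eq_of_lt he]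
    · simpa [View.assign, View.pay, add_assoc] using hQ
  | aset j i e =>
    intro Q s v h ⟨hi, ho, hj, hb, hQ⟩
    obtain ⟨ρ, h1, h2, h3, h4⟩ := hexpr i s v h hi
    obtain ⟨ρ', g1, g2, g3, g4⟩ := e.exec_code E b 1 { s with reg := ρ, time := s.time + i.cost }
      { v with vt := v.vt + i.cost } (h.temps h3 h4 (s.time + i.cost) i.cost (by simp)) ((Expr.ok_vt e v _).2 ho)
    rw [Expr.eval_vt] at g2
    have hbase : ρ' 99 = b := by rw [g3 _ (by omega)]; exact (h3 _ (by omega)).trans h.base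
    have hi2 : ρ' 100 = i.eval E v := by rw [g3 _ (by omega)]; exact h2
    have hev : e.eval E v < 2 ^ E.w := g2 ▸ g4 _
    have h8 : 8 % 2 ^ E.w = 8 := Nat.mod_eq_of_lt (by omega)
    have hjm : j % 2 ^ E.w = j := Nat.mod_eq_of_lt (by omega)
    have a1 : i.eval E v * 8 % 2 ^ E.w = 8 * i.eval E v := by
      rw [Nat.mod_eq_of_lt (by omega)]; omega
    have a2 : (b + 8 * i.eval E v) % 2 ^ E.w = b + 8 * i.eval E v := Nat.mod_eq_of_lt (by omega)
    have a3 : (b + 8 * i.eval E v + j) % 2 ^ E.w = b + 8 * i.eval E v + j := Nat.mod_eq_of_lt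
      (by omega)
    have hr := h.temps (ρ := Function.update (Function.update ρ' 102 j) 100 (b + 8 * i.eval E v +
      j)) (fun z hz => by
        rw [Function.update_of_ne (by omega), Function.update_of_ne (by omega), g3 _ (by omega)]
        exact h3 z hz)
      (fun z => by
        simp only [Function.update_apply]
        split_ifs
        exacts [by omega, by omega, g4 z])
      (s.time + (i.cost + e.cost + 6)) (i.cost + e.cost + 6) (by push_cast; omega)
    refine ⟨_, _, Exec.seq h1 (Exec.seq g1 (Exec.seq (Exec.instr rfl) (Exec.seq (Exec.instr rfl)
      (Exec.seq (Exec.instr rfl) (Exec.seq (Exec.instr rfl) (Exec.seq (Exec.instr rfl) (Exec.instr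
      rfl))))))), ?_, hQ⟩
    simp only [State.put, WordOp.eval, h8, hjm]
    have n1 : (100 : ℕ) ≠ 102 := by omega
    have n2 : (99 : ℕ) ≠ 102 := by omega
    have n3 : (99 : ℕ) ≠ 100 := by omega
    have n4 : (101 : ℕ) ≠ 100 := by omega
    have n5 : (101 : ℕ) ≠ 102 := by omega
    have g2' : ρ' 101 = e.eval E v := g2
    simp only [Function.update_self, Function.update_of_ne n1, Function.update_of_ne n2,
        Function.update_of_ne n3, Function.update_of_ne n4, Function.update_of_ne n5, hbase, hi2,
        a1, a2, a3, g2']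
    refine { h with
      base := ?_, var := fun x => ?_, regLt := fun z => ?_, memLt := fun z => ?_
      low := fun z hz => ?_, arr := fun j' hj' i' => ?_, time := ?_ }
    · grind
    · have := hr.var x
      have hx := x.reg_lt
      simp only [Function.update_apply, View.pay] at this ⊢
      rw [if_neg (by omega), if_neg (by omega)] at this
      rw [if_neg (by omega), if_neg (by omega), if_neg (by omega), if_neg (by omega),
        if_neg (by omega)]
      exact this
    · grind
    · simp only [Function.update_apply]
      split_ifs
      exacts [hev, h.memLt z]
    · exact (Function.update_of_ne (by omega) _ _).trans (h.low z hz)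
    · by_cases hjj : j' = j
      · subst hjj
        by_cases hii : i' = i.eval E v
        · simp_all
        · simp only [Function.update_self, Function.update_of_ne hii]
          rw [Function.update_of_ne (by omega)]
          exact h.arr j' hj' i'
      · simp only [Function.update_of_ne hjj]
        rw [Function.update_of_ne (by omega)]
        exact h.arr j' hj' i'
    · have := h.time
      simp only
      push_cast
      omega
  | lowset i e =>
    intro Q s v h ⟨hi, ho, hb, hQ⟩
    obtain ⟨ρ, h1, h2, h3, h4⟩ := hexpr i s v h hi
    obtain ⟨ρ', g1, g2, g3, g4⟩ := e.exec_code E b 1 { s with reg := ρ, time := s.time + i.cost }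
      { v with vt := v.vt + i.cost } (h.temps h3 h4 (s.time + i.cost) i.cost (by simp)) ((Expr.ok_vt e v _).2 ho)
    rw [Expr.eval_vt] at g2
    have hi2 : ρ' 100 = i.eval E v := by rw [g3 _ (by omega)]; exact h2
    have g2' : ρ' 101 = e.eval E v := g2
    have hev : e.eval E v < 2 ^ E.w := g2 ▸ g4 _
    have hr := h.temps (ρ := ρ') (fun z hz => by rw [g3 _ (by omega)]; exact h3 z hz) g4 (s.time +
      (i.cost + e.cost + 1)) (i.cost + e.cost + 1) (by push_cast; omega)
    refine ⟨_, _, Exec.seq h1 (Exec.seq g1 (Exec.instr rfl)), ?_, hQ⟩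
    simp only [hi2, g2']
    refine { hr with memLt := fun z => ?_, low := fun z hz => ?_, arr := fun j' hj' i' => ?_, time := ?_ }
    · simp only [Function.update_apply]
      split_ifs
      exacts [hev, h.memLt z]
    · simp only [Function.update_apply]
      split_ifs
      exacts [rfl, h.low z hz]
    · exact (Function.update_of_ne (by omega) _ _).trans (h.arr j' hj' i')
    · have := h.time
      simp only
      push_cast
      omega
  | inp x =>
    intro Q s v h hQ
    have h' := h.update_reg x (a := v.inp.headD 0 % 2 ^ E.w) (Nat.mod_lt _ (by positivity)) (s.time
      + 1) 1 (by simp)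
    refine ⟨_, _, Exec.instr rfl, ?_, hQ⟩
    exact { h' with
      base := by simpa [State.put, h.inp] using h'.base
      var := by simpa [State.put, h.inp] using h'.var
      regLt := by simpa [State.put, h.inp] using h'.regLt
      inp := by simp [h.inp] }
  | rnd x =>
    intro Q s v h hQ
    have h' := h.update_reg x (a := E.coins v.used) (E.coins v.used).2 (s.time + 1) 1 (by simp)
    have hm : (E.coins v.used : ℕ) % 2 ^ E.w = E.coins v.used := Nat.mod_eq_of_lt (E.coins v.used).2
    refine ⟨_, _, Exec.instr rfl, ?_, hQ⟩
    exact { h' with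
      base := by simpa [State.put, h.used, hm] using h'.base
      var := by simpa [State.put, h.used, hm] using h'.var
      regLt := by simpa [State.put, h.used, hm] using h'.regLt
      used := by simp [h.used] }
  | create x n src k num den len =>
    intro Q s v h ⟨hl, hI, hlen, hQ⟩
    set I := startOf v n src k num den len with hIdef
    set ρ := Function.update s.reg 100 0 with hρ
    have hρx : ∀ z : Var, ρ z.reg = v.var z := fun z => by
      have := z.reg_lt
      rw [hρ, Function.update_of_ne (by omega), h.var]
    have h' := h.temps (ρ := ρ) (fun z hz => Function.update_of_ne (by omega) _ _) (fun z =>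
      by rw [hρ, Function.update_apply]; split_ifs; exacts [by positivity, h.regLt z]) (s.time + 1)
      1 (by simp)
    have h'' := h'.update_reg x hlen (s.time + 2) 1 (by simp; omega)
    have hst := hbox.time_start s.sessions.length I hI
    have hIe : SSSPInput.mk (ρ n.reg) ((List.range (ρ len.reg)).map fun i =>
        (s.mem (ρ 100 + 2 * i), s.mem (ρ 100 + 2 * i + 1))) (ρ src.reg) (ρ k.reg) (ρ num.reg)
        (ρ den.reg) = I := by
      simp only [hIdef, startOf, hρx, SSSPInput.mk.injEq, and_true, true_and]
      refine List.map_congr_left fun i hi => ?_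
      have := List.mem_range.1 hi
      have h0 : ρ 100 = 0 := Function.update_self _ _ _
      rw [h0, zero_add, h.low _ (by omega), h.low _ (by omega)]
    refine ⟨{ s with
        reg := Function.update ρ x.reg s.sessions.length
        sessions := s.sessions ++ [⟨I, [], E.box.changed s.sessions.length I []⟩]
        time := s.time + 1 + 1 + E.box.time s.sessions.length I [] }, _,
      Exec.seq (Exec.instr rfl) (Exec.instr ?_), ?_, hQ⟩
    · simp only [Instr.step, State.put, Nat.zero_mod, ← hρ, hIe, Nat.mod_eq_of_lt (show
        s.sessions.length < 2 ^ E.w from h.sess ▸ hlen)]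
      exact if_pos (by rw [← hIe] at hI; exact hI)
    · refine { h with
        base := by simpa [h.sess] using h''.base
        var := by simpa [h.sess, View.assign, View.pay] using h''.var
        regLt := by simpa [h.sess] using h''.regLt
        sess := by simp only [h.sess]
        time := ?_ }
      -- The start takes at least `n + m` plus the length of the output. Of the 10001 shares of that
      -- time one pays the run itself, 10000 for each output stay reserved in the credit, and `10000
      -- * (n + m)` are released at once.
      · have := h.time
        rw [h.sess] at hst
        simp only [credit_append, Session.credit, Session.boxTime, View.assign, h.sess]
        simp only [List.length_nil, zero_add, Finset.range_one, Finset.sum_singleton, List.take_nil]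
        push_cast
        omega
  | tell i x y =>
    rintro Q s v h ⟨c, hc, hv, hl, hlu, hQ⟩
    have hst := hbox.time_update (v.var i) c.start c.updates _ hv hl
    refine ⟨_, _, Exec.instr ?_, h.set_sess hc (s.time + 1 + E.box.time (v.var i) c.start (c.updates
      ++ [(v.var x, v.var y)])) (1 - 10000) ?_, hQ⟩
    · simp only [Instr.step, h.var, h.sess, hc]
      exact if_pos (by rw [h.var, h.var]; exact hlu)
    · simp only [Session.credit, Session.boxTime, List.length_append, List.length_singleton]
      rw [Finset.sum_range_succ _ (c.updates.length + 1)]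
      have h1 : (c.updates ++ [(v.var x, v.var y)]).take (c.updates.length + 1) = c.updates ++
          [(v.var x, v.var y)] := List.take_of_length_le (by simp)
      have h2 : ∑ t ∈ Finset.range (c.updates.length + 1), E.box.time (v.var i) c.start ((c.updates
            ++ [(v.var x, v.var y)]).take t) = ∑ t ∈ Finset.range (c.updates.length + 1),
            E.box.time (v.var i) c.start (c.updates.take t) := by
        refine Finset.sum_congr rfl fun t ht => ?_
        have := Finset.mem_range.1 ht
        rw [List.take_append_of_le_length (by omega)]
      rw [h1, h2]
      push_cast
      omega
  | next x i =>
    rintro Q s v h ⟨c, hc, h0, h1⟩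
    rcases hL : c.unread with _ | ⟨z, L⟩
    · have h' := h.update_reg x (a := 0) (by positivity) (s.time + 1) 1 (by simp)
      refine ⟨_, _, Exec.instr ?_, h', h0 hL⟩
      simp [Instr.step, h.var, h.sess, hc, hL, State.put]
    · obtain ⟨hz, hQ⟩ := h1 z L hL
      have h' := h.update_reg x hz (s.time) 0 (by simp)
      refine ⟨_, _, Exec.instr ?_, h'.set_sess (i := v.var i) (c := c) (c' :=
        { c with unread := L }) hc (s.time + 1) (1 - 10000) ?_, ?_⟩
      · simp only [Instr.step, h.var, h.sess, hc, hL, State.put, Nat.mod_eq_of_lt hz]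
      -- Fetching one output releases the 10000 units that were reserved for it.
      · simp only [Session.credit, Session.boxTime, hL, List.length_cons]
        push_cast
        omega
      · simpa [View.assign] using hQ
  | seq P R hP hR =>
    intro Q s v h hQ
    obtain ⟨s1, v1, e1, r1, q1⟩ := hP _ s v h hQ
    obtain ⟨s2, v2, e2, r2, q2⟩ := hR _ s1 v1 r1 q1
    exact ⟨s2, v2, Exec.seq e1 e2, r2, q2⟩
  | ite e P R hP hR =>
    intro Q s v h ⟨ho, ht, hf⟩
    obtain ⟨ρ, h1, h2, h3, h4⟩ := hexpr e s v h ho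
    have h' := h.temps h3 h4 (s.time + e.cost + 1) (e.cost + 1) (by push_cast; omega)
    by_cases hv : e.eval E v = 0
    · obtain ⟨s1, v1, e1, r1, q1⟩ := hR _ _ _ h' (hf hv)
      exact ⟨s1, v1, Exec.seq h1 (Exec.condFalse (h2.trans hv) e1), r1, q1⟩
    · obtain ⟨s1, v1, e1, r1, q1⟩ := hP _ _ _ h' (ht hv)
      exact ⟨s1, v1, Exec.seq h1 (Exec.condTrue (by rw [← h2] at hv; exact hv) e1), r1, q1⟩
  | whil e P hP =>
    rintro Q s v h ⟨I, f, hI, hinv⟩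
    -- The loop tests register 100, so the induction on the variant starts after the guard has been
    -- evaluated, in a configuration whose scratch registers already hold its value.
    suffices H : ∀ (k : ℕ) (s : State) (v : View), f v = k → SeenAs E b s v → I v → ∀ ρ : ℕ → ℕ,
        ρ 100 = e.eval E v → (∀ x < 100, ρ x = s.reg x) → (∀ x, ρ x < 2 ^ E.w) → ∃ s' v',
        Exec E (.loop 100 (.seq P.code (e.code 0))) { s with reg := ρ, time := s.time + e.cost } s'
        ∧ SeenAs E b s' v' ∧ Q v' by
      obtain ⟨ρ, h1, h2, h3, h4⟩ := hexpr e s v h (hinv v hI).1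
      obtain ⟨s', v', e1, r1, q1⟩ := H _ s v rfl h hI ρ h2 h3 h4
      exact ⟨s', v', Exec.seq h1 e1, r1, q1⟩
    intro k
    induction k using Nat.strong_induction_on with
    | _ k ih =>
      intro s v hk h hI ρ h2 h3 h4
      have h' := h.temps h3 h4 (s.time + e.cost + 1) (e.cost + 1) (by push_cast; omega)
      by_cases hv : e.eval E v = 0
      · exact ⟨_, _, Exec.loopDone (h2.trans hv), h', (hinv v hI).2.2 hv⟩
      · obtain ⟨s1, v1, e1, r1, q1, q2⟩ := hP _ _ _ h' ((hinv v hI).2.1 hv)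
        obtain ⟨ρ', g1, g2, g3, g4⟩ := hexpr e s1 v1 r1 (hinv v1 q1).1
        obtain ⟨s2, v2, e2, r2, q3⟩ := ih _ (hk ▸ q2) s1 v1 rfl r1 q1 ρ' g2 g3 g4
        exact ⟨s2, v2, Exec.loopStep (by rw [← h2] at hv; exact hv) (Exec.seq e1 g1) e2, r2, q3⟩

end soundness

/-! ### Determinism and dependence on random words -/

/-- Executions are determined by the random words that they use. -/
theorem Exec.congr_coins {mode : UpdateMode} {B : BlackBox} {w : ℕ} {ω ω' : ℕ → Fin (2 ^ w)}
    {P : Code} {s s' : State} (h : Exec ⟨mode, B, w, ω⟩ P s s') : s.used ≤ s'.used ∧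
    ((∀ i < s'.used, ω i = ω' i) → Exec ⟨mode, B, w, ω'⟩ P s s') := by
  generalize hE : (⟨mode, B, w, ω⟩ : Env) = E at h
  induction h with
  | @instr i s s' h =>
    subst hE
    have hu : s.used ≤ s'.used ∧ ((∀ i < s'.used, ω i = ω' i) → Instr.step ⟨mode, B, w,
        ω'⟩ s i = some s') := by
      cases i with
      | random x =>
        simp only [Instr.step, Option.some.injEq] at h ⊢
        subst h
        refine ⟨Nat.le_succ _, fun h => ?_⟩
        rw [h s.used (Nat.lt_succ_self _)]
      | const | arith | load | store | input => cases h; exact ⟨le_rfl, fun _ => rfl⟩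
      | create x n src k num den addr len =>
        refine ⟨?_, fun _ => h⟩
        simp only [Instr.step] at h
        split_ifs at h
        cases h; exact le_rfl
      | tell i u v =>
        refine ⟨?_, fun _ => h⟩
        simp only [Instr.step] at h
        split at h
        · simp at h
        · grind
      | nextChange x i =>
        refine ⟨?_, fun _ => h⟩
        simp only [Instr.step] at h
        split at h
        · simp at h
        · split at h <;> (cases h; exact le_rfl)
      | estimate x i v =>
        refine ⟨?_, fun _ => h⟩
        simp only [Instr.step] at h
        split at h
        · simp at h
        · cases h; exact le_rfl
    exact ⟨hu.1, fun h => Exec.instr (hu.2 h)⟩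
  | seq _ _ h1 h2 =>
    exact ⟨h1.1.trans h2.1, fun h =>
      Exec.seq (h1.2 fun i hi => h i (hi.trans_le h2.1)) (h2.2 h)⟩
  | condTrue hx _ h1 => exact ⟨h1.1, fun h => Exec.condTrue hx (h1.2 h)⟩
  | condFalse hx _ h1 => exact ⟨h1.1, fun h => Exec.condFalse hx (h1.2 h)⟩
  | loopDone hx => exact ⟨le_rfl, fun _ => Exec.loopDone hx⟩
  | loopStep hx _ _ h1 h2 =>
    exact ⟨h1.1.trans h2.1, fun h =>
      Exec.loopStep hx (h1.2 fun i hi => h i (hi.trans_le h2.1)) (h2.2 h)⟩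

theorem Exec.det {E : Env} {P : Code} {s s₁ s₂ : State} (h₁ : Exec E P s s₁) (h₂ : Exec E P s s₂) :
    s₁ = s₂ := by
  induction h₁ generalizing s₂ with
  | instr h =>
    cases h₂ with
    | instr h' => exact Option.some.inj (h.symm.trans h')
  | seq _ _ h1 h2 =>
    cases h₂ with
    | seq g1 g2 => cases h1 g1; exact h2 g2
  | condTrue hx _ h1 =>
    cases h₂ with
    | condTrue _ g => exact h1 g
    | condFalse hx' _ => exact absurd hx' hx
  | condFalse hx _ h1 =>
    cases h₂ with
    | condTrue hx' _ => exact absurd hx hx'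
    | condFalse _ g => exact h1 g
  | loopDone hx =>
    cases h₂ with
    | loopDone _ => rfl
    | loopStep hx' _ _ => exact absurd hx hx'
  | loopStep hx _ _ h1 h2 =>
    cases h₂ with
    | loopDone hx' => exact absurd hx' hx
    | loopStep _ g1 g2 => cases h1 g1; exact h2 g2

/-! ## Distances in the current graph -/

/-- The distance of two vertices in the graph with edge list `L`. -/
noncomputable def gdist (n : ℕ) (L : List Edge) (u v : ℕ) : ℕ := if h : u < n ∧ v < n then (graphOf
  n L).dist ⟨u, h.1⟩ ⟨v, h.2⟩ else 0

/-- The radius of the graph with edge list `L`. -/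
noncomputable def grad (n : ℕ) (L : List Edge) : ℕ := (graphOf n L).radius.toNat

/-- The ball of radius `h` around `v`. -/
noncomputable def gball (n : ℕ) (L : List Edge) (v h : ℕ) : Finset ℕ := (Finset.range n).filter
  fun u => gdist n L v u ≤ h

theorem mem_gball {n : ℕ} {L : List Edge} {v h u : ℕ} : u ∈ gball n L v h ↔ u < n ∧ gdist n L v u ≤
    h := by
  simp [gball]

theorem gdist_fin {n : ℕ} (L : List Edge) (u v : Fin n) : gdist n L u v = (graphOf n L).dist u v :=
    by
  simp [gdist]

theorem gdist_self (n : ℕ) (L : List Edge) (u : ℕ) : gdist n L u u = 0 := by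
  unfold gdist
  split_ifs <;> simp

theorem gdist_comm (n : ℕ) (L : List Edge) (u v : ℕ) : gdist n L u v = gdist n L v u := by
  unfold gdist
  split_ifs with h1 h2 h2
  · exact SimpleGraph.dist_comm
  · grind
  · grind
  · rfl

section connected

variable {n : ℕ} {L : List Edge} (hc : (graphOf n L).Connected)
include hc

theorem gdist_triangle {u x v : ℕ} (hu : u < n) (hx : x < n) (hv : v < n) : gdist n L u v ≤ gdist n
    L u x + gdist n L x v := by
  have := hc.dist_triangle (u := ⟨u, hu⟩) (v := ⟨x, hx⟩) (w := ⟨v, hv⟩)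
  simpa [gdist, hu, hx, hv] using this

/-- The vertex number `j` on a shortest path: both parts of the path bound the two distances from
above, and the triangle inequality turns these bounds into equalities. -/
theorem exists_gdist_between {u v j : ℕ} (hu : u < n) (hv : v < n) (hj : j ≤ gdist n L u v) :
    ∃ y < n, gdist n L u y = j ∧ gdist n L y v = gdist n L u v - j := by
  obtain ⟨W, hW⟩ := hc.exists_walk_length_eq_dist ⟨u, hu⟩ ⟨v, hv⟩
  rw [← gdist_fin] at hW
  simp only at hW
  refine ⟨W.getVert j, Fin.is_lt _, ?_⟩
  have h1 : gdist n L u (W.getVert j) ≤ j := by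
    have := SimpleGraph.dist_le (W.take j)
    rw [← gdist_fin, SimpleGraph.Walk.take_length] at this
    exact this.trans (min_le_left _ _)
  have h2 : gdist n L (W.getVert j) v ≤ gdist n L u v - j := by
    have := SimpleGraph.dist_le (W.drop j)
    rw [← gdist_fin, SimpleGraph.Walk.drop_length, hW] at this
    exact this
  have h3 := gdist_triangle hc hu (W.getVert j).is_lt hv
  omega

theorem gdist_lt (u v : ℕ) (hn : 0 < n) : gdist n L u v < n := by
  unfold gdist
  split_ifs with h
  · obtain ⟨W, hW, hl⟩ := hc.exists_path_of_dist ⟨u, h.1⟩ ⟨v, h.2⟩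
    rw [← hl]
    simpa using hW.length_lt
  · exact hn

/-- If some vertex has distance at least `h` from `v`, a shortest path to it provides one vertex at
each of the distances `0, …, h`; otherwise the ball is the whole graph. This makes disjoint balls of
radius `σ / 2` few. -/
theorem le_gball_card {v h : ℕ} (hv : v < n) (hh : h + 1 ≤ n) : h + 1 ≤ (gball n L v h).card := by
  by_cases hx : ∃ x < n, h ≤ gdist n L v x
  · obtain ⟨x, hxn, hx⟩ := hx
    have : ∀ j, ∃ y, j ≤ h → y < n ∧ gdist n L v y = j := by
      intro j
      by_cases hj : j ≤ h
      · obtain ⟨y, h1, h2, -⟩ := exists_gdist_between hc hv hxn (hj.trans hx)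
        exact ⟨y, fun _ => ⟨h1, h2⟩⟩
      · grind
    choose y hy using this
    have hcard : ((Finset.range (h + 1)).image y).card = h + 1 := by
      rw [Finset.card_image_of_injOn, Finset.card_range]
      intro i hi j hj hij
      have hi := hy i (by simpa [Nat.lt_succ_iff] using hi)
      have hj := hy j (by simpa [Nat.lt_succ_iff] using hj)
      have hij : y i = y j := hij
      rw [← hi.2, ← hj.2, hij]
    rw [← hcard]
    refine Finset.card_le_card fun z hz => ?_
    obtain ⟨j, hj, rfl⟩ := Finset.mem_image.1 hz
    have hj : j ≤ h := by simpa [Nat.lt_succ_iff] using hj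
    exact mem_gball.2 ⟨(hy j hj).1, (hy j hj).2.le.trans hj⟩
  · push Not at hx
    have : gball n L v h = Finset.range n := by
      ext u
      simp only [mem_gball, Finset.mem_range, and_iff_left_iff_imp]
      exact fun hu => (hx u hu).le
    rw [this, Finset.card_range]
    exact hh

theorem gdist_anti {L' : List Edge} (hle : graphOf n L ≤ graphOf n L') (u v : ℕ) : gdist n L' u v ≤
    gdist n L u v := by
  unfold gdist
  split_ifs with h
  · exact SimpleGraph.Reachable.dist_anti hle (hc _ _)
  · exact le_rfl

theorem edist_eq_gdist (u v : Fin n) : (graphOf n L).edist u v = gdist n L u v := by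
  rw [gdist_fin]
  exact ((hc u v).coe_dist_eq_edist).symm

theorem grad_le {x h : ℕ} (hx : x < n) (hh : ∀ v < n, gdist n L x v ≤ h) : grad n L ≤ h := by
  have h1 : (graphOf n L).radius ≤ (h : ℕ∞) := by
    refine (SimpleGraph.radius_le_eccent (u := ⟨x, hx⟩)).trans ?_
    rw [SimpleGraph.eccent_le_iff]
    intro v
    rw [edist_eq_gdist hc]
    exact_mod_cast hh v v.is_lt
  have := ENat.toNat_le_toNat h1 (ENat.natCast_ne_top h)
  simpa [grad] using this

theorem exists_center (hn : 0 < n) : ∃ c < n, ∀ v < n, gdist n L c v ≤ grad n L := by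
  have : Nonempty (Fin n) := ⟨⟨0, hn⟩⟩
  obtain ⟨c, hcc⟩ := (graphOf n L).exists_eccent_eq_radius
  refine ⟨c, c.is_lt, fun v hv => ?_⟩
  have h1 : (graphOf n L).edist c ⟨v, hv⟩ ≤ (graphOf n L).radius := hcc ▸
    SimpleGraph.edist_le_eccent
  have htop : (graphOf n L).radius ≠ ⊤ := SimpleGraph.radius_ne_top_iff.2 hc
  rw [edist_eq_gdist hc] at h1
  have := ENat.toNat_le_toNat h1 htop
  simpa [grad] using this

theorem grad_pos (hn : 2 ≤ n) : 0 < grad n L := by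
  by_contra h
  obtain ⟨c, hcn, hcc⟩ := exists_center hc (by omega)
  have h0 : grad n L = 0 := by omega
  have : ∃ x < n, x ≠ c := by
    by_cases h : c = 0
    · exact ⟨1, by omega, by omega⟩
    · exact ⟨0, by omega, by omega⟩
  obtain ⟨x, hx, hxc⟩ := this
  have := hcc x hx
  rw [h0, gdist, dif_pos ⟨hcn, hx⟩, Nat.le_zero, hc.dist_eq_zero_iff] at this
  exact hxc (by simpa using (Fin.mk.inj_iff.1 this).symm)

theorem grad_lt (hn : 0 < n) : grad n L < n := by
  have := grad_le hc hn (fun v hv => Nat.le_sub_one_of_lt (gdist_lt hc 0 v hn))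
  omega

theorem gdist_le_two_grad {u v : ℕ} (hu : u < n) (hv : v < n) : gdist n L u v ≤ 2 * grad n L := by
  obtain ⟨c, hcn, hcc⟩ := exists_center hc (by omega)
  have := gdist_triangle hc hu hcn hv
  have h1 := hcc u hu
  have h2 := hcc v hv
  rw [gdist_comm] at h1
  omega

theorem grad_anti {L' : List Edge} (hn : 0 < n) (hle : graphOf n L ≤ graphOf n L') (hc' :
    (graphOf n L').Connected) : grad n L' ≤ grad n L := by
  obtain ⟨c, hcn, hcc⟩ := exists_center hc hn
  exact grad_le hc' hcn fun v hv => (gdist_anti hc hle c v).trans (hcc v hv)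

end connected

/-! ## Update sequences -/

theorem graphOf_mono (n : ℕ) {L L' : List Edge} (h : ∀ e ∈ L, e ∈ L') : graphOf n L ≤ graphOf n
    L' := by
  intro u v huv
  simp only [graphOf, SimpleGraph.fromRel_adj] at huv ⊢
  exact ⟨huv.1, huv.2.imp (h _) (h _)⟩

theorem afterUpdates_append (mode : UpdateMode) (l us : List Edge) (e : Edge) : afterUpdates mode l
    (us ++ [e]) = applyUpdate mode (afterUpdates mode l us) e := by
  simp [afterUpdates]

theorem graphOf_insert_le (n : ℕ) (l us : List Edge) (e : Edge) :
    graphOf n (afterUpdates .incremental l us) ≤ graphOf n (afterUpdates .incremental l (us ++ [e])) :=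
  graphOf_mono n fun x hx => by
    rw [afterUpdates_append]
    exact List.mem_append_left _ hx

theorem graphOf_erase_le (n : ℕ) (l us : List Edge) (e : Edge) :
    graphOf n (afterUpdates .decremental l (us ++ [e])) ≤ graphOf n (afterUpdates .decremental l us) :=
  graphOf_mono n fun x hx => by
    rw [afterUpdates_append] at hx
    exact List.mem_of_mem_erase hx

theorem legalSeq_append (mode : UpdateMode) (n : ℕ) (l us : List Edge) (e : Edge) : LegalSeq mode n
    l (us ++ [e]) ↔ LegalSeq mode n l us ∧ LegalUpdate mode n (afterUpdates mode l us) e := by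
  induction us generalizing l with
  | nil => simp [LegalSeq, afterUpdates]
  | cons a us ih => simp only [List.cons_append, LegalSeq, ih, afterUpdates, List.foldl_cons, and_assoc]

theorem LegalSeq.prefix {mode : UpdateMode} {n : ℕ} {l us us' : List Edge} (h : LegalSeq mode n l
    us) (hp : us' <+: us) : LegalSeq mode n l us' := by
  obtain ⟨t, rfl⟩ := hp
  induction t using List.reverseRecOn with
  | nil => simpa using h
  | append_singleton t e ih =>
    rw [← List.append_assoc, legalSeq_append] at h
    exact ih h.1

theorem AlwaysConnected.prefix {mode : UpdateMode} {n : ℕ} {l us us' : List Edge}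
    (h : AlwaysConnected mode n l us) (hp : us' <+: us) : AlwaysConnected mode n l us' :=
  fun vs hv => h vs (hv.trans hp)

theorem LegalSeq.isEdgeList {mode : UpdateMode} {n : ℕ} {l us : List Edge} (h : LegalSeq mode n l
    us) (hl : IsEdgeList n l) : IsEdgeList n (afterUpdates mode l us) := by
  induction us using List.reverseRecOn with
  | nil => simpa [afterUpdates] using hl
  | append_singleton us e ih =>
    rw [legalSeq_append] at h
    rw [afterUpdates_append]
    have ih := ih h.1
    cases mode with
    | incremental =>
      refine ⟨List.nodup_append.2 ⟨ih.1, by simp, ?_⟩, fun x hx => ?_⟩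
      · rintro a ha b hb rfl
        rw [List.mem_singleton] at hb
        exact h.2.2 (hb ▸ ha)
      · rcases List.mem_append.1 hx with hx | hx
        · exact ih.2 x hx
        · rw [List.mem_singleton] at hx
          exact hx ▸ h.2.1
    | decremental => exact ⟨ih.1.erase _, fun x hx => ih.2 x (List.mem_of_mem_erase hx)⟩

theorem LegalSeq.isEdge {mode : UpdateMode} {n : ℕ} {l us : List Edge} (h : LegalSeq mode n l us)
    (hl : IsEdgeList n l) : ∀ e ∈ us, IsEdge n e := by
  induction us using List.reverseRecOn with
  | nil => simp
  | append_singleton us e ih =>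
    rw [legalSeq_append] at h
    intro x hx
    rcases List.mem_append.1 hx with hx | hx
    · grind
    · rw [List.mem_singleton] at hx
      subst hx
      cases mode with
      | incremental => exact h.2.1
      | decremental => exact (h.1.isEdgeList hl).2 _ h.2

theorem IsEdgeList.length_le {n : ℕ} {l : List Edge} (h : IsEdgeList n l) : l.length ≤ n * n := by
  have h1 : l.toFinset ⊆ Finset.range n ×ˢ Finset.range n := by
    intro e he
    have := h.2 e (List.mem_toFinset.1 he)
    have h3 : e.1 < e.2 := this.1
    have h4 : e.2 < n := this.2
    simp only [Finset.mem_product, Finset.mem_range]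
    omega
  have h2 := Finset.card_le_card h1
  rwa [List.toFinset_card_of_nodup h.1, Finset.card_product, Finset.card_range] at h2

theorem LegalSeq.length_after {mode : UpdateMode} {n : ℕ} {l us : List Edge} (h : LegalSeq mode n l
    us) : us.length ≤ maxEdges mode l us ∧ (mode = .incremental → (afterUpdates mode l us).length =
    l.length + us.length) ∧ (mode = .decremental → (afterUpdates mode l us).length + us.length =
    l.length) := by
  induction us using List.reverseRecOn with
  | nil => simp [maxEdges, afterUpdates]
  | append_singleton us e ih =>
    rw [legalSeq_append] at h
    obtain ⟨h1, h2, h3⟩ := ih h.1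
    rw [afterUpdates_append]
    cases mode with
    | incremental =>
      have := h2 rfl
      simp only [applyUpdate, maxEdges, List.length_append, List.length_singleton] at *
      refine ⟨by omega, fun _ => by omega, fun h => nomatch h⟩
    | decremental =>
      have := h3 rfl
      have h4 := h.2
      simp only [LegalUpdate] at h4
      have h5 := List.length_erase_of_mem h4
      have h6 := List.length_pos_of_mem h4
      simp only [applyUpdate, maxEdges, List.length_append, List.length_singleton] at *
      exact ⟨by omega, by simp, fun _ => by omega⟩

theorem LegalSeq.maxEdges_le {mode : UpdateMode} {n : ℕ} {l us : List Edge} (h : LegalSeq mode n l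
    us) (hl : IsEdgeList n l) : maxEdges mode l us ≤ n * n := by
  cases mode with
  | incremental =>
    have h1 := (h.isEdgeList hl).length_le
    rw [h.length_after.2.1 rfl] at h1
    exact h1
  | decremental => exact hl.length_le

theorem maxEdges_mono (mode : UpdateMode) (l : List Edge) {us us' : List Edge} (h : us' <+: us) :
    maxEdges mode l us' ≤ maxEdges mode l us := by
  cases mode with
  | incremental => exact Nat.add_le_add_left h.length_le _
  | decremental => exact le_rfl

/-! ## What the estimates say about distances -/

/-- The estimates `f` of a run with source `x`, for distances up to `16 r`, have error at most
`σ`. -/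
def Accurate (n : ℕ) (L : List Edge) (r σ x : ℕ) (f : ℕ → ℕ) : Prop := ∀ v < n, gdist n L x v ≤ 16 *
  r → f v ≤ gdist n L x v ∧ gdist n L x v ≤ f v + σ

theorem Accurate.lt_gdist {n : ℕ} {L : List Edge} {r σ x h v : ℕ} {f : ℕ → ℕ} (hf : Accurate n L r σ
    x f) (hv : v < n) (hh : h ≤ 16 * r) (h1 : h < f v) : h < gdist n L x v := by
  by_contra h2
  have := (hf v hv (by omega)).1
  omega

/-- In a connected graph, estimates that are all small cannot be wrong. -/
theorem Accurate.gdist_le {n : ℕ} {L : List Edge} {r σ x h : ℕ} {f : ℕ → ℕ} (hf : Accurate n L r σ x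
    f) (hc : (graphOf n L).Connected) (hx : x < n) (hh : h + σ < 16 * r) (h1 : ∀ v < n, f v ≤ h) :
    ∀ v < n, gdist n L x v ≤ h + σ := by
  intro v hv
  by_contra h2
  -- A vertex that is too far away may be outside the range in which estimates mean anything. The
  -- vertex at distance exactly `h + σ + 1` on the way to it is within that range, and its estimate
  -- is larger than `h`.
  obtain ⟨y, hy, h3, -⟩ := exists_gdist_between hc hx hv (j := h + σ + 1) (by omega)
  have := (hf y hy (by omega)).2
  have := h1 y hy
  omega

/-- With `δ = p / (256 q)` and distances at most `16 r` the error is at most `16 r δ = p r / (16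
q)`, and it may be rounded down because distances are integers. Reducing modulo the word size `W` is
harmless: within the range estimates are at most the distance, which is less than `n`. -/
theorem accurate_est {mode : UpdateMode} {B : BlackBox} (hB : IsTruncatedSSSP mode B)
    {n p q r x id W : ℕ} {l us : List Edge} (hx : x < n) (hp : 0 < p) (hpq : p < q) (hl :
    IsEdgeList n l) (hus : LegalSeq mode n l us) (hc : (graphOf n (afterUpdates mode l
    us)).Connected) (hW : n ≤ W) : Accurate n (afterUpdates mode l us) r (p * r / (16 * q)) x
    fun v => B.est id ⟨n, l, x, 16 * r, p, 256 * q⟩ us v % W := by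
  intro v hv hd
  have hn : 0 < n := by omega
  set I : SSSPInput := ⟨n, l, x, 16 * r, p, 256 * q⟩ with hI
  have hval : I.Valid := ⟨hl, hx, hp, by simp only [hI]; omega⟩
  have hacc := hB.accurate id I us hval hus (⟨x, hx⟩ : Fin n) (⟨v, hv⟩ : Fin n) rfl (by
      have := edist_eq_gdist hc ⟨x, hx⟩ ⟨v, hv⟩
      simp only [hI]
      rw [this]
      exact_mod_cast hd)
  have hdd : (graphOf I.n (afterUpdates mode I.edges us)).dist (⟨x, hx⟩ : Fin n) (⟨v, hv⟩ :
      Fin n) = gdist n (afterUpdates mode l us) x v := (gdist_fin _ _ _).symm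
  rw [hdd] at hacc
  set d := gdist n (afterUpdates mode l us) x v
  have hdn : d < n := gdist_lt hc x v hn
  simp only
  rw [show B.est id I us v % W = B.est id I us v from Nat.mod_eq_of_lt (by
    have : B.est id I us v ≤ d := by exact_mod_cast hacc.2
    omega)]
  have hle : B.est id I us v ≤ d := by exact_mod_cast hacc.2
  refine ⟨hle, ?_⟩
  have h1 := hacc.1
  have hδ : I.delta = (p : ℝ) / (256 * q) := by simp [SSSPInput.delta, hI]
  rw [hδ] at h1
  have hq : (0 : ℝ) < 256 * q := by
    have : 0 < q := by omega
    positivity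
  have h2 : ((256 * q : ℝ) - p) * d ≤ 256 * q * B.est id I us v := by
    have h3 := mul_le_mul_of_nonneg_left h1 hq.le
    have h4 : 256 * (q : ℝ) * ((1 - p / (256 * q)) * d) = ((256 * q : ℝ) - p) * d := by grind
    rw [h4] at h3
    exact h3
  have h3 : 256 * q * d ≤ 256 * q * B.est id I us v + p * d := by
    have : (256 * q : ℝ) * d ≤ 256 * q * B.est id I us v + p * d := by linarith
    exact_mod_cast this
  have h4 : (d - B.est id I us v) * (16 * q) ≤ p * r := by
    have h5 : p * d ≤ p * (16 * r) := Nat.mul_le_mul_left _ hd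
    obtain ⟨t, ht⟩ := Nat.exists_eq_add_of_le hle
    rw [ht] at h3 ⊢
    rw [Nat.add_sub_cancel_left]
    rw [ht] at h5
    nlinarith
  have h5 := (Nat.le_div_iff_mul_le (by omega)).2 h4
  omega

/-! ## Parts common to both algorithms -/

/-- The additive error that is allowed when the radius is about `r`. -/
def slack (p q r : ℕ) : ℕ := p * r / (16 * q)

/-- Eccentricities up to this bound are good enough when the radius is about `r`. -/
def threshold (p q r : ℕ) : ℕ := r + (r + 1) / 2 + 4 * slack p q r

/-- The number of random vertices used when the radius is about `r`: about `√(n / r)`. -/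
noncomputable def sampleSize (n r : ℕ) : ℕ := sInf {N | n ≤ N * N * r}

theorem le_sampleSize {n r : ℕ} (hr : 0 < r) : n ≤ sampleSize n r * sampleSize n r * r := by
  have : n ∈ {N | n ≤ N * N * r} := by
    simp only [Set.mem_ofPred_eq]
    nlinarith [Nat.le_mul_self n, Nat.zero_le (n * n)]
  exact Nat.sInf_mem ⟨n, this⟩

theorem lt_of_lt_sampleSize {n r N : ℕ} (h : N < sampleSize n r) : N * N * r < n := by
  have := Nat.notMem_of_lt_sInf h
  simpa using this

theorem sampleSize_le {n r : ℕ} (hr : 0 < r) : sampleSize n r ≤ n := Nat.sInf_le (by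
    simp only [Set.mem_ofPred_eq]
    nlinarith [Nat.le_mul_self n, Nat.zero_le (n * n)])

theorem sampleSize_pos {n r : ℕ} (hn : 0 < n) (hr : 0 < r) : 0 < sampleSize n r := by
  by_contra h
  have h0 : sampleSize n r = 0 := by omega
  have := le_sampleSize (n := n) hr
  rw [h0] at this
  omega

theorem slack_le {p q r : ℕ} (hpq : p < q) : 16 * slack p q r ≤ r := by
  have h1 : slack p q r * (16 * q) ≤ p * r := Nat.div_mul_le_self _ _
  have h2 : p * r ≤ q * r := Nat.mul_le_mul_right _ hpq.le
  have h3 : q * (16 * slack p q r) ≤ q * r := by nlinarith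
  exact Nat.le_of_mul_le_mul_left h3 (by omega)

/-- The standing assumptions about the input and the word length. -/
structure Ctx (E : Env) (n p q : ℕ) (l : List Edge) : Prop where
  box : IsTruncatedSSSP E.mode E.box
  two_le : 2 ≤ n
  p_pos : 0 < p
  p_lt : p < q
  edges : IsEdgeList n l
  size : 10 ^ 7 * (n + q) ^ 8 ≤ 2 ^ E.w

/-- The polynomial bounds from which all later overflow conditions follow by linear arithmetic: the
numbers in the programs are bounded by constant multiples of `n³` and `n q`, or are random words. -/
theorem Ctx.bounds {E : Env} {n p q : ℕ} {l : List Edge} (h : Ctx E n p q l) : 2 * n ≤ n * n ∧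
    2 * (n * n) ≤ n * n * n ∧ l.length ≤ n * n ∧ 2 * q ≤ n * q ∧ 10 ^ 6 * (n * n * n) < 2 ^ E.w ∧
    10 ^ 6 * (n * q) < 2 ^ E.w ∧ 2 ≤ n := by
  have h1 := h.two_le
  have h2 := h.p_pos
  have h3 := h.p_lt
  have h4 := h.edges.length_le
  have h5 := h.size
  have h6 : n * n * n ≤ (n + q) ^ 3 := by
    calc n * n * n = n ^ 3 := by ring
      _ ≤ (n + q) ^ 3 := Nat.pow_le_pow_left (by omega) 3
  have h7 : n * q ≤ (n + q) ^ 2 := by nlinarith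
  have h8 : 1 ≤ n + q := by omega
  have h9 : (n + q) ^ 3 ≤ (n + q) ^ 8 := Nat.pow_le_pow_right h8 (by norm_num)
  have h10 : (n + q) ^ 2 ≤ (n + q) ^ 8 := Nat.pow_le_pow_right h8 (by norm_num)
  have h11 : 1 ≤ (n + q) ^ 8 := Nat.one_le_pow _ _ h8
  refine ⟨Nat.mul_le_mul_right _ h1, ?_, h4, Nat.mul_le_mul_right _ h1, by omega, by omega, h1⟩
  calc 2 * (n * n) ≤ n * (n * n) := Nat.mul_le_mul_right _ h1
    _ = n * n * n := by ring

/-- The views `v` and `u` differ at most in the variables `X`, the arrays `J`, the random words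
used, the runs of the black box and the time. -/
structure Frame (v u : View) (X : List Var) (J : List ℕ) : Prop where
  var : ∀ x, x ∉ X → u.var x = v.var x
  arr : ∀ j, j ∉ J → u.arr j = v.arr j
  low : u.low = v.low
  inp : u.inp = v.inp

/-- The part of the view that does not change between updates: input, parameters and the list of
updates. -/
structure Static (n p q : ℕ) (l us : List Edge) (v : View) : Prop where
  n' : v.var .n = n
  p' : v.var .p = p
  q' : v.var .q = q
  m' : v.var .m = l.length
  den' : v.var .den = 256 * q
  U' : v.var .U = us.length
  low' : ∀ i (h : i < l.length), (v.low (2 * i), v.low (2 * i + 1)) = l[i]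
  log' : ∀ i (h : i < us.length), (v.arr 0 i, v.arr 1 i) = us[i]

theorem update_of_notMem {α β : Type*} [DecidableEq α] {f g : α → β} {X : List α} (h : ∀ x, x ∉ X →
    f x = g x) {y : α} {a : β} (hy : y ∈ X) : ∀ x, x ∉ X → Function.update f y a x = g x := by grind

theorem Frame.iff {v : View} {V : Var → ℕ} {A : ℕ → ℕ → ℕ} {L : ℕ → ℕ} {I : List ℕ} {us s t} {X :
    List Var} {J : List ℕ} : Frame v ⟨V, A, L, I, us, s, t⟩ X J ↔ (∀ x, x ∉ X → V x = v.var x) ∧ (∀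
    j, j ∉ J → A j = v.arr j) ∧ L = v.low ∧ I = v.inp := ⟨fun h => ⟨h.1, h.2, h.3, h.4⟩, fun h =>
    ⟨h.1, h.2.1, h.2.2.1, h.2.2.2⟩⟩

theorem Frame.all {v u : View} {X : List Var} {J : List ℕ} (h : Frame v u X J) : (∀ x, x ∉ X →
    u.var x = v.var x) ∧ (∀ j, j ∉ J → u.arr j = v.arr j) ∧ u.low = v.low ∧ u.inp = v.inp := ⟨h.1,
    h.2, h.3, h.4⟩

theorem Frame.get {v u : View} {X : List Var} {J : List ℕ} (h : Frame v u X J) (x : Var) (hx :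
    x ∉ X := by simp) : u.var x = v.var x := h.var x hx

theorem Frame.off {v u : View} {X Y : List Var} {J : List ℕ} (h : Frame v u X J)
    (hX : ∀ x ∈ Y, x ∉ X) {x : Var} (hx : x ∈ Y := by simp) : u.var x = v.var x := h.var x (hX x hx)

theorem Frame.offArr {v u : View} {X : List Var} {J K : List ℕ} (h : Frame v u X J)
    (hJ : ∀ j ∈ K, j ∉ J) {j : ℕ} (hj : j ∈ K := by simp) : u.arr j = v.arr j := h.arr j (hJ j hj)

theorem Frame.mem {v u : View} {X : List Var} {J : List ℕ} (h : Frame v u X J) (j : ℕ) (hj :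
    j ∉ J := by simp) : u.arr j = v.arr j := h.arr j hj

theorem Frame.refl (v : View) (X : List Var) (J : List ℕ) : Frame v v X J := ⟨fun _ _ => rfl,
  fun _ _ => rfl, rfl, rfl⟩

theorem Frame.trans {v u z : View} {X X' : List Var} {J J' : List ℕ} (h : Frame v u X J) (h' : Frame
    u z X' J') (hX : X' ⊆ X := by simp) (hJ : J' ⊆ J := by simp) : Frame v z X J := ⟨fun x hx =>
    (h'.var x fun h => hx (hX h)).trans (h.var x hx), fun j hj => (h'.arr j fun h => hj (hJ
    h)).trans (h.arr j hj), h'.low.trans h.low, h'.inp.trans h.inp⟩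

theorem Static.frame {n p q : ℕ} {l us : List Edge} {v u : View} {X : List Var} {J : List ℕ} (h :
    Static n p q l us v) (hf : Frame v u X J) (hX : ∀ x ∈ [Var.n, .p, .q, .m, .den, .U],
    x ∉ X := by simp) (hJ : ∀ j ∈ [0, 1], j ∉ J := by simp) : Static n p q l us u where
  n' := by rw [hf.off hX, h.n']
  p' := by rw [hf.off hX, h.p']
  q' := by rw [hf.off hX, h.q']
  m' := by rw [hf.off hX, h.m']
  den' := by rw [hf.off hX, h.den']
  U' := by rw [hf.off hX, h.U']
  low' := by rw [hf.low]; exact h.low'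
  log' := by rw [hf.offArr hJ, hf.offArr hJ]; exact h.log'

/-- The parameters for a radius of about `r` are set. -/
structure Params (n p q r : ℕ) (v : View) : Prop where
  r' : v.var .r = r
  sg' : v.var .sg = slack p q r
  hS' : v.var .hS = r / 2
  hA' : v.var .hA = r / 2 - 2 * slack p q r
  thr' : v.var .thr = threshold p q r
  k' : v.var .k = 16 * r
  N' : v.var .N = sampleSize n r

theorem Params.frame {n p q r : ℕ} {v u : View} {X : List Var} {J : List ℕ} (h : Params n p q r v)
    (hf : Frame v u X J) (hX : ∀ x ∈ [Var.r, .sg, .hS, .hA, .thr, .k, .N], x ∉ X := by simp) :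
    Params n p q r u where
  r' := by rw [hf.off hX, h.r']
  sg' := by rw [hf.off hX, h.sg']
  hS' := by rw [hf.off hX, h.hS']
  hA' := by rw [hf.off hX, h.hA']
  thr' := by rw [hf.off hX, h.thr']
  k' := by rw [hf.off hX, h.k']
  N' := by rw [hf.off hX, h.N']

namespace Cmd

/-- Read the edge list. -/
def readEdges : Cmd := .set .i 0 ;; .whil (2 * ↟.m - ↟.i) (.inp .y ;; .lowset ↟.i ↟.y ;; .set .i
  (↟.i + 1))

/-- Set the parameters for a radius of about `r`. -/
def params : Cmd := .set .sg (↟.p * ↟.r / (16 * ↟.q)) ;; .set .hS (↟.r / 2) ;; .set .hA (↟.r / 2 - 2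
  * ↟.sg) ;; .set .thr (↟.r + (↟.r + 1) / 2 + 4 * ↟.sg) ;; .set .k (16 * ↟.r) ;; .set .N 0 ;; .whil
  (↟.n - ↟.N * ↟.N * ↟.r) (.set .N (↟.N + 1))

/-- Draw `n` random vertices and `n` random words, and clear all marks. -/
def draw : Cmd := .set .i 0 ;; .whil (↟.n - ↟.i) (.rnd .y ;; .aset 3 ↟.i (↟.y - ↟.y / ↟.n * ↟.n) ;;
  .rnd .y ;; .aset 4 ↟.i ↟.y ;; .aset 2 ↟.i 0 ;; .aset 7 ↟.i 0 ;; .set .i (↟.i + 1))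

/-- Create a run of the black box for the source `x` and pass all previous updates to it. -/
def newSession : Cmd := .create .cur .n .x .k .p .den .m ;; .set .j 0 ;; .whil (↟.U - ↟.j) (.set .a1
  (.arr 0 ↟.j) ;; .set .a2 (.arr 1 ↟.j) ;; .tell .cur .a1 .a2 ;; .set .j (↟.j + 1))

/-- Execute `body` for each vertex whose estimate in the run `cur` may have changed; the vertex is
`y - 1`. -/
def drain (body : Cmd) : Cmd := .next .y .cur ;; .whil ↟.y (body ;; .next .y .cur)

/-- The estimate for the vertex `y - 1`. -/
abbrev estY : Expr := .est ↟.cur (↟.y - 1)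

end Cmd

/-! ### Specifications of the commands common to both algorithms -/

section specs

variable {E : Env} {b n p q : ℕ} {l : List Edge} {Q : View → Prop} {v : View}

theorem Cmd.readEdges_spec (hC : Ctx E n p q l) (hb : b = 2 * l.length) (hm : v.var .m = l.length)
    (hinp : v.inp = l.flatMap fun e => [e.1, e.2]) (hQ : ∀ u, Frame { v with low := u.low, inp :=
    u.inp } u [.i, .y] [] → u.sess = v.sess → u.used = v.used → u.vt ≤ v.vt + 100 * (l.length + 1) →
    (∀ i (h : i < l.length), (u.low (2 * i), u.low (2 * i + 1)) = l[i]) → Q u) : readEdges.WP E b Q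
    v := by
  obtain ⟨h1, h2, h3, h4, h5, h6, hn⟩ := hC.bounds
  set F := l.flatMap fun e => [e.1, e.2] with hF
  have hlen : F.length = 2 * l.length := by
    rw [hF]
    clear * -
    induction l with
    | nil => rfl
    | cons a l ih => simp [ih]; ring
  have hlt : ∀ x ∈ F, x < n := by
    intro x hx
    obtain ⟨e, he, hx⟩ := List.mem_flatMap.1 hx
    have hE := hC.edges.2 e he
    have h7 : e.1 < e.2 := hE.1
    have h8 : e.2 < n := hE.2
    simp only [List.mem_cons, List.not_mem_nil, or_false] at hx
    omega
  simp only [readEdges, Cmd.WP, View.pay, View.assign, Expr.rules, Function.update_apply,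
    reduceCtorEq, if_false, if_true, true_and, and_true]
  refine ⟨by omega, fun u => ∃ i, u.var .i = i ∧ i ≤ 2 * l.length ∧ Frame
      { v with low := u.low, inp := u.inp } u [.i, .y] [] ∧ u.sess = v.sess ∧ u.used = v.used ∧ u.vt ≤ v.vt + 10 + 40 * i ∧
      u.inp = F.drop i ∧ ∀ j (h : j < F.length), j < i → u.low j = F[j], fun u => 2 * l.length -
      u.var .i, ⟨0, ?_⟩, ?_⟩
  · refine ⟨by simp, by omega, by simp +contextual [Frame.iff], rfl, rfl, by simp, by simp [hinp],
      by simp⟩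
  · rintro u ⟨i, hi, hi2, hf, hs, hu, ht, hin, hlow⟩
    have hmu : u.var .m = l.length := by rw [hf.get _]; exact hm
    simp only [Function.update_apply, reduceCtorEq, if_false, if_true,
    hmu, hi]
    refine ⟨by omega, fun hne => ?_, fun he => ?_⟩
    · have hiF : i < F.length := by omega
      have hhead : u.inp.headD 0 = F[i] := by
        rw [hin, List.drop_eq_getElem_cons hiF]; rfl
      have hFi : F[i] < n := hlt _ (List.getElem_mem hiF)
      have hmod : F[i] % 2 ^ E.w = F[i] := Nat.mod_eq_of_lt (by omega)
      rw [hhead, hmod]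
      refine ⟨by omega, ⟨by omega, by omega⟩, ⟨i + 1, rfl, by omega, ?_, hs, hu, ?_, ?_, ?_⟩, ?_⟩
      · exact ⟨update_of_notMem (update_of_notMem hf.var (by simp)) (by simp), hf.arr, rfl, rfl⟩
      · grind
      · simp_all
      · grind
      · omega
    · refine hQ _ ?_ hs hu ?_ ?_
      · constructor
        exacts [hf.var, hf.arr, rfl, rfl]
      · grind
      · intro i hi
        simp only
        rw [hlow (2 * i) (by omega) (by omega), hlow (2 * i + 1) (by omega) (by omega)]
        clear * - hi
        have : ∀ (l : List Edge) (i : ℕ) (hi : i < l.length) (h1 : 2 * i < (l.flatMap fun e => [e.1,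
            e.2]).length) (h2 : 2 * i + 1 < (l.flatMap fun e => [e.1, e.2]).length), ((l.flatMap fun
            e => [e.1, e.2])[2 * i], (l.flatMap fun e => [e.1, e.2])[2 * i + 1]) = l[i] := by
          intro l
          induction l with
          | nil => intro i hi; simp at hi
          | cons a l ih =>
            intro i hi h1 h2
            cases i with
            | zero => rfl
            | succ i =>
              have := ih i (by simpa using hi)
                (by simp only [List.flatMap_cons, List.length_append, List.length_cons,
                      List.length_nil] at h1; omega)
                (by simp only [List.flatMap_cons, List.length_append, List.length_cons,
                      List.length_nil] at h2; omega)
              simpa [Nat.mul_succ] using this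
        exact this l i hi _ _

theorem Cmd.params_spec (hC : Ctx E n p q l) (hn : v.var .n = n) (hp : v.var .p = p) (hq :
    v.var .q = q) {r : ℕ} (hr : v.var .r = r) (hr0 : 0 < r) (hr1 : r ≤ 10 * n) (hQ : ∀ u,
    Frame v u [.sg, .hS, .hA, .thr, .k, .N] [] → u.sess = v.sess → u.used = v.used →
    u.vt ≤ v.vt + 100 * (n + 1) → Params n p q r u → Q u) : params.WP E b Q v := by
  obtain ⟨h1, h2, h3, h4, h5, h6, hn2⟩ := hC.bounds
  have hpq := hC.p_lt
  have hpr : p * r ≤ 10 * (n * q) := by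
    calc p * r ≤ q * (10 * n) := Nat.mul_le_mul hpq.le hr1
      _ = 10 * (n * q) := by ring
  have hsl := slack_le (r := r) hpq
  have hsl' : p * r / (16 * q) = slack p q r := rfl
  simp only [params, Cmd.WP, View.pay, View.assign, Expr.rules, Function.update_apply, reduceCtorEq,
    if_false, if_true, true_and, hp, hq, hr, hsl']
  refine ⟨by omega, by omega, by omega, by omega, by omega, by omega, ?_⟩
  have hN0 := sampleSize_pos (n := n) (by omega) hr0
  have hN1 := sampleSize_le (n := n) hr0
  -- The counter never passes `sampleSize n r ≤ n`, so the product `N * N * r` in the loop test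
  -- stays within a word.
  have hNb : ∀ N ≤ sampleSize n r, N * N ≤ n * n ∧ N * N * r ≤ 10 * (n * n * n) := by
    intro N hN
    have : N * N ≤ n * n := Nat.mul_le_mul (hN.trans hN1) (hN.trans hN1)
    refine ⟨this, (Nat.mul_le_mul this hr1).trans_eq (by ring)⟩
  refine ⟨fun u => ∃ N, u.var .N = N ∧ N ≤ sampleSize n r ∧ Frame v u [.sg, .hS, .hA, .thr, .k,
      .N] [] ∧ u.sess = v.sess ∧ u.used = v.used ∧ u.vt ≤ v.vt + 100 + 40 * N ∧ u.var .sg = slack p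
      q r ∧ u.var .hS = r / 2 ∧ u.var .hA = r / 2 - 2 * slack p q r ∧ u.var .thr = threshold p q r ∧
      u.var .k = 16 * r, fun u => n - u.var .N, ⟨0, ?_⟩, ?_⟩
  · refine ⟨by simp, by omega, ?_, rfl, rfl, ?_, by simp, by simp, by simp, ?_, by simp⟩
    · simp +contextual [Frame.iff]
    · grind
    · simp [threshold]
  · rintro u ⟨N, hN, hN2, hf, hs, hu, ht, e1, e2, e3, e4, e5⟩
    have en : u.var .n = n := by rw [hf.get _, hn]
    have er : u.var .r = r := by rw [hf.get _, hr]
    have hb := hNb N hN2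
    simp only [Function.update_apply, reduceCtorEq, if_false, if_true,
    hN, en, er]
    refine ⟨by omega, fun hne => ?_, fun he => ?_⟩
    · have hlt : N < sampleSize n r := by
        by_contra hc
        have : N = sampleSize n r := by omega
        have h8 := le_sampleSize (n := n) hr0
        rw [← this, ← hN] at h8
        rw [← hN] at hne
        exact hne (Nat.sub_eq_zero_of_le h8)
      refine ⟨by omega, ⟨N + 1, rfl, hlt, ?_, hs, hu, ?_, ?_⟩, by omega⟩
      · simp +contextual [Frame.iff, hf.all]
      · grind
      · grind
    · refine hQ _ ⟨hf.var, hf.arr, hf.low, hf.inp⟩ hs hu ?_ ⟨er, e1, e2, e3, e4, e5, ?_⟩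
      · grind
      · simp only [hN]
        by_contra hc
        have := lt_of_lt_sampleSize (n := n) (r := r) (N := N) (by omega)
        omega

theorem Cmd.draw_spec (hC : Ctx E n p q l) (hb : b = 2 * l.length) (hn : v.var .n = n) (hQ : ∀ u,
    Frame v u [.i, .y] [2, 3, 4, 7] → u.sess = v.sess → u.used = v.used + 2 * n → u.vt ≤ v.vt + 200
    * n + 100 → (∀ i < n, u.arr 3 i = (E.coins (v.used + 2 * i) : ℕ) % n ∧ u.arr 4 i = (E.coins
    (v.used + 2 * i + 1) : ℕ) ∧ u.arr 2 i = 0 ∧ u.arr 7 i = 0) → (∀ i, n ≤ i → u.arr 2 i = v.arr 2 i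
    ∧ u.arr 7 i = v.arr 7 i) → Q u) : draw.WP E b Q v := by
  obtain ⟨h1, h2, h3, h4, h5, h6, hn2⟩ := hC.bounds
  simp only [draw, Cmd.WP, View.pay, View.assign, Expr.rules, Function.update_apply, reduceCtorEq,
    if_false, if_true, true_and, and_true]
  refine ⟨by omega, fun u => ∃ i, u.var .i = i ∧ i ≤ n ∧ Frame v u [.i, .y] [2, 3, 4, 7] ∧
      u.sess = v.sess ∧ u.used = v.used + 2 * i ∧ u.vt ≤ v.vt + 20 + 200 * i ∧ (∀ j < i,
      u.arr 3 j = (E.coins (v.used + 2 * j) : ℕ) % n ∧ u.arr 4 j = (E.coins (v.used + 2 * j + 1) :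
      ℕ) ∧ u.arr 2 j = 0 ∧ u.arr 7 j = 0) ∧ (∀ j, i ≤ j → u.arr 2 j = v.arr 2 j ∧ u.arr 7 j = v.arr
      7 j), fun u => n - u.var .i, ⟨0, ?_⟩, ?_⟩
  · refine ⟨by simp, by omega, ?_, rfl, rfl, ?_, by simp, by simp⟩
    · simp +contextual [Frame.iff]
    · grind
  · rintro u ⟨i, hi, hi2, hf, hs, hu, ht, harr, hrest⟩
    have en : u.var .n = n := by rw [hf.get _, hn]
    simp only [Function.update_apply, reduceCtorEq, if_false, if_true,
    en, hi]
    refine ⟨fun hne => ?_, fun he => ?_⟩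
    · have hy := (E.coins u.used).2
      -- The remainder has to be expressed by division and multiplication, as there is no
      -- instruction for it.
      have hmod : (E.coins u.used : ℕ) - (E.coins u.used : ℕ) / n * n = (E.coins u.used : ℕ) % n := by
        have := Nat.mod_add_div' (E.coins u.used : ℕ) n
        omega
      have hle : (E.coins u.used : ℕ) / n * n ≤ E.coins u.used := Nat.div_mul_le_self _ _
      refine ⟨by omega, by omega, by omega, by omega, by omega, by omega, by omega, by omega,
        by omega, by omega, by omega, by omega, ⟨i + 1, rfl, by omega, ?_, hs, ?_, ?_, ?_, ?_⟩, ?_⟩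
      · simp +contextual [Frame.iff, hf.all]
      · grind
      · grind
      · grind
      · grind
      · omega
    · refine hQ _ ⟨hf.var, hf.arr, hf.low, hf.inp⟩ hs ?_ ?_ ?_ ?_
      · grind
      · grind
      · grind
      · grind

/-- The estimate, as a word, of a run of the black box. -/
def wordEst (E : Env) (i : ℕ) (I : SSSPInput) (us : List Edge) (a : ℕ) : ℕ := E.box.est i I us a % 2
  ^ E.w

theorem eval_est_of_sess {v : View} {c : Session} {x y : Expr} (h : v.sess[x.eval E v]? = some c) :
    (Expr.est x y).eval E v = wordEst E (x.eval E v) c.start c.updates (y.eval E v) := by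
  rw [Expr.eval_est, h]; rfl

/-- A run is always started on the initial graph, whose edge list stays in memory, and the logged
updates are replayed. Thus its life is a prefix of the real update sequence, to which the bound `T`
applies. The replay costs nothing, since each update passed on releases more than the body of the
loop takes. Nothing is fetched meanwhile, so every vertex is still in the unread output afterwards.
-/
theorem Cmd.newSession_spec (hC : Ctx E n p q l) (hb : b = 2 * l.length) {us : List Edge} (hS :
    Static n p q l us v) (hus : LegalSeq E.mode n l us) {x k : ℕ} (hx : v.var .x = x) (hxn :
    x < n) (hk : v.var .k = k) (hlen : v.sess.length < 2 ^ E.w) (hQ : ∀ u un, Frame v u [.cur, .j,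
    .a1, .a2] [] → u.sess = v.sess ++ [⟨⟨n, l, x, k, p, 256 * q⟩, us, un⟩] →
    u.var .cur = v.sess.length → u.used = v.used → u.vt ≤ v.vt + 100 - 10000 * (n + l.length) →
    (∀ a ∈ un, a < n) → (∀ a < n, a ∈ un) → Q u) : newSession.WP E b Q v := by
  obtain ⟨h1, h2, h3, h4, h5, h6, hn2⟩ := hC.bounds
  have hp := hC.p_pos
  have hpq := hC.p_lt
  set I : SSSPInput := ⟨n, l, x, k, p, 256 * q⟩ with hI
  have hst : startOf v .n .x .k .p .den .m = I := by
    simp only [startOf, hS.n', hS.p', hS.m', hS.den', hx, hk, hI, SSSPInput.mk.injEq, and_true,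
      true_and]
    refine List.ext_getElem (by simp) fun i hi _ => ?_
    rw [List.getElem_map, List.getElem_range]
    exact hS.low' i (by simpa using hi)
  have hval : I.Valid := ⟨hC.edges, hxn, hp, by simp only [hI]; omega⟩
  have husl : us.length ≤ n * n := hus.length_after.1.trans (hus.maxEdges_le hC.edges)
  simp only [newSession, Cmd.WP, View.pay, View.assign, Expr.rules, Function.update_apply,
    reduceCtorEq, if_false, if_true, true_and, and_true, hst, hS.m', hb]
  refine ⟨le_rfl, hval, hlen, by omega, ?_⟩
  refine ⟨fun u => ∃ i un, u.var .j = i ∧ i ≤ us.length ∧ Frame v u [.cur, .j, .a1, .a2] [] ∧ u.sess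
      = v.sess ++ [⟨I, us.take i, un⟩] ∧ u.var .cur = v.sess.length ∧ u.used = v.used ∧ u.vt ≤ v.vt
      + 50 - 10000 * (n + l.length) ∧ (∀ a ∈ un, a < n) ∧ ∀ a < n, a ∈ un, fun u => us.length -
      u.var .j, ⟨0, _, by simp, by omega, ?_, by simp; rfl, by simp, rfl, ?_, ?_, ?_⟩, ?_⟩
  · simp +contextual [Frame.iff]
  · grind
  · exact hC.box.changed_lt _ I [] hval trivial
  · exact hC.box.mem_changed_start _ I hval
  · rintro u ⟨i, un, hi, hi2, hf, hs, hcur, hu, ht, hun1, hun2⟩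
    have hU : u.var .U = us.length := by rw [hf.get _, hS.U']
    simp only [Function.update_apply, reduceCtorEq, if_false, if_true,
    true_and, hi, hU, hcur, hs]
    refine ⟨fun hne => ?_, fun he => ?_⟩
    · have hil : i < us.length := by omega
      have hlog := hS.log' i hil
      have htk : us.take i ++ [us[i]] = us.take (i + 1) := List.take_concat_get' us i hil
      have hpre : us.take (i + 1) <+: us := List.take_prefix _ _
      have hlegal := hus.prefix hpre
      have hupd : LegalUpdate E.mode n (afterUpdates E.mode l (us.take i)) us[i] := by
        have := hlegal
        rw [← htk, legalSeq_append] at this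
        exact this.2
      rw [hf.mem 0, hf.mem 1, hlog]
      refine ⟨⟨by norm_num, by omega⟩, ⟨by norm_num, by omega⟩, ⟨I, us.take i, un⟩, by simp, hval,
        ?_, hupd, by omega, ⟨i + 1, un ++ E.box.changed v.sess.length I (us.take (i + 1)), rfl, hil,
        ?_, ?_, hu, ?_, ?_, ?_⟩, by omega⟩
      · grind
      · simp +contextual [Frame.iff, hf.all]
      · simp [htk]
      · grind
      · intro a ha
        rcases List.mem_append.1 ha with h | h
        · grind
        · exact hC.box.changed_lt _ I _ hval hlegal a h
      · grind
    · refine hQ _ un ⟨hf.var, hf.arr, hf.low, hf.inp⟩ ?_ hcur hu ?_ hun1 hun2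
      · simp only [List.take_of_length_le (show us.length ≤ i by omega)]
      · grind

/-- Each fetched vertex releases 10000 units, and a body takes at most 5000, so emptying the unread
output is free up to a constant. The invariant `I` is indexed by the vertices not yet fetched and
may not depend on the fetched value, the runs or the time. All updates have been passed on before,
so the estimate seen by the body is the current one. -/
theorem Cmd.drain_spec {body : Cmd} {c : Session} (hsess : v.sess[v.var .cur]? = some c) (hlt : ∀ a
    ∈ c.unread, a + 1 < 2 ^ E.w) (I : List ℕ → View → Prop) (h0 : I c.unread v) (hstab : ∀ L u y t
    s, I L u → I L { u with var := Function.update u.var .y y, vt := t, sess := s }) (hbody : ∀ a L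
    u, I (a :: L) u → u.sess = v.sess.set (v.var .cur) { c with unread := L } → u.var .cur = v.var
    .cur → u.var .y = a + 1 → estY.ok E b u → estY.eval E u = wordEst E (v.var .cur) c.start
    c.updates a → body.WP E b (fun z => I L z ∧ z.sess = u.sess ∧ z.var .cur = u.var .cur ∧ z.used =
    u.used ∧ z.vt ≤ u.vt + 5000) u) (hQ : ∀ u, I [] u → u.sess = v.sess.set (v.var .cur) { c with
    unread := [] } → u.var .cur = v.var .cur → u.used = v.used → u.vt ≤ v.vt + 10 → Q u) : (drain
    body).WP E b Q v := by
  have hcl : v.var .cur < v.sess.length := (List.getElem?_eq_some_iff.1 hsess).1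
  have hw : 1 < 2 ^ E.w → True := fun _ => trivial
  -- The state just before the loop test: either nothing was left to fetch and `y` is 0, or `y`
  -- holds a vertex plus one, with at least 9000 units saved up for its treatment.
  set J : View → Prop := fun u => ∃ L, u.var .cur = v.var .cur ∧ u.used = v.used ∧
    u.sess = v.sess.set (v.var .cur) { c with unread := L } ∧ u.vt ≤ v.vt + 5 ∧ (∀ a ∈ L,
    a + 1 < 2 ^ E.w) ∧ ((u.var .y = 0 ∧ L = [] ∧ I [] u) ∨ ∃ a, u.var .y = a + 1 ∧ a + 1 < 2 ^ E.w ∧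
    I (a :: L) u ∧ u.vt + 9000 ≤ v.vt) with hJ
  have hnext : ∀ u L, u.var .cur = v.var .cur → u.used = v.used → u.sess = v.sess.set (v.var .cur)
      { c with unread := L } → u.vt ≤ v.vt → (∀ a ∈ L, a + 1 < 2 ^ E.w) → I L u →
      (Cmd.next .y .cur).WP E b (fun z => J z ∧ (u.sess = z.sess → z.var .y = 0) ∧ (u.sess ≠ z.sess
      → ∃ a, L = a :: (z.sess[v.var .cur]?.elim [] Session.unread))) u := by
    intro u L e1 e2 e3 e4 e5 e6
    simp only [Cmd.WP, View.assign, e1]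
    have hc : u.sess[v.var .cur]? = some { c with unread := L } := by grind
    refine ⟨_, hc, ?_, ?_⟩
    · grind
    · intro a L' hL
      simp only at hL
      subst hL
      have ha := e5 a (by simp)
      refine ⟨ha, ⟨L', ?_, e2, ?_, ?_, fun z hz => e5 z (by simp [hz]), Or.inr ⟨a, by simp, ha,
        hstab _ _ _ _ _ e6, ?_⟩⟩, ?_, ?_⟩
      · grind
      · simp_all
      · grind
      · grind
      · intro h
        have := congrArg (fun s => (s[v.var .cur]?).elim [] Session.unread) h
        simp [e3, hcl] at this
      · grind
  have hc0 : v.sess = v.sess.set (v.var .cur) { c with unread := c.unread } := by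
    have : v.sess[v.var .cur] = c := (List.getElem?_eq_some_iff.1 hsess).2
    rw [← this]
    simp
  change (Cmd.next .y .cur).WP E b ((Cmd.whil ↟.y (body ;; .next .y .cur)).WP E b Q) v
  refine WP.mono (hnext v c.unread rfl rfl hc0 le_rfl hlt h0) fun u hu => ?_
  -- The variant is the length of the unread output plus one for the vertex that has been fetched
  -- but not treated, and 0 at the end. That a fetch shortens the output is read off from the change
  -- of the runs.
  refine ⟨J, fun u => if u.var .y = 0 then 0 else
    ((u.sess[v.var .cur]?).elim [] Session.unread).length + 1, hu.1, ?_⟩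
  rintro u ⟨L, e1, e2, e3, e4, e5, e6⟩
  refine ⟨trivial, ?_, ?_⟩
  · intro hy
    rcases e6 with ⟨h, -⟩ | ⟨a, f1, f2, f3, f4⟩
    · exact absurd h hy
    have hoky : estY.ok E b (u.pay 3) := by
      simp only [Expr.rules, View.pay, e1, e3, List.length_set, true_and]
      exact ⟨by omega, hcl⟩
    have hcu : (u.pay 3).sess[(u.pay 3).var .cur]? = some { c with unread := L } := by
      simp only [View.pay]
      rw [e3, e1, List.getElem?_set_self hcl]
    change body.WP E b ((Cmd.next .y .cur).WP E b _) (u.pay 3)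
    refine WP.mono (hbody a L (u.pay 3) ?_ e3 e1 f1 hoky ?_) ?_
    · have := hstab _ u (u.var .y) (u.vt + 3) u.sess f3
      simpa [View.pay] using this
    · rw [eval_est_of_sess (c := { c with unread := L }) hcu]
      simp only [Expr.rules, View.pay, e1, f1, Nat.add_sub_cancel]
    · rintro z ⟨g1, g2, g3, g4, g5⟩
      simp only [View.pay] at g2 g3 g4 g5
      refine WP.mono (hnext z L (g3.trans e1) (g4.trans e2) (g2.trans e3) (by omega) e5 g1) fun z'
        hz' => ⟨hz'.1, ?_⟩
      by_cases hzz : z.sess = z'.sess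
      · simp only [Expr.rules] at hy
        show (if _ then _ else _) < (if _ then _ else _)
        rw [if_pos (hz'.2.1 hzz), if_neg hy]
        omega
      · obtain ⟨a', ha'⟩ := hz'.2.2 hzz
        simp only [Expr.rules] at hy
        show (if _ then _ else _) < (if _ then _ else _)
        rw [if_neg hy, e3, List.getElem?_set_self hcl]
        simp only [Option.elim_some]
        rw [ha']
        split_ifs <;> simp
  · intro hy
    simp only [Expr.rules] at hy
    rcases e6 with ⟨-, h, h'⟩ | ⟨a, f1, -⟩
    · subst h
      refine hQ _ ?_ e3 e1 e2 ?_
      · have := hstab _ u (u.var .y) (u.vt + 3) u.sess h'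
        simpa [View.pay] using this
      · simp only [View.pay, Expr.rules]; omega
    · omega

end specs

/-! ## The search for a good vertex when edges are deleted -/

/-- How far the search for a vertex of small eccentricity has come, when the radius is about `r`:
in stage `0` the random vertices `S c` are tried, in stage `1` a vertex far from all of them, and in
stage `2` vertices close to that one. Marked vertices need not be tried. At most `k` vertices have
been tried so far, including the current one `x`. -/
def Stage (n : ℕ) (G : List Edge) (r σ N B : ℕ) (S : ℕ → ℕ) (st c x : ℕ) (mk : ℕ → ℕ) (k : ℕ) :
    Prop :=
  (st = 0 ∧ c < N ∧ x = S c ∧ (∀ v < n, mk v ≠ 0 → ∃ u < n, r < gdist n G v u) ∧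
    (∀ v < n, mk v = 0 → ∀ i < c, r / 2 < gdist n G (S i) v) ∧ k ≤ c + 1) ∨
  (st = 1 ∧ (∀ i < N, r / 2 < gdist n G (S i) x) ∧ k ≤ N + 1) ∨
  (st = 2 ∧ mk x = 0 ∧ ∃ w < n, ∃ (Z : Finset ℕ) (y : ℕ),
    (∀ v < n, mk v ≠ 0 → r / 2 - 2 * σ < gdist n G w v ∨
      ∃ u < n, r + (r - (r / 2 - 2 * σ)) < gdist n G v u) ∧
    (∀ v < n, mk v = 0 → gball n G v (σ / 2) ⊆ Z) ∧
    Z.card + y * (σ / 2 + 1) ≤ B ∧ k ≤ N + 2 + y)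

section stage

variable {n : ℕ} {G : List Edge} {r σ N B : ℕ} {S : ℕ → ℕ} {st c x : ℕ} {mk : ℕ → ℕ} {k : ℕ}

theorem gball_anti {G' : List Edge} (hc : (graphOf n G').Connected)
    (hle : graphOf n G' ≤ graphOf n G) (v h : ℕ) : gball n G' v h ⊆ gball n G v h := by
  intro u hu
  rw [mem_gball] at hu ⊢
  exact ⟨hu.1, (gdist_anti hc hle v u).trans hu.2⟩

theorem Stage.delete {G' : List Edge} (h : Stage n G r σ N B S st c x mk k)
    (hc : (graphOf n G').Connected) (hle : graphOf n G' ≤ graphOf n G) :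
    Stage n G' r σ N B S st c x mk k := by
  have hd := fun u v => gdist_anti hc hle u v
  rcases h with ⟨h1, h2, h3, h4, h5, h6⟩ | ⟨h1, h2, h3⟩ | ⟨h1, h2, w, hw, Z, y, h3, h4, h5⟩
  · refine Or.inl ⟨h1, h2, h3, fun v hv hm => ?_, fun v hv hm i hi => ?_, h6⟩
    · grind
    · grind
  · exact Or.inr (Or.inl ⟨h1, fun i hi => (h2 i hi).trans_le (hd _ _), h3⟩)
  · refine Or.inr (Or.inr ⟨h1, h2, w, hw, Z, y, fun v hv hm => ?_, fun v hv hm => ?_, h5⟩)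
    · grind
    · exact (gball_anti hc hle _ _).trans (h4 v hv hm)

/-- In the last stage each of `y` failures has removed at least `σ / 2 + 1` vertices from a set of
at most `B`. -/
theorem Stage.le (h : Stage n G r σ N B S st c x mk k) : k ≤ N + 2 + B / (σ / 2 + 1) := by
  have h0 := Nat.zero_le (B / (σ / 2 + 1))
  rcases h with ⟨h1, h2, h3, h4, h5, h6⟩ | ⟨h1, h2, h3⟩ | ⟨h1, h2, w, hw, Z, y, h3, h4, h5, h6⟩
  · omega
  · omega
  · have : y ≤ B / (σ / 2 + 1) := (Nat.le_div_iff_mul_le (by omega)).2 (by omega)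
    omega

theorem exists_center_of_le (hc : (graphOf n G).Connected) (hn : 0 < n) (h : ¬ r < grad n G) :
    ∃ z < n, ∀ v < n, gdist n G z v ≤ r := by
  obtain ⟨z, hz, h'⟩ := exists_center hc hn
  exact ⟨z, hz, fun v hv => (h' v hv).trans (by omega)⟩

variable {f : ℕ → ℕ}

/-- The diameter is at most twice the radius, so a distance above `4 r` refutes the guess at once,
and no marking is needed. -/
theorem lt_grad_of_far (hc : (graphOf n G).Connected) (hn : 0 < n) (hx : x < n)
    (hf : Accurate n G r σ x f) (h : ∃ a < n, 4 * r < f a) : r < grad n G := by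
  obtain ⟨a, ha, h⟩ := h
  have h1 := hf.lt_gdist ha (by omega) h
  have h2 := gdist_le_two_grad hc hx ha
  omega

/-- If no estimate exceeds `4 r`, all true distances are below `16 r`, so the accuracy guarantee
holds for all vertices and not only for those in range. -/
theorem Accurate.close (hf : Accurate n G r σ x f) (hc : (graphOf n G).Connected) (hx : x < n)
    (hr : 0 < r) (hσ : 16 * σ ≤ r) (h4 : ∀ a < n, f a ≤ 4 * r) :
    ∀ v < n, f v ≤ gdist n G x v ∧ gdist n G x v ≤ f v + σ := fun v hv =>
  hf v hv ((hf.gdist_le hc hx (by omega) h4 v hv).trans (by omega))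

variable (hc : (graphOf n G).Connected) (hn : 0 < n) (hr : 0 < r) (hσ : 16 * σ ≤ r) (hx : x < n)
  (hf : Accurate n G r σ x f) (h4 : ∀ a < n, f a ≤ 4 * r)
  (hbad : ∃ a < n, r + (r + 1) / 2 + 4 * σ < f a)
include hc hn hr hσ hx hf h4 hbad

/-- The failed sample vertex `x` has eccentricity above `r + ⌈r/2⌉ + 4σ`, hence every vertex within
`r/2 + σ` of it has eccentricity above `r` and cannot be a centre for the guess. If all vertices get
marked in this way, then `R > r`; otherwise an unmarked vertex is farther than `r/2` from the whole
sample. -/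
theorem Stage.next_zero (h : Stage n G r σ N B S 0 c x mk k) {mk' : ℕ → ℕ}
    (hmk : ∀ v < n, mk' v = if f v ≤ r / 2 then 1 else mk v) :
    (c + 1 < N → Stage n G r σ N B S 0 (c + 1) (S (c + 1)) mk' (k + 1)) ∧
    (N ≤ c + 1 → (∀ y < n, mk' y = 0 → Stage n G r σ N B S 1 c y mk' (k + 1)) ∧
      ((∀ y < n, mk' y ≠ 0) → r < grad n G)) := by
  have hcl := hf.close hc hx hr hσ h4
  obtain ⟨a, ha, hbad⟩ := hbad
  have hxa := hf.lt_gdist ha (by omega) hbad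
  rcases h with ⟨-, h2, h3, h5, h6, h7⟩ | ⟨h1, -⟩ | ⟨h1, -⟩
  · have hmark : ∀ v < n, mk' v ≠ 0 → ∃ u < n, r < gdist n G v u := by
      intro v hv hm
      rw [hmk v hv] at hm
      split_ifs at hm with hle
      · refine ⟨a, ha, ?_⟩
        have := gdist_triangle hc hx hv ha
        have := (hcl v hv).2
        omega
      · grind
    have hun : ∀ v < n, mk' v = 0 → ∀ i < c + 1, r / 2 < gdist n G (S i) v := by grind
    refine ⟨fun hlt => Or.inl ⟨rfl, hlt, rfl, hmark, hun, by omega⟩, fun hle => ⟨fun y hy hm =>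
      Or.inr (Or.inl ⟨rfl, fun i hi => hun y hy hm i (by omega), by omega⟩), fun hall => ?_⟩⟩
    by_contra hg
    obtain ⟨z, hz, hz'⟩ := exists_center_of_le hc hn hg
    obtain ⟨u, hu, hu'⟩ := hmark z hz (hall z hz)
    exact absurd (hz' u hu) (by omega)
  · omega
  · omega

-- Suppose that `z` has eccentricity at most `r`. If `z` is at distance less than `r/2 - 2σ` from
-- `w`, then `z` itself is too eccentric by assumption. Otherwise let `y` be the vertex at that
-- distance on a shortest path from `w` to `z`. It is at distance at most `r - (r/2 - 2σ)` from `z`,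
-- which bounds its eccentricity by `r + (r - (r/2 - 2σ))`, and it is not farther from `w` than
-- allowed: both alternatives for `y` fail.
omit hr hx hf h4 hbad in
theorem lt_grad_of_marked {w : ℕ} (hw : w < n)
    (h : ∀ v < n, r / 2 - 2 * σ < gdist n G w v ∨
      ∃ u < n, r + (r - (r / 2 - 2 * σ)) < gdist n G v u) : r < grad n G := by
  by_contra hg
  obtain ⟨z, hz, hz'⟩ := exists_center_of_le hc hn hg
  by_cases hle : r / 2 - 2 * σ ≤ gdist n G w z
  · obtain ⟨y, hy, h1, h2⟩ := exists_gdist_between hc hw hz hle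
    rcases h y hy with h3 | ⟨u, hu, h3⟩
    · omega
    · have := gdist_triangle hc hy hz hu
      have := hz' u hu
      have := hz' w hw
      rw [gdist_comm] at this
      omega
  · grind

/-- From now on only the vertices near `w = x` matter, so the old marks are overwritten: a vertex is
marked if its estimate exceeds `r/2 - 2σ`. An unmarked vertex is within `r/2 - σ` of `x`, so its
ball of radius `σ/2` lies in the ball of radius `r/2` around `x`; that ball is the initial set `Z`.
It has at most `B` elements because `x` is far from the sample. -/
theorem Stage.next_one (h : Stage n G r σ N B S 1 c x mk k) {mk' : ℕ → ℕ}
    (hmk : ∀ v < n, mk' v ≠ 0 ↔ r / 2 - 2 * σ < f v)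
    (hB : (∀ i < N, r / 2 < gdist n G (S i) x) → (gball n G x (r / 2)).card ≤ B) :
    (∀ y < n, mk' y = 0 → Stage n G r σ N B S 2 c y mk' (k + 1)) ∧
      ((∀ y < n, mk' y ≠ 0) → r < grad n G) := by
  have hcl := hf.close hc hx hr hσ h4
  rcases h with ⟨h1, -⟩ | ⟨-, h2, h3⟩ | ⟨h1, -⟩
  · omega
  · have hmark : ∀ v < n, mk' v ≠ 0 → r / 2 - 2 * σ < gdist n G x v ∨
        ∃ u < n, r + (r - (r / 2 - 2 * σ)) < gdist n G v u := by grind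
    refine ⟨fun y hy hm => Or.inr (Or.inr ⟨rfl, hm, x, hx, gball n G x (r / 2), 0, hmark, ?_, ?_,
      by omega⟩), fun hall => lt_grad_of_marked hc hn hσ hx fun v hv => hmark v hv (hall v hv)⟩
    · intro v hv hm u hu
      rw [mem_gball] at hu ⊢
      refine ⟨hu.1, ?_⟩
      have h5 : ¬ r / 2 - 2 * σ < f v := fun h => (hmk v hv).2 h hm
      have := (hcl v hv).2
      have := gdist_triangle hc hx hv hu.1
      omega
    · grind
  · omega

/-- All vertices with estimate at most `σ` are within `2σ` of the failed vertex `x` and inherit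
eccentricity above `r + ⌈r/2⌉ + 2σ`, exactly what `lt_grad_of_marked` asks for. Vertices that remain
unmarked are more than `σ` from `x`, so their balls of radius `σ/2` are disjoint from the ball of
`x`, which can be removed from `Z`. -/
theorem Stage.next_two (h : Stage n G r σ N B S 2 c x mk k) {mk' : ℕ → ℕ}
    (hmk : ∀ v < n, mk' v = if f v ≤ σ then 1 else mk v) :
    (∀ y < n, mk' y = 0 → Stage n G r σ N B S 2 c y mk' (k + 1)) ∧
      ((∀ y < n, mk' y ≠ 0) → r < grad n G) := by
  have hcl := hf.close hc hx hr hσ h4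
  obtain ⟨a, ha, hbad⟩ := hbad
  have hxa := hf.lt_gdist ha (by omega) hbad
  rcases h with ⟨h1, -⟩ | ⟨h1, -⟩ | ⟨-, h2, w, hw, Z, y, h3, h5, h6, h7⟩
  · omega
  · omega
  · have hmark : ∀ v < n, mk' v ≠ 0 → r / 2 - 2 * σ < gdist n G w v ∨
        ∃ u < n, r + (r - (r / 2 - 2 * σ)) < gdist n G v u := by
      intro v hv hm
      rw [hmk v hv] at hm
      split_ifs at hm with hle
      · refine Or.inr ⟨a, ha, ?_⟩
        have := gdist_triangle hc hx hv ha
        have := (hcl v hv).2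
        omega
      · grind
    refine ⟨fun z hz hm => Or.inr (Or.inr ⟨rfl, hm, w, hw, Z \ gball n G x (σ / 2), y + 1, hmark,
      ?_, ?_, by omega⟩), fun hall => lt_grad_of_marked hc hn hσ hw fun v hv => hmark v hv (hall v hv)⟩
    · intro v hv hm u hu
      rw [hmk v hv] at hm
      split_ifs at hm with hle
      rw [Finset.mem_sdiff]
      refine ⟨h5 v hv hm hu, fun hu' => ?_⟩
      rw [mem_gball] at hu hu'
      have := (hcl v hv).1
      have := gdist_triangle hc hx hu.1 hv
      have := hu.2
      rw [gdist_comm] at this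
      omega
    · have hsub := h5 x hx h2
      have := Finset.card_sdiff_add_card_eq_card hsub
      -- There is a vertex farther than `σ` from `x`, so the ball of `x` need not be the whole graph
      -- and has its full size.
      have hn' : σ / 2 + 1 ≤ n := by
        have h8 := gdist_lt hc x a hn
        omega
      have := le_gball_card hc hx hn'
      rw [Nat.add_mul]
      omega

end stage

/-! ## Programs for marking vertices and for watching the current run -/

namespace Cmd

/-- Write `x` or `y` at every vertex, according to whether its estimate is more than `rad`. -/
def mark (rad : Var) (x y : Expr) : Cmd :=
  .set .i 0 ;; .whil (↟.n - ↟.i) (.ite (.est ↟.cur ↟.i - ↟rad) (.aset 2 ↟.i x) (.aset 2 ↟.i y) ;;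
    .set .i (↟.i + 1))

/-- Let `x` be the first unmarked vertex, or `n`. -/
def findUnmarked : Cmd := .set .x 0 ;; .whil (.arr 2 ↟.x) (.set .x (↟.x + 1))

/-- Note which changed vertices are too far away. -/
def check : Cmd :=
  drain (.ite (estY - ↟.thr) (.set .bad 1) .skip ;; .ite (estY - 4 * ↟.r) (.set .vb 1) .skip)

end Cmd

/-! ### Specifications of marking and watching -/

section specs

variable {E : Env} {b n p q : ℕ} {l : List Edge} {Q : View → Prop} {v : View}

/-- The expression `x` has the value `f i` as long as cell `i` is unchanged. -/
def Cell (E : Env) (b : ℕ) (v : View) (x : Expr) (f : ℕ → ℕ) : Prop :=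
  x.cost ≤ 8 ∧ ∀ u i, u.var .i = i → u.arr 2 i = v.arr 2 i → b + 8 * i + 8 < 2 ^ E.w → x.ok E b u ∧ x.eval E u = f i

theorem Cmd.mark_spec (hC : Ctx E n p q l) (hb : b = 2 * l.length) (hn : v.var .n = n)
    {rad : Var} {x y : Expr} {f g : ℕ → ℕ} (hx : Cell E b v x f) (hy : Cell E b v y g)
    (hrad : rad ∉ [Var.i]) {c : Session} (hsess : v.sess[v.var .cur]? = some c)
    (hQ : ∀ u, Frame v u [.i] [2] → u.sess = v.sess → u.used = v.used →
      u.vt ≤ v.vt + 50 * (n + 1) → u.arr 2 n = v.arr 2 n → (∀ a < n, u.arr 2 a =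
        if v.var rad < wordEst E (v.var .cur) c.start c.updates a then f a else g a) → Q u) :
    (mark rad x y).WP E b Q v := by
  obtain ⟨h1, h2, h3, h4, h5, h6, hn2⟩ := hC.bounds
  have hcl : v.var .cur < v.sess.length := (List.getElem?_eq_some_iff.1 hsess).1
  simp only [mark, Cmd.WP, View.pay, View.assign, Expr.rules, true_and, and_true]
  refine ⟨by omega, fun u => ∃ i, u.var .i = i ∧ i ≤ n ∧ Frame v u [.i] [2] ∧ u.sess = v.sess ∧
      u.used = v.used ∧ u.vt ≤ v.vt + 20 + 50 * i ∧ (∀ a, i ≤ a → u.arr 2 a = v.arr 2 a) ∧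
      ∀ a < i, u.arr 2 a =
        if v.var rad < wordEst E (v.var .cur) c.start c.updates a then f a else g a,
    fun u => n - u.var .i, ⟨0, ?_⟩, ?_⟩
  · exact ⟨by simp, by omega, by simp +contextual [Frame.iff], rfl, rfl, by grind, by simp, by simp⟩
  · rintro u ⟨i, hi, hi2, hf, hs, hu, ht, ha1, ha2⟩
    have hest : ∀ t : ℤ, (Expr.est ↟.cur ↟.i).eval E { u with vt := t }
        = wordEst E (v.var .cur) c.start c.updates i := by
      intro t
      rw [eval_est_of_sess (c := c) (by simp only [Expr.rules, hf.get .cur, hs, hsess])]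
      simp only [Expr.rules, hf.get .cur, hi]
    have hcl' : u.var .cur < u.sess.length := by rw [hf.get .cur, hs]; exact hcl
    simp only [Function.update_apply, if_true, hf.get .n, hn, hi, hest, hf.var _ hrad]
    refine ⟨fun hne => ⟨hcl', fun hlt => ?_, fun hle => ?_⟩, fun he => ?_⟩
    · obtain ⟨k1, k2⟩ := hx.2 u i hi (ha1 i le_rfl) (by omega)
      have k3 := hx.1
      simp only [Expr.ok_vt, Expr.eval_vt, k1, k2]
      exact ⟨trivial, by norm_num, by omega, by omega, ⟨i + 1, rfl, by omega,
        by simp +contextual [Frame.iff, hf.all], hs, hu, by grind, by grind, by grind⟩, by omega⟩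
    · obtain ⟨k1, k2⟩ := hy.2 u i hi (ha1 i le_rfl) (by omega)
      have k3 := hy.1
      simp only [Expr.ok_vt, Expr.eval_vt, k1, k2]
      exact ⟨trivial, by norm_num, by omega, by omega, ⟨i + 1, rfl, by omega,
        by simp +contextual [Frame.iff, hf.all], hs, hu, by grind, by grind, by grind⟩, by omega⟩
    · exact hQ _ ⟨hf.var, hf.arr, hf.low, hf.inp⟩ hs hu (by grind) (ha1 n (by omega))
        fun a ha => ha2 a (by omega)

/-- The cell with index `n` is kept at 0 and serves as a sentinel, so the search needs no bound test
and ends with `n` if all vertices are marked. -/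
theorem Cmd.findUnmarked_spec (hC : Ctx E n p q l) (hb : b = 2 * l.length) (h0 : v.arr 2 n = 0)
    (hQ : ∀ u, Frame v u [.x] [] → u.sess = v.sess → u.used = v.used →
      u.vt ≤ v.vt + 50 * (n + 1) → u.var .x ≤ n → v.arr 2 (u.var .x) = 0 →
      (∀ a < u.var .x, v.arr 2 a ≠ 0) → Q u) :
    findUnmarked.WP E b Q v := by
  obtain ⟨h1, h2, h3, h4, h5, h6, hn2⟩ := hC.bounds
  simp only [findUnmarked, Cmd.WP, View.pay, View.assign, Expr.rules,
    true_and]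
  refine ⟨by omega, fun u => ∃ x, u.var .x = x ∧ x ≤ n ∧ Frame v u [.x] [] ∧ u.sess = v.sess ∧
      u.used = v.used ∧ u.vt ≤ v.vt + 20 + 50 * x ∧ ∀ a < x, v.arr 2 a ≠ 0,
    fun u => n - u.var .x, ⟨0, ?_⟩, ?_⟩
  · refine ⟨by simp, by omega, ?_, rfl, rfl, ?_, by simp⟩
    · simp +contextual [Frame.iff]
    · grind
  · rintro u ⟨x, hx, hx2, hf, hs, hu, ht, ha⟩
    have earr : u.arr 2 = v.arr 2 := hf.mem _
    simp only [Function.update_apply, if_true,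
    hx, earr]
    refine ⟨⟨by norm_num, by omega⟩, fun hne => ?_, fun he => ?_⟩
    · have hxn : x ≠ n := by rintro rfl; exact hne h0
      refine ⟨by omega, ⟨x + 1, rfl, by omega, ?_, hs, hu, by grind, fun a h => ?_⟩, by omega⟩
      · simp +contextual [Frame.iff, hf.all]
      · grind
    · refine hQ _ ⟨hf.var, hf.arr, hf.low, hf.inp⟩ hs hu (by grind) (hx.trans_le hx2) ?_ ?_
      · grind
      · grind

/-- The flags tell whether the run `cur` of the black box, which has no unread output, shows that
some vertex is too far away from `x`. -/
structure Watch (E : Env) (n p q : ℕ) (l us : List Edge) (r : ℕ) (v : View) : Prop where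
  run : v.sess[v.var .cur]? = some ⟨⟨n, l, v.var .x, 16 * r, p, 256 * q⟩, us, []⟩
  src : v.var .x < n
  bad : v.var .bad ≠ 0 ↔ ∃ a < n, threshold p q r <
    wordEst E (v.var .cur) ⟨n, l, v.var .x, 16 * r, p, 256 * q⟩ us a
  vb : v.var .vb ≠ 0 ↔ ∃ a < n, 4 * r <
    wordEst E (v.var .cur) ⟨n, l, v.var .x, 16 * r, p, 256 * q⟩ us a

/-- The flags record the existence of a large estimate, but only changed vertices are inspected.
This is enough since all others are known to have had small estimates before (`hold`): after a start
every vertex is among the outputs, and after an update an unchanged estimate was acceptable already.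
-/
theorem Cmd.check_spec (hC : Ctx E n p q l) {us : List Edge} {r : ℕ} (hr1 : r ≤ 10 * n)
    (hr : v.var .r = r) (hthr : v.var .thr = threshold p q r) {un : List ℕ}
    (hsess : v.sess[v.var .cur]? = some ⟨⟨n, l, v.var .x, 16 * r, p, 256 * q⟩, us, un⟩)
    (hx : v.var .x < n) (hun : ∀ a ∈ un, a < n) (hbad : v.var .bad = 0) (hvb : v.var .vb = 0)
    (hold : ∀ a < n, a ∉ un →
      wordEst E (v.var .cur) ⟨n, l, v.var .x, 16 * r, p, 256 * q⟩ us a ≤ threshold p q r ∧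
      wordEst E (v.var .cur) ⟨n, l, v.var .x, 16 * r, p, 256 * q⟩ us a ≤ 4 * r)
    (hQ : ∀ u, Frame v u [.y, .bad, .vb] [] →
      u.sess = v.sess.set (v.var .cur) ⟨⟨n, l, v.var .x, 16 * r, p, 256 * q⟩, us, []⟩ →
      u.used = v.used → u.vt ≤ v.vt + 10 → Watch E n p q l us r u → Q u) :
    check.WP E b Q v := by
  obtain ⟨h1, h2, h3, h4, h5, h6, hn2⟩ := hC.bounds
  set I : SSSPInput := ⟨n, l, v.var .x, 16 * r, p, 256 * q⟩ with hI
  have hcl : v.var .cur < v.sess.length := (List.getElem?_eq_some_iff.1 hsess).1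
  refine Cmd.drain_spec (c := ⟨I, us, un⟩) hsess (fun a ha => by have := hun a ha; omega)
    (fun L u => Frame v u [.y, .bad, .vb] [] ∧ (∀ a ∈ L, a < n) ∧
      (∀ a < n, a ∉ L → wordEst E (v.var .cur) I us a ≤ threshold p q r ∨ u.var .bad ≠ 0) ∧
      (u.var .bad ≠ 0 → ∃ a < n, threshold p q r < wordEst E (v.var .cur) I us a) ∧
      (∀ a < n, a ∉ L → wordEst E (v.var .cur) I us a ≤ 4 * r ∨ u.var .vb ≠ 0) ∧
      (u.var .vb ≠ 0 → ∃ a < n, 4 * r < wordEst E (v.var .cur) I us a)) ?_ ?_ ?_ ?_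
  · refine ⟨Frame.refl _ _ _, hun, fun a ha h => Or.inl (hold a ha h).1, fun h => absurd hbad h,
      fun a ha h => Or.inl (hold a ha h).2, fun h => absurd hvb h⟩
  · rintro L u y t s ⟨hf, h⟩
    refine ⟨by simp +contextual [Frame.iff, hf.all], ?_⟩
    simpa using h
  · rintro a L u ⟨hf, hL, g1, g2, g3, g4⟩ hs hcur hy hok hev
    have er : u.var .r = r := by rw [hf.get _, hr]
    have ethr : u.var .thr = threshold p q r := by rw [hf.get _, hthr]
    have hev' : ∀ (x : Var) (t : ℤ) (y : ℕ), x ≠ .cur → x ≠ .y →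
        estY.eval E { u with var := Function.update u.var x y, vt := t }
          = wordEst E (v.var .cur) I us a := by
      intro x t y hx1 hx2
      rw [← hev]
      simp only [Expr.eval_est, Expr.rules,
        Function.update_of_ne hx1.symm, Function.update_of_ne hx2.symm]
    have hev2 : ∀ t : ℤ, estY.eval E { u with vt := t } = wordEst E (v.var .cur) I us a := by
      intro t
      rw [← hev, Expr.eval_vt]
    have hok' : ∀ (x : Var) (t : ℤ) (y : ℕ), x ≠ .cur → x ≠ .y →
        estY.ok E b { u with var := Function.update u.var x y, vt := t } := by
      intro x t y hx1 hx2
      simp only [Expr.rules,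
        Function.update_of_ne hx1.symm] at hok ⊢
      exact hok
    have hok2 : ∀ t : ℤ, estY.ok E b { u with vt := t } := fun t => (Expr.ok_vt _ _ _).2 hok
    have han := hL a (by simp)
    simp only [Cmd.WP, View.pay, View.assign, Expr.rules, hok, hok2, hok', hev, hev2, hev',
      ne_eq, reduceCtorEq, not_false_eq_true, er, ethr, Function.update_of_ne, true_and, and_true]
    refine ⟨fun k1 => ⟨by omega, ⟨by omega, by omega⟩, fun k2 => ⟨by omega, ?_⟩, fun k2 => ?_⟩,
      fun k1 => ⟨⟨by omega, by omega⟩, fun k2 => ⟨by omega, ?_⟩, fun k2 => ?_⟩⟩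
    all_goals
      refine ⟨⟨by simp +contextual [Frame.iff, hf.all], fun z hz => hL z (by simp [hz]), fun z hz hzL => ?_, fun h => ?_,
        fun z hz hzL => ?_, fun h => ?_⟩, by grind⟩
    all_goals
      try
        by_cases hza : z = a
        · grind
        · grind
    all_goals first
      | exact ⟨a, han, by omega⟩
      | exact g2 (by simpa using h)
      | exact g4 (by simpa using h)
  · rintro u ⟨hf, hL, g1, g2, g3, g4⟩ hs hcur hu ht
    have ex : u.var .x = v.var .x := hf.get _
    refine hQ u hf hs hu ht ⟨?_, ex ▸ hx, ?_, ?_⟩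
    · grind
    · grind
    · grind

end specs

/-! ## The algorithm for edge deletions -/

/-- The radii that are guessed one after the other. -/
def guess (p q : ℕ) : ℕ → ℕ
  | 0 => 0
  | g + 1 => guess p q g + 1 + slack p q (guess p q g)

namespace Cmd

/-- Guess a larger radius. -/
def newGuess : Cmd := .set .r (↟.r + 1 + ↟.p * ↟.r / (16 * ↟.q)) ;; params ;; .set .out (↟.thr +
  ↟.sg) ;; draw ;; .set .st 0 ;; .set .c 0 ;; .set .x (.arr 3 0)

/-- Mark the vertices that need not be tried after the vertex of the current run has failed. -/
def remark : Cmd := .set .go 1 ;; .ite ↟.st (.ite (↟.st - 1) (mark .sg (.arr 2 ↟.i) 1) (mark .hA 1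
  0)) (mark .hS (.arr 2 ↟.i) 1)

/-- Go on to the first unmarked vertex, if there is one. -/
def scan : Cmd := findUnmarked ;; .ite (↟.n - ↟.x) (.set .go 0 ;; .ite (↟.st - 1) .skip (.set .st
  (↟.st + 1))) .skip

/-- Find the next vertex to be tried; the flag `go` is set if there is none. -/
def advance : Cmd := remark ;; .ite ↟.st scan (.ite (↟.N - (↟.c + 1)) (.set .c (↟.c + 1) ;; .set .x
  (.arr 3 ↟.c) ;; .set .go 0) scan)

/-- Start a run of the black box at `x`. -/
def retry : Cmd := .set .bad 0 ;; .set .vb 0 ;; newSession ;; check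

/-- Replace the vertex that has failed. -/
def replace : Cmd := .ite ↟.vb newGuess (advance ;; .ite ↟.go newGuess .skip) ;; retry

/-- Go on until the vertex that is tried does not fail. -/
def search : Cmd := .whil ↟.bad replace

/-- Process an update. -/
def deletion : Cmd := .inp .a1 ;; .inp .a2 ;; .aset 0 ↟.U ↟.a1 ;; .aset 1 ↟.U ↟.a2 ;; .set .U (↟.U +
  1) ;; .tell .cur .a1 .a2 ;; check ;; search

end Cmd

theorem Frame.weaken {v u : View} {X X' : List Var} {J J' : List ℕ} (h : Frame v u X J)
    (hX : X ⊆ X' := by simp) (hJ : J ⊆ J' := by simp) : Frame v u X' J' :=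
  ⟨fun x hx => h.var x fun h => hx (hX h), fun j hj => h.arr j fun h => hj (hJ h), h.low, h.inp⟩

theorem Frame.of_assign {v u : View} {X : List Var} {J : List ℕ} {y : Var} {a : ℕ} {t : ℤ} (h :
    Frame { v with var := Function.update v.var y a, vt := t } u X J) : Frame v u (y :: X) J := by
  refine ⟨fun x hx => ?_, h.arr, h.low, h.inp⟩
  rw [List.mem_cons, not_or] at hx
  rw [h.var x hx.2]
  grind

theorem le_guess (p q g : ℕ) : g ≤ guess p q g := by
  induction g with
  | zero => exact le_rfl
  | succ g ih => simp only [guess]; omega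

theorem guess_succ_le {p q g : ℕ} (hpq : p < q) : guess p q (g + 1) ≤ guess p q g + 1 + guess p q g
    / 16 := by
  have := slack_le (r := guess p q g) hpq
  simp only [guess]; omega

/-- The total of `F` over the distance bounds of all runs of the black box. -/
def sessCost (F : ℕ → ℝ) (L : List Session) : ℝ := (L.map fun c => F c.start.k).sum

theorem sessCost_append (F : ℕ → ℝ) (L : List Session) (c : Session) : sessCost F (L ++ [c]) =
    sessCost F L + F c.start.k := by
  simp [sessCost]

theorem sessCost_set (F : ℕ → ℝ) (L : List Session) (i : ℕ) (c c' : Session) (h : L[i]? = some c)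
    (hc : c'.start = c.start) : sessCost F (L.set i c') = sessCost F L := by
  unfold sessCost
  rw [List.map_set, hc]
  congr 1
  obtain ⟨hi, rfl⟩ := List.getElem?_eq_some_iff.1 h
  exact List.set_getElem_self (as := L.map fun c => F c.start.k) (by simpa using hi) ▸ by simp

/-- The runs of the black box are started on the initial graph, and have received updates that have
been made. -/
def SessionsOK (n p q : ℕ) (l us : List Edge) (L : List Session) : Prop := ∀ c ∈ L, c.start.n = n ∧
  c.start.edges = l ∧ c.start.src < n ∧ c.start.num = p ∧ c.start.den = 256 * q ∧ c.updates <+: us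

theorem SessionsOK.set {n p q : ℕ} {l us : List Edge} {L : List Session} (h : SessionsOK n p q l us
    L) {i : ℕ} {c c' : Session} (hi : L[i]? = some c) (hc : c'.start = c.start) (hu : c'.updates <+:
    us) : SessionsOK n p q l us (L.set i c') := by
  intro d hd
  rcases List.mem_or_eq_of_mem_set hd with hd | rfl
  · exact h d hd
  · obtain ⟨h1, h2, h3, h4, h5, -⟩ := h c (List.mem_of_getElem? hi)
    grind

/-- How many vertices may be tried for a guess. -/
noncomputable def tryBound (n p q : ℕ) (l : List Edge) (Bz : ℕ → ℕ) (g : ℕ) : ℕ := if grad n l ≤ 5 *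
  guess p q (g + 1) then
    sampleSize n (guess p q (g + 1)) + 2 + Bz g / (slack p q (guess p q (g + 1)) / 2 + 1)
  else 1

/-- The state of the algorithm, apart from the progress of the search with the current guess, the
`g + 1`-st one, for which `j` runs of the black box have been started. -/
structure DelBase (E : Env) (n p q : ℕ) (l : List Edge) (Bz : ℕ → ℕ) (us : List Edge) (g j : ℕ) (v :
    View) : Prop where
  static : Static n p q l us v
  params : Params n p q (guess p q (g + 1)) v
  lt_grad : guess p q g < grad n (afterUpdates E.mode l us)
  used : v.used = 2 * n * (g + 1)
  out : v.var .out = threshold p q (guess p q (g + 1)) + slack p q (guess p q (g + 1))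
  sample : ∀ i < n, v.arr 3 i = (E.coins (2 * n * g + 2 * i) : ℕ) % n
  sentinel : v.arr 2 n = 0
  cost : ∀ F : ℕ → ℝ, (∀ k, 0 ≤ F k) → sessCost F v.sess ≤ ∑ i ∈ Finset.range g, tryBound n p q l Bz
    i * F (16 * guess p q (i + 1)) + j * F (16 * guess p q (g + 1))
  sessions : SessionsOK n p q l us v.sess

/-- The progress of the search, after `k` vertices have been tried. -/
structure DelStage (E : Env) (n p q : ℕ) (l : List Edge) (Bz : ℕ → ℕ) (us : List Edge) (g k :
    ℕ) (v : View) : Prop where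
  stage : Stage n (afterUpdates E.mode l us) (guess p q (g + 1)) (slack p q (guess p q (g + 1)))
    (sampleSize n (guess p q (g + 1))) (Bz g) (v.arr 3) (v.var .st) (v.var .c) (v.var .x) (v.arr 2)
    k
  early : k ≤ 1 ∨ grad n l ≤ 5 * guess p q (g + 1)
  src : v.var .x < n

/-- Balls that the sample for the `g + 1`-st guess does not hit have at most `B` elements. -/
def Hits (E : Env) (n p q : ℕ) (G : List Edge) (g B : ℕ) : Prop := ∀ v < n, (∀ i < sampleSize n
  (guess p q (g + 1)), guess p q (g + 1) / 2 < gdist n G ((E.coins (2 * n * g + 2 * i) :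
  ℕ) % n) v) → (gball n G v (guess p q (g + 1) / 2)).card ≤ B

/-! ### One step of the search under deletions -/

section specs

variable {E : Env} {b n p q : ℕ} {l : List Edge} {Q : View → Prop} {v : View} {us : List Edge}
  {Bz : ℕ → ℕ} {g j k : ℕ}

theorem DelStage.le_tryBound (h : DelStage E n p q l Bz us g k v) (hk : j ≤ k) : j ≤ tryBound n p q
    l Bz g := by
  have h1 := h.stage.le
  have h2 := h.early
  unfold tryBound
  grind

theorem tryBound_le (hn : 2 ≤ n) (hBz : Bz g ≤ n) : tryBound n p q l Bz g ≤ 3 * n := by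
  unfold tryBound
  have h1 := sampleSize_le (n := n) (r := guess p q (g + 1)) (by have := le_guess p q (g + 1); omega)
  have h2 := Nat.div_le_self (Bz g) (slack p q (guess p q (g + 1)) / 2 + 1)
  split_ifs <;> omega

theorem sessCost_one (L : List Session) : sessCost (fun _ => 1) L = L.length := by
  simp [sessCost]

theorem DelBase.guess_le (h : DelBase E n p q l Bz us g j v) (hC : Ctx E n p q l) (hcon : (graphOf n
    (afterUpdates E.mode l us)).Connected) : guess p q g < n ∧ guess p q (g + 1) ≤ 2 * n := by
  have h1 := h.lt_grad
  have h2 := grad_lt hcon (by have := hC.two_le; omega)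
  have h3 := guess_succ_le (g := g) hC.p_lt
  omega

/-- The cost invariant holds for every nonnegative weight `F` of the runs. With constant weight 1 it
counts them, which keeps run numbers within a word and makes the search terminate; with `F` the
bound `T` it will give the running time. There are at most `n` guesses because `g ≤ guess p q g < R
< n`. -/
theorem DelBase.length_le (h : DelBase E n p q l Bz us g j v) (hC : Ctx E n p q l) (hBz : ∀ g,
    Bz g ≤ n) (hcon : (graphOf n (afterUpdates E.mode l us)).Connected) (hj : j ≤ 3 * n) :
    v.sess.length ≤ 3 * (n * n) := by
  have h1 := h.cost (fun _ => 1) (fun _ => zero_le_one)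
  have h2 := (h.guess_le hC hcon).1
  have h3 := le_guess p q g
  simp only [sessCost_one, mul_one] at h1
  have h4 : ∑ i ∈ Finset.range g, tryBound n p q l Bz i ≤ g * (3 * n) := by
    refine (Finset.sum_le_card_nsmul _ _ (3 * n) fun i _ => tryBound_le hC.two_le (hBz i)).trans ?_
    simp
  have h5 : v.sess.length ≤ ∑ i ∈ Finset.range g, tryBound n p q l Bz i + j := by
    exact_mod_cast h1
  have h6 : (g + 1) * (3 * n) ≤ n * (3 * n) := Nat.mul_le_mul_right _ (by omega)
  grind

theorem DelBase.frame {u : View} {X : List Var} {J : List ℕ} (h : DelBase E n p q l Bz us g j v) (hf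
    : Frame v u X J) (hs : u.sess = v.sess) (hu : u.used = v.used) (h2 : u.arr 2 n = v.arr 2 n) (hX
    : ∀ x ∈ [Var.n, .p, .q, .m, .den, .U, .r, .sg, .hS, .hA, .thr, .k, .N, .out], x ∉ X := by simp)
    (hJ : ∀ j ∈ [0, 1, 3], j ∉ J := by simp) : DelBase E n p q l Bz us g j u where
  static := h.static.frame hf (fun x hx => hX x (by revert hx; simp; tauto)) (fun j hj => hJ j
    (by revert hj; simp; tauto))
  params := h.params.frame hf (fun x hx => hX x (by revert hx; simp; tauto))
  lt_grad := h.lt_grad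
  used := hu.trans h.used
  out := by rw [hf.off hX, h.out]
  sample := by rw [hf.offArr hJ]; exact h.sample
  sentinel := h2.trans h.sentinel
  cost := by rw [hs]; exact h.cost
  sessions := by rw [hs]; exact h.sessions

theorem Cmd.newGuess_spec (hC : Ctx E n p q l) (hb : b = 2 * l.length) (hS : Static n p q l us v) {ρ
    : ℕ} (hr : v.var .r = ρ) (hρ : ρ + 1 + slack p q ρ ≤ 10 * n) (hQ : ∀ u, Frame v u [.r, .sg, .hS,
    .hA, .thr, .k, .N, .out, .i, .y, .st, .c, .x] [2, 3, 4, 7] → u.sess = v.sess → u.used = v.used +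
    2 * n → u.vt ≤ v.vt + 400 * n + 500 → Params n p q (ρ + 1 + slack p q ρ) u → u.var .out =
    threshold p q (ρ + 1 + slack p q ρ) + slack p q (ρ + 1 + slack p q ρ) → (∀ i < n, u.arr 3 i =
    (E.coins (v.used + 2 * i) : ℕ) % n) → u.var .st = 0 → u.var .c = 0 → u.var .x = u.arr 3 0 → (∀ i
    < n, u.arr 2 i = 0) → u.arr 2 n = v.arr 2 n → Q u) : newGuess.WP E b Q v := by
  obtain ⟨h1, h2, h3, h4, h5, h6, hn2⟩ := hC.bounds
  have hpq := hC.p_lt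
  have hsl' : p * ρ / (16 * q) = slack p q ρ := rfl
  have hpr : p * ρ ≤ 10 * (n * q) := by
    calc p * ρ ≤ q * (10 * n) := Nat.mul_le_mul hpq.le (by omega)
      _ = 10 * (n * q) := by ring
  unfold newGuess
  simp only [Cmd.WP, View.assign, Expr.rules, hr, hS.p', hS.q', hsl', true_and]
  refine ⟨⟨⟨by omega, by omega⟩, ⟨by omega, by omega, by omega⟩, by omega⟩, ?_⟩
  refine Cmd.params_spec hC (r := ρ + 1 + slack p q ρ) ?_ ?_ ?_ (by simp) (by omega) hρ ?_
  · simpa using hS.n'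
  · simpa using hS.p'
  · simpa using hS.q'
  intro u hf hs hu ht hP
  have hsl := slack_le (r := ρ + 1 + slack p q ρ) hpq
  have hthr : threshold p q (ρ + 1 + slack p q ρ) ≤ 20 * n := by unfold threshold; omega
  simp only [hP.thr', hP.sg']
  refine ⟨by omega, ?_⟩
  refine Cmd.draw_spec hC hb ?_ ?_
  · simp only [ne_eq, reduceCtorEq, not_false_eq_true, Function.update_of_ne]
    rw [hf.get _]
    simpa using hS.n'
  intro w wf ws wu wt wa wb
  refine ⟨by omega, by omega, ⟨by omega, by norm_num, by omega⟩, ?_⟩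
  have hf' : Frame v w [.r, .sg, .hS, .hA, .thr, .k, .N, .out, .i, .y, .st, .c, .x] [2, 3, 4,
    7] := Frame.trans (hf.of_assign.weaken) (wf.of_assign.weaken (X' := [.out, .i, .y]) (J' := [2,
    3, 4, 7]) (by simp) (by simp)) (by simp) (by simp)
  refine hQ _ (by simp +contextual [Frame.iff, hf'.all]) (ws.trans hs) ?_ ?_ ?_ ?_ ?_ (by simp) (by simp) (by simp) ?_ ?_
  · grind
  · grind
  · have hP' : Params n p q (ρ + 1 + slack p q ρ) w := (hP.frame (X := [.out]) (J := []) (u :=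
      { u with var := Function.update u.var .out _, vt := _ }) (by simp +contextual [Frame.iff])
      (by simp)).frame wf (by simp)
    exact hP'.frame (X := [.st, .c, .x]) (J := []) (by simp +contextual [Frame.iff]) (by simp)
  · simp only [ne_eq, reduceCtorEq, not_false_eq_true, Function.update_of_ne]
    rw [wf.get _]
    simp
  · grind
  · grind
  · have := (wb n le_rfl).1
    simp only at this ⊢
    rw [this, hf.mem _]

theorem Cmd.remark_spec (hC : Ctx E n p q l) (hb : b = 2 * l.length) (hn : v.var .n = n) {c :
    Session} (hsess : v.sess[v.var .cur]? = some c) (hQ : ∀ u, Frame v u [.i, .go] [2] → u.sess =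
    v.sess → u.used = v.used → u.vt ≤ v.vt + 50 * n + 100 → u.arr 2 n = v.arr 2 n → u.var .go = 1 →
    (v.var .st = 0 → ∀ a < n, u.arr 2 a = if wordEst E (v.var .cur) c.start c.updates a ≤ v.var .hS
    then 1 else v.arr 2 a) → (v.var .st = 1 → ∀ a < n, u.arr 2 a ≠ 0 ↔ v.var .hA < wordEst E (v.var
    .cur) c.start c.updates a) → (2 ≤ v.var .st → ∀ a < n, u.arr 2 a = if wordEst E (v.var .cur)
    c.start c.updates a ≤ v.var .sg then 1 else v.arr 2 a) → Q u) : remark.WP E b Q v := by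
  obtain ⟨h1, h2, h3, h4, h5, h6, hn2⟩ := hC.bounds
  unfold remark
  simp only [Cmd.WP, View.assign, View.pay, Expr.rules, true_and, ne_eq, reduceCtorEq,
    not_false_eq_true, Function.update_of_ne]
  have hfr : ∀ (t : ℤ) {u : View}, Frame
      { v with var := Function.update v.var .go 1, vt := t } u [.i] [2] → Frame v u [.i, .go] [2] ∧ u.var .go = 1 := fun t u hf =>
    ⟨hf.of_assign.weaken, by rw [hf.get _]; simp⟩
  have keep : ∀ w : View, w.arr = v.arr → Cell E b w (.arr 2 ↟.i) (v.arr 2) := fun w hw =>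
    ⟨by simp, fun u i hi h2 hlt => by simp [hi, h2, hw, hlt]⟩
  have const : ∀ w : View, Cell E b w 1 (fun _ => 1) ∧ Cell E b w 0 (fun _ => 0) := fun w =>
    ⟨⟨by simp, fun u i _ _ hlt => ⟨show 1 < 2 ^ E.w by omega, rfl⟩⟩, by simp, fun u i _ _ hlt => by simp⟩
  refine ⟨by omega, fun hst => ⟨by omega, fun hst2 => ?_, fun hst2 => ?_⟩, fun hst => ?_⟩
  · refine Cmd.mark_spec hC hb (by simpa using hn) (keep _ rfl) (const _).1 (by simp) hsess ?_
    intro u hf hs hu ht hsen hm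
    exact hQ u (hfr _ hf).1 hs hu (by grind) hsen (hfr _ hf).2 (by omega) (by omega) (by grind)
  · refine Cmd.mark_spec hC hb (by simpa using hn) (const _).1 (const _).2 (by simp) hsess ?_
    intro u hf hs hu ht hsen hm
    exact hQ u (hfr _ hf).1 hs hu (by grind) hsen (hfr _ hf).2 (by omega) (by grind) (by omega)
  · refine Cmd.mark_spec hC hb (by simpa using hn) (keep _ rfl) (const _).1 (by simp) hsess ?_
    intro u hf hs hu ht hsen hm
    exact hQ u (hfr _ hf).1 hs hu (by grind) hsen (hfr _ hf).2 (by grind) (by omega) (by omega)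

theorem Cmd.scan_spec (hC : Ctx E n p q l) (hb : b = 2 * l.length) (hn : v.var .n = n) (h0 :
    v.arr 2 n = 0) (hst : v.var .st ≤ 2) (hQ : ∀ u, Frame v u [.x, .go, .st] [] → u.sess = v.sess →
    u.used = v.used → u.vt ≤ v.vt + 50 * n + 100 → (u.var .x < n ∧ v.arr 2 (u.var .x) = 0 ∧
    u.var .go = 0 ∧ u.var .st = (if v.var .st = 0 then 1 else 2) ∨ (∀ a < n, v.arr 2 a ≠ 0) ∧
    u.var .go = v.var .go) → Q u) : scan.WP E b Q v := by
  obtain ⟨h1, h2, h3, h4, h5, h6, hn2⟩ := hC.bounds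
  unfold scan
  refine Cmd.findUnmarked_spec hC hb h0 ?_
  intro u hf hs hu ht hx hx0 hall
  have en : u.var .n = n := by rw [hf.get _, hn]
  have est : u.var .st = v.var .st := hf.get _
  have hf' : Frame v u [.x, .go, .st] [] := ⟨fun x hx => hf.var x
    (by intro h; exact hx (by revert h; simp; tauto)), hf.arr, hf.low, hf.inp⟩
  simp only [Cmd.WP, View.pay, View.assign, Expr.rules, Function.update_apply, reduceCtorEq,
    if_false, true_and, and_true, en, est]
  refine ⟨fun hlt => ⟨by omega, by omega, fun hst1 => ?_, fun hst1 => ⟨⟨by omega, by omega⟩, ?_⟩⟩,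
    fun he => ?_⟩
  · refine hQ _ (by simp +contextual [Frame.iff, hf'.all]) hs hu (by grind) (Or.inl
      ⟨by simpa using (by omega), by simpa using hx0, by simp, ?_⟩)
    grind
  · refine hQ _ (by simp +contextual [Frame.iff, hf'.all]) hs hu (by grind) (Or.inl
      ⟨by simpa using (by omega), by simpa using hx0, by simp, ?_⟩)
    grind
  · refine hQ _ (by simp +contextual [Frame.iff, hf'.all]) hs hu (by grind) (Or.inr ⟨fun a ha => hall a (by omega), ?_⟩)
    exact hf.get _

variable (hC : Ctx E n p q l) (hb : b = 2 * l.length) (hus : LegalSeq E.mode n l us) (hcon :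
  (graphOf n (afterUpdates E.mode l us)).Connected)
include hC hus hcon

theorem Watch.accurate {r : ℕ} (h : Watch E n p q l us r v) : Accurate n (afterUpdates E.mode l us)
    r (slack p q r) (v.var .x) (wordEst E (v.var .cur) ⟨n, l, v.var .x, 16 * r, p, 256 * q⟩ us) :=
    accurate_est hC.box h.src hC.p_pos hC.p_lt hC.edges hus hcon (by
    obtain ⟨h1, h2, h3, h4, h5, h6, -⟩ := hC.bounds
    omega)

-- The place where the three stages are combined. When the watched vertex has failed, with all
-- estimates at most `4 r`, the marks are updated. Then there is either a next vertex to try, the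
-- flag `go` being cleared, or everything is marked and the guess is refuted.
include hb in
theorem Cmd.advance_spec (hgr : grad n l ≤ grad n (afterUpdates E.mode l us)) (hB : DelBase E n p q
    l Bz us g j v) (hSt : DelStage E n p q l Bz us g k v) (hW : Watch E n p q l us (guess p q (g +
    1)) v) (hbad : v.var .bad ≠ 0) (hvb : v.var .vb = 0) (hh : Hits E n p q (afterUpdates E.mode l
    us) g (Bz g)) (hQ : ∀ u, Frame v u [.i, .go, .x, .st, .c] [2] → u.sess = v.sess →
    u.used = v.used → u.vt ≤ v.vt + 200 * n + 500 → u.arr 2 n = v.arr 2 n → (u.var .go = 0 ∧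
    DelStage E n p q l Bz us g (k + 1) u ∨ u.var .go ≠ 0 ∧ guess p q (g + 1) < grad n (afterUpdates
    E.mode l us)) → Q u) : advance.WP E b Q v := by
  obtain ⟨h1, h2, h3, h4, h5, h6, hn2⟩ := hC.bounds
  have hn0 : 0 < n := by omega
  have hf := hW.accurate hC hus hcon
  set G := afterUpdates E.mode l us with hG
  set r := guess p q (g + 1) with hr
  set f := wordEst E (v.var .cur) ⟨n, l, v.var .x, 16 * r, p, 256 * q⟩ us with hfdef
  have hbad' := hW.bad.1 hbad
  have hr0 : 0 < r := by have := le_guess p q (g + 1); omega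
  have hr2 := (hB.guess_le hC hcon).2
  have hσ := slack_le (r := r) hC.p_lt
  have h4' : ∀ a < n, f a ≤ 4 * r := by
    intro a ha
    by_contra hlt
    exact hW.vb.2 ⟨a, ha, Nat.lt_of_not_le hlt⟩ hvb
  have hN := sampleSize_le (n := n) hr0
  -- All estimates are at most `4 r`, so the current radius, and the smaller initial radius as well,
  -- is at most `4 r + σ ≤ 5 r`. Thus guesses far below the initial radius are given up after a
  -- single run and pass through no stages.
  have hearly : grad n l ≤ 5 * r := by
    refine hgr.trans (grad_le hcon hW.src fun a ha => ?_)
    have h7 := (hf.close hcon hW.src hr0 hσ h4' a ha).2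
    grind
  have hst : Stage n G r (slack p q r) (sampleSize n r) (Bz g) (v.arr 3) (v.var .st) (v.var .c)
      (v.var .x) (v.arr 2) k := hSt.stage
  unfold advance
  refine Cmd.remark_spec hC hb hB.static.n' hW.run ?_
  intro u uf us' uu ut un ugo m0 m1 m2
  have en : u.var .n = n := by rw [uf.get _, hB.static.n']
  have est : u.var .st = v.var .st := uf.get _
  have ec : u.var .c = v.var .c := uf.get _
  have eN : u.var .N = sampleSize n r := by rw [uf.get _, hB.params.N']
  have e3 : u.arr 3 = v.arr 3 := uf.mem _
  rw [hB.params.hS'] at m0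
  rw [hB.params.hA'] at m1
  rw [hB.params.sg'] at m2
  have hscan : ∀ t ≤ v.vt + 60 * n + 200, v.var .st ≤ 2 → ((∀ y < n, u.arr 2 y = 0 →
      Stage n G r (slack p q r) (sampleSize n r) (Bz g) (v.arr 3) (if v.var .st = 0 then 1 else 2)
      (v.var .c) y (u.arr 2) (k + 1)) ∧ ((∀ y < n, u.arr 2 y ≠ 0) → r < grad n G)) →
      scan.WP E b Q { u with vt := t } := by
    intro t htt hst2 ⟨k1, k2⟩
    refine Cmd.scan_spec hC hb en (un.trans hB.sentinel) (by rw [← est] at hst2; exact hst2) ?_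
    intro w wf ws wu wt wc
    have w2 : w.arr 2 = u.arr 2 := wf.mem _
    have w3 : w.arr 3 = v.arr 3 := (wf.mem _).trans e3
    have wcc : w.var .c = v.var .c := (wf.get _).trans ec
    refine hQ w ?_ (ws.trans us') (wu.trans uu) (by simp only at wt; omega) ?_ ?_
    · have wf' : Frame u w [.x, .go, .st] [] := ⟨wf.var, wf.arr, wf.low, wf.inp⟩
      exact (uf.weaken).trans wf'
    · rw [w2, un]
    · rcases wc with ⟨c1, c2, c3, c4⟩ | ⟨c1, c2⟩
      · refine Or.inl ⟨c3, ⟨?_, Or.inr hearly, c1⟩⟩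
        rw [w2, w3, wcc, c4]
        have := k1 (w.var .x) c1 c2
        simp only [est]
        exact this
      · grind
  simp only [Cmd.WP, View.pay, Expr.rules, est, true_and]
  rcases Nat.lt_or_ge (v.var .st) 1 with hs0 | hs0
  · have hs0' : v.var .st = 0 := by omega
    have hst0 := hst
    rw [hs0'] at hst0
    obtain ⟨n0, n1⟩ := hst0.next_zero hcon hn0 hr0 hσ hW.src hf h4' hbad' (m0 hs0')
    refine ⟨fun h => absurd hs0' h, fun _ => ?_⟩
    have hcN : v.var .c < sampleSize n r := by
      rcases hst0 with ⟨-, h, -⟩ | ⟨h, -⟩ | ⟨h, -⟩ <;> first | exact h | omega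
    simp only [View.assign, Function.update_apply, if_true,
    ec, eN]
    refine ⟨by omega, fun hlt => ⟨by omega, by omega, by omega, hQ _ ?_ us' uu (by grind) un (Or.inl
      ⟨by simp, ⟨?_, Or.inr hearly, ?_⟩⟩)⟩, fun hle => hscan _ (by grind) (by omega) ?_⟩
    · have := uf.weaken (X' := [.i, .go, .x, .st, .c]) (J' := [2])
      simp +contextual [Frame.iff, this.all]
    · grind
    · have := hB.sample (v.var .c + 1) (by omega)
      simp only [e3, Function.update_self, reduceCtorEq, ne_eq, not_false_eq_true,
        Function.update_of_ne, this]
      simpa [this] using Nat.mod_lt _ hn0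
    · grind
  · refine ⟨fun _ => hscan _ (by grind) ?_ ?_, fun h => by omega⟩
    · rcases hst with ⟨h, -⟩ | ⟨h, -⟩ | ⟨h, -⟩ <;> omega
    · rw [if_neg (by omega)]
      rcases Nat.lt_or_ge (v.var .st) 2 with hs1 | hs1
      · have hs1' : v.var .st = 1 := by omega
        have hst1 := hst
        rw [hs1'] at hst1
        refine hst1.next_one hcon hn0 hr0 hσ hW.src hf h4' hbad' (m1 hs1') fun hfar => ?_
        refine hh _ hW.src fun i hi => ?_
        have := hfar i hi
        rwa [hB.sample i (lt_of_lt_of_le hi hN)] at this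
      · have hs2' : v.var .st = 2 := by
          rcases hst with ⟨h, -⟩ | ⟨h, -⟩ | ⟨h, -⟩ <;> omega
        have hst2 := hst
        rw [hs2'] at hst2
        exact hst2.next_two hcon hn0 hr0 hσ hW.src hf h4' hbad' (m2 hs1)

-- The new run is taken into account in the cost, and its start releases `10000 * (n + m)` units,
-- which later pay for marking, scanning and drawing the next sample.
omit hcon in
include hb in
theorem Cmd.retry_spec (hBz : ∀ g, Bz g ≤ n) (hcon : (graphOf n (afterUpdates E.mode l
    us)).Connected) (hB : DelBase E n p q l Bz us g k v) (hSt : DelStage E n p q l Bz us g (k + 1)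
    v) (hQ : ∀ u, DelBase E n p q l Bz us g (k + 1) u → DelStage E n p q l Bz us g (k + 1) u →
    Watch E n p q l us (guess p q (g + 1)) u → u.sess.length = v.sess.length + 1 → u.used = v.used →
    u.inp = v.inp → u.vt ≤ v.vt + 200 - 10000 * (n + l.length) → Q u) : retry.WP E b Q v := by
  obtain ⟨h1, h2, h3, h4, h5, h6, hn2⟩ := hC.bounds
  have hr2 := (hB.guess_le hC hcon).2
  have hk := (hSt.le_tryBound (j := k) (by omega)).trans (tryBound_le hn2 (hBz g))
  have hlen := hB.length_le hC hBz hcon hk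
  unfold retry
  simp only [Cmd.WP, View.assign, Expr.rules]
  refine ⟨by omega, by omega, ?_⟩
  have hf0 : Frame v { v with
      var := Function.update (Function.update v.var .bad 0) .vb 0
      vt := v.vt + ((1 : ℕ) + 2) + ((1 : ℕ) + 2) } [.bad, .vb] [] := by
    simp +contextual [Frame.iff]
  have hS0 := hB.static.frame hf0
  have hP0 := hB.params.frame hf0 (by simp)
  refine Cmd.newSession_spec hC hb hS0 hus rfl hSt.src hP0.k' (by simp only; omega) ?_
  intro u un uf us' ucur uu ut un1 un2
  have huf : Frame v u [.bad, .vb, .cur, .j, .a1, .a2] [] := (hf0.weaken).trans uf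
  have ex : u.var .x = v.var .x := huf.get _
  have ebad : u.var .bad = 0 := by rw [uf.get _]; simp
  have evb : u.var .vb = 0 := by rw [uf.get _]; simp
  simp only [reduceCtorEq, ne_eq, not_false_eq_true, Function.update_of_ne] at us' ucur uu ut
  have hrun : u.sess[u.var .cur]? = some ⟨⟨n, l, u.var .x, 16 * guess p q (g + 1), p, 256 * q⟩, us,
      un⟩ := by grind
  have hP1 := hP0.frame uf (by simp)
  refine Cmd.check_spec hC (by omega) hP1.r' hP1.thr' hrun (ex ▸ hSt.src) un1 ebad evb (fun a ha
    h => absurd (un2 a ha) h) ?_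
  intro w wf ws wu wt wW
  have hwf : Frame v w [.bad, .vb, .cur, .j, .a1, .a2, .y] [] := (huf.weaken).trans wf
  have hws : w.sess = v.sess ++ [⟨⟨n, l, v.var .x, 16 * guess p q (g + 1), p, 256 * q⟩, us,
      []⟩] := by grind
  refine hQ w ?_ ?_ wW ?_ (wu.trans uu) hwf.inp ?_
  · refine ⟨hB.static.frame hwf, hB.params.frame hwf (by simp), hB.lt_grad, (wu.trans uu).trans
      hB.used, ?_, ?_, ?_, ?_, ?_⟩
    · rw [hwf.get _]; exact hB.out
    · rw [hwf.mem _]; exact hB.sample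
    · rw [hwf.mem _]; exact hB.sentinel
    · intro F hF
      rw [hws, sessCost_append]
      have := hB.cost F hF
      push_cast
      linarith
    · intro c hc
      rw [hws, List.mem_append, List.mem_singleton] at hc
      rcases hc with hc | rfl
      · exact hB.sessions c hc
      · exact ⟨rfl, rfl, hSt.src, rfl, rfl, List.prefix_rfl⟩
  · refine ⟨?_, hSt.early, ?_⟩
    · rw [hwf.mem 3, hwf.mem 2, hwf.get .st, hwf.get .c, hwf.get .x]
      exact hSt.stage
    · rw [hwf.get .x]; exact hSt.src
  · grind
  · grind

-- Whatever happens, exactly one run is started, and it pays for all the passes over the vertices,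
-- so the virtual time decreases. A new guess is made only after `r < R` has been shown, which is
-- the lower bound that the next guess inherits.
include hb in
theorem Cmd.replace_spec (hBz : ∀ g, Bz g ≤ n) (hgr : grad n l ≤ grad n (afterUpdates E.mode l us))
    (hB : DelBase E n p q l Bz us g k v) (hSt : DelStage E n p q l Bz us g k v) (hW : Watch E n p q
    l us (guess p q (g + 1)) v) (hbad : v.var .bad ≠ 0) (hh : Hits E n p q (afterUpdates E.mode l
    us) g (Bz g)) (hQ : ∀ u g' k', g ≤ g' → DelBase E n p q l Bz us g' k' u → DelStage E n p q l Bz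
    us g' k' u → Watch E n p q l us (guess p q (g' + 1)) u → u.sess.length = v.sess.length + 1 →
    u.inp = v.inp → u.vt + 100 ≤ v.vt → Q u) : replace.WP E b Q v := by
  obtain ⟨h1, h2, h3, h4, h5, h6, hn2⟩ := hC.bounds
  have hf := hW.accurate hC hus hcon
  have hnew : ∀ u : View, DelBase E n p q l Bz us g k u → guess p q (g + 1) < grad n (afterUpdates
      E.mode l us) → u.sess.length = v.sess.length → u.inp = v.inp → u.vt ≤ v.vt + 200 * n + 800 →
      newGuess.WP E b (retry.WP E b Q) u := by
    intro u hu hlt hlen hinp hvt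
    have hgl := grad_lt hcon (by omega : 0 < n)
    have hsl := slack_le (r := guess p q (g + 1)) hC.p_lt
    refine Cmd.newGuess_spec hC hb hu.static hu.params.r' (by omega) ?_
    intro w wf ws wu wt wP wout w3 wst wc wx w2 w2n
    have hx : w.var .x < n := by
      rw [wx, w3 0 (by omega)]
      exact Nat.mod_lt _ (by omega)
    refine Cmd.retry_spec hC hb hus hBz hcon (g := g + 1) (k := 0) ?_ ⟨?_, Or.inl (by simp), hx⟩ ?_
    · refine ⟨hu.static.frame wf, wP, hlt, ?_, wout, ?_, ?_, ?_, ?_⟩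
      · rw [wu, hu.used]; ring
      · intro i hi
        rw [w3 i hi, hu.used]
      · rw [w2n, hu.sentinel]
      · intro F hF
        have h7 := hu.cost F hF
        -- The guess is finished: its actual number of runs is replaced by the bound `tryBound`.
        have h8 : (k : ℝ) * F (16 * guess p q (g + 1)) ≤ tryBound n p q l Bz g * F (16 * guess p q
            (g + 1)) := mul_le_mul_of_nonneg_right (by exact_mod_cast hSt.le_tryBound le_rfl) (hF _)
        rw [ws, Finset.sum_range_succ]
        push_cast
        linarith
      · rw [ws]; exact hu.sessions
    · refine Or.inl ⟨wst, ?_, ?_, fun a ha h => absurd (w2 a ha) h, ?_, by omega⟩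
      · rw [wc]
        exact sampleSize_pos (by omega) (by have := le_guess p q (g + 1 + 1); omega)
      · rw [wc, wx]
      · grind
    · intro z zB zS zW zl zu zi zt
      refine hQ z (g + 1) _ (by omega) zB zS zW (by rw [zl, ws, hlen]) (zi.trans (wf.inp.trans
        hinp)) (by omega)
  unfold replace
  change Cmd.WP E b (.ite ↟.vb newGuess (advance ;; .ite ↟.go newGuess .skip)) (retry.WP E b Q) v
  simp only [Cmd.WP, View.pay, Expr.rules, true_and]
  have hfr : ∀ t, Frame v { v with vt := t } [] [] := fun t => ⟨fun _ _ => rfl, fun _ _ => rfl, rfl, rfl⟩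
  refine ⟨fun hvb => ?_, fun hvb => ?_⟩
  · refine hnew _ (hB.frame (hfr _) rfl rfl rfl) ?_ rfl rfl (by grind)
    exact lt_grad_of_far hcon (by omega) hW.src hf (hW.vb.1 hvb)
  · refine Cmd.advance_spec hC hb hus hcon hgr (hB.frame (hfr _) rfl rfl rfl) ⟨hSt.stage, hSt.early,
      hSt.src⟩ ⟨hW.run, hW.src, hW.bad, hW.vb⟩ hbad hvb hh ?_
    intro u uf us' uu ut un hu
    have uf' : Frame v u [.i, .go, .x, .st, .c] [2] := ⟨uf.var, uf.arr, uf.low, uf.inp⟩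
    have hBu := hB.frame uf' us' uu un
    simp only at us' ut
    refine ⟨fun hgo => ?_, fun hgo => ?_⟩
    · rcases hu with ⟨h, -⟩ | ⟨-, h⟩
      · grind
      · refine hnew _ (hBu.frame (u := { u with vt := _ }) (X := []) (J := []) ⟨fun _ _ => rfl,
          fun _ _ => rfl, rfl, rfl⟩ rfl rfl rfl (by simp) (by simp)) h (by rw [us']) uf.inp
          (by simp only; push_cast at *; omega)
    · rcases hu with ⟨-, h⟩ | ⟨h, -⟩
      · refine Cmd.retry_spec hC hb hus hBz hcon (g := g) (k := k) (hBu.frame (u :=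
          { u with vt := _ }) (X := []) (J := []) ⟨fun _ _ => rfl, fun _ _ => rfl, rfl,
          rfl⟩ rfl rfl rfl (by simp) (by simp)) ⟨h.stage, h.early, h.src⟩ ?_
        intro z zB zS zW zl zu zi zt
        refine hQ z g _ le_rfl zB zS zW (by rw [zl]; simp only [us']) (zi.trans uf.inp) ?_
        grind
      · grind

end specs

/-- What holds between the updates, during the `g + 1`-st guess. -/
def DelInv (E : Env) (n p q : ℕ) (l : List Edge) (Bz : ℕ → ℕ) (us : List Edge) (g : ℕ) (v : View) :
    Prop := v.var .bad = 0 ∧ ∃ k, DelBase E n p q l Bz us g k v ∧ DelStage E n p q l Bz us g k v ∧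
    Watch E n p q l us (guess p q (g + 1)) v

theorem graphOf_delete_le (n : ℕ) (l us : List Edge) : graphOf n (afterUpdates .decremental l us) ≤
    graphOf n l := by
  induction us generalizing l with
  | nil => exact le_rfl
  | cons e us ih =>
    exact (ih _).trans (graphOf_mono n fun _ h => List.mem_of_mem_erase h)

theorem Static.append {n p q : ℕ} {l us : List Edge} {v u : View} {e : Edge} (h : Static n p q l us
    v) (hvar : ∀ x, x ≠ .U → x ≠ .a1 → x ≠ .a2 → u.var x = v.var x) (hU : u.var .U = us.length + 1)
    (hlow : u.low = v.low) (h0 : u.arr 0 = Function.update (v.arr 0) us.length e.1) (h1 :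
    u.arr 1 = Function.update (v.arr 1) us.length e.2) : Static n p q l (us ++ [e]) u where
  n' := by rw [hvar _ (by simp) (by simp) (by simp), h.n']
  p' := by rw [hvar _ (by simp) (by simp) (by simp), h.p']
  q' := by rw [hvar _ (by simp) (by simp) (by simp), h.q']
  m' := by rw [hvar _ (by simp) (by simp) (by simp), h.m']
  den' := by rw [hvar _ (by simp) (by simp) (by simp), h.den']
  U' := by simp [hU]
  low' := by rw [hlow]; exact h.low'
  log' := by
    intro i hi
    rw [h0, h1]
    by_cases hiu : i = us.length
    · grind
    · simp only [List.length_append, List.length_singleton] at hi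
      rw [Function.update_of_ne hiu, Function.update_of_ne hiu, List.getElem_append_left (by omega)]
      exact h.log' i (by omega)

section specs

variable {E : Env} {b n p q : ℕ} {l : List Edge} {Q : View → Prop} {v : View} {us : List Edge}
  {Bz : ℕ → ℕ} {g j k : ℕ}

/-- Every round of the loop starts a run and the number of runs is at most `3 n²`, which gives
termination for any random words, even unlucky ones when `Bz` is taken as `n`. -/
theorem Cmd.search_spec (hC : Ctx E n p q l) (hb : b = 2 * l.length) (hus : LegalSeq E.mode n l us)
    (hcon : (graphOf n (afterUpdates E.mode l us)).Connected) (hBz : ∀ g, Bz g ≤ n) (hgr :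
    grad n l ≤ grad n (afterUpdates E.mode l us)) (hB : DelBase E n p q l Bz us g k v) (hSt :
    DelStage E n p q l Bz us g k v) (hW : Watch E n p q l us (guess p q (g + 1)) v) (hh : ∀ g',
    g ≤ g' → Hits E n p q (afterUpdates E.mode l us) g' (Bz g')) (hQ : ∀ u g', g ≤ g' →
    DelInv E n p q l Bz us g' u → u.vt ≤ v.vt + 10 → Q u) : search.WP E b Q v := by
  have hn2 := hC.two_le
  refine ⟨fun u => (∃ g' k', g ≤ g' ∧ DelBase E n p q l Bz us g' k' u ∧ DelStage E n p q l Bz us g'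
      k' u ∧ Watch E n p q l us (guess p q (g' + 1)) u) ∧ u.vt ≤ v.vt, fun u => 3 * (n * n) + 1 -
      u.sess.length, ⟨⟨g, k, le_rfl, hB, hSt, hW⟩, le_rfl⟩, ?_⟩
  rintro u ⟨⟨g', k', hg, uB, uS, uW⟩, ut⟩
  have hfr : Frame u (u.pay 3) [] [] := ⟨fun _ _ => rfl, fun _ _ => rfl, rfl, rfl⟩
  have uB' := uB.frame hfr rfl rfl rfl
  have uS' : DelStage E n p q l Bz us g' k' (u.pay 3) := ⟨uS.stage, uS.early, uS.src⟩
  have uW' : Watch E n p q l us (guess p q (g' + 1)) (u.pay 3) := ⟨uW.run, uW.src, uW.bad, uW.vb⟩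
  refine ⟨trivial, fun hbad => ?_, fun hbad => ?_⟩
  · refine Cmd.replace_spec hC hb hus hcon hBz hgr uB' uS' uW' hbad (hh g' hg) ?_
    intro z g'' k'' hg' zB zS zW zl zi zt
    refine ⟨⟨⟨g'', k'', hg.trans hg', zB, zS, zW⟩, by simp only [View.pay, Expr.rules] at zt; push_cast at zt; omega⟩, ?_⟩
    have hk := (zS.le_tryBound le_rfl).trans (tryBound_le hn2 (hBz g''))
    have := zB.length_le hC hBz hcon hk
    simp only [View.pay] at zl
    grind
  · exact hQ _ g' hg ⟨hbad, k', uB', uS', uW'⟩ (by simp only [View.pay, Expr.rules]; push_cast; omega)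

/-- Only the run of the watched vertex learns of the deletion; runs of failed vertices are
abandoned. If the estimates stay acceptable nothing else happens, otherwise the search is resumed
with the marks made so far. -/
theorem Cmd.deletion_spec (hC : Ctx E n p q l) (hb : b = 2 * l.length) (hmode :
    E.mode = .decremental) {e : Edge} (hus : LegalSeq E.mode n l (us ++ [e])) (hcon :
    (graphOf n (afterUpdates E.mode l us)).Connected) (hcon' : (graphOf n (afterUpdates E.mode l (us
    ++ [e]))).Connected) (hcon0 : (graphOf n l).Connected) (hBz : ∀ g, Bz g ≤ n) (hv :
    DelInv E n p q l Bz us g v) (hin : v.inp = [e.1, e.2]) (hh : ∀ g', g ≤ g' →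
    Hits E n p q (afterUpdates E.mode l (us ++ [e])) g' (Bz g')) (hQ : ∀ u g', g ≤ g' →
    DelInv E n p q l Bz (us ++ [e]) g' u → u.vt ≤ v.vt + 200 → Q u) : deletion.WP E b Q v := by
  obtain ⟨h1, h2, h3, h4, h5, h6, hn2⟩ := hC.bounds
  have hn0 : 0 < n := by omega
  obtain ⟨hbad, k, hB, hSt, hW⟩ := hv
  obtain ⟨hus0, hupd⟩ := (legalSeq_append _ _ _ _ _).1 hus
  have he : IsEdge n e := hus.isEdge hC.edges e (by simp)
  have he1 : e.1 < e.2 := he.1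
  have he2 : e.2 < n := he.2
  have husl : us.length < n * n := by
    have := hus.length_after.1.trans (hus.maxEdges_le hC.edges)
    simpa using this
  have hle : graphOf n (afterUpdates E.mode l (us ++ [e])) ≤ graphOf n (afterUpdates E.mode l us) := by
    rw [hmode]; exact graphOf_erase_le n l us e
  have hle0 : graphOf n (afterUpdates E.mode l (us ++ [e])) ≤ graphOf n l := by
    rw [hmode]; exact graphOf_delete_le n l _
  have hgr := grad_anti hcon' hn0 hle0 hcon0
  have hr2 := (hB.guess_le hC hcon).2
  have hσ := slack_le (r := guess p q (g + 1)) hC.p_lt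
  have hrun := hW.run
  have hcl : v.var .cur < v.sess.length := (List.getElem?_eq_some_iff.1 hrun).1
  set I : SSSPInput := ⟨n, l, v.var .x, 16 * guess p q (g + 1), p, 256 * q⟩ with hI
  have hval : I.Valid := ⟨hC.edges, hW.src, hC.p_pos, by
    have := hC.p_lt; simp only [hI]; omega⟩
  -- The threshold is below `4 r`, so an acceptable run shows no vertex beyond `4 r` either.
  have hvb : v.var .vb = 0 := by
    by_contra h
    obtain ⟨a, ha, h'⟩ := hW.vb.1 h
    refine hW.bad.2 ⟨a, ha, lt_of_le_of_lt ?_ h'⟩ hbad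
    have := le_guess p q (g + 1)
    unfold threshold
    omega
  have m1 : e.1 % 2 ^ E.w = e.1 := Nat.mod_eq_of_lt (by omega)
  have m2 : e.2 % 2 ^ E.w = e.2 := Nat.mod_eq_of_lt (by omega)
  unfold deletion
  simp only [Cmd.WP, View.assign, Expr.rules, Function.update_apply, reduceCtorEq, if_false,
    if_true, true_and, hin, List.headD_cons, List.tail_cons, m1, m2, hB.static.U', hrun]
  refine ⟨by omega, by omega, by omega, by omega, by omega, ?_⟩
  refine ⟨_, rfl, hval, hus, hupd, ?_⟩
  have hchg : ∀ a ∈ E.box.changed (v.var .cur) I (us ++ [e]), a < n := hC.box.changed_lt _ I _ hval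
    hus
  refine Cmd.check_spec hC (by omega) (r := guess p q (g + 1)) ?_ ?_ (un := [] ++ E.box.changed
    (v.var .cur) I (us ++ [e])) (us := us ++ [e]) ?_ ?_ ?_ ?_ ?_ ?_ ?_
  · simpa using hB.params.r'
  · simpa using hB.params.thr'
  · grind
  · simpa using hW.src
  · grind
  · grind
  · grind
  · intro a ha hun
    simp only [ne_eq, reduceCtorEq, not_false_eq_true, Function.update_of_ne, List.nil_append,
      ← hI] at hun ⊢
    -- A vertex that is not output has kept its estimate, which was acceptable before the update.
    have heq : wordEst E (v.var .cur) I (us ++ [e]) a = wordEst E (v.var .cur) I us a := by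
      unfold wordEst
      rw [show E.box.est (v.var .cur) I (us ++ [e]) a = E.box.est (v.var .cur) I us a from by
        by_contra hne
        exact hun (hC.box.mem_changed_update _ I us e hval hus a ha hne)]
    rw [heq]
    constructor
    · by_contra hlt
      exact hW.bad.2 ⟨a, ha, Nat.lt_of_not_le hlt⟩ hbad
    · by_contra hlt
      exact hW.vb.2 ⟨a, ha, Nat.lt_of_not_le hlt⟩ hvb
  intro u uf us' uu ut uW
  have hx : u.var .x = v.var .x := by rw [uf.get _]; simp
  have hsv : u.sess = v.sess.set (v.var .cur) ⟨I, us ++ [e], []⟩ := by simp_all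
  have hvar : ∀ x, x ∉ [Var.y, .bad, .vb, .a1, .a2, .U] → u.var x = v.var x := by
    intro x hx
    simp only [List.mem_cons, List.not_mem_nil, or_false, not_or] at hx
    rw [uf.var x (by simp; tauto)]
    simp [hx]
  have harr : ∀ j, j ≠ 0 → j ≠ 1 → u.arr j = v.arr j := by
    intro j h0 h1
    rw [uf.arr j (by simp)]
    simp [h0, h1]
  refine Cmd.search_spec hC hb hus hcon' hBz hgr (g := g) (k := k) ?_ ?_ uW hh ?_
  · refine ⟨?_, ?_, hB.lt_grad.trans_le (grad_anti hcon' hn0 hle hcon), uu.trans hB.used, ?_, ?_,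
      ?_, ?_, ?_⟩
    · have h0 := hB.static.append (e := e) (u := { v with
        var := Function.update (Function.update (Function.update v.var .a1 e.1) .a2 e.2) .U
          (us.length + 1)
        arr := Function.update (Function.update v.arr 0 (Function.update (v.arr 0) us.length e.1)) 1
          (Function.update (v.arr 1) us.length e.2)
        inp := [] }) (by intro x h1 h2 h3; simp [h1, h2, h3]) (by simp) rfl (by simp) (by simp)
      exact h0.frame (X := [.y, .bad, .vb]) (J := []) ⟨uf.var, uf.arr, uf.low, uf.inp⟩ (by simp)
        (by simp)
    · exact ⟨by rw [hvar _ (by simp), hB.params.r'], by rw [hvar _ (by simp), hB.params.sg'],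
        by rw [hvar _ (by simp), hB.params.hS'], by rw [hvar _ (by simp), hB.params.hA'],
        by rw [hvar _ (by simp), hB.params.thr'], by rw [hvar _ (by simp), hB.params.k'],
        by rw [hvar _ (by simp), hB.params.N']⟩
    · rw [hvar _ (by simp), hB.out]
    · rw [harr 3 (by simp) (by simp)]; exact hB.sample
    · rw [harr 2 (by simp) (by simp)]; exact hB.sentinel
    · intro F hF
      have hcs := sessCost_set F v.sess (v.var .cur) ⟨I, us, []⟩ ⟨I, us ++ [e], []⟩ hrun rfl
      rw [hsv, hcs]
      exact hB.cost F hF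
    · rw [hsv]
      refine SessionsOK.set (c := ⟨I, us, []⟩) ?_ hrun rfl List.prefix_rfl
      intro c hc
      obtain ⟨c1, c2, c3, c4, c5, c6⟩ := hB.sessions c hc
      grind
  · refine ⟨?_, hSt.early, hx ▸ hSt.src⟩
    rw [harr 3 (by simp) (by simp), harr 2 (by simp) (by simp), hvar .st (by simp),
      hvar .c (by simp), hx]
    exact hSt.stage.delete hcon' hle
  · grind

end specs

/-! ## Start of both algorithms -/

namespace Cmd

/-- Read the input, and go on with `c`. -/
def boot (c : Cmd) : Code := .seq (.seq (.instr (.input Var.n.reg)) (.seq (.instr (.input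
  Var.p.reg)) (.seq (.instr (.input Var.q.reg)) (.seq (.instr (.input Var.m.reg)) (.seq (.instr
  (.const 100 2)) (.instr (.arith 99 .mul Var.m.reg 100))))))) (readEdges ;; .set .den (256 * ↟.q)
  ;; c).code

end Cmd

section start

variable {E : Env} {n p q : ℕ} {l : List Edge}

/-- The variables of the programs need the base address of the arrays, which is twice the number of
edges and becomes known only from the input. So the first instructions are plain machine code,
executed by hand, and the calculus starts from the configuration they reach. -/
theorem Cmd.boot_sound (hC : Ctx E n p q l) {c : Cmd} {Q : View → Prop} (hwp : ∀ v, Static n p q l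
    [] v → v.var .r = 0 → v.arr = (fun _ _ => 0) → v.used = 0 → v.sess = [] → v.vt ≤ 100 * l.length
    + 300 → c.WP E (2 * l.length) Q v) : ∃ s v, Exec E (boot c) (startState n p q l) s ∧
    SeenAs E (2 * l.length) s v ∧ Q v := by
  obtain ⟨h1, h2, h3, h4, h5, h6, hn2⟩ := hC.bounds
  have hpq := hC.p_lt
  set ρ : ℕ → ℕ := Function.update (Function.update (Function.update (Function.update
    (Function.update (fun _ => 0) Var.n.reg (n % 2 ^ E.w)) Var.p.reg (p % 2 ^ E.w)) Var.q.reg (q % 2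
    ^ E.w)) Var.m.reg (l.length % 2 ^ E.w)) 100 (2 % 2 ^ E.w) with hρ
  set s : State := ⟨Function.update ρ 99 (WordOp.mul.eval (ρ Var.m.reg) (ρ 100) % 2 ^ E.w), fun _ =>
    0, l.flatMap fun e => [e.1, e.2], 0, [], 6⟩ with hs
  set v : View := ⟨fun x => s.reg x.reg, fun _ _ => 0, fun _ => 0, l.flatMap fun e => [e.1, e.2], 0,
    [], 6⟩ with hv
  have n1 : n % 2 ^ E.w = n := Nat.mod_eq_of_lt (by omega)
  have n2 : p % 2 ^ E.w = p := Nat.mod_eq_of_lt (by omega)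
  have n3 : q % 2 ^ E.w = q := Nat.mod_eq_of_lt (by omega)
  have n4 : l.length % 2 ^ E.w = l.length := Nat.mod_eq_of_lt (by omega)
  have n5 : 2 % 2 ^ E.w = 2 := Nat.mod_eq_of_lt (by omega)
  have n6 : (l.length * 2) % 2 ^ E.w = 2 * l.length := by rw [Nat.mod_eq_of_lt (by omega)]; omega
  have hρm : ρ Var.m.reg = l.length := by
    rw [hρ, Function.update_of_ne (by decide), Function.update_self, n4]
  have hρ100 : ρ 100 = 2 := by rw [hρ, Function.update_self, n5]
  have hreg : s.reg = Function.update ρ 99 (2 * l.length) := by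
    simp only [hs, hρm, hρ100, WordOp.eval, n6]
  have hseen : SeenAs E (2 * l.length) s v := by
    refine ⟨by rw [hreg, Function.update_self], fun _ => rfl, fun x => ?_, fun _ => by simp [hs],
      fun _ _ => rfl, fun _ _ _ => rfl, rfl, rfl, rfl, by simp [hs, hv, credit]⟩
    rw [hreg, Function.update_apply]
    grind
  have hvn : ∀ x : Var, v.var x = ρ x.reg := fun x => by
    have := x.reg_lt
    grind
  have e1 : v.var .n = n := by
    rw [hvn, hρ, Function.update_of_ne (by decide), Function.update_of_ne (by decide),
      Function.update_of_ne (by decide), Function.update_of_ne (by decide), Function.update_self, n1]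
  have e2 : v.var .p = p := by
    rw [hvn, hρ, Function.update_of_ne (by decide), Function.update_of_ne (by decide),
      Function.update_of_ne (by decide), Function.update_self, n2]
  have e3 : v.var .q = q := by
    rw [hvn, hρ, Function.update_of_ne (by decide), Function.update_of_ne (by decide),
      Function.update_self, n3]
  have e4 : v.var .m = l.length := by rw [hvn, hρm]
  have e0 : ∀ x : Var, x ∉ [Var.n, .p, .q, .m] → v.var x = 0 := by
    intro x hx
    simp only [List.mem_cons, List.not_mem_nil, or_false, not_or] at hx
    have := x.reg_lt
    rw [hvn, hρ, Function.update_of_ne (by omega), Function.update_of_ne fun h => hx.2.2.2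
      (Var.reg_injective h), Function.update_of_ne fun h => hx.2.2.1 (Var.reg_injective h),
      Function.update_of_ne fun h => hx.2.1 (Var.reg_injective h), Function.update_of_ne fun h =>
      hx.1 (Var.reg_injective h)]
  obtain ⟨s', v', r1, r2, r3⟩ := Cmd.sound hC.box (readEdges ;; .set .den (256 * ↟.q) ;; c) Q s v hseen (by
    refine Cmd.readEdges_spec hC rfl e4 rfl ?_
    intro u uf us uu ut ul
    have uv : ∀ x, x ∉ [Var.i, .y] → u.var x = v.var x := uf.var
    simp only [Cmd.WP, View.assign, Expr.rules, uv .q (by simp), e3, true_and]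
    refine ⟨by omega, hwp _ ⟨?_, ?_, ?_, ?_, ?_, ?_, ul, by simp⟩ ?_ ?_ uu us ?_⟩
    · grind
    · grind
    · grind
    · grind
    · simp
    · grind
    · grind
    · funext j
      exact uf.arr j (by simp)
    · grind)
  exact ⟨s', v', Exec.seq (Exec.seq (Exec.instr rfl) (Exec.seq (Exec.instr rfl) (Exec.seq (Exec.instr rfl)
    (Exec.seq (Exec.instr rfl) (Exec.seq (Exec.instr rfl) (Exec.instr rfl)))))) r1, r2, r3⟩

theorem Adversary.Plays.append {adv : Adversary} {us : List Edge} {outs : List ℕ} {e : Edge} (hp :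
    adv.Plays us outs) (he : adv outs = some e) (x : ℕ) : adv.Plays (us ++ [e]) (outs ++ [x]) := by
  refine ⟨by simp [hp.1], fun i hi => ?_⟩
  simp only [List.length_append, List.length_singleton] at hi
  rw [List.take_append_of_le_length (by rw [hp.1]; omega)]
  rcases Nat.lt_succ_iff_lt_or_eq.1 hi with h | rfl
  · rw [List.getElem?_append_left h, hp.2 i h]
  · rw [← hp.1, List.take_length, he]
    simp

/-- A property that holds after the start and is preserved by updates holds when the adversary
stops. -/
theorem exists_run {A : DynAlg} {mode : UpdateMode} {adv : Adversary} (hmode : E.mode = mode) (hadv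
    : adv.IsLegal mode n l) (hl : IsEdgeList n l) {I : List Edge → List ℕ → State → Prop} (h0 : ∃ s,
    Exec E A.setup (startState n p q l) s ∧ I [] [s.reg 0] s) (hstep : ∀ us outs s e,
    A.Run E n p q l us outs s → adv.Plays us outs → I us outs s → adv outs = some e →
    LegalSeq mode n l (us ++ [e]) → AlwaysConnected mode n l (us ++ [e]) → ∃ s', Exec E A.update
    { s with inp := [e.1, e.2] } s' ∧ I (us ++ [e]) (outs ++ [s'.reg 0]) s') : ∃ us outs s,
    A.Run E n p q l us outs s ∧ adv.Plays us outs ∧ adv outs = none ∧ I us outs s := by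
  -- A legal update sequence has at most `n²` updates, so the adversary has to stop and induction on
  -- the remaining number is possible.
  have key : ∀ k us outs s, n * n - us.length = k → A.Run E n p q l us outs s → adv.Plays us outs →
      I us outs s → ∃ us outs s, A.Run E n p q l us outs s ∧ adv.Plays us outs ∧ adv outs = none ∧
      I us outs s := by
    intro k
    induction k using Nat.strong_induction_on with
    | _ k ih =>
      intro us outs s hk hr hp hi
      cases he : adv outs with
      | none => exact ⟨us, outs, s, hr, hp, he, hi⟩
      | some e =>
        have hpl := hp.append he
        obtain ⟨hl1, hl2⟩ := hadv _ _ (hpl 0)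
        obtain ⟨s', r1, r2⟩ := hstep us outs s e hr hp hi he hl1 hl2
        have hlen := hl1.length_after.1.trans (hl1.maxEdges_le hl)
        simp only [List.length_append, List.length_singleton] at hlen
        exact ih _ (by simp only [List.length_append, List.length_singleton]; omega) _ _ s' rfl
          (.update e hr r1) (hpl _) r2
  obtain ⟨s, r1, r2⟩ := h0
  exact key _ [] _ s rfl (.start r1) ⟨by simp, by simp⟩ r2

theorem SeenAs.set_inp {b : ℕ} {s : State} {v : View} (h : SeenAs E b s v) (L : List ℕ) :
    SeenAs E b { s with inp := L } { v with inp := L } :=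
  ⟨h.base, h.var, h.regLt, h.memLt, h.low, h.arr, rfl, h.used, h.sess, h.time⟩

end start

/-! ## Runs of the algorithm for edge deletions -/

/-- The algorithm for edge deletions. -/
def delAlg : DynAlg := ⟨(Cmd.newGuess ;; Cmd.retry ;; Cmd.search).boot, Cmd.deletion.code, 20⟩

section del

variable {E : Env} {n p q : ℕ} {l : List Edge} {Bz : ℕ → ℕ}

theorem del_start (hC : Ctx E n p q l) (hcon : (graphOf n l).Connected) (hBz : ∀ g, Bz g ≤ n) (hh :
    ∀ g, Hits E n p q l g (Bz g)) : ∃ s v g, Exec E delAlg.setup (startState n p q l) s ∧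
    SeenAs E (2 * l.length) s v ∧ DelInv E n p q l Bz [] g v ∧ v.vt ≤ 2000 := by
  have hn2 := hC.two_le
  obtain ⟨s, v, h1, h2, g, h3, h4⟩ := Cmd.boot_sound hC (c := Cmd.newGuess ;; Cmd.retry ;;
    Cmd.search) (Q := fun v => ∃ g, DelInv E n p q l Bz [] g v ∧ v.vt ≤ 2000) (by
    intro v hS hr harr hu hs ht
    have hs0 : slack p q 0 = 0 := by simp [slack]
    refine Cmd.newGuess_spec hC rfl hS hr (by omega) ?_
    intro u uf us uu ut uP uo u3 ust uc ux u2 u2n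
    have hg1 : guess p q 1 = 0 + 1 + slack p q 0 := rfl
    have hx : u.var .x < n := by
      rw [ux, u3 0 (by omega)]
      exact Nat.mod_lt _ (by omega)
    refine Cmd.retry_spec hC rfl (us := []) trivial hBz hcon (g := 0) (k := 0) (Bz := Bz) ?_ ⟨?_,
      Or.inl (by simp), hx⟩ ?_
    · refine ⟨hS.frame uf, uP, grad_pos hcon hn2, by rw [uu, hu]; ring, uo, ?_, ?_, ?_, ?_⟩
      · grind
      · grind
      · intro F hF
        rw [us, hs]; simp [sessCost]
      · rw [us, hs]; simp [SessionsOK]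
    · refine Or.inl ⟨ust, ?_, ?_, fun a ha h => absurd (u2 a ha) h, ?_, by omega⟩
      · rw [uc]
        exact sampleSize_pos (by omega) (by rw [hg1]; omega)
      · rw [uc, ux]
      · grind
    · intro w wB wS wW wl wu wi wt
      refine Cmd.search_spec hC rfl (us := []) trivial hcon hBz le_rfl wB wS wW (fun g _ => hh g) ?_
      intro z g _ zI zt
      refine ⟨g, zI, ?_⟩
      omega)
  exact ⟨s, v, g, h1, h2, h3, h4⟩

theorem del_update (hC : Ctx E n p q l) (hmode : E.mode = .decremental) {us : List Edge} {e : Edge}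
    (hus : LegalSeq E.mode n l (us ++ [e])) (hcon : AlwaysConnected E.mode n l (us ++ [e])) (hBz :
    ∀ g, Bz g ≤ n) {g : ℕ} {v : View} {s : State} (hs : SeenAs E (2 * l.length) s v) (hv :
    DelInv E n p q l Bz us g v) (hh : ∀ g', g ≤ g' → Hits E n p q (afterUpdates E.mode l (us ++
    [e])) g' (Bz g')) : ∃ s' v' g', g ≤ g' ∧ Exec E delAlg.update { s with inp := [e.1, e.2] } s' ∧
    SeenAs E (2 * l.length) s' v' ∧ DelInv E n p q l Bz (us ++ [e]) g' v' ∧ v'.vt ≤ v.vt + 200 := by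
  obtain ⟨h1, k, hB, hS, hW⟩ := hv
  obtain ⟨s', v', r1, r2, g', r3, r4, r5⟩ := Cmd.sound hC.box Cmd.deletion (fun v' => ∃ g', g ≤ g' ∧
    DelInv E n p q l Bz (us ++ [e]) g' v' ∧ v'.vt ≤ v.vt + 200) _ _ (hs.set_inp [e.1,
    e.2]) (Cmd.deletion_spec hC rfl hmode hus (hcon us (List.prefix_append _ _)) (hcon _
    List.prefix_rfl) (hcon [] (by simp)) hBz ⟨h1, k, ⟨⟨hB.static.n', hB.static.p', hB.static.q',
    hB.static.m', hB.static.den', hB.static.U', hB.static.low', hB.static.log'⟩, ⟨hB.params.r',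
    hB.params.sg', hB.params.hS', hB.params.hA', hB.params.thr', hB.params.k', hB.params.N'⟩,
    hB.lt_grad, hB.used, hB.out, hB.sample, hB.sentinel, hB.cost, hB.sessions⟩, ⟨hS.stage, hS.early,
    hS.src⟩, ⟨hW.run, hW.src, hW.bad, hW.vb⟩⟩ rfl hh fun u g' hg uI ut => ⟨g', hg, uI, ut⟩)
  exact ⟨s', v', g', r3, r1, r2, r4, r5⟩

theorem Hits.trivial (E : Env) (n p q : ℕ) (G : List Edge) (g : ℕ) : Hits E n p q G g n := by
  intro v hv _
  exact (Finset.card_filter_le _ _).trans (by simp)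

/-- From `guess p q g + 1 ≤ R` the guess itself is at most `(1 + ε/16) R`, and the value shown is at
most `r (3/2 + 5ε/16) + 1/2`. The product of the two factors is below `(3/2) (1 + ε)`. -/
theorem guess_bounds {p q R g : ℕ} (hp : 0 < p) (hpq : p < q) (h : guess p q g < R) :
    ((threshold p q (guess p q (g + 1)) + slack p q (guess p q (g + 1)) : ℕ) : ℝ) ≤ (1 + (p :
    ℝ) / q) * (3 / 2 * R + 1 / 2) := by
  have hq : (0 : ℝ) < q := by exact_mod_cast (by omega : 0 < q)
  set ε : ℝ := (p : ℝ) / q with hε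
  have hε0 : 0 < ε := by positivity
  have hε1 : ε < 1 := by rw [hε, div_lt_one hq]; exact_mod_cast hpq
  have hsl : ∀ x : ℕ, (slack p q x : ℝ) ≤ ε * x / 16 := by
    intro x
    have : (slack p q x : ℝ) ≤ ((p * x : ℕ) : ℝ) / ((16 * q : ℕ) : ℝ) := Nat.cast_div_le
    refine this.trans_eq ?_
    grind
  set a := guess p q g with ha
  set r := guess p q (g + 1) with hr
  have hra : (r : ℝ) ≤ (a + 1) + ε * (a + 1) / 16 := by
    have h1 : (r : ℝ) = a + 1 + slack p q a := by simp only [hr, guess, ← ha]; push_cast; ring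
    grind
  have hR : (a : ℝ) + 1 ≤ R := by exact_mod_cast h
  have hhalf : (((r + 1) / 2 : ℕ) : ℝ) ≤ (r + 1) / 2 := by
    have : (((r + 1) / 2 : ℕ) : ℝ) ≤ ((r + 1 : ℕ) : ℝ) / ((2 : ℕ) : ℝ) := Nat.cast_div_le
    grind
  have h1 := hsl r
  have h2 : (r : ℝ) ≤ (1 + ε / 16) * R := by nlinarith
  have hR0 : (0 : ℝ) ≤ R := by positivity
  unfold threshold
  push_cast
  have h3 : (r : ℝ) + (r + 1) / 2 + 4 * (ε * r / 16) + ε * r / 16 ≤ r * (3 / 2 + 5 / 16 * ε) + 1 / 2 := by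
    nlinarith
  have h4 : (r : ℝ) * (3 / 2 + 5 / 16 * ε) ≤ (1 + ε / 16) * R * (3 / 2 + 5 / 16 * ε) :=
    mul_le_mul_of_nonneg_right h2 (by positivity)
  have h5 : (1 + ε / 16) * (3 / 2 + 5 / 16 * ε) ≤ (1 + ε) * (3 / 2) := by nlinarith
  have h6 := mul_le_mul_of_nonneg_right h5 hR0
  nlinarith

/-- The estimate that is shown is correct. -/
theorem DelInv.correct (hC : Ctx E n p q l) {us : List Edge} (hus : LegalSeq E.mode n l us) (hcon :
    (graphOf n (afterUpdates E.mode l us)).Connected) {g : ℕ} {v : View} (hv : DelInv E n p q l Bz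
    us g v) : (radiusAfter E.mode n l us : ℝ) ≤ v.var .out ∧ (v.var .out : ℝ) ≤ (1 + (p :
    ℝ) / q) * (3 / 2 * radiusAfter E.mode n l us + 1 / 2) := by
  obtain ⟨hbad, k, hB, hSt, hW⟩ := hv
  have hf := hW.accurate hC hus hcon
  have hr0 : 0 < guess p q (g + 1) := by have := le_guess p q (g + 1); omega
  have hσ := slack_le (r := guess p q (g + 1)) hC.p_lt
  rw [hB.out]
  constructor
  · have := grad_le hcon hW.src (h := threshold p q (guess p q (g + 1)) + slack p q (guess p q (g +
      1))) (hf.gdist_le hcon hW.src (by unfold threshold; omega) fun a ha => by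
        by_contra h
        exact hW.bad.2 ⟨a, ha, Nat.lt_of_not_le h⟩ hbad)
    exact_mod_cast this
  · exact guess_bounds hC.p_pos hC.p_lt hB.lt_grad

/-- Words of `20 * Nat.size (n + q)` bits hold numbers up to `(n + q)²⁰`, and `n + q ≥ 4` gives `(n
+ q)¹² ≥ 4¹² > 10⁷`. -/
theorem ctx_of {B : BlackBox} {mode : UpdateMode} (hB : IsTruncatedSSSP mode B) (h2 : 2 ≤ n) (hp :
    0 < p) (hpq : p < q) (hl : IsEdgeList n l) (coins : ℕ → Fin (2 ^ (20 * Nat.size (n + q)))) :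
    Ctx ⟨mode, B, 20 * Nat.size (n + q), coins⟩ n p q l := by
  refine ⟨hB, h2, hp, hpq, hl, ?_⟩
  have h1 : n + q < 2 ^ Nat.size (n + q) := Nat.lt_size_self _
  have h4 : 4 ≤ n + q := by omega
  simp only
  calc 10 ^ 7 * (n + q) ^ 8 ≤ 4 ^ 12 * (n + q) ^ 8 := Nat.mul_le_mul_right _ (by norm_num)
    _ ≤ (n + q) ^ 12 * (n + q) ^ 8 := Nat.mul_le_mul_right _ (Nat.pow_le_pow_left h4 _)
    _ = (n + q) ^ 20 := by ring
    _ ≤ (2 ^ Nat.size (n + q)) ^ 20 := Nat.pow_le_pow_left h1.le _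
    _ = 2 ^ (20 * Nat.size (n + q)) := by rw [← pow_mul, mul_comm]

/-- The invariant is used with the bound `n` on all balls, for which `Hits` is trivial. Hence the
estimate is correct for every outcome of the random choices. -/
theorem delAlg_maintainsRadius : delAlg.MaintainsRadius .decremental := by
  intro B hB n p q l h2 hp hpq hl us hus hcon coins outs s hrun
  have hC := ctx_of hB h2 hp hpq hl coins
  set E : Env := ⟨.decremental, B, 20 * Nat.size (n + q), coins⟩ with hE
  have key : ∀ us outs s, delAlg.Run E n p q l us outs s → LegalSeq .decremental n l us →
      AlwaysConnected .decremental n l us → ∃ v g, SeenAs E (2 * l.length) s v ∧ DelInv E n p q l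
      (fun _ => n) us g v := by
    intro us outs s hr
    induction hr with
    | @start s h =>
      intro hus hcon
      obtain ⟨s', v, g, r1, r2, r3, -⟩ := del_start hC (hcon [] (by simp)) (Bz := fun _ => n)
        (fun _ => le_rfl) (fun g => Hits.trivial _ _ _ _ _ g)
      cases h.det r1
      exact ⟨v, g, r2, r3⟩
    | @update us outs s s' e h1 h2 ih =>
      intro hus hcon
      obtain ⟨v, g, v1, v2⟩ := ih (hus.prefix (List.prefix_append _ _)) (hcon.prefix
        (List.prefix_append _ _))
      obtain ⟨s'', v', g', -, r1, r2, r3, -⟩ := del_update hC rfl hus hcon (Bz := fun _ => n)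
        (fun _ => le_rfl) v1 v2 (fun g _ => Hits.trivial _ _ _ _ _ g)
      cases h2.det r1
      exact ⟨v', g', r2, r3⟩
  obtain ⟨v, g, v1, v2⟩ := key us outs s hrun hus hcon
  have := v2.correct hC hus (hcon us List.prefix_rfl)
  have h0 : s.reg 0 = v.var .out := v1.var .out
  rw [h0]
  exact this

end del

/-! ## Random words -/

section coins

variable {w : ℕ}

noncomputable instance (w : ℕ) : IsProbabilityMeasure (coinLaw w) := by
  unfold coinLaw; infer_instance

/-- What depends on finitely many random words only is measurable. -/
theorem measurable_of_finitely_many {β : Type*} [MeasurableSpace β] {f : (ℕ → Fin (2 ^ w)) → β} (M :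
    ℕ) (h : ∀ ω ω', (∀ i < M, ω i = ω' i) → f ω = f ω') : Measurable f := by
  have : f = (fun x : Fin M → Fin (2 ^ w) =>
      f fun i => if hi : i < M then x ⟨i, hi⟩ else ⟨0, by positivity⟩) ∘ fun ω i => ω i := by grind
  rw [this]
  exact (Measurable.of_discrete).comp (measurable_pi_lambda _ fun i => measurable_pi_apply _)

theorem measurableSet_of_finitely_many {A : Set (ℕ → Fin (2 ^ w))} (M : ℕ)
    (h : ∀ ω ω', (∀ i < M, ω i = ω' i) → ω ∈ A → ω' ∈ A) : MeasurableSet A :=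
  measurableSet_setOfPred.2 (measurable_of_finitely_many (f := fun ω => ω ∈ A) M fun ω ω' hω =>
    propext ⟨h ω ω' hω, h ω' ω fun i hi => (hω i hi).symm⟩)

/-- A product measure is determined by its values on boxes over finitely many coordinates; whether
`i` is among them decides if the fresh word contributes a factor or none. -/
theorem measurePreserving_update (i : ℕ) : MeasurePreserving (fun z : (ℕ → Fin (2 ^ w)) × Fin (2 ^
    w) => Function.update z.1 i z.2) ((coinLaw w).prod (PMF.uniformOfFintype (Fin (2 ^
    w))).toMeasure) (coinLaw w) := by
  have hm : Measurable fun z : (ℕ → Fin (2 ^ w)) × Fin (2 ^ w) => Function.update z.1 i z.2 := by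
    refine measurable_pi_lambda _ fun j => ?_
    by_cases hj : j = i
    · subst hj; simpa using measurable_snd
    · simp only [Function.update_of_ne hj]
      exact (measurable_pi_apply j).comp measurable_fst
  refine ⟨hm, ?_⟩
  refine Measure.eq_infinitePi _ fun s t ht => ?_
  rw [Measure.map_apply hm (MeasurableSet.pi s.countable_toSet fun i _ => ht i)]
  by_cases hi : i ∈ s
  · have : (fun z : (ℕ → Fin (2 ^ w)) × Fin (2 ^ w) => Function.update z.1 i z.2) ⁻¹' (Set.pi s t) =
        (Set.pi (s.erase i : Finset ℕ) t) ×ˢ (t i) := by grind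
    rw [this, Measure.prod_prod, coinLaw, Measure.infinitePi_pi _ fun i _ => ht i, mul_comm,
      Finset.mul_prod_erase s (fun j => (PMF.uniformOfFintype (Fin (2 ^ w))).toMeasure (t j)) hi]
  · have : (fun z : (ℕ → Fin (2 ^ w)) × Fin (2 ^ w) => Function.update z.1 i z.2) ⁻¹' (Set.pi s t) =
        (Set.pi s t) ×ˢ Set.univ := by grind
    rw [this, Measure.prod_prod, coinLaw, Measure.infinitePi_pi _ fun i _ => ht i]
    simp

/-- A random word may be drawn anew. -/
theorem lintegral_resample (i : ℕ) {f : (ℕ → Fin (2 ^ w)) → ENNReal} (hf : Measurable f) : ∫⁻ ω,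
    f ω ∂coinLaw w = ∫⁻ ω, (∑ x, f (Function.update ω i x)) / 2 ^ w ∂coinLaw w := by
  have hmp := measurePreserving_update (w := w) i
  rw [← hmp.lintegral_comp hf]
  refine (lintegral_prod _ (hf.comp hmp.measurable).aemeasurable).trans ?_
  refine lintegral_congr fun ω => ?_
  rw [lintegral_fintype, ENNReal.div_eq_inv_mul, Finset.mul_sum]
  refine Finset.sum_congr rfl fun x _ => ?_
  rw [PMF.toMeasure_apply_singleton _ _ (measurableSet_singleton x), PMF.uniformOfFintype_apply,
    mul_comm]
  simp

-- A substitute for conditional probability: given all words except word `i`, the event `A` has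
-- probability at most `ρ`, and it is impossible outside `A'`.
open Classical in
theorem measure_resample {A A' : Set (ℕ → Fin (2 ^ w))} (hA : MeasurableSet A) (hA' :
    MeasurableSet A') (i : ℕ) {ρ : ENNReal} (h0 : ∀ ω, ∀ x, Function.update ω i x ∈ A → ω ∈ A') (h :
    ∀ ω ∈ A', ((Finset.univ.filter fun x => Function.update ω i x ∈ A).card : ENNReal) ≤ ρ * 2 ^ w)
    : coinLaw w A ≤ ρ * coinLaw w A' := by
  rw [← lintegral_indicator_one hA, lintegral_resample i (measurable_one.indicator hA),
    ← lintegral_indicator_const hA']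
  refine lintegral_mono fun ω => ?_
  by_cases hω : ω ∈ A'
  · rw [Set.indicator_of_mem hω]
    refine ENNReal.div_le_of_le_mul ((le_of_eq ?_).trans (h ω hω))
    simp [Set.indicator_apply]
  · rw [Set.indicator_of_notMem hω]
    have : ∀ x, A.indicator (1 : (ℕ → Fin (2 ^ w)) → ENNReal) (Function.update ω i x) = 0 :=
      fun x => Set.indicator_of_notMem (fun hx => hω (h0 ω x hx)) _
    simp [this]

/-- Residues of a random word are almost uniform. -/
theorem card_mod_mem_ge {n : ℕ} (hn : 0 < n) (hw : n ≤ 2 ^ w) {Q : Finset ℕ} (hQ : Q ⊆ Finset.range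
    n) : Q.card * 2 ^ w ≤ 2 * n * (Finset.univ.filter fun x : Fin (2 ^ w) => (x :
    ℕ) % n ∈ Q).card := by
  -- Every residue below `n` is attained by at least `k` words, namely `a + n j` with `j < k`, and
  -- `2 n k ≥ 2 ^ w`; rounding loses a factor of at most 2.
  set k := 2 ^ w / n with hk
  have hk1 : n * k ≤ 2 ^ w := Nat.mul_div_le _ _
  have hk2 : 2 ^ w < n * k + n := by
    have h1 := Nat.div_add_mod (2 ^ w) n
    have h2 := Nat.mod_lt (2 ^ w) hn
    rw [← hk] at h1
    omega
  have hk3 : 1 ≤ k := (Nat.one_le_div_iff hn).2 hw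
  have hcard : (Q ×ˢ Finset.range k).card ≤ (Finset.univ.filter fun x : Fin (2 ^ w) => (x :
      ℕ) % n ∈ Q).card := by
    refine Finset.card_le_card_of_injOn (fun z => if h : z.1 + n * z.2 < 2 ^ w then ⟨z.1 + n * z.2,
      h⟩ else ⟨0, by positivity⟩) ?_ ?_
    · rintro ⟨a, j⟩ hz
      simp only [Finset.coe_product, Set.mem_prod, Finset.mem_coe, Finset.mem_range] at hz
      have ha := Finset.mem_range.1 (hQ hz.1)
      have hlt : a + n * j < 2 ^ w := by
        have : n * (j + 1) ≤ n * k := Nat.mul_le_mul_left _ hz.2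
        grind
      simp only [hlt, dif_pos, Finset.coe_filter, Finset.mem_univ, true_and, Set.mem_ofPred_eq,
        Nat.add_mul_mod_self_left, Nat.mod_eq_of_lt ha]
      exact hz.1
    · rintro ⟨a, j⟩ hz ⟨a', j'⟩ hz' he
      simp only [Finset.coe_product, Set.mem_prod, Finset.mem_coe, Finset.mem_range] at hz hz'
      have ha := Finset.mem_range.1 (hQ hz.1)
      have ha' := Finset.mem_range.1 (hQ hz'.1)
      have hlt : a + n * j < 2 ^ w := by
        have : n * (j + 1) ≤ n * k := Nat.mul_le_mul_left _ hz.2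
        grind
      have hlt' : a' + n * j' < 2 ^ w := by
        have : n * (j' + 1) ≤ n * k := Nat.mul_le_mul_left _ hz'.2
        grind
      simp only [hlt, hlt', dif_pos, Fin.mk.injEq] at he
      have h1 := congrArg (· % n) he
      simp only [Nat.add_mul_mod_self_left, Nat.mod_eq_of_lt ha, Nat.mod_eq_of_lt ha'] at h1
      subst h1
      have h2 : n * j = n * j' := by omega
      rw [Nat.eq_of_mul_eq_mul_left hn h2]
  rw [Finset.card_product, Finset.card_range] at hcard
  have h3 : 2 ^ w ≤ 2 * n * k := by nlinarith
  calc Q.card * 2 ^ w ≤ Q.card * (2 * n * k) := Nat.mul_le_mul_left _ h3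
    _ = 2 * n * (Q.card * k) := by ring
    _ ≤ _ := Nat.mul_le_mul_left _ hcard

/-- A large set that is determined by other random words is hit by one of `N` random vertices. -/
theorem measure_miss_le {n : ℕ} (hn : 0 < n) (hw : n ≤ 2 ^ w) {B : ℕ} (M :
    ℕ) {Q : (ℕ → Fin (2 ^ w)) → Finset ℕ} (hQn : ∀ ω, Q ω ⊆ Finset.range n) (hQ : ∀ ω ω', (∀ i < M,
    ω i = ω' i) → Q ω = Q ω') (N : ℕ) : coinLaw w {ω | B < (Q ω).card ∧ ∀ i < N, (ω (M + 2 * i) :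
    ℕ) % n ∉ Q ω} ≤ ENNReal.ofReal ((1 - B / (2 * n)) ^ N) := by
  classical
  have hn' : (0 : ℝ) < n := by exact_mod_cast hn
  -- A subset of `n` vertices cannot have more than `n` elements. In the remaining case `1 - B / (2
  -- n)` is nonnegative, as the induction needs.
  by_cases hB : n ≤ B
  · have : {ω | B < (Q ω).card ∧ ∀ i < N, (ω (M + 2 * i) : ℕ) % n ∉ Q ω} = ∅ := by
      ext ω
      simp only [Set.mem_ofPred_eq, Set.mem_empty_iff_false, iff_false, not_and]
      intro h
      have := Finset.card_le_card (hQn ω)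
      grind
    rw [this]; simp
  have hρ : (0 : ℝ) ≤ 1 - B / (2 * n) := by
    have : (B : ℝ) / (2 * n) ≤ 1 := by
      rw [div_le_one (by positivity)]
      have : (B : ℝ) ≤ n := by exact_mod_cast (by omega : B ≤ n)
      linarith
    linarith
  have hmeas : ∀ N, MeasurableSet {ω | B < (Q ω).card ∧ ∀ i < N, (ω (M + 2 * i) : ℕ) % n ∉ Q ω} :=
      by
    intro N
    refine measurableSet_of_finitely_many (M + 2 * N) fun ω ω' h hω => ?_
    have hq := hQ ω ω' fun i hi => h i (by omega)
    refine ⟨hq ▸ hω.1, fun i hi => ?_⟩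
    rw [← hq, ← h _ (by omega)]
    exact hω.2 i hi
  induction N with
  | zero => simpa using prob_le_one
  | succ N ih =>
    -- The word at position `M + 2 * N` is drawn anew. It affects neither the set nor the earlier
    -- samples, and at least `B * 2 ^ w / (2 n)` of its values hit the set.
    refine (measure_resample (hmeas _) (hmeas N) (M + 2 * N) (ρ := ENNReal.ofReal (1 - B / (2 * n)))
      ?_ ?_).trans ?_
    · rintro ω x ⟨h1, h2⟩
      have hq := hQ (Function.update ω (M + 2 * N) x) ω fun i hi =>
        Function.update_of_ne (by omega) _ _
      rw [hq] at h1 h2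
      refine ⟨h1, fun i hi => ?_⟩
      have := h2 i (by omega)
      grind
    · rintro ω ⟨h1, h2⟩
      have hsub : (Finset.univ.filter fun x => Function.update ω (M + 2 * N) x ∈
          {ω | B < (Q ω).card ∧ ∀ i < N + 1, (ω (M + 2 * i) : ℕ) % n ∉ Q ω}) ⊆ (Finset.univ.filter
          fun x : Fin (2 ^ w) => (x : ℕ) % n ∈ Q ω)ᶜ := by
        intro x hx
        simp only [Finset.mem_filter, Finset.mem_univ, true_and, Set.mem_ofPred_eq, Finset.mem_compl]
          at hx ⊢
        have hq := hQ (Function.update ω (M + 2 * N) x) ω fun i hi =>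
          Function.update_of_ne (by omega) _ _
        have := hx.2 N (by omega)
        grind
      have h3 := Finset.card_le_card hsub
      rw [Finset.card_compl, Fintype.card_fin] at h3
      have h4 := card_mod_mem_ge hn hw (hQn ω)
      set a := (Finset.univ.filter fun x : Fin (2 ^ w) => (x : ℕ) % n ∈ Q ω).card
      have h5 : a ≤ 2 ^ w := by
        have := Finset.card_le_univ (Finset.univ.filter fun x : Fin (2 ^ w) => (x : ℕ) % n ∈ Q ω)
        rwa [Fintype.card_fin] at this
      have h6 : (((Finset.univ.filter fun x => Function.update ω (M + 2 * N) x ∈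
          {ω | B < (Q ω).card ∧ ∀ i < N + 1, (ω (M + 2 * i) : ℕ) % n ∉ Q ω}).card : ℕ) :
          ℝ) ≤ (1 - B / (2 * n)) * 2 ^ w := by
        have h7 : ((B : ℝ)) * 2 ^ w ≤ 2 * n * a := by
          have : B * 2 ^ w ≤ 2 * n * a := (Nat.mul_le_mul_right _ h1.le).trans h4
          exact_mod_cast this
        have h8 : ((2 ^ w - a : ℕ) : ℝ) = 2 ^ w - a := by simp_all
        refine (Nat.cast_le.2 h3).trans ?_
        rw [h8, sub_mul, one_mul, div_mul_eq_mul_div]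
        have : (B : ℝ) * 2 ^ w / (2 * n) ≤ a := by
          rw [div_le_iff₀ (by positivity)]
          linarith
        linarith
      rw [← ENNReal.ofReal_natCast]
      have h9 : ENNReal.ofReal ((1 - B / (2 * n)) * 2 ^ w) = ENNReal.ofReal (1 - B / (2 * n)) * 2 ^
          w := by simp_all
      rw [← h9]
      exact ENNReal.ofReal_le_ofReal (by convert h6)
    · rw [pow_succ', ENNReal.ofReal_mul hρ]
      gcongr
end coins

/-! ## Costs -/

section costs

theorem eps_bounds {p q : ℕ} (hp : 0 < p) (hpq : p < q) : (0 : ℝ) < q ∧ (0 : ℝ) < p ∧ 0 < (p :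
    ℝ) / q ∧ (p : ℝ) / q < 1 := by
  have hq : (0 : ℝ) < q := by exact_mod_cast hp.trans hpq
  have hp' : (0 : ℝ) < p := by exact_mod_cast hp
  exact ⟨hq, hp', div_pos hp' hq, by rw [div_lt_one hq]; exact_mod_cast hpq⟩

variable {mode : UpdateMode} {B : BlackBox} {T : ℕ → ℕ → ℕ → ℝ → ℝ} {K : ℝ} {n p q : ℕ}
  {l us : List Edge}

theorem le_total_time (hB : IsTruncatedSSSP mode B) {id : ℕ} {I : SSSPInput} (hI : I.Valid) (hus :
    LegalSeq mode I.n I.edges us) : I.n + I.edges.length + us.length ≤ ∑ i ∈ Finset.range (us.length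
    + 1), B.time id I (us.take i) := by
  induction us using List.reverseRecOn with
  | nil => simpa using (Nat.le_add_right _ _).trans (hB.time_start id I hI)
  | append_singleton us e ih =>
    have h1 := ih (hus.prefix (List.prefix_append _ _))
    have h2 := hB.time_update id I us e hI hus
    rw [List.length_append, List.length_singleton, Finset.sum_range_succ _ (us.length + 1)]
    have h3 : (us ++ [e]).take (us.length + 1) = us ++ [e] := List.take_of_length_le (by simp)
    have h4 : ∑ i ∈ Finset.range (us.length + 1), B.time id I ((us ++ [e]).take i) = ∑ i ∈
        Finset.range (us.length + 1), B.time id I (us.take i) := by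
      refine Finset.sum_congr rfl fun i hi => ?_
      grind
    rw [h3, h4]
    omega

theorem valid_start (h2 : 2 ≤ n) (hp : 0 < p) (hpq : p < q) (hl : IsEdgeList n l) {x : ℕ} (hx :
    x < n) (k : ℕ) : SSSPInput.Valid ⟨n, l, x, k, p, 256 * q⟩ := ⟨hl, hx, hp, by simp only; omega⟩

theorem delta_eq (n p q x k : ℕ) (l : List Edge) : SSSPInput.delta ⟨n, l, x, k, p, 256 * q⟩ = (p :
    ℝ) / q / 256 := by
  simp only [SSSPInput.delta]
  grind

/-- A run reads its input and every update, which is the only reason why `T` is positive and why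
terms like `n`, `m` and the number of updates can be absorbed in the final bound. -/
theorem le_bound (hB : IsTruncatedSSSP mode B) (hT : RunsInTotalTime mode B T) (h2 : 2 ≤ n) (hp :
    0 < p) (hpq : p < q) (hl : IsEdgeList n l) (hus : LegalSeq mode n l us) (k : ℕ) :
    (n + l.length + us.length : ℕ) ≤ T n (maxEdges mode l us) k ((p : ℝ) / q / 256) := by
  have hv := valid_start h2 hp hpq hl (x := 0) (by omega) k
  have h1 := hT 0 _ us hv hus
  rw [delta_eq] at h1
  exact (Nat.cast_le.2 (le_total_time hB (id := 0) hv hus)).trans h1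

theorem bound_scale (hT : PolyGrowth K T) (hK : 0 ≤ K) {m k : ℕ} {δ : ℝ} (h0 : 0 < δ) (h1 :
    δ < 1) (i : ℕ) : T (2 ^ i * n) (2 ^ i * m) (2 ^ i * k) (δ / 2 ^ i) ≤ K ^ i * T n m k δ := by
  induction i with
  | zero => simp
  | succ i ih =>
    have h3 : (1 : ℝ) ≤ 2 ^ i := one_le_pow₀ (by norm_num)
    have h2 := hT.doubling (2 ^ i * n) (2 ^ i * m) (2 ^ i * k) (δ / 2 ^ i) (by positivity)
      ((div_le_self h0.le h3).trans_lt h1)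
    have e1 : ∀ x, 2 ^ (i + 1) * x = 2 * (2 ^ i * x) := fun x => by ring
    rw [e1, e1, e1, pow_succ, ← div_div, pow_succ, mul_right_comm, mul_comm _ K]
    exact h2.trans (mul_le_mul_of_nonneg_left ih hK)

/-- Since `256 = 2⁸`, eight doublings pass from `2 R` and `ε` to the distance bound and the accuracy
that are really used; those in `n` and `m` are undone by monotonicity. -/
theorem bound_le (hB : IsTruncatedSSSP mode B) (hT : RunsInTotalTime mode B T) (hK : PolyGrowth K T)
    (h2 : 2 ≤ n) (hp : 0 < p) (hpq : p < q) (hl : IsEdgeList n l) (hus : LegalSeq mode n l us)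
    {k R : ℕ} (hk : k ≤ 256 * (2 * R)) : T n (maxEdges mode l us) k ((p : ℝ) / q / 256) ≤ K ^ 8 * T
    n (maxEdges mode l us) (2 * R) ((p : ℝ) / q) := by
  set m := maxEdges mode l us
  obtain ⟨hq, hp', h0, h1⟩ := eps_bounds hp hpq
  have hpos := le_bound hB hT h2 hp hpq hl hus k
  have hpos' : 0 < T n m k ((p : ℝ) / q / 256) := lt_of_lt_of_le
    (by exact_mod_cast (by omega : 0 < n + l.length + us.length)) hpos
  -- The constant `K` is an arbitrary real number. Positivity of `T` at one point together with
  -- monotonicity excludes negative values.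
  have hK0 : 0 ≤ K := by
    have h3 := hK.doubling n m k ((p : ℝ) / q / 256) (by positivity) (by linarith)
    have h4 := hK.mono n (2 * n) m (2 * m) k (2 * k) ((p : ℝ) / q / 256) ((p : ℝ) / q / 256 / 2)
      (by omega) (by omega) (by omega) (by positivity) (by linarith) (by linarith)
    by_contra hneg
    nlinarith
  have h3 := bound_scale (n := n) hK hK0 (m := m) (k := 2 * R) h0 h1 8
  refine le_trans (hK.mono _ _ _ _ _ _ _ _ ?_ ?_ ?_ ?_ ?_ ?_) h3
  all_goals grind

/-- The credit is at most 10001 times the time of the runs. Each run has received a prefix of the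
updates, so its bound only grows when the whole sequence is taken. -/
theorem credit_le (hT : RunsInTotalTime mode B T) (hK : PolyGrowth K T) (h2 : 2 ≤ n) (hp :
    0 < p) (hpq : p < q) (hl : IsEdgeList n l) (hus : LegalSeq mode n l us) {L : List Session} (hL :
    SessionsOK n p q l us L) : (credit B L : ℝ) ≤ 10001 * sessCost (fun k => T n (maxEdges mode l
    us) k ((p : ℝ) / q / 256)) L := by
  obtain ⟨hq, hp', -, h1⟩ := eps_bounds hp hpq
  induction L using List.reverseRecOn with
  | nil => simp [credit, sessCost]
  | append_singleton L c ih =>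
    rw [credit_append, sessCost_append]
    push_cast
    rw [mul_add]
    refine add_le_add (ih fun d hd => hL d (List.mem_append_left _ hd)) ?_
    obtain ⟨c1, c2, c3, c4, c5, c6⟩ := hL c (by simp)
    have hc : c.start = ⟨n, l, c.start.src, c.start.k, p, 256 * q⟩ := by
      obtain ⟨⟨_, _, _, _, _, _⟩, _, _⟩ := c
      grind
    have hv : c.start.Valid := by rw [hc]; exact valid_start h2 hp hpq hl c3 _
    have h3 := hT L.length c.start c.updates hv (by rw [c1, c2]; exact hus.prefix c6)
    have h4 : c.start.delta = (p : ℝ) / q / 256 := by rw [hc, delta_eq]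
    have h5 := hK.mono n n (maxEdges mode l c.updates) (maxEdges mode l us) c.start.k c.start.k
      _ _ le_rfl (maxEdges_mono mode l c6) le_rfl (by positivity : 0 < (p : ℝ) / q / 256) le_rfl
      (by linarith)
    rw [c1, c2, h4] at h3
    have h6 : ((c.boxTime B L.length : ℤ) : ℝ) ≤ T n (maxEdges mode l us) c.start.k ((p :
        ℝ) / q / 256) := by
      refine le_trans ?_ (h3.trans h5)
      simp [Session.boxTime]
    unfold Session.credit
    push_cast at h6 ⊢
    grind

/-- Balls with more vertices are hit by the sample with high probability. -/
noncomputable def ballBound (c n r : ℕ) : ℕ := min n ⌈2 * n * ((c + 8) * Real.log n) / sampleSize n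
  r⌉₊

theorem ballBound_le (c n r : ℕ) : ballBound c n r ≤ n := min_le_left _ _

/-- A sample misses a set of more than `B` vertices with probability at most `(1 - B/(2n))^N ≤ exp
(-N B / (2n))`, and `ballBound` is chosen to make the exponent at least `(c + 8) log n`. If the
minimum in it is `n`, there is no larger set to miss. -/
theorem measure_miss_ballBound {w : ℕ} (c : ℕ) {r : ℕ} (hn : 0 < n) (hw : n ≤ 2 ^ w) (hr : 0 < r) {M
    : ℕ} {Q : (ℕ → Fin (2 ^ w)) → Finset ℕ} (hQn : ∀ ω, Q ω ⊆ Finset.range n) (hQ : ∀ ω ω', (∀ i <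
    M, ω i = ω' i) → Q ω = Q ω') : coinLaw w {ω | ballBound c n r < (Q ω).card ∧ ∀ i < sampleSize n
    r, (ω (M + 2 * i) : ℕ) % n ∉ Q ω} ≤ ENNReal.ofReal (1 / (n : ℝ) ^ (c + 8)) := by
  have hn' : (0 : ℝ) < n := by exact_mod_cast hn
  have hcard : ∀ ω, (Q ω).card ≤ n := fun ω => by simpa using Finset.card_le_card (hQn ω)
  rcases le_total n ⌈2 * n * ((c + 8) * Real.log n) / sampleSize n r⌉₊ with h | h
  · have h1 : ballBound c n r = n := min_eq_left h
    have : {ω | ballBound c n r < (Q ω).card ∧ ∀ i < sampleSize n r, (ω (M + 2 * i) : ℕ) % n ∉ Q ω}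
        = ∅ := by grind
    rw [this]
    simp
  · refine (measure_miss_le hn hw _ hQn hQ _).trans (ENNReal.ofReal_le_ofReal ?_)
    have h1 : ballBound c n r = ⌈2 * n * ((c + 8) * Real.log n) / sampleSize n r⌉₊ := min_eq_right h
    set N := sampleSize n r with hN
    have hN0 : (0 : ℝ) < N := by exact_mod_cast sampleSize_pos hn hr
    have h2 : 2 * n * ((c + 8) * Real.log n) / N ≤ ballBound c n r := by rw [h1]; exact Nat.le_ceil _
    have h3 : (ballBound c n r : ℝ) ≤ n := by exact_mod_cast ballBound_le c n r
    set b : ℝ := ((ballBound c n r : ℕ) : ℝ)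
    have h4 : 1 - b / (2 * n) ≤ Real.exp (-(b / (2 * n))) := by
      have := Real.add_one_le_exp (-(b / (2 * n))); linarith
    have h5 : 0 ≤ 1 - b / (2 * n) := by
      rw [sub_nonneg, div_le_one (by positivity)]; linarith
    refine (pow_le_pow_left₀ h5 h4 N).trans ?_
    rw [← Real.exp_nat_mul]
    have h6 : (n : ℝ) ^ (c + 8) = Real.exp ((c + 8) * Real.log n) := by
      rw [show ((c : ℝ) + 8) = ((c + 8 : ℕ) : ℝ) by push_cast; ring, Real.exp_nat_mul, Real.exp_log hn']
    rw [h6, one_div, ← Real.exp_neg, Real.exp_le_exp]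
    rw [div_le_iff₀ hN0] at h2
    have h7 : (c + 8) * Real.log n ≤ N * (b / (2 * n)) := by
      rw [← mul_div_assoc, le_div_iff₀ (by positivity)]
      linarith
    linarith

theorem sqrt_le_sampleSize {r : ℕ} (hr : 0 < r) : √((n : ℝ) / r) ≤ sampleSize n r := by
  have hr' : (0 : ℝ) < r := by exact_mod_cast hr
  refine Real.sqrt_le_iff.2 ⟨by positivity, ?_⟩
  rw [div_le_iff₀ hr']
  have := le_sampleSize (n := n) hr
  have h : (n : ℝ) ≤ sampleSize n r * sampleSize n r * r := by exact_mod_cast this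
  rw [sq]; exact h

theorem one_le_sqrt {r : ℕ} (hr : 0 < r) (hrn : r ≤ 10 * n) : 1 ≤ 4 * √((n : ℝ) / r) := by
  have hr' : (0 : ℝ) < r := by exact_mod_cast hr
  have h : (1 : ℝ) / 4 ≤ √((n : ℝ) / r) := by
    refine Real.le_sqrt_of_sq_le ?_
    rw [le_div_iff₀ hr']
    have : (r : ℝ) ≤ 10 * n := by exact_mod_cast hrn
    linarith
  linarith

theorem sampleSize_le_sqrt {r : ℕ} (hr : 0 < r) (hrn : r ≤ 10 * n) : (sampleSize n r :
    ℝ) ≤ 5 * √((n : ℝ) / r) := by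
  have hr' : (0 : ℝ) < r := by exact_mod_cast hr
  have h1 := one_le_sqrt hr hrn
  obtain h0 | h0 := Nat.eq_zero_or_pos (sampleSize n r)
  · rw [h0]; push_cast; positivity
  have h2 := lt_of_lt_sampleSize (n := n) (r := r) (N := sampleSize n r - 1) (by omega)
  have h3 : ((sampleSize n r - 1 : ℕ) : ℝ) ≤ √((n : ℝ) / r) := by
    refine Real.le_sqrt_of_sq_le ?_
    rw [le_div_iff₀ hr', sq]
    exact_mod_cast h2.le
  rw [Nat.cast_sub (by omega)] at h3
  push_cast at h3
  linarith

theorem log_pos' (h2 : 2 ≤ n) : 1 / 2 ≤ Real.log n := by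
  have h1 := Real.log_two_gt_d9
  have h3 : Real.log 2 ≤ Real.log n := Real.log_le_log (by norm_num) (by exact_mod_cast h2)
  linarith

/-- With `S = √(n/r)` the ball bound is about `2 n (c + 8) log n / S`, and a ball of radius `σ/2`
has at least `ε r / 32` vertices. Because `S² r = n`, the quotient is of order `S log n / ε`: the
choice of the sample size balances the sample against the packing. -/
theorem ballBound_div_le (c : ℕ) {r : ℕ} (h2 : 2 ≤ n) (hp : 0 < p) (hpq : p < q) (hr : 0 < r) :
    ((ballBound c n r / (slack p q r / 2 + 1) : ℕ) : ℝ) ≤ 1 + 64 * (c + 8) * Real.log n * √((n :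
    ℝ) / r) / ((p : ℝ) / q) := by
  obtain ⟨hq, hp', hε0, -⟩ := eps_bounds hp hpq
  have hr' : (0 : ℝ) < r := by exact_mod_cast hr
  have hn' : (0 : ℝ) < n := by exact_mod_cast (by omega : 0 < n)
  set ε : ℝ := (p : ℝ) / q with hε
  have hlog := log_pos' h2
  have hN := sqrt_le_sampleSize (n := n) hr
  set S := √((n : ℝ) / r) with hS
  have hS0 : 0 < S := Real.sqrt_pos.2 (by positivity)
  have hSS : S * S = n / r := Real.mul_self_sqrt (by positivity)
  have h1 : (ballBound c n r : ℝ) ≤ 2 * n * ((c + 8) * Real.log n) / S + 1 := by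
    have h3 : (ballBound c n r : ℝ) ≤ (⌈2 * n * ((c + 8) * Real.log n) / sampleSize n r⌉₊ : ℕ) := by
      exact Nat.cast_le.2 (min_le_right _ _)
    have h4 := (Nat.ceil_lt_add_one (show (0 : ℝ) ≤ 2 * n * ((c + 8) * Real.log n) / sampleSize n r
      by positivity)).le
    refine (h3.trans h4).trans ?_
    gcongr
  set D : ℕ := slack p q r / 2 + 1 with hD
  have hD1 : (1 : ℝ) ≤ D := by exact_mod_cast (by omega : 1 ≤ D)
  have hD2 : ε * r / 32 ≤ D := by
    have h3 : p * r < 16 * q * (slack p q r + 1) := by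
      have := Nat.lt_mul_div_succ (p * r) (show 0 < 16 * q by omega)
      exact this
    have h4 : (p : ℝ) * r < 16 * q * (2 * D) := by
      have : p * r < 16 * q * (2 * D) := h3.trans_le (Nat.mul_le_mul_left _ (by omega))
      exact_mod_cast this
    rw [hε, div_mul_eq_mul_div, div_div, div_le_iff₀ (by positivity)]
    linarith
  refine Nat.cast_div_le.trans ?_
  rw [div_le_iff₀ (by linarith)]
  have h5 : 2 * n * ((c + 8) * Real.log n) / S ≤ 64 * (c + 8) * Real.log n * S / ε * (ε * r / 32) := by
    have : 64 * (c + 8) * Real.log n * S / ε * (ε * r / 32) = 2 * (c + 8) * Real.log n * S * r := by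
      grind
    rw [this, div_le_iff₀ hS0]
    have h6 : S * r * S = n := by grind
    have h7 : 2 * (c + 8) * Real.log n * S * r * S = 2 * (c + 8) * Real.log n * (S * r * S) := by ring
    rw [h7, h6]
    linarith
  have h8 : 64 * (c + 8) * Real.log n * S / ε * (ε * r / 32) ≤ 64 * (c + 8) * Real.log n * S / ε *
    D := mul_le_mul_of_nonneg_left hD2 (by positivity)
  grind

/-- One of the values over which the maximum is taken. -/
theorem le_radiusTimeBound {ε : ℝ} {R : ℕ}
    (hR : R ∈ Finset.uIcc (radiusAfter mode n l []) (radiusAfter mode n l us)) :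
    T n (maxEdges mode l us) (2 * R) ε * √((n : ℝ) / R) / ε ^ 2 ≤ radiusTimeBound mode T n l us ε :=
  Finset.le_sup' (fun R' => T n (maxEdges mode l us) (2 * R') ε * √((n : ℝ) / R') / ε ^ 2) hR

theorem sqrt_le_of_le {r R a : ℕ} (hr : 0 < r) (hR : 0 < R) (h : R ≤ a * a * r) : √((n :
    ℝ) / r) ≤ a * √((n : ℝ) / R) := by
  have hr' : (0 : ℝ) < r := by exact_mod_cast hr
  have hR' : (0 : ℝ) < R := by exact_mod_cast hR
  refine Real.sqrt_le_iff.2 ⟨by positivity, ?_⟩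
  rw [mul_pow, Real.sq_sqrt (by positivity), div_le_iff₀ hr', mul_div_assoc', div_mul_eq_mul_div,
    le_div_iff₀ hR']
  have : (R : ℝ) ≤ a * a * r := by exact_mod_cast h
  nlinarith [(Nat.cast_nonneg n : (0 : ℝ) ≤ n)]

/-- The cost of `t` runs of the black box for a radius of about `R`. -/
theorem cost_le (hB : IsTruncatedSSSP mode B) (hT : RunsInTotalTime mode B T) (hK : PolyGrowth K T)
    (h2 : 2 ≤ n) (hp : 0 < p) (hpq : p < q) (hl : IsEdgeList n l) (hus : LegalSeq mode n l us)
    {k R : ℕ} {t A : ℝ} (hk : k ≤ 256 * (2 * R)) (hA : 0 ≤ A) (hR : R ∈ Finset.uIcc (radiusAfter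
    mode n l []) (radiusAfter mode n l us)) (ht : t ≤ A * √((n : ℝ) / R) / ((p : ℝ) / q)) :
    t * T n (maxEdges mode l us) k ((p : ℝ) / q / 256) ≤ A * K ^ 8 * ((p : ℝ) / q) * radiusTimeBound
    mode T n l us ((p : ℝ) / q) := by
  obtain ⟨hq, hp', hε0, -⟩ := eps_bounds hp hpq
  have h1 := bound_le hB hT hK h2 hp hpq hl hus hk
  have h3 := le_radiusTimeBound (T := T) (ε := (p : ℝ) / q) hR
  have h4 : (0 : ℝ) ≤ T n (maxEdges mode l us) k ((p : ℝ) / q / 256) := le_trans (by positivity)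
    (le_bound hB hT h2 hp hpq hl hus k)
  set ε : ℝ := (p : ℝ) / q with hε
  set S := √((n : ℝ) / R) with hS
  have hS0 : 0 ≤ S := Real.sqrt_nonneg _
  calc t * T n (maxEdges mode l us) k (ε / 256) ≤ A * S / ε * T n (maxEdges mode l us) k (ε /
      256) := mul_le_mul_of_nonneg_right ht h4
    _ ≤ A * S / ε * (K ^ 8 * T n (maxEdges mode l us) (2 * R) ε) := mul_le_mul_of_nonneg_left h1
        (by positivity)
    _ = A * K ^ 8 * ε * (T n (maxEdges mode l us) (2 * R) ε * S / ε ^ 2) := by field_simp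
    _ ≤ _ := mul_le_mul_of_nonneg_left h3 (by positivity)

end costs

/-! ## Histories -/

/-- The updates of an adversary that is shown the values `outs`. -/
def Adversary.play (adv : Adversary) (outs : List ℕ) : List Edge := (List.range (outs.length -
  1)).map fun i => (adv (outs.take (i + 1))).getD (0, 0)

theorem Adversary.Plays.eq_play {adv : Adversary} {us : List Edge} {outs : List ℕ} (h :
    adv.Plays us outs) : us = adv.play outs := by
  refine List.ext_getElem (by simp [Adversary.play, h.1]) fun i h1 h2 => ?_
  have := h.2 i h1
  simp [Adversary.play, this, h1]

section history

variable {A : DynAlg} {mode : UpdateMode} {B : BlackBox} {w : ℕ} {ω ω' : ℕ → Fin (2 ^ w)}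
  {n p q M τ : ℕ} {l us us' : List Edge} {adv : Adversary} {outs outs' : List ℕ} {s s' : State}

/-- Once the adversary is fixed, the number of values shown determines the whole history, for each
value determines the next update. -/
theorem DynAlg.Run.det {E : Env} (h : A.Run E n p q l us outs s) (h' : A.Run E n p q l us' outs' s')
    (hp : adv.Plays us outs) (hp' : adv.Plays us' outs') (hl : outs.length = outs'.length) :
    outs = outs' ∧ us = us' ∧ s = s' := by
  induction h generalizing us' outs' s' with
  | start h1 =>
    cases h' with
    | start h2 =>
      cases h1.det h2
      exact ⟨rfl, rfl, rfl⟩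
    | update e h3 h4 =>
      have := hp'.1
      grind
  | @update us outs s s1 e h1 h2 ih =>
    cases h' with
    | start h3 =>
      have := hp.1
      grind
    | @update us' outs' s' s1' e' h3 h4 =>
      have g : ∀ {us : List Edge} {outs : List ℕ} {e : Edge} {x : ℕ}, adv.Plays (us ++ [e]) (outs ++
          [x]) → adv.Plays us outs ∧ adv outs = some e := by
        intro us outs e x hp
        have hlen : outs.length = us.length + 1 := by simpa using hp.1
        refine ⟨⟨hlen, fun i hi => ?_⟩, ?_⟩
        · have := hp.2 i (by simp; omega)
          grind
        · have := hp.2 us.length (by simp)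
          grind
      obtain ⟨p1, p2⟩ := g hp
      obtain ⟨p3, p4⟩ := g hp'
      obtain ⟨rfl, rfl, rfl⟩ := ih h3 p1 p3 (by simpa using hl)
      rw [p2, Option.some.injEq] at p4
      subst p4
      cases h2.det h4
      exact ⟨rfl, rfl, rfl⟩

theorem DynAlg.Run.congr_coins (h : A.Run ⟨mode, B, w, ω⟩ n p q l us outs s) (hω : ∀ i < s.used,
    ω i = ω' i) : A.Run ⟨mode, B, w, ω'⟩ n p q l us outs s := by
  induction h with
  | start h1 => exact .start (h1.congr_coins.2 hω)
  | update e h1 h2 ih =>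
    have h3 := h2.congr_coins (ω' := ω')
    exact .update e (ih fun i hi => hω i (hi.trans_le h3.1)) (h3.2 hω)

/-- The values `outs` are shown first, when at most the first `M` random words have been used. -/
def Shown (A : DynAlg) (E : Env) (n p q : ℕ) (l : List Edge) (adv : Adversary) (M : ℕ) (outs :
    List ℕ) : Prop := outs = [] ∨ ∃ us s, A.Run E n p q l us outs s ∧ adv.Plays us outs ∧ s.used ≤ M

theorem Shown.unique {E : Env} (h : Shown A E n p q l adv M outs) (h' : Shown A E n p q l adv M
    outs') (hl : outs.length = outs'.length) : outs = outs' := by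
  rcases h with rfl | ⟨us, s, h1, h2, -⟩
  · grind
  · rcases h' with rfl | ⟨us', s', h3, h4, -⟩
    · grind
    · exact (h1.det h3 h2 h4 hl).1

theorem Shown.congr_coins (h : Shown A ⟨mode, B, w, ω⟩ n p q l adv M outs) (hω : ∀ i < M,
    ω i = ω' i) : Shown A ⟨mode, B, w, ω'⟩ n p q l adv M outs := by
  rcases h with rfl | ⟨us, s, h1, h2, h3⟩
  · exact Or.inl rfl
  · exact Or.inr ⟨us, s, h1.congr_coins fun i hi => hω i (hi.trans_le h3), h2, h3⟩

/-- The first `τ` values that are shown, if at most the first `M` random words have been used by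
then. -/
noncomputable def shown (A : DynAlg) (E : Env) (n p q : ℕ) (l : List Edge) (adv : Adversary) (M τ :
    ℕ) : List ℕ := Classical.epsilon fun outs => Shown A E n p q l adv M outs ∧ outs.length = τ

theorem Shown.eq_shown {E : Env} (h : Shown A E n p q l adv M outs) : shown A E n p q l adv M
    outs.length = outs := by
  have h1 := Classical.epsilon_spec (p := fun outs' => Shown A E n p q l adv M outs' ∧
    outs'.length = outs.length) ⟨outs, h, rfl⟩
  exact h1.1.unique h h1.2

theorem shown_congr (hω : ∀ i < M, ω i = ω' i) : shown A ⟨mode, B, w, ω⟩ n p q l adv M τ = shown A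
    ⟨mode, B, w, ω'⟩ n p q l adv M τ := by
  refine congrArg Classical.epsilon (funext fun outs => ?_)
  exact propext ⟨fun h => ⟨h.1.congr_coins hω, h.2⟩, fun h => ⟨h.1.congr_coins fun i hi => (hω i
    hi).symm, h.2⟩⟩

end history

/-! ## The time for edge deletions -/

section del

variable {B : BlackBox} {T : ℕ → ℕ → ℕ → ℝ → ℝ} {K : ℝ} {n p q w c : ℕ} {l us : List Edge}
  {adv : Adversary}

/-- The bound on the size of the balls that the sample for the `g + 1`-st guess does not hit. -/
noncomputable def delBound (c n p q g : ℕ) : ℕ := if g < n then ballBound c n (guess p q (g + 1))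
  else n

theorem delBound_le (c n p q g : ℕ) : delBound c n p q g ≤ n := by
  unfold delBound
  split_ifs
  · exact ballBound_le _ _ _
  · exact le_rfl

/-- What is shown during the `g + 1`-st guess. -/
def delOut (p q g : ℕ) : ℕ := threshold p q (guess p q (g + 1)) + slack p q (guess p q (g + 1))

/-- The ball around `v` of half the guessed radius, after `j` updates made during the `g + 1`-st
guess, which has begun when `τ` values had been shown. -/
noncomputable def delBall (B : BlackBox) (n p q w : ℕ) (l : List Edge) (adv : Adversary) (g τ j v :
    ℕ) (ω : ℕ → Fin (2 ^ w)) : Finset ℕ := gball n (afterUpdates .decremental l (adv.play (shown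
    delAlg ⟨.decremental, B, w, ω⟩ n p q l adv (2 * n * g) τ ++ List.replicate (j + 1) (delOut p q
    g)))) v (guess p q (g + 1) / 2)

/-- The random words for which the sample fails to hit a large ball. -/
noncomputable def delMiss (B : BlackBox) (n p q w : ℕ) (l : List Edge) (adv : Adversary) (c : ℕ) :
    Set (ℕ → Fin (2 ^ w)) := ⋃ z ∈ (Finset.range n ×ˢ Finset.range n) ×ˢ (Finset.range (n * n + 1)
    ×ˢ Finset.range (n * n + 1)), {ω | ballBound c n (guess p q (z.1.1 + 1)) < (delBall B n p q w l
    adv z.1.1 z.2.1 z.2.2 z.1.2 ω).card ∧ ∀ i < sampleSize n (guess p q (z.1.1 + 1)), (ω (2 * n *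
    z.1.1 + 2 * i) : ℕ) % n ∉ delBall B n p q w l adv z.1.1 z.2.1 z.2.2 z.1.2 ω}

/-- The history up to the start of guess `g + 1` depends on the first `2 n g` random words only, and
after that the shown values are constant. So each ball in the union is determined before its sample
is drawn. The index set has `n² (n² + 1)² ≤ n⁸` elements, each event having probability at most `n ^
(-(c + 8))`. -/
theorem measure_delMiss_le (hn : 2 ≤ n) (hw : n ≤ 2 ^ w) (c : ℕ) : coinLaw w (delMiss B n p q w l
    adv c) ≤ ENNReal.ofReal (1 / (n : ℝ) ^ c) := by
  have hn' : (0 : ℝ) < n := by exact_mod_cast (by omega : 0 < n)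
  refine (measure_biUnion_finset_le _ _).trans ?_
  refine (Finset.sum_le_card_nsmul _ _ (ENNReal.ofReal (1 / (n : ℝ) ^ (c + 8))) ?_).trans ?_
  · rintro ⟨⟨g, v⟩, τ, j⟩ -
    refine measure_miss_ballBound c (by omega) hw ((Nat.succ_pos g).trans_le (le_guess p q (g + 1))) ?_ ?_
    · intro ω
      exact Finset.filter_subset _ _
    · intro ω ω' hω
      unfold delBall
      rw [shown_congr hω]
  · rw [← ENNReal.ofReal_nsmul]
    refine ENNReal.ofReal_le_ofReal ?_
    simp only [Finset.card_product, Finset.card_range, nsmul_eq_mul]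
    have h1 : n * n * ((n * n + 1) * (n * n + 1)) ≤ n ^ 8 := by
      have h2 : n * n + 1 ≤ n ^ 3 := by nlinarith [Nat.mul_le_mul hn hn]
      calc n * n * ((n * n + 1) * (n * n + 1)) ≤ n * n * (n ^ 3 * n ^ 3) := Nat.mul_le_mul_left _
            (Nat.mul_le_mul h2 h2)
        _ = n ^ 8 := by ring
    have h2 : ((n * n * ((n * n + 1) * (n * n + 1)) : ℕ) : ℝ) ≤ (n : ℝ) ^ 8 := by exact_mod_cast h1
    rw [pow_add, mul_one_div, div_le_div_iff₀ (by positivity) (by positivity)]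
    have h3 : (0 : ℝ) < (n : ℝ) ^ c := by positivity
    nlinarith

/-- The current graph is recovered from data that do not involve the current sample: the values
`outs` shown before the guess, and the number `j + 1` of repetitions of the value belonging to the
guess. For `g ≥ n`, which does not occur, the bound is the trivial one. -/
theorem hits_of_notMem {ω : ℕ → Fin (2 ^ w)} (hω : ω ∉ delMiss B n p q w l adv c) {g j : ℕ}
    {outs : List ℕ} (hs : Shown delAlg ⟨.decremental, B, w, ω⟩ n p q l adv (2 * n * g) outs) (hus :
    us.length ≤ n * n) (hp : adv.Plays us (outs ++ List.replicate (j + 1) (delOut p q g))) :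
    Hits ⟨.decremental, B, w, ω⟩ n p q (afterUpdates .decremental l us) g (delBound c n p q g) := by
  have hlen := hp.1
  simp only [List.length_append, List.length_replicate] at hlen
  by_cases hg : g < n
  · intro v hv hmiss
    unfold delBound
    rw [if_pos hg]
    by_contra hlt
    refine hω (Set.mem_biUnion (x := ((g, v), (outs.length, j))) ?_ ?_)
    · grind
    · have : delBall B n p q w l adv g outs.length j v ω = gball n (afterUpdates .decremental l us)
          v (guess p q (g + 1) / 2) := by
        unfold delBall
        rw [hs.eq_shown, ← hp.eq_play]
      simp only [Set.mem_ofPred_eq, this]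
      refine ⟨Nat.lt_of_not_le hlt, fun i hi h => ?_⟩
      have h1 : _ < gdist n _ ((ω (2 * n * g + 2 * i) : ℕ) % n) v := hmiss i hi
      have h2 := (mem_gball.1 h).2
      rw [gdist_comm] at h2
      omega
  · unfold delBound
    rw [if_neg hg]
    exact Hits.trivial _ _ _ _ _ _

theorem guess_ge_pow {p q : ℕ} (hq : 0 < q) (g : ℕ) : (1 + (p : ℝ) / q / 16) ^ g ≤ guess p q (g +
    1) := by
  induction g with
  | zero => simp [guess, slack]
  | succ g ih =>
    have hq' : (0 : ℝ) < q := by exact_mod_cast hq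
    set a := guess p q (g + 1) with ha
    have h1 : p * a < 16 * q * (slack p q a + 1) := Nat.lt_mul_div_succ (p * a) (by omega)
    have h2 : (p : ℝ) * a < 16 * q * (slack p q a + 1) := by exact_mod_cast h1
    have h3 : (p : ℝ) / q / 16 * a ≤ slack p q a + 1 := by
      rw [div_div, div_mul_eq_mul_div, div_le_iff₀ (by positivity)]
      linarith
    have h4 : ((guess p q (g + 1 + 1) : ℕ) : ℝ) = a + 1 + slack p q a := by
      rw [ha]; simp only [guess]; push_cast; ring
    rw [h4, pow_succ]
    have h5 : (0 : ℝ) ≤ (p : ℝ) / q / 16 := by positivity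
    nlinarith

/-- The guesses grow at least like `(1 + ε/16)^g`, and `log (1 + ε/16) ≥ ε/32`. -/
theorem guess_count {p q g : ℕ} (hn : 2 ≤ n) (hp : 0 < p) (hpq : p < q) (h : guess p q g ≤ n) :
    (g + 1 : ℝ) ≤ 36 * Real.log n / ((p : ℝ) / q) := by
  obtain ⟨hq, hp', hε0, h1⟩ := eps_bounds hp hpq
  have hlog := log_pos' hn
  have hge : ∀ i, (1 + (p : ℝ) / q / 16) ^ i ≤ guess p q (i + 1) := guess_ge_pow (by omega)
  set ε : ℝ := (p : ℝ) / q with hε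
  rw [le_div_iff₀ hε0]
  cases g with
  | zero => push_cast; nlinarith
  | succ g =>
    have h2 : (1 + ε / 16) ^ g ≤ n := (hge g).trans (by exact_mod_cast h)
    have h3 : g * Real.log (1 + ε / 16) ≤ Real.log n := by
      rw [← Real.log_pow]
      exact Real.log_le_log (by positivity) h2
    have h4 : ε / 32 ≤ Real.log (1 + ε / 16) := by
      refine le_trans ?_ (Real.one_sub_inv_le_log_of_pos (by positivity))
      rw [le_sub_iff_add_le, ← le_sub_iff_add_le', inv_le_comm₀ (by positivity) (by linarith)]
      rw [inv_le_comm₀ (by linarith) (by positivity), ← one_div, div_le_iff₀ (by positivity)]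
      nlinarith
    have h5 : g * (ε / 32) ≤ Real.log n := (mul_le_mul_of_nonneg_left h4 (by positivity)).trans h3
    push_cast
    nlinarith

/-- The bound on the number of vertices that are tried. -/
theorem tries_le (c : ℕ) {r R : ℕ} (h2 : 2 ≤ n) (hp : 0 < p) (hpq : p < q) (hr : 0 < r) (hrn :
    r ≤ 10 * n) (hR : 0 < R) (hRr : R ≤ 9 * r) : ((sampleSize n r + 2 + ballBound c n r / (slack p q
    r / 2 + 1) : ℕ) : ℝ) ≤ 300 * (c + 8) * Real.log n * √((n : ℝ) / R) / ((p : ℝ) / q) := by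
  obtain ⟨hq, hp', hε0, h1⟩ := eps_bounds hp hpq
  have hlog := log_pos' h2
  have a1 := sampleSize_le_sqrt hr hrn
  have a2 := one_le_sqrt hr hrn
  have a3 := ballBound_div_le c h2 hp hpq hr
  have a4 : √((n : ℝ) / r) ≤ (3 : ℕ) * √((n : ℝ) / R) := sqrt_le_of_le hr hR (by omega)
  set ε : ℝ := (p : ℝ) / q with hε
  set S := √((n : ℝ) / r)
  set S' := √((n : ℝ) / R)
  have hS : 0 ≤ S := Real.sqrt_nonneg _
  rw [Nat.cast_add, Nat.cast_add]
  have b1 : 5 * S + 2 + 1 ≤ 34 * Real.log n * S / ε := by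
    rw [le_div_iff₀ hε0]
    have : 5 * S + 2 + 1 ≤ 17 * S := by linarith
    have h3 : (5 * S + 2 + 1) * ε ≤ 17 * S := by nlinarith
    nlinarith
  have b2 : 34 * Real.log n * S / ε + 64 * (c + 8) * Real.log n * S / ε ≤ 100 * (c + 8) * Real.log n
      * S / ε := by
    rw [← add_div]
    refine div_le_div_of_nonneg_right ?_ hε0.le
    have : 0 ≤ Real.log n * S := by positivity
    have h3 : (0 : ℝ) ≤ c := by positivity
    nlinarith [mul_nonneg h3 this]
  have b3 : 100 * (c + 8) * Real.log n * S / ε ≤ 300 * (c + 8) * Real.log n * S' / ε := by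
    refine div_le_div_of_nonneg_right ?_ hε0.le
    push_cast at a4
    have : 0 ≤ 100 * (c + 8) * Real.log n := by positivity
    nlinarith [mul_le_mul_of_nonneg_left a4 this]
  grind

/-- Each guess costs at most a constant times `log n * ε` times the target bound, where `ε` appears
because the number of tries has `1/ε` and the target has `1/ε²`. The `O(log n / ε)` guesses cancel
this factor and add a logarithm. -/
theorem DelInv.cost_le {E : Env} (hC : Ctx E n p q l) (hmode : E.mode = .decremental) (hT :
    RunsInTotalTime .decremental E.box T) (hK : PolyGrowth K T) (hus : LegalSeq .decremental n l us)
    (hcon : AlwaysConnected .decremental n l us) {g : ℕ} {v : View} (hv : DelInv E n p q l (delBound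
    c n p q) us g v) : sessCost (fun k => T n (maxEdges .decremental l us) k ((p : ℝ) / q / 256))
    v.sess ≤ 10800 * (c + 8) * K ^ 8 * Real.log n ^ 2 * radiusTimeBound .decremental T n l us ((p :
    ℝ) / q) := by
  obtain ⟨-, k, hB, hS, -⟩ := hv
  have hbox : IsTruncatedSSSP .decremental E.box := hmode ▸ hC.box
  have h2 := hC.two_le
  have hpq := hC.p_lt
  have hp := hC.p_pos
  have hcf : (graphOf n (afterUpdates .decremental l us)).Connected := hcon us List.prefix_rfl
  have hc0 : (graphOf n l).Connected := hcon [] (by simp)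
  have hgr := grad_anti hcf (by omega) (graphOf_delete_le n l us) hc0
  have hR0 := grad_pos hc0 h2
  have hR0n := grad_lt hc0 (by omega)
  have hlt := hB.lt_grad
  rw [hmode] at hlt
  have hgn := hB.guess_le hC (by rw [hmode]; exact hcf)
  set F : ℕ → ℝ := fun k => T n (maxEdges .decremental l us) k ((p : ℝ) / q / 256) with hF
  have hFpos : ∀ k, 0 ≤ F k := fun k =>
    le_trans (by positivity) (le_bound hbox hT h2 hp hpq hC.edges hus k)
  obtain ⟨hq', hp', hε0, hε1⟩ := eps_bounds hp hpq
  have hlog := log_pos' h2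
  set X := radiusTimeBound .decremental T n l us ((p : ℝ) / q) with hX
  set A : ℝ := 300 * (c + 8) * Real.log n with hA
  have hA0 : 0 ≤ A := by positivity
  have hmono : ∀ i ≤ g, guess p q i ≤ guess p q g := fun i hi =>
    monotone_nat_of_le_succ (fun j => by simp only [guess]; omega) hi
  have key : ∀ i ≤ g, tryBound n p q l (delBound c n p q) i * F (16 * guess p q (i + 1)) ≤ A * K ^ 8
      * ((p : ℝ) / q) * X := by
    intro i hi
    have hi1 := hmono i hi
    have hi2 := guess_succ_le (g := i) hpq
    have hi3 := le_guess p q (i + 1)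
    have hi4 := le_guess p q i
    set r := guess p q (i + 1) with hr
    have huIcc : ∀ R, grad n l ≤ R → R ≤ grad n (afterUpdates .decremental l us) → R ∈ Finset.uIcc
        (radiusAfter .decremental n l []) (radiusAfter .decremental n l us) := by
      intro R h1 h3
      exact Finset.mem_uIcc.2 ⟨(min_le_left _ _).trans h1, h3.trans (le_max_right _ _)⟩
    by_cases h5 : grad n l ≤ 5 * r
    -- The guess clamped to the interval between the initial and the final radius; it differs from
    -- `r` by a constant factor, as `r` is at most about the final radius and the initial radius is
    -- at most `5 r`.
    · refine _root_.cost_le hbox hT hK h2 hp hpq hC.edges hus (R := max (grad n l) (min r (grad n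
        (afterUpdates .decremental l us)))) (by omega) hA0 (huIcc _ (by omega) (by omega)) ?_
      have : tryBound n p q l (delBound c n p q) i = sampleSize n r + 2 + ballBound c n r / (slack p
          q r / 2 + 1) := by
        unfold tryBound delBound
        grind
      rw [this]
      exact tries_le c h2 hp hpq (by omega) (by omega) (by omega) (by omega)
    -- A guess far below the initial radius takes a single run with a small distance bound; it is
    -- charged to the initial radius.
    · refine _root_.cost_le hbox hT hK h2 hp hpq hC.edges hus (R := grad n l) (by omega) hA0
        (huIcc _ le_rfl (by omega)) ?_
      have : tryBound n p q l (delBound c n p q) i = 1 := if_neg h5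
      rw [this, le_div_iff₀ hε0]
      have h6 := one_le_sqrt (n := n) (r := grad n l) hR0 (by omega)
      have h7 : 4 ≤ A := by
        rw [hA]
        have : (0 : ℝ) ≤ c := by positivity
        nlinarith
      have h8 := Real.sqrt_nonneg ((n : ℝ) / grad n l)
      push_cast
      nlinarith
  have hj : (k : ℝ) ≤ tryBound n p q l (delBound c n p q) g := by
    exact_mod_cast hS.le_tryBound le_rfl
  have h5 := hB.cost F hFpos
  have h6 : ∑ i ∈ Finset.range g, tryBound n p q l (delBound c n p q) i * F (16 * guess p q (i + 1))
      + k * F (16 * guess p q (g + 1)) ≤ (g + 1) * (A * K ^ 8 * ((p : ℝ) / q) * X) := by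
    have h7 := Finset.sum_le_card_nsmul (Finset.range g) _ _ fun i hi =>
      key i (Finset.mem_range.1 hi).le
    rw [Finset.card_range, nsmul_eq_mul] at h7
    have h8 := (mul_le_mul_of_nonneg_right hj (hFpos (16 * guess p q (g + 1)))).trans (key g le_rfl)
    linarith
  have h7 := guess_count h2 hp hpq hgn.1.le
  have h8 : 0 ≤ A * K ^ 8 * ((p : ℝ) / q) * X := le_trans (by have := hFpos (16 * guess p q (g + 1)); positivity) (key g le_rfl)
  refine (h5.trans h6).trans ((mul_le_mul_of_nonneg_right h7 h8).trans_eq ?_)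
  rw [hA]
  field_simp
  ring

/-- A hypothetical run with distance bound 0 pays for the constant time per update. As a by-product
the target bound, multiplied by `K⁸`, is nonnegative. -/
theorem base_cost_le {mode : UpdateMode} (hB : IsTruncatedSSSP mode B) (hT : RunsInTotalTime mode B
    T) (hK : PolyGrowth K T) (h2 : 2 ≤ n) (hp : 0 < p) (hpq : p < q) (hl : IsEdgeList n l) (hus :
    LegalSeq mode n l us) (hcon : (graphOf n l).Connected) : (1 + us.length : ℝ) ≤ 8 * K ^ 8 *
    Real.log n * radiusTimeBound mode T n l us ((p : ℝ) / q) := by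
  obtain ⟨hq', hp', hε0, hε1⟩ := eps_bounds hp hpq
  have hlog := log_pos' h2
  have hR0 := grad_pos hcon h2
  have hR0n := grad_lt hcon (by omega)
  have h1 := le_bound hB hT h2 hp hpq hl hus 0
  have h3 := cost_le (t := 1) (A := 4) hB hT hK h2 hp hpq hl hus (k := 0) (R := grad n l) (by omega)
    (by norm_num) Finset.left_mem_uIcc (by
      rw [le_div_iff₀ hε0]
      have := one_le_sqrt (n := n) (r := grad n l) hR0 (by omega)
      linarith)
  have h4 : (1 + us.length : ℝ) ≤ 4 * K ^ 8 * ((p : ℝ) / q) * radiusTimeBound mode T n l us ((p :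
      ℝ) / q) := by
    refine le_trans ?_ (h1.trans (by linarith))
    exact_mod_cast (by omega : 1 + us.length ≤ n + l.length + us.length)
  set X := radiusTimeBound mode T n l us ((p : ℝ) / q)
  set ε := (p : ℝ) / q
  have h5 : 0 ≤ K ^ 8 * X := by
    by_contra h
    have h6 : 4 * K ^ 8 * ε * X = 4 * ε * (K ^ 8 * X) := by ring
    rw [h6] at h4
    have : (0 : ℝ) ≤ us.length := by positivity
    nlinarith
  nlinarith

/-- The invariant of the run is strengthened by the form of the history: a part `base`, shown before
the current guess and independent of its sample, followed by copies of one value. -/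
theorem delAlg_time {ω : ℕ → Fin (2 ^ delAlg.wordLength n q)} (hB : IsTruncatedSSSP .decremental B)
    (hT : RunsInTotalTime .decremental B T) (hK : PolyGrowth K T) (h2 : 2 ≤ n) (hp : 0 < p) (hpq :
    p < q) (hl : IsEdgeList n l) (hadv : adv.IsLegal .decremental n l) (hω : ω ∉ delMiss B n p q
    (delAlg.wordLength n q) l adv c) : ω ∈ delAlg.FinishesWithin .decremental B n p q l adv
    fun us =>
      (10001 * 10800 * (c + 8) + 32000) * K ^ 8 * Real.log n ^ 2 * radiusTimeBound .decremental T n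
        l us ((p : ℝ) / q) := by
  have hC := ctx_of hB h2 hp hpq hl ω
  have h0 := hadv [] [0] ⟨rfl, by simp⟩
  have hlen : ∀ {us}, LegalSeq .decremental n l us → us.length ≤ n * n := fun h =>
    h.length_after.1.trans (h.maxEdges_le hl)
  set E : Env := ⟨.decremental, B, delAlg.wordLength n q, ω⟩ with hE
  have key : ∃ us outs s, delAlg.Run E n p q l us outs s ∧ adv.Plays us outs ∧ adv outs = none ∧
      ∃ v g base j, SeenAs E (2 * l.length) s v ∧ DelInv E n p q l (delBound c n p q) us g v ∧
      v.vt ≤ 2000 + 200 * us.length ∧ outs = base ++ List.replicate (j + 1) (delOut p q g) ∧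
      Shown delAlg E n p q l adv (2 * n * g) base := by
    refine exists_run (I := fun us outs s => ∃ v g base j, SeenAs E (2 * l.length) s v ∧
      DelInv E n p q l (delBound c n p q) us g v ∧ v.vt ≤ 2000 + 200 * us.length ∧ outs = base ++
      List.replicate (j + 1) (delOut p q g) ∧ Shown delAlg E n p q l adv (2 * n * g) base) (mode :=
      .decremental) rfl hadv hl ?_ ?_
    · obtain ⟨s, v, g, a1, a2, a3, a4⟩ := del_start hC (h0.2 [] (by simp)) (delBound_le c n p q)
        fun g => hits_of_notMem hω (us := []) (j := 0) (Or.inl rfl) (by simp) ⟨by simp, by simp⟩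
      obtain ⟨-, k, hBs, -⟩ := id a3
      refine ⟨s, a1, v, g, [], 0, a2, a3, by simpa using a4, ?_, Or.inl rfl⟩
      have : s.reg 0 = delOut p q g := (a2.var .out).trans hBs.out
      simp [this]
    · rintro us outs s e b1 b2 ⟨v, g, base, j, i1, i2, i3, i4, i5⟩ b3 b4 b5
      have hpl := b2.append b3
      obtain ⟨-, k, hBs, -⟩ := id i2
      have hused : s.used = 2 * n * (g + 1) := i1.used.trans hBs.used
      have hsh : ∀ g', g < g' → Shown delAlg E n p q l adv (2 * n * g') outs := fun g' hg =>
        Or.inr ⟨us, s, b1, b2, hused.trans_le (Nat.mul_le_mul_left _ hg)⟩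
      -- An update may use up several guesses. For the current one the history is extended by one
      -- more copy of its value; for a later one all values shown so far precede its sample. The
      -- value shown after the update plays no role for the graph.
      have hits : ∀ g', g ≤ g' → Hits E n p q (afterUpdates .decremental l (us ++ [e])) g' (delBound
          c n p q g') := by
        intro g' hg
        rcases hg.eq_or_lt with rfl | hg
        · refine hits_of_notMem hω (j := j + 1) i5 (hlen b4) ?_
          have := hpl (delOut p q g)
          rwa [i4, List.append_assoc, ← List.replicate_succ'] at this
        · exact hits_of_notMem hω (j := 0) (hsh g' hg) (hlen b4) (hpl _)
      obtain ⟨s', v', g', c1, c2, c3, c4, c5⟩ := del_update hC rfl b4 b5 (delBound_le c n p q) i1 i2 hits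
      obtain ⟨-, k', hBs', -⟩ := id c4
      have hout : s'.reg 0 = delOut p q g' := (c3.var .out).trans hBs'.out
      have hvt : v'.vt ≤ 2000 + 200 * ((us ++ [e]).length : ℤ) := by grind
      rcases c1.eq_or_lt with rfl | hg
      · refine ⟨s', c2, v', g, base, j + 1, c3, c4, hvt, ?_, i5⟩
        rw [hout, i4, List.append_assoc, ← List.replicate_succ']
      · exact ⟨s', c2, v', g', outs, 0, c3, c4, hvt, by rw [hout]; rfl, hsh g' hg⟩
  obtain ⟨us, outs, s, r1, r2, r3, v, g, base, j, i1, i2, i3, i4, i5⟩ := key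
  refine ⟨us, outs, s, r1, r2, r3, ?_⟩
  obtain ⟨hl1, hl2⟩ := hadv us outs r2
  obtain ⟨-, k, hBs, -⟩ := id i2
  have t1 : (s.time : ℝ) ≤ (v.vt : ℝ) + (credit B v.sess : ℝ) := by exact_mod_cast i1.time
  have t2 : (v.vt : ℝ) ≤ 2000 + 200 * us.length := by exact_mod_cast i3
  have t3 := credit_le hT hK h2 hp hpq hl hl1 hBs.sessions
  have t4 := i2.cost_le hC rfl hT hK hl1 hl2
  have t5 := base_cost_le hB hT hK h2 hp hpq hl hl1 (h0.2 [] (by simp))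
  have t6 := log_pos' h2
  set X := radiusTimeBound .decremental T n l us ((p : ℝ) / q)
  have t7 : 8 * K ^ 8 * Real.log n * X ≤ 16 * K ^ 8 * Real.log n ^ 2 * X := by
    have : 0 ≤ 8 * K ^ 8 * Real.log n * X := le_trans (by positivity) t5
    nlinarith
  grind

end del

/-! ## Random representatives of a shrinking set

Elements leave a set one after the other: `P τ u` says that `u` has left by the time `τ`. A random
element is chosen, and chosen anew whenever it has left. -/

open Classical in
/-- The elements of `C` that leave after `w`. -/
noncomputable def survivors (P : ℕ → ℕ → Prop) (C : Finset ℕ) (w : ℕ) : Finset ℕ := C.filter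
  fun u => ∃ τ, P τ w ∧ ¬ P τ u

/-- The element of `C` that is chosen by the word `z`. -/
noncomputable def choice (C : Finset ℕ) (z : ℕ) : ℕ := Nat.nth (· ∈ C) (z % C.card)

/-- What is left after `k` choices. -/
noncomputable def remains (P : ℕ → ℕ → Prop) (C : Finset ℕ) (z : ℕ → ℕ) : ℕ → Finset ℕ
  | 0 => C
  | k + 1 => survivors P (remains P C z k) (choice (remains P C z k) (z k))

section chain

variable {P : ℕ → ℕ → Prop} {C : Finset ℕ} {z : ℕ → ℕ}

theorem nth_mem_of_lt {i : ℕ} (hi : i < C.card) : Nat.nth (· ∈ C) i ∈ C := Nat.nth_mem i fun hf =>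
  by
    have e : hf.toFinset = C := Finset.ext fun x => hf.mem_toFinset.trans Iff.rfl
    exact hi.trans_eq (congrArg Finset.card e).symm

theorem nth_injOn : Set.InjOn (Nat.nth (· ∈ C)) (Set.Iio C.card) := by
  have hf : (setOf (· ∈ C)).Finite := C.finite_toSet
  have e : hf.toFinset = C := Finset.ext fun x => hf.mem_toFinset.trans Iff.rfl
  have e' := (congrArg Finset.card e).symm
  exact fun i hi j hj h => Nat.nth_injOn hf (lt_of_lt_of_eq hi e') (lt_of_lt_of_eq hj e') h

theorem choice_mem (h : C.Nonempty) (x : ℕ) : choice C x ∈ C := nth_mem_of_lt (Nat.mod_lt _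
  h.card_pos)

theorem survivors_subset (w : ℕ) : survivors P C w ⊆ C := by
  intro x hx
  simp only [survivors, Finset.mem_filter] at hx
  exact hx.1

theorem card_survivors_lt {w : ℕ} (hw : w ∈ C) : (survivors P C w).card < C.card := by
  refine Finset.card_lt_card ⟨survivors_subset w, fun h => ?_⟩
  have := h hw
  simp only [survivors, Finset.mem_filter] at this
  grind

theorem remains_subset (k : ℕ) : remains P C z k ⊆ C := by
  induction k with
  | zero => exact Finset.Subset.refl _
  | succ k ih => exact (survivors_subset _).trans ih

theorem card_remains_le (k : ℕ) : (remains P C z k).card ≤ C.card - k := by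
  induction k with
  | zero => exact le_rfl
  | succ k ih =>
    rcases (remains P C z k).eq_empty_or_nonempty with h | h
    · have : (remains P C z (k + 1)).card ≤ (remains P C z k).card := Finset.card_le_card
        (survivors_subset _)
      grind
    · have := card_survivors_lt (P := P) (choice_mem h (z k))
      show (survivors P _ _).card ≤ _
      omega

/-- On average, at most half of the elements leave after a given one. -/
theorem sum_survivors_le (hP : ∀ u, Monotone fun τ => P τ u) : 2 * ∑ i ∈ Finset.range C.card,
    (survivors P C (Nat.nth (· ∈ C) i)).card ≤ C.card * C.card := by
  classical
  have h1 : ∑ i ∈ Finset.range C.card, (survivors P C (Nat.nth (· ∈ C) i)).card ≤ ∑ w ∈ C,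
      (survivors P C w).card := by
    rw [← Finset.sum_image (f := fun w => (survivors P C w).card) (s := Finset.range C.card) (g :=
      Nat.nth (· ∈ C)) (fun i hi j hj h => nth_injOn (by simpa using hi) (by simpa using hj) h)]
    refine Finset.sum_le_sum_of_subset fun x hx => ?_
    obtain ⟨i, hi, rfl⟩ := Finset.mem_image.1 hx
    exact nth_mem_of_lt (Finset.mem_range.1 hi)
  -- The sum counts pairs of which the second leaves strictly after the first. By monotonicity a
  -- pair and its reversal are never both counted, hence at most half of all pairs are.
  set D := (C ×ˢ C).filter fun z => ∃ τ, P τ z.1 ∧ ¬ P τ z.2 with hD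
  have h2 : ∑ w ∈ C, (survivors P C w).card = D.card := by
    rw [hD, Finset.card_filter, Finset.sum_product]
    refine Finset.sum_congr rfl fun w _ => ?_
    unfold survivors
    rw [Finset.card_filter]
  have h3 : Disjoint D (D.image Prod.swap) := by
    rw [Finset.disjoint_left]
    rintro ⟨u, w⟩ hz hz'
    obtain ⟨⟨w', u'⟩, h4, h5⟩ := Finset.mem_image.1 hz'
    obtain ⟨rfl, rfl⟩ := Prod.mk.inj h5
    obtain ⟨-, τ, a1, a2⟩ := Finset.mem_filter.1 hz
    obtain ⟨-, τ', b1, b2⟩ := Finset.mem_filter.1 h4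
    rcases le_total τ τ' with h | h
    · exact b2 (hP _ h a1)
    · exact a2 (hP _ h b1)
  have h4 : (D.image Prod.swap).card = D.card := Finset.card_image_of_injective _
    Prod.swap_injective
  have h5 : (D ∪ D.image Prod.swap).card ≤ (C ×ˢ C).card := by
    refine Finset.card_le_card (Finset.union_subset (Finset.filter_subset _ _) fun x hx => ?_)
    grind
  rw [Finset.card_union_of_disjoint h3, h4, Finset.card_product] at h5
  omega

theorem card_mod_eq_le {w c : ℕ} (hc : 0 < c) (i : ℕ) : (Finset.univ.filter fun x : Fin (2 ^ w) =>
    (x : ℕ) % c = i).card ≤ 2 ^ w / c + 1 := by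
  have : (Finset.univ.filter fun x : Fin (2 ^ w) => (x : ℕ) % c = i).card ≤ (Finset.range (2 ^ w / c
      + 1)).card := by
    refine Finset.card_le_card_of_injOn (fun x => (x : ℕ) / c) ?_ ?_
    · intro x _
      simp only [Finset.coe_range, Set.mem_Iio, Nat.lt_succ_iff]
      exact Nat.div_le_div_right x.2.le
    · intro x hx y hy h
      simp only [Finset.coe_filter, Finset.mem_univ, true_and, Set.mem_ofPred_eq] at hx hy
      refine Fin.ext ?_
      rw [← Nat.div_add_mod (x : ℕ) c, ← Nat.div_add_mod (y : ℕ) c, hx, hy, show (x : ℕ) / c = y / c from h]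
  simpa using this

/-- A random choice leaves at most two thirds, on average. -/
theorem sum_choice_le (hP : ∀ u, Monotone fun τ => P τ u) {w : ℕ} (hw : 3 * C.card ≤ 2 ^ w) :
    3 * ∑ x : Fin (2 ^ w), (survivors P C (choice C x)).card ≤ 2 * (2 ^ w * C.card) := by
  rcases C.eq_empty_or_nonempty with rfl | hC
  · simp [survivors]
  have hc := hC.card_pos
  set c := C.card with hcc
  set f : ℕ → ℕ := fun i => (survivors P C (Nat.nth (· ∈ C) i)).card with hf
  have h1 : ∑ x : Fin (2 ^ w), (survivors P C (choice C x)).card = ∑ i ∈ Finset.range c,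
      (Finset.univ.filter fun x : Fin (2 ^ w) => (x : ℕ) % c = i).card * f i := by
    rw [← Finset.sum_fiberwise_of_maps_to (s := Finset.univ) (t := Finset.range c) (g := fun x :
      Fin (2 ^ w) => (x : ℕ) % c) (fun x _ => Finset.mem_range.2 (Nat.mod_lt _ hc))]
    refine Finset.sum_congr rfl fun i _ => ?_
    rw [← smul_eq_mul, ← Finset.sum_const]
    refine Finset.sum_congr rfl fun x hx => ?_
    rw [← (Finset.mem_filter.1 hx).2]
    rfl
  have h2 : ∑ x : Fin (2 ^ w), (survivors P C (choice C x)).card ≤ (2 ^ w / c + 1) * ∑ i ∈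
      Finset.range c, f i := by
    rw [h1, Finset.mul_sum]
    exact Finset.sum_le_sum fun i _ => Nat.mul_le_mul_right _ (card_mod_eq_le hc i)
  have h3 := sum_survivors_le (C := C) hP
  -- As `3 c ≤ 2 ^ w`, the rounding in the residues costs a factor of at most `4/3`; multiplied with
  -- the average of one half this gives two thirds.
  have h4 : 3 * ((2 ^ w / c + 1) * c) ≤ 4 * 2 ^ w := by
    have := Nat.div_mul_le_self (2 ^ w) c
    grind
  have h5 : 6 * ∑ x : Fin (2 ^ w), (survivors P C (choice C x)).card ≤ 4 * 2 ^ w * c := by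
    calc 6 * ∑ x : Fin (2 ^ w), (survivors P C (choice C x)).card ≤ 3 * (2 ^ w / c + 1) * (2 * ∑ i ∈
        Finset.range c, f i) := by grind
      _ ≤ 3 * (2 ^ w / c + 1) * (c * c) := Nat.mul_le_mul_left _ h3
      _ = 3 * ((2 ^ w / c + 1) * c) * c := by ring
      _ ≤ _ := Nat.mul_le_mul_right _ h4
  linarith

/-- The expected size of what remains shrinks by a factor `2/3` with every choice, and nonemptiness
is bounded by Markov's inequality. The choice words must not influence the order in which elements
leave (`hPM`); dependence on finitely many words (`hPL`) serves for measurability only. -/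
theorem measure_remains_le {w n M L : ℕ} (hn : 3 * n ≤ 2 ^ w) {P : (ℕ → Fin (2 ^ w)) → ℕ → ℕ → Prop}
    {C : (ℕ → Fin (2 ^ w)) → Finset ℕ} (hP : ∀ ω u, Monotone fun τ => P ω τ u) (hC : ∀ ω,
    (C ω).card ≤ n) (hPL : ∀ ω ω', (∀ i < L, ω i = ω' i) → P ω = P ω' ∧ C ω = C ω') (hPM : ∀ ω k x,
    P (Function.update ω (M + 2 * k + 1) x) = P ω ∧ C (Function.update ω (M + 2 * k + 1) x) = C ω)
    (k : ℕ) : coinLaw w {ω | (remains (P ω) (C ω) (fun j => ω (M + 2 * j + 1)) k).Nonempty} ≤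
    ENNReal.ofReal (n * (2 / 3) ^ k) := by
  set F : ℕ → (ℕ → Fin (2 ^ w)) → Finset ℕ := fun k ω => remains (P ω) (C ω) (fun j => ω (M + 2 * j
    + 1)) k with hF
  have hcong : ∀ k ω ω', (∀ i < L + M + 2 * k, ω i = ω' i) → F k ω = F k ω' := by
    intro k ω ω' h
    obtain ⟨h1, h2⟩ := hPL ω ω' fun i hi => h i (by omega)
    simp only [hF, h1, h2]
    have : ∀ j ≤ k, remains (P ω') (C ω') (fun j => ω (M + 2 * j + 1)) j = remains (P ω') (C ω')
        (fun j => ω' (M + 2 * j + 1)) j := by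
      intro j
      induction j with
      | zero => intro _; rfl
      | succ j ih =>
        intro hj
        simp only [remains]
        grind
    exact this k le_rfl
  have hmeas : ∀ k, Measurable fun ω => ((F k ω).card : ENNReal) := fun k =>
    measurable_of_finitely_many _ fun ω ω' h => by rw [hcong k ω ω' h]
  have hint : ∀ k, ∫⁻ ω, ((F k ω).card : ENNReal) ∂coinLaw w ≤ ENNReal.ofReal (n * (2 / 3) ^ k) := by
    intro k
    induction k with
    | zero =>
      refine (lintegral_mono (g := fun _ => (n : ENNReal)) fun ω => ?_).trans ?_
      · exact Nat.cast_le.2 (hC ω)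
      · simp
    | succ k ih =>
      -- Only the last choice word is redrawn. The set that remains before it depends on earlier
      -- choice words, so it is fixed in the inner sum.
      rw [lintegral_resample (M + 2 * k + 1) (hmeas (k + 1))]
      have : ∀ ω, (∑ x, ((F (k + 1) (Function.update ω (M + 2 * k + 1) x)).card : ENNReal)) / 2 ^ w
          ≤ ENNReal.ofReal (2 / 3) * (F k ω).card := by
        intro ω
        have h1 : ∀ x, F (k + 1) (Function.update ω (M + 2 * k + 1) x) = survivors (P ω) (F k ω)
            (choice (F k ω) x) := by
          intro x
          have h2 : F k (Function.update ω (M + 2 * k + 1) x) = F k ω := by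
            simp only [hF, (hPM ω k x).1, (hPM ω k x).2]
            have : ∀ j ≤ k, remains (P ω) (C ω) (fun j => (Function.update ω (M + 2 * k + 1) x (M +
                2 * j + 1) : ℕ)) j = remains (P ω) (C ω) (fun j => (ω (M + 2 * j + 1) : ℕ)) j := by
              intro j
              induction j with
              | zero => intro _; rfl
              | succ j ih =>
                intro hj
                simp only [remains]
                grind
            exact this k le_rfl
          show survivors (P _) (F k (Function.update ω (M + 2 * k + 1) x)) (choice (F k
            (Function.update ω (M + 2 * k + 1) x)) _) = _
          grind
        simp only [h1]
        have hcard : (F k ω).card ≤ n := (Finset.card_le_card (remains_subset k)).trans (hC ω)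
        have h3 := sum_choice_le (C := F k ω) (hP ω) (w := w) (by omega)
        refine ENNReal.div_le_of_le_mul ?_
        have h4 : (∑ x : Fin (2 ^ w), ((survivors (P ω) (F k ω) (choice (F k ω) x)).card :
            ℝ)) ≤ 2 / 3 * (F k ω).card * 2 ^ w := by
          have : (3 * ∑ x : Fin (2 ^ w), ((survivors (P ω) (F k ω) (choice (F k ω) x)).card :
            ℝ)) ≤ 2 * (2 ^ w * (F k ω).card) := by exact_mod_cast h3
          linarith
        have h5 := ENNReal.ofReal_le_ofReal h4
        rw [ENNReal.ofReal_sum_of_nonneg (fun _ _ => by positivity), ENNReal.ofReal_mul (by positivity),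
          ENNReal.ofReal_mul (by positivity), ENNReal.ofReal_pow (by norm_num)] at h5
        simpa using h5
      refine (lintegral_mono this).trans ?_
      rw [lintegral_const_mul _ (hmeas k)]
      refine (mul_le_mul_right ih _).trans (le_of_eq ?_)
      rw [← ENNReal.ofReal_mul (by norm_num)]
      congr 1
      ring
  -- Markov's inequality at level 1 for an integer-valued cardinality.
  have h1 := mul_meas_ge_le_lintegral (μ := coinLaw w) (hmeas k) 1
  rw [one_mul] at h1
  refine (measure_mono fun ω hω => ?_).trans (h1.trans (hint k))
  simp only [Set.mem_ofPred_eq] at hω ⊢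
  exact_mod_cast hω.card_pos

end chain

/-! ## The algorithm for edge insertions -/

namespace Cmd

/-- Use the estimate of the run with index `b` for the vertex `y - 1`: a run for a sampled vertex
excludes the vertices close to it, the run for the representative makes the vertices close to it
candidates, and the other runs mark the vertices close to them. -/
def note : Cmd := .set .e estY ;; .ite (↟.N - ↟.b) (.ite (↟.hS + 1 - ↟.e) (.ite (.arr 7 (↟.y - 1))
  .skip (.aset 7 (↟.y - 1) 1 ;; .set .cnt (↟.cnt - 1))) .skip) (.ite (↟.b - ↟.N) (.ite (↟.sg + 1 -
  ↟.e) (.ite (.arr 2 (↟.y - 1)) .skip (.set .cand (↟.cand - 1)) ;; .aset 2 (↟.y - 1) 2) .skip) (.ite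
  (↟.hA + 1 - ↟.e) (.ite (.arr 2 (↟.y - 1) * (2 - .arr 2 (↟.y - 1))) (.aset 2 (↟.y - 1) 0 ;; .set
  .cand (↟.cand + 1)) .skip) .skip))

/-- Bring the run with index `b` up to date; the flag `acc` is set if all vertices have been found to
be close to its source. -/
def settle : Cmd := .set .cur (.arr 5 ↟.b) ;; drain note ;; .set .t (.arr 6 ↟.b) ;; .whil ((↟.thr +
  1 - .est ↟.cur ↟.t) * (↟.n - ↟.t)) (.set .t (↟.t + 1)) ;; .aset 6 ↟.b ↟.t ;; .ite (↟.n - ↟.t)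
  .skip (.set .acc 1)

/-- Start a run of the black box at `x`. -/
def launch : Cmd := newSession ;; .set .b ↟.a ;; .aset 5 ↟.b ↟.cur ;; .aset 6 ↟.b 0 ;; .set .a (↟.a
  + 1) ;; settle

end Cmd

/-- The number of zeros of a function. -/
def zeros (n : ℕ) (f : ℕ → ℕ) : ℕ := ((Finset.range n).filter (f · = 0)).card

theorem zeros_update_ne {n y a : ℕ} {f : ℕ → ℕ} (hy : y < n) (h : f y = 0) (ha : a ≠ 0) :
    zeros n (Function.update f y a) = zeros n f - 1 := by
  unfold zeros
  rw [← Finset.card_erase_of_mem (Finset.mem_filter.2 ⟨Finset.mem_range.2 hy, h⟩)]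
  congr 1
  grind

theorem zeros_update_zero {n y : ℕ} {f : ℕ → ℕ} (hy : y < n) (h : f y ≠ 0) :
    zeros n (Function.update f y 0) = zeros n f + 1 := by
  unfold zeros
  rw [← Finset.card_insert_of_notMem (a := y) (by simp [h])]
  congr 1
  grind

theorem zeros_update_same {n y a : ℕ} {f : ℕ → ℕ} (h : f y = 0 ↔ a = 0) : zeros n (Function.update f
    y a) = zeros n f := by
  unfold zeros
  congr 1
  grind

theorem zeros_pos {n : ℕ} {f : ℕ → ℕ} : zeros n f ≠ 0 ↔ ∃ y < n, f y = 0 := by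
  unfold zeros
  rw [← Nat.pos_iff_ne_zero, Finset.card_pos]
  simp [Finset.Nonempty]

/-- The flags of the vertices: `P` holds for excluded vertices, `near` for candidates and `cov` for
marked vertices. -/
structure Flags (n : ℕ) (P near cov : ℕ → Prop) (v : View) : Prop where
  out : ∀ y < n, v.arr 7 y ≠ 0 → P y
  near : ∀ y < n, v.arr 2 y = 0 → near y
  cov : ∀ y < n, v.arr 2 y = 2 → cov y
  le : ∀ y < n, v.arr 2 y ≤ 2
  cnt : v.var .cnt = zeros n (v.arr 7)
  cand : v.var .cand = zeros n (v.arr 2)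
  sent2 : v.arr 2 n = 0
  sent7 : v.arr 7 n = 0

/-- Flags are only set. -/
structure Grows (n : ℕ) (v u : View) : Prop where
  out : ∀ y < n, v.arr 7 y ≠ 0 → u.arr 7 y ≠ 0
  mark : ∀ y < n, v.arr 2 y = 2 → u.arr 2 y = 2
  near : ∀ y < n, v.arr 2 y ≠ 1 → u.arr 2 y ≠ 1

theorem Grows.trans {n : ℕ} {v u z : View} (h : Grows n v u) (h' : Grows n u z) : Grows n v z :=
  ⟨fun y hy hv => h'.out y hy (h.out y hy hv), fun y hy hv => h'.mark y hy (h.mark y hy hv),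
  fun y hy hv => h'.near y hy (h.near y hy hv)⟩

/-- A cell of array 2 holds 0 for a candidate that still needs a source, 1 for a vertex that is not
a candidate, and 2 for a vertex close to a source. Also noncandidates are marked, so that they need
no source if they become candidates later. -/
theorem Flags.mark {n : ℕ} {P near cov : ℕ → Prop} {v u : View} (hF : Flags n P near cov v) {a : ℕ}
    (ha : a < n) (hc : cov a) (h2 : u.arr 2 = Function.update (v.arr 2) a 2) (h7 : u.arr 7 = v.arr
    7) (hcnt : u.var .cnt = v.var .cnt) (hcand : u.var .cand = if v.arr 2 a = 0 then v.var .cand - 1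
    else v.var .cand) : Flags n P near cov u ∧ Grows n v u := by
  refine ⟨⟨h7 ▸ hF.out, fun y hy h => ?_, fun y hy h => ?_, fun y hy => ?_, by rw [hcnt, h7, hF.cnt], ?_,
    ?_, h7 ▸ hF.sent7⟩, fun y hy h => h7 ▸ h, fun y hy h => ?_, fun y hy h => ?_⟩
  · by_cases hya : y = a
    · simp_all
    · exact hF.near y hy (by simpa [h2, hya] using h)
  · by_cases hya : y = a
    · grind
    · exact hF.cov y hy (by simpa [h2, hya] using h)
  · by_cases hya : y = a
    · simp_all
    · simpa [h2, hya] using hF.le y hy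
  · rw [hcand, h2]
    split_ifs with h
    · rw [zeros_update_ne ha h two_ne_zero, ← hF.cand]
    · rw [zeros_update_same (by simp [h]), ← hF.cand]
  · simpa [h2, show n ≠ a by omega] using hF.sent2
  all_goals by_cases hya : y = a <;> simp_all

/-- The distance that matters for the run with index `b`. -/
noncomputable def noteRadius (n p q r b : ℕ) : ℕ := if b < sampleSize n r then r / 2 else
    if b = sampleSize n r then r / 2 - 2 * slack p q r else slack p q r

/-- The run with index `b` has set the flag of `y`. -/
def Noted (n r b : ℕ) (v : View) (y : ℕ) : Prop := (b < sampleSize n r → v.arr 7 y ≠ 0) ∧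
  (b = sampleSize n r → v.arr 2 y ≠ 1) ∧ (sampleSize n r < b → v.arr 2 y = 2)

theorem Noted.grows {n r b y : ℕ} {v u : View} (h : Noted n r b v y) (hg : Grows n v u) (hy : y < n) :
    Noted n r b u y :=
  ⟨fun hb => hg.out y hy (h.1 hb), fun hb => hg.near y hy (h.2.1 hb), fun hb => hg.mark y hy (h.2.2 hb)⟩

/-- The run with index `b`, which has the source `x`, is up to date. -/
structure Tracked (E : Env) (n p q : ℕ) (l us : List Edge) (r b x : ℕ) (v : View) : Prop where
  run : v.sess[v.arr 5 b]? = some ⟨⟨n, l, x, 16 * r, p, 256 * q⟩, us, []⟩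
  ptr_le : v.arr 6 b ≤ n
  ptr : ∀ a < v.arr 6 b, gdist n (afterUpdates E.mode l us) x a ≤ threshold p q r + slack p q r
  acc : v.arr 6 b = n → v.var .acc ≠ 0
  halt : v.arr 6 b < n → threshold p q r < wordEst E (v.arr 5 b) ⟨n, l, x, 16 * r, p,
    256 * q⟩ us (v.arr 6 b)
  noted : ∀ y < n, wordEst E (v.arr 5 b) ⟨n, l, x, 16 * r, p, 256 * q⟩ us y ≤ noteRadius n p q r b →
    Noted n r b v y

theorem Tracked.congr {E : Env} {n p q : ℕ} {l us : List Edge} {r b x : ℕ} {v u : View} (h :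
    Tracked E n p q l us r b x v) (h5 : u.arr 5 b = v.arr 5 b) (h6 : u.arr 6 b = v.arr 6 b) (hs :
    u.sess[v.arr 5 b]? = v.sess[v.arr 5 b]?) (hacc : v.var .acc ≠ 0 → u.var .acc ≠ 0) (hg :
    Grows n v u) : Tracked E n p q l us r b x u where
  run := by rw [h5, hs, h.run]
  ptr_le := h6 ▸ h.ptr_le
  ptr := h6 ▸ h.ptr
  acc := fun h' => hacc (h.acc (h6 ▸ h'))
  halt := by rw [h5, h6]; exact h.halt
  noted := by rw [h5]; exact fun y hy he => (h.noted y hy he).grows hg hy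

/-! ### Keeping the runs up to date under insertions -/

section specs

variable {E : Env} {b n p q : ℕ} {l : List Edge} {Q : View → Prop} {v : View} {us : List Edge}
  {r : ℕ} {P near cov : ℕ → Prop}

/-- The rank of a run among the runs in use decides its role, and `noteRadius` is the distance at
which it acts. The hypothesis `hal` says that setting the flag is justified, the conclusion `Noted`
that it has been set; the counters stay equal to the numbers of zeros. -/
theorem Cmd.note_spec (hC : Ctx E n p q l) (hb : b = 2 * l.length) (hP : Params n p q r v) (hr :
    r ≤ 10 * n) {a ev : ℕ} (ha : a < n) (hy : v.var .y = a + 1) (hok : estY.ok E b v) (hev :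
    estY.eval E v = ev) (hF : Flags n P near cov v) {B : ℕ} (hB : v.var .b = B) (hal :
    ev ≤ noteRadius n p q r B → (B < sampleSize n r → P a) ∧ (B = sampleSize n r → near a) ∧
    (sampleSize n r < B → cov a)) (hQ : ∀ u, Frame v u [.e, .cnt, .cand] [2, 7] → u.sess = v.sess →
    u.used = v.used → u.vt ≤ v.vt + 1000 → Flags n P near cov u → Grows n v u → (ev ≤ noteRadius n p
    q r B → Noted n r B u a) → Q u) : note.WP E b Q v := by
  obtain ⟨h1, h2, h3, h4, h5, h6, -⟩ := hC.bounds
  have hσ := slack_le (r := r) hC.p_lt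
  have hcnt : v.var .cnt ≤ n := by
    rw [hF.cnt]; exact (Finset.card_filter_le _ _).trans (by simp)
  have hcand : v.var .cand ≤ n := by
    rw [hF.cand]; exact (Finset.card_filter_le _ _).trans (by simp)
  have hle := hF.le a ha
  have hskip : ∀ t : ℤ, t ≤ v.vt + 1000 → (ev ≤ noteRadius n p q r B → Noted n r B v a) → Q { v with
      var := Function.update v.var .e ev, vt := t } := by
    intro t ht hno
    refine hQ _ (by simp +contextual [Frame.iff]) rfl rfl ht ?_ ⟨fun _ _ h => h, fun _ _ h => h,
      fun _ _ h => h⟩ hno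
    constructor
    exacts [hF.out, hF.near, hF.cov, hF.le, by simpa using hF.cnt, by simpa using hF.cand, hF.sent2,
      hF.sent7]
  simp only [note, Cmd.WP]
  refine ⟨hok, ?_⟩
  rw [hev]
  have eN : v.var .N = sampleSize n r := hP.N'
  have eS : v.var .hS = r / 2 := hP.hS'
  have eA : v.var .hA = r / 2 - 2 * slack p q r := hP.hA'
  have eG : v.var .sg = slack p q r := hP.sg'
  simp only [View.pay, View.assign, Expr.rules, Function.update_apply, reduceCtorEq, if_false,
    if_true, true_and, and_true, hy, hB, eN, eS, eA, eG, Nat.add_sub_cancel]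
  have hrad0 : B < sampleSize n r → noteRadius n p q r B = r / 2 := fun h => if_pos h
  have hrad1 : B = sampleSize n r → noteRadius n p q r B = r / 2 - 2 * slack p q r := fun h => by
    unfold noteRadius; rw [if_neg (by omega), if_pos h]
  have hrad2 : sampleSize n r < B → noteRadius n p q r B = slack p q r := fun h => by
    unfold noteRadius; rw [if_neg (by omega), if_neg (by omega)]
  have h2a : v.arr 2 a = 0 ∨ v.arr 2 a = 1 ∨ v.arr 2 a = 2 := by omega
  have hmul : v.arr 2 a * (2 - v.arr 2 a) < 2 ^ E.w := by rcases h2a with h | h | h <;> rw [h] <;> omega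
  repeat' first | (refine And.intro ?_ ?_) | (intro _)
  any_goals omega
  · exact hskip _ (by omega) fun _ => ⟨fun _ => by assumption, by omega, by omega⟩
  · rename_i g1 g2 g3
    have hrad := hrad0 (by omega)
    refine hQ _ (by simp +contextual [Frame.iff]) rfl rfl (by grind) ?_ ?_ fun _ => ?_
    · constructor
      · intro y hy h
        by_cases hya : y = a
        · grind
        · exact hF.out y hy (by simpa [hya] using h)
      · simpa using hF.near
      · simpa using hF.cov
      · simpa using hF.le
      · simp only [Function.update_self]
        rw [zeros_update_ne ha g3 one_ne_zero, ← hF.cnt]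
      · simpa using hF.cand
      · simpa using hF.sent2
      · simpa [show n ≠ a by omega] using hF.sent7
    · refine ⟨fun y hy h => ?_, fun y hy h => by simpa using h, fun y hy h => by simpa using h⟩
      by_cases hya : y = a
      · simp [hya]
      · simp_all
    · exact ⟨fun _ => by simp, by omega, by omega⟩
  · grind
  · rename_i g1 g2 g3 g4
    have hrad := hrad2 (by omega)
    obtain ⟨k1, k2⟩ := hF.mark (u := { v with
      var := Function.update v.var .e ev
      arr := Function.update v.arr 2 (Function.update (v.arr 2) a 2) }) ha ((hal (by omega)).2.2 (by omega))
      (by simp) (by simp) (by simp) (by simp [g4])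
    exact hQ _ (by simp +contextual [Frame.iff]) rfl rfl (by grind) ⟨k1.1, k1.2, k1.3, k1.4, k1.5,
      k1.6, k1.7, k1.8⟩ ⟨k2.1, k2.2, k2.3⟩ fun _ => ⟨by omega, by omega, fun _ => by simp⟩
  · rename_i g1 g2 g3 g4
    have hrad := hrad2 (by omega)
    obtain ⟨k1, k2⟩ := hF.mark (u := { v with
      var := Function.update (Function.update v.var .e ev) .cand (v.var .cand - 1)
      arr := Function.update v.arr 2 (Function.update (v.arr 2) a 2) }) ha ((hal (by omega)).2.2 (by omega))
      (by simp) (by simp) (by simp) (by simp [g4])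
    exact hQ _ (by simp +contextual [Frame.iff]) rfl rfl (by grind) ⟨k1.1, k1.2, k1.3, k1.4, k1.5,
      k1.6, k1.7, k1.8⟩ ⟨k2.1, k2.2, k2.3⟩ fun _ => ⟨by omega, by omega, fun _ => by simp⟩
  · grind
  · rename_i g1 g2 g3 g4
    have h8 : v.arr 2 a = 1 := by rcases h2a with h | h | h <;> rw [h] at g4 ⊢ <;> omega
    refine hQ _ (by simp +contextual [Frame.iff]) rfl rfl (by grind) ?_ ?_ fun _ => ?_
    · constructor
      · simpa using hF.out
      · intro y hy h
        by_cases hya : y = a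
        · grind
        · exact hF.near y hy (by simpa [hya] using h)
      · intro y hy h
        by_cases hya : y = a
        · simp_all
        · exact hF.cov y hy (by simpa [hya] using h)
      · intro y hy
        by_cases hya : y = a
        · simp [hya]
        · simpa [hya] using hF.le y hy
      · simpa using hF.cnt
      · simp only [Function.update_self]
        rw [zeros_update_zero ha (by omega), ← hF.cand]
      · simpa [show n ≠ a by omega] using hF.sent2
      · simpa using hF.sent7
    · refine ⟨fun y hy h => by simpa using h, fun y hy h => ?_, fun y hy h => ?_⟩ <;> by_cases hya :
        y = a <;> simp_all
    · exact ⟨by omega, fun _ => by simp, by omega⟩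
  · rename_i g1 g2 g3 g4
    refine hskip _ (by omega) fun h => ⟨by omega, fun _ h8 => ?_, by omega⟩
    simp [h8] at g4
  · grind

/-- Testing whether all estimates are below the threshold must not cost `n` per update. A pointer to
the first vertex not known to be close suffices: true distances only decrease, so a vertex that has
been passed stays close up to the error `σ`, and the pointer only moves forward. Its total movement
of `n` is paid when the run is started. -/
theorem Cmd.settle_spec (hC : Ctx E n p q l) (hb : b = 2 * l.length) (hn : v.var .n = n) (hP :
    Params n p q r v) (hr : r ≤ 10 * n) {B x : ℕ} (hB : v.var .b = B) (hBn :
    B ≤ 3 * n) {un : List ℕ} (hsess : v.sess[v.arr 5 B]? = some ⟨⟨n, l, x, 16 * r, p, 256 * q⟩, us,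
    un⟩) (hun : ∀ a ∈ un, a < n) {f : ℕ → ℕ} (hf : f = wordEst E (v.arr 5 B) ⟨n, l, x, 16 * r, p,
    256 * q⟩ us) (hold : ∀ y < n, y ∉ un → f y ≤ noteRadius n p q r B → Noted n r B v y) (hdist :
    ∀ y < n, gdist n (afterUpdates E.mode l us) x y ≤ f y + slack p q r) (hptr_le : v.arr 6 B ≤ n)
    (hptr : ∀ a < v.arr 6 B, gdist n (afterUpdates E.mode l us) x a ≤ threshold p q r + slack p q r)
    (hF : Flags n P near cov v) (hal : ∀ y < n, f y ≤ noteRadius n p q r B → (B < sampleSize n r →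
    P y) ∧ (B = sampleSize n r → near y) ∧ (sampleSize n r < B → cov y)) (hQ : ∀ u, Frame v u [.cur,
    .y, .e, .cnt, .cand, .t, .acc] [2, 6, 7] → u.sess = v.sess.set (v.arr 5 B) ⟨⟨n, l, x, 16 * r, p,
    256 * q⟩, us, []⟩ → u.used = v.used → (∀ a, a ≠ B → u.arr 6 a = v.arr 6 a) → (v.var .acc ≠ 0 →
    u.var .acc ≠ 0) → (u.var .acc ≠ 0 → v.var .acc ≠ 0 ∨ ∀ y < n, gdist n (afterUpdates E.mode l us)
    x y ≤ threshold p q r + slack p q r) → Tracked E n p q l us r B x u → Flags n P near cov u →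
    Grows n v u → u.vt + 50 * (n - u.arr 6 B : ℕ) ≤ v.vt + 50 * (n - v.arr 6 B : ℕ) + 300 → Q u) :
    settle.WP E b Q v := by
  obtain ⟨h1, h2, h3, h4, h5, h6, hn2⟩ := hC.bounds
  have hσ := slack_le (r := r) hC.p_lt
  have hthr : threshold p q r ≤ 20 * n := by unfold threshold; omega
  set I : SSSPInput := ⟨n, l, x, 16 * r, p, 256 * q⟩ with hI
  have hcl : v.arr 5 B < v.sess.length := (List.getElem?_eq_some_iff.1 hsess).1
  simp only [settle, Cmd.WP, View.assign, Expr.rules, hB]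
  refine ⟨⟨trivial, by norm_num, by omega⟩, ?_⟩
  set v₁ : View := { v with
    var := Function.update v.var .cur (v.arr 5 B), vt := v.vt + ((2 + 6 : ℕ) + 2) } with hv₁
  have hcur : v₁.var .cur = v.arr 5 B := by simp [hv₁]
  have hf₁ : Frame v v₁ [.cur] [] := by exact Frame.iff.2 (by simp +contextual)
  refine Cmd.drain_spec (v := v₁) (c := ⟨I, us, un⟩) (by rw [hcur]; exact hsess) (fun a ha =>
    by have := hun a ha; omega) (fun L u => Frame v u [.cur, .y, .e, .cnt, .cand] [2, 7] ∧ Flags n P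
    near cov u ∧ Grows n v u ∧ (∀ a ∈ L, a < n) ∧ ∀ y < n, y ∉ L → f y ≤ noteRadius n p q r B →
    Noted n r B u y) ?_ ?_ ?_ ?_
  · refine ⟨hf₁.weaken, ?_, ⟨fun _ _ h => h, fun _ _ h => h, fun _ _ h => h⟩, hun, hold⟩
    constructor
    exacts [hF.out, hF.near, hF.cov, hF.le, by simpa [hv₁] using hF.cnt,
      by simpa [hv₁] using hF.cand, hF.sent2, hF.sent7]
  · rintro L u y t s ⟨g1, g2, g3, g4, g5⟩
    refine ⟨by simp +contextual [Frame.iff, g1.all], ?_, ⟨g3.1, g3.2, g3.3⟩, g4, g5⟩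
    constructor
    exacts [g2.out, g2.near, g2.cov, g2.le, by simpa using g2.cnt, by simpa using g2.cand, g2.sent2,
      g2.sent7]
  · rintro a L u ⟨g1, g2, g3, g4, g5⟩ hs hcu hy hok hev
    rw [hcur] at hev; replace hev : estY.eval E u = f a := by rw [hev, hf]
    have ha := g4 a (by simp)
    refine Cmd.note_spec hC hb (hP.frame g1) hr ha hy hok hev g2 (B := B) (by rw [g1.get _, hB])
      (hal a ha) ?_
    intro z zf zs zu zt zF zG zN
    refine ⟨⟨g1.trans zf, zF, g3.trans zG, fun y h => g4 y (by simp [h]), fun y hy hyL hle => ?_⟩,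
      zs, zf.get _, zu, by omega⟩
    by_cases hya : y = a
    · grind
    · exact (g5 y hy (by simp [hya, hyL]) hle).grows zG hy
  rintro u ⟨g1, g2, g3, -, g5⟩ us' ucur uu ut
  rw [hcur] at ucur us'
  have eb : u.var .b = B := by rw [g1.get _, hB]
  have e6 : u.arr 6 = v.arr 6 := g1.mem _
  simp only [eb, e6]
  -- The time of the loop is taken out of the reserve `50 * (n - T)` that belongs to the pointer.
  refine ⟨⟨trivial, by norm_num, by omega⟩, fun z => ∃ T, z.var .t = T ∧ v.arr 6 B ≤ T ∧ T ≤ n ∧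
      Frame u z [.t] [] ∧ z.sess = u.sess ∧ z.used = u.used ∧ z.vt + 50 * (n - T : ℕ) ≤ v.vt + 50 *
      (n - v.arr 6 B : ℕ) + 100 ∧ ∀ a < T, gdist n (afterUpdates E.mode l us) x a ≤ threshold p q r
      + slack p q r, fun z => n - z.var .t, ⟨v.arr 6 B, ?_⟩, ?_⟩
  · refine ⟨by simp, le_rfl, hptr_le, by simp +contextual [Frame.iff], rfl, rfl, ?_, hptr⟩
    grind
  rintro z ⟨T, hT, hT0, hTn, zf, zs, zu, zt, zd⟩
  have en : z.var .n = n := by rw [zf.get _, g1.get _, hn]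
  have ethr : z.var .thr = threshold p q r := by
    rw [zf.get _, g1.get _, hP.thr']
  have ecur : z.var .cur = v.arr 5 B := by rw [zf.get _, ucur]
  have zrun : z.sess[v.arr 5 B]? = some ⟨I, us, []⟩ := by grind
  have hest : (Expr.est ↟.cur ↟.t).eval E z = f T := by
    rw [eval_est_of_sess (c := ⟨I, us, []⟩) (by simp only [Expr.rules, ecur, zrun]), hf]
    simp only [Expr.rules, ecur, hT]
  have hzl : v.arr 5 B < z.sess.length := (List.getElem?_eq_some_iff.1 zrun).1
  have hprod : (threshold p q r + 1 - f T) * (n - T) ≤ 22 * (n * n) := by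
    calc _ ≤ (22 * n) * n := Nat.mul_le_mul (by omega) (by omega)
      _ = 22 * (n * n) := by ring
  simp only [hest, hT, en, ethr, ecur, View.pay]
  refine ⟨⟨⟨⟨by trivial, by omega, by omega⟩, by trivial, by trivial, hzl⟩, ⟨by trivial,
    by trivial⟩, by omega⟩, fun hne => ?_, fun he => ?_⟩
  · have hT1 : T < n ∧ f T ≤ threshold p q r := by
      constructor
      · grind
      · grind
    refine ⟨⟨by trivial, by omega, by omega⟩, ⟨T + 1, by simp, by omega, by omega, by simp +contextual [Frame.iff, zf.all], zs, zu, ?_,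
      fun a ha => ?_⟩, by simp only [Function.update_self]; omega⟩
    · grind
    · grind
  have hfar : T < n → threshold p q r < f T := by
    intro hTn'
    rcases Nat.mul_eq_zero.1 he with h | h <;> omega
  have ebz : z.var .b = B := by rw [zf.get _, eb]
  simp only [ebz]
  have hfin : ∀ (A : ℕ) (t : ℤ), (v.var .acc ≠ 0 → A ≠ 0) → (T = n → A ≠ 0) → (A ≠ 0 → v.var .acc ≠
      0 ∨ T = n) → t ≤ z.vt + 150 → Q { z with
        var := Function.update z.var .acc A
        arr := Function.update z.arr 6 (Function.update (z.arr 6) B T)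
        vt := t } := by
    intro A t hA1 hA2 hA3 ht
    have hz6 : z.arr 6 = v.arr 6 := by rw [zf.mem _, e6]
    have hg : ∀ j ∈ [2, 7], z.arr j = u.arr j := fun j _ => zf.mem _
    have h5' : z.arr 5 = v.arr 5 := by rw [zf.mem _, g1.mem _]
    have hz2 := hg 2
    have hz7 := hg 7
    have hfr : Frame v z [.cur, .y, .e, .cnt, .cand, .t, .acc] [2, 6, 7] := (g1.weaken).trans zf
    refine hQ _ (by simp +contextual [Frame.iff, hfr.all]) (zs.trans us') (zu.trans uu) ?_ (by simpa using hA1) ?_ ?_ ?_ ?_ ?_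
    · exact fun a ha => by simp [ha, hz6]
    · grind
    · constructor
      · simpa [h5'] using zrun
      · simpa using hTn
      · simpa using zd
      · simpa using hA2
      · simpa [h5', ← hI, ← hf] using hfar
      · intro y hy hle
        have hle' : f y ≤ noteRadius n p q r B := by simpa [h5', ← hI, hf] using hle
        simpa [Noted, hz2, hz7] using g5 y hy (by simp) hle'
    · constructor
      exacts [by simpa [hz7] using g2.out, by simpa [hz2] using g2.near,
        by simpa [hz2] using g2.cov, by simpa [hz2] using g2.le,
        by simpa [hz7, zf.var .cnt] using g2.cnt, by simpa [hz2, zf.var .cand] using g2.cand,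
        by simpa [hz2] using g2.sent2, by simpa [hz7] using g2.sent7]
    · exact ⟨by simpa [hz7] using g3.out, by simpa [hz2] using g3.mark, by simpa [hz2] using g3.near⟩
    · simp only [Function.update_self]
      omega
  have hzacc : z.var .acc = v.var .acc := by rw [zf.get _, g1.get _]
  refine ⟨trivial, trivial, by norm_num, by omega, ⟨trivial, trivial⟩, fun hc => ?_, fun hc => ⟨by omega, ?_⟩⟩
  · have key : ∀ t ≤ z.vt + 150, Q { z with
        arr := Function.update z.arr 6 (Function.update (z.arr 6) B T), vt := t } := fun t ht => by
      have := hfin (z.var .acc) t (by simp [hzacc]) (by omega) (by simp only [hzacc]; tauto) ht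
      rwa [Function.update_eq_self] at this
    exact key _ (by omega)
  · grind

end specs

namespace Cmd

/-- Forget all candidates and marks. -/
def clear : Cmd := .set .i 0 ;; .whil (↟.n - ↟.i) (.aset 2 ↟.i 1 ;; .set .i (↟.i + 1))

/-- Let `x` be the vertex number `z` among those that are not excluded. -/
def pick : Cmd := .set .x 0 ;; .whil (1 - (1 - .arr 7 ↟.x) * (1 - ↟.z)) (.ite (.arr 7 ↟.x) .skip
  (.set .z (↟.z - 1)) ;; .set .x (↟.x + 1))

end Cmd

theorem Flags.congr {n : ℕ} {P near cov : ℕ → Prop} {v u : View} (h : Flags n P near cov v) (h2 :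
    u.arr 2 = v.arr 2) (h7 : u.arr 7 = v.arr 7) (hcnt : u.var .cnt = v.var .cnt) (hcand :
    u.var .cand = v.var .cand) : Flags n P near cov u where
  out := h7 ▸ h.out
  near := h2 ▸ h.near
  cov := h2 ▸ h.cov
  le := h2 ▸ h.le
  cnt := by rw [hcnt, h7, h.cnt]
  cand := by rw [hcand, h2, h.cand]
  sent2 := h2 ▸ h.sent2
  sent7 := h7 ▸ h.sent7

theorem Flags.mono {n : ℕ} {P near cov P' near' cov' : ℕ → Prop} {v : View} (h : Flags n P near cov
    v) (hP : ∀ y < n, P y → P' y) (hn : ∀ y < n, near y → near' y) (hc : ∀ y < n, cov y → cov' y) :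
    Flags n P' near' cov' v := ⟨fun y hy h' => hP y hy (h.out y hy h'), fun y hy h' => hn y hy
    (h.near y hy h'), fun y hy h' => hc y hy (h.cov y hy h'), h.le, h.cnt, h.cand, h.sent2, h.sent7⟩

theorem Grows.of_eq {n : ℕ} {v u : View} (h2 : u.arr 2 = v.arr 2) (h7 : u.arr 7 = v.arr 7) :
    Grows n v u := ⟨fun _ _ h => h7 ▸ h, fun _ _ h => h2 ▸ h, fun _ _ h => h2 ▸ h⟩

section specs

variable {E : Env} {b n p q : ℕ} {l : List Edge} {Q : View → Prop} {v : View} {us : List Edge}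
  {r : ℕ} {P near cov : ℕ → Prop}

theorem Cmd.launch_spec (hC : Ctx E n p q l) (hb : b = 2 * l.length) (hS : Static n p q l us v) (hus
    : LegalSeq E.mode n l us) (hP : Params n p q r v) (hr : r ≤ 10 * n) {A x : ℕ} (hA : v.var .a =
    A) (hAn : A < 3 * n) (hx : v.var .x = x) (hxn : x < n) (hlen : v.sess.length < 2 ^ E.w) {f : ℕ →
    ℕ} (hf : f = wordEst E v.sess.length ⟨n, l, x, 16 * r, p, 256 * q⟩ us) (hdist : ∀ y < n, gdist n
    (afterUpdates E.mode l us) x y ≤ f y + slack p q r) (hF : Flags n P near cov v) (hal : ∀ y < n,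
    f y ≤ noteRadius n p q r A → (A < sampleSize n r → P y) ∧ (A = sampleSize n r → near y) ∧
    (sampleSize n r < A → cov y)) (hQ : ∀ u, Frame v u [.cur, .j, .a1, .a2, .b, .a, .y, .e, .cnt,
    .cand, .t, .acc] [2, 5, 6, 7] → u.sess = v.sess ++ [⟨⟨n, l, x, 16 * r, p, 256 * q⟩, us, []⟩] →
    u.used = v.used → u.var .a = A + 1 → u.arr 5 = Function.update (v.arr 5) A v.sess.length → (∀ a,
    a ≠ A → u.arr 6 a = v.arr 6 a) → (v.var .acc ≠ 0 → u.var .acc ≠ 0) → (u.var .acc ≠ 0 → v.var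
    .acc ≠ 0 ∨ ∀ y < n, gdist n (afterUpdates E.mode l us) x y ≤ threshold p q r + slack p q r) →
    Tracked E n p q l us r A x u → Flags n P near cov u → Grows n v u → u.vt + 50 * (n - u.arr 6 A :
    ℕ) ≤ v.vt + 600 + 50 * n - 10000 * (n + l.length) → Q u) : launch.WP E b Q v := by
  obtain ⟨h1, h2, h3, h4, h5, h6, hn2⟩ := hC.bounds
  unfold launch
  simp only [Cmd.WP]
  refine Cmd.newSession_spec hC hb hS hus hx hxn hP.k' hlen ?_
  intro u un uf us' ucur uu ut un1 un2
  have ea : u.var .a = A := by rw [uf.get _, hA]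
  simp only [View.assign, Expr.rules, ea, ucur, Function.update_self, ne_eq, reduceCtorEq,
    not_false_eq_true, Function.update_of_ne]
  refine ⟨trivial, trivial, trivial, by norm_num, by omega, trivial, by omega, by norm_num,
    by omega, ⟨trivial, by omega, by omega⟩, ?_⟩
  suffices H : ∀ t ≤ u.vt + 40, settle.WP E b Q { u with
      var := Function.update (Function.update u.var .b A) .a (A + 1)
      arr := Function.update (Function.update u.arr 5 (Function.update (u.arr 5) A v.sess.length)) 6
        (Function.update (u.arr 6) A 0)
      vt := t } from H _ (by grind)
  intro t ht
  set z : View := { u with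
    var := Function.update (Function.update u.var .b A) .a (A + 1)
    arr := Function.update (Function.update u.arr 5 (Function.update (u.arr 5) A v.sess.length)) 6
      (Function.update (u.arr 6) A 0)
    vt := t } with hz
  have hzf : Frame v z [.cur, .j, .a1, .a2, .b, .a] [5, 6] := (uf.weaken (X' := [.cur, .j, .a1, .a2,
    .b, .a]) (J' := [5, 6])).trans (X' := [.b, .a]) (J' := [5,
    6]) (by exact Frame.iff.2 (by simp +contextual)) (by simp) (by simp)
  have z5 : z.arr 5 = Function.update (v.arr 5) A v.sess.length := by
    simp [hz, uf.arr 5]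
  have z6 : z.arr 6 = Function.update (v.arr 6) A 0 := by
    simp [hz, uf.arr 6]
  have z5A : z.arr 5 A = v.sess.length := by rw [z5, Function.update_self]
  have z6A : z.arr 6 A = 0 := by rw [z6, Function.update_self]
  refine Cmd.settle_spec hC hb ?_ (hP.frame hzf (by simp)) hr (B := A) (x := x) (by simp [hz])
    (by omega) (un := un) ?_ un1 (f := f) (us := us) ?_ (fun y hy h => absurd (un2 y hy) h) hdist
    (by rw [z6A]; omega) (by rw [z6A]; omega) (hF.congr (hzf.mem _) (hzf.mem _) (hzf.get _)
    (hzf.get _)) hal ?_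
  · rw [hzf.get _, hS.n']
  · grind
  · rw [z5A, hf]
  intro w wf ws wu w6 wacc wacc' wT wF wG wt
  rw [z5A] at ws
  rw [z6A] at wt
  have wzacc : z.var .acc = v.var .acc := hzf.get _
  have hwf : Frame v w [.cur, .j, .a1, .a2, .b, .a, .y, .e, .cnt, .cand, .t, .acc] [2, 5, 6,
    7] := (hzf.weaken).trans wf
  refine hQ w hwf ?_ (wu.trans uu) ?_ ?_ ?_ ?_ ?_ wT wF ?_ ?_
  · grind
  · rw [wf.get _]; simp [hz]
  · rw [wf.mem _, z5]
  · simp_all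
  · grind
  · grind
  · exact (Grows.of_eq (hzf.mem _) (hzf.mem _)).trans wG
  · grind

theorem Cmd.clear_spec (hC : Ctx E n p q l) (hb : b = 2 * l.length) (hn : v.var .n = n) (hQ : ∀ u,
    Frame v u [.i] [2] → u.sess = v.sess → u.used = v.used → u.vt ≤ v.vt + 50 * (n + 1) → (∀ a < n,
    u.arr 2 a = 1) → u.arr 2 n = v.arr 2 n → Q u) : clear.WP E b Q v := by
  obtain ⟨h1, h2, h3, h4, h5, h6, hn2⟩ := hC.bounds
  simp only [clear, Cmd.WP, View.pay, View.assign, Expr.rules, true_and, and_true]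
  refine ⟨by omega, fun u => ∃ i, u.var .i = i ∧ i ≤ n ∧ Frame v u [.i] [2] ∧ u.sess = v.sess ∧
      u.used = v.used ∧ u.vt ≤ v.vt + 20 + 50 * i ∧ (∀ a, i ≤ a → u.arr 2 a = v.arr 2 a) ∧ ∀ a < i,
      u.arr 2 a = 1, fun u => n - u.var .i, ⟨0, ?_⟩, ?_⟩
  · refine ⟨by simp, by omega, ?_, rfl, rfl, ?_, by simp, by simp⟩
    · simp +contextual [Frame.iff]
    · grind
  · rintro u ⟨i, hi, hi2, hf, hs, hu, ht, ha1, ha2⟩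
    have en : u.var .n = n := by rw [hf.get _, hn]
    simp only [Function.update_apply, if_true,
    en, hi]
    refine ⟨fun hne => ?_, fun he => ?_⟩
    · refine ⟨by omega, by norm_num, by omega, by omega, ⟨i + 1, rfl, by omega, ?_, hs, hu,
        by grind, fun a ha => ?_, fun a ha => ?_⟩, by omega⟩
      · simp +contextual [Frame.iff, hf.all]
      · grind
      · grind
    · exact hQ _ ⟨hf.var, hf.arr, hf.low, hf.inp⟩ hs hu (by grind) (fun a ha => ha2 a (by omega))
        (ha1 n hi2)

/-- The loop decreases `z` at every vertex that is not excluded, so the number of such vertices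
passed plus `z` is invariant. This finds the element number `Z` of `F` in increasing order, in
agreement with `choice`. -/
theorem Cmd.pick_spec (hC : Ctx E n p q l) (hb : b = 2 * l.length) (h7 : v.arr 7 n = 0)
    {F : Finset ℕ} (hF : ∀ a, a ∈ F ↔ a < n ∧ v.arr 7 a = 0) {Z : ℕ} (hz : v.var .z = Z) (hZ :
    Z < F.card) (hQ : ∀ u, Frame v u [.x, .z] [] → u.sess = v.sess → u.used = v.used →
    u.vt ≤ v.vt + 100 * (n + 1) → u.var .x = Nat.nth (· ∈ F) Z → Q u) : pick.WP E b Q v := by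
  classical
  obtain ⟨h1, h2, h3, h4, h5, h6, hn2⟩ := hC.bounds
  have hFn : F.card ≤ n := by
    have : F ⊆ Finset.range n := fun a ha => Finset.mem_range.2 ((hF a).1 ha).1
    simpa using Finset.card_le_card this
  have hcount : Nat.count (· ∈ F) n = F.card := by
    rw [Nat.count_eq_card_filter_range]
    congr 1
    grind
  simp only [pick, Cmd.WP, View.pay, View.assign, Expr.rules, Function.update_apply, reduceCtorEq,
    if_false, true_and, and_true]
  refine ⟨by omega, fun u => ∃ x, u.var .x = x ∧ x ≤ n ∧ Frame v u [.x, .z] [] ∧ u.sess = v.sess ∧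
      u.used = v.used ∧ u.vt ≤ v.vt + 20 + 100 * x ∧ Nat.count (· ∈ F) x + u.var .z = Z,
    fun u => n - u.var .x, ⟨0, ?_⟩, ?_⟩
  · refine ⟨by simp, by omega, ?_, rfl, rfl, ?_, by simp [hz]⟩
    · simp +contextual [Frame.iff]
    · grind
  · rintro u ⟨x, hx, hx2, hf, hs, hu, ht, hc⟩
    have earr : u.arr 7 = v.arr 7 := hf.mem _
    have hxn : x ≠ n := by rintro rfl; omega
    have hone : ∀ a c : ℕ, (1 - a) * (1 - c) ≤ 1 := fun a c => Nat.mul_le_mul (Nat.sub_le 1 a) (Nat.sub_le 1 c)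
    have h9 := hone (v.arr 7 x) (u.var .z)
    simp only [Function.update_apply, reduceCtorEq, if_false, if_true,
    hx, earr]
    refine ⟨⟨by omega, ⟨by omega, ⟨by norm_num, by omega⟩⟩, by omega, by omega⟩, fun hne =>
      ⟨⟨by norm_num, by omega⟩, fun h8 => ?_, fun h8 => ?_⟩, fun he => ?_⟩
    · refine ⟨by omega, ⟨x + 1, rfl, by omega, by simp +contextual [Frame.iff, hf.all], hs, hu, by grind, ?_⟩, by omega⟩
      grind
    · refine ⟨by omega, by omega, ⟨x + 1, rfl, by omega, by simp +contextual [Frame.iff, hf.all], hs, hu, by grind, ?_⟩, by omega⟩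
      grind
    · have h10 : v.arr 7 x = 0 ∧ u.var .z = 0 := by
        by_contra hc'
        grind
      refine hQ _ ⟨hf.var, hf.arr, hf.low, hf.inp⟩ hs hu (by grind) ?_
      have hxF : x ∈ F := by rw [hF]; omega
      have := Nat.nth_count (p := (· ∈ F)) hxF
      grind

end specs

/-! ### Rounds under insertions and the random choices made in them -/

/-- The edge list after the first `τ` of the insertions `U`. -/
abbrev graphAt (E : Env) (l U : List Edge) (τ : ℕ) : List Edge := afterUpdates E.mode l (U.take τ)

/-- The standing assumptions when the insertions `U` are made one after the other. -/
structure IncCtx (E : Env) (n p q : ℕ) (l U : List Edge) : Prop where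
  ctx : Ctx E n p q l
  mode : E.mode = .incremental
  legal : LegalSeq E.mode n l U
  conn : AlwaysConnected E.mode n l U

namespace IncCtx

variable {E : Env} {n p q : ℕ} {l U : List Edge} (h : IncCtx E n p q l U)
include h

theorem length_le : U.length ≤ n * n := h.legal.length_after.1.trans (h.legal.maxEdges_le
  h.ctx.edges)

theorem legal_at (τ : ℕ) : LegalSeq E.mode n l (U.take τ) := h.legal.prefix (List.take_prefix _ _)

theorem conn_at (τ : ℕ) : (graphOf n (graphAt E l U τ)).Connected := h.conn _ (List.take_prefix _ _)

theorem graph_le {τ τ' : ℕ} (hτ : τ ≤ τ') : graphOf n (graphAt E l U τ) ≤ graphOf n (graphAt E l U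
    τ') := by
  refine monotone_nat_of_le_succ (f := fun τ => graphOf n (graphAt E l U τ)) (fun τ => ?_) hτ
  simp only [graphAt, h.mode]
  rcases lt_or_ge τ U.length with hlt | hge
  · rw [← List.take_concat_get' U τ hlt]
    exact graphOf_insert_le n l _ _
  · rw [List.take_of_length_le hge, List.take_of_length_le (by omega)]

theorem gdist_le {τ τ' : ℕ} (hτ : τ ≤ τ') (u v : ℕ) : gdist n (graphAt E l U τ') u v ≤ gdist n
    (graphAt E l U τ) u v := gdist_anti (h.conn_at τ) (h.graph_le hτ) u v

theorem grad_le {τ τ' : ℕ} (hτ : τ ≤ τ') : grad n (graphAt E l U τ') ≤ grad n (graphAt E l U τ) :=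
  grad_anti (h.conn_at τ) (by have := h.ctx.two_le; omega) (h.graph_le hτ) (h.conn_at τ')

/-- The estimates are accurate for all pairs of vertices if the radius is not too large. -/
theorem est_close {τ r x : ℕ} (hr : grad n (graphAt E l U τ) ≤ 8 * r) (hx : x < n) (id : ℕ) :
    ∀ y < n, wordEst E id ⟨n, l, x, 16 * r, p, 256 * q⟩ (U.take τ) y ≤ gdist n (graphAt E l U τ) x y
    ∧ gdist n (graphAt E l U τ) x y ≤ wordEst E id ⟨n, l, x, 16 * r, p, 256 * q⟩ (U.take τ) y +
    slack p q r := by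
  intro y hy
  have hd := gdist_le_two_grad (h.conn_at τ) hx hy
  refine accurate_est h.ctx.box hx h.ctx.p_pos h.ctx.p_lt h.ctx.edges (h.legal_at τ) (h.conn_at τ)
    ?_ y hy (hd.trans (by omega))
  obtain ⟨h1, h2, h3, h4, h5, h6, -⟩ := h.ctx.bounds
  omega

end IncCtx

/-- A round of the algorithm: its number, the guessed radius, the number of the first run of the
black box in this round, and the number of updates made before it. -/
structure Round where
  g : ℕ
  r : ℕ
  base : ℕ
  t0 : ℕ

section rounds

variable (E : Env) (n p q : ℕ) (l U : List Edge) (R : Round)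

/-- The sampled vertices. -/
def Round.src (i : ℕ) : ℕ := (E.coins (2 * n * R.g + 2 * i) : ℕ) % n

/-- The words for the choice of representatives. -/
def Round.word (k : ℕ) : ℕ := E.coins (2 * n * R.g + 2 * k + 1)

/-- Up to time `τ`, the vertex `u` has come close to a sampled vertex. -/
def Round.Reached (τ u : ℕ) : Prop := ∃ t, R.t0 ≤ t ∧ t ≤ τ ∧ ∃ i < sampleSize n R.r,
  wordEst E (R.base + i) ⟨n, l, R.src E n i, 16 * R.r, p, 256 * q⟩ (U.take t) u ≤ R.r / 2

open Classical in
/-- The vertices that are not close to sampled vertices at time `τ`. -/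
noncomputable def Round.rest (τ : ℕ) : Finset ℕ := (Finset.range n).filter fun u => ¬ R.Reached E n
  p q l U τ u

/-- The vertices that may still be representatives after `k` choices. -/
noncomputable def Round.left (k : ℕ) : Finset ℕ := remains (R.Reached E n p q l U) (R.rest E n p q l
  U R.t0) (R.word E n) k

/-- The random words of the round have the properties on which the running time depends: fewer than
`K` representatives are needed, and large balls are hit. -/
structure Round.Good (K B : ℕ) : Prop where
  few : R.left E n p q l U K = ∅
  hit : ∀ τ ≤ U.length, ∀ v < n, (∀ i < sampleSize n R.r, R.r / 2 < gdist n (graphAt E l U τ) (R.src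
    E n i) v) → (gball n (graphAt E l U τ) v (R.r / 2)).card ≤ B

/-- At least `a - N - 1` disjoint balls of radius `σ / 2` around the vertices `xs b`, `N < b < a`, fit
into the ball of radius `h` around `w`. -/
def Packed (G : List Edge) (σ h B N a w : ℕ) (xs : ℕ → ℕ) : Prop := ∃ Z : Finset ℕ, Z ⊆ gball n G w
  h ∧ (∀ z ∈ Z, ∃ b, N < b ∧ b < a ∧ gdist n G (xs b) z ≤ σ / 2) ∧ (a - N - 1) * (σ / 2 + 1) ≤
  Z.card ∧ Z.card ≤ B

end rounds

section rounds

variable {E : Env} {n p q : ℕ} {l U : List Edge} {R : Round}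

theorem Round.Reached.mono {τ τ' u : ℕ} (h : R.Reached E n p q l U τ u) (hτ : τ ≤ τ') :
    R.Reached E n p q l U τ' u := by
  obtain ⟨t, h1, h2, h3⟩ := h
  exact ⟨t, h1, h2.trans hτ, h3⟩

theorem Round.mem_rest {τ u : ℕ} : u ∈ R.rest E n p q l U τ ↔ u < n ∧ ¬ R.Reached E n p q l U τ u := by
  simp [Round.rest]

theorem Round.card_rest_le (τ : ℕ) : (R.rest E n p q l U τ).card ≤ n := by
  classical exact (Finset.card_filter_le _ _).trans (by simp)

theorem Round.left_subset (k : ℕ) : R.left E n p q l U k ⊆ Finset.range n := by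
  classical exact (remains_subset k).trans (Finset.filter_subset _ _)

/-- When the representative has been reached, the next candidates are those that have not. -/
theorem Round.left_succ {k τ w : ℕ} (hw : w = choice (R.left E n p q l U k) (R.word E n k)) (h0 :
    ¬ R.Reached E n p q l U τ w) (h1 : R.Reached E n p q l U (τ + 1) w) (hs : R.rest E n p q l U τ ⊆
    R.left E n p q l U k) : R.left E n p q l U (k + 1) = R.rest E n p q l U (τ + 1) := by
  ext u
  change u ∈ survivors (R.Reached E n p q l U) (R.left E n p q l U k) (choice (R.left E n p q l U k)
    (R.word E n k)) ↔ _
  rw [← hw]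
  simp only [survivors, Finset.mem_filter, Round.mem_rest]
  constructor
  · rintro ⟨hu, τ', h2, h3⟩
    refine ⟨Finset.mem_range.1 (R.left_subset k hu), fun h => h3 (h.mono ?_)⟩
    by_contra hlt
    exact h0 (h2.mono (by omega))
  · rintro ⟨hu, h2⟩
    exact ⟨hs (Round.mem_rest.2 ⟨hu, fun h => h2 (h.mono (Nat.le_succ _))⟩), _, h1, h2⟩

/-- What is left decreases with the number of choices, so if anything is left then fewer than `K`
choices have been made. -/
theorem Round.Good.lt {K B k : ℕ} (h : R.Good E n p q l U K B) (hne : (R.left E n p q l U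
    k).Nonempty) : k < K := by
  by_contra hk
  have hanti : Antitone (R.left E n p q l U) := antitone_nat_of_succ_le fun k => survivors_subset _
  have := hanti (Nat.le_of_not_lt hk)
  rw [h.few] at this
  grind

theorem Packed.mono {G G' : List Edge} {σ h B N a w : ℕ} {xs : ℕ → ℕ} (hP : Packed n G σ h B N a w
    xs) (hd : ∀ u v, gdist n G' u v ≤ gdist n G u v) : Packed n G' σ h B N a w xs := by
  obtain ⟨Z, h1, h2, h3, h4⟩ := hP
  refine ⟨Z, fun z hz => ?_, fun z hz => ?_, h3, h4⟩
  · have := mem_gball.1 (h1 hz)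
    exact mem_gball.2 ⟨this.1, (hd _ _).trans this.2⟩
  · grind

/-- The new source is more than `σ` from all earlier ones around `w`, so its ball of radius `σ/2` is
disjoint from theirs. Unlike in the case of deletions distances shrink later; therefore `Z` is a
fixed set of vertices, each of which remains close to some source and inside the ball of `w`. -/
theorem Packed.insert {G : List Edge} (hc : (graphOf n G).Connected) {σ h B N a w x : ℕ}
    {xs : ℕ → ℕ} (hP : Packed n G σ h B N a w xs) (hw : w < n) (hx : x < n) (hN : N < a) (hσ :
    σ / 2 + 1 ≤ n) (hwx : gdist n G w x + σ / 2 ≤ h) (hsrc : ∀ b < a, xs b < n) (hfar : ∀ b, N < b →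
    b < a → σ < gdist n G (xs b) x) (hB : (gball n G w h).card ≤ B) : Packed n G σ h B N (a + 1) w
    (Function.update xs a x) := by
  obtain ⟨Z, h1, h2, h3, h4⟩ := hP
  have hsub : Z ∪ gball n G x (σ / 2) ⊆ gball n G w h := by
    refine Finset.union_subset h1 fun u hu => ?_
    rw [mem_gball] at hu ⊢
    have := gdist_triangle hc hw hx hu.1
    exact ⟨hu.1, by omega⟩
  refine ⟨Z ∪ gball n G x (σ / 2), hsub, fun z hz => ?_, ?_, (Finset.card_le_card hsub).trans hB⟩
  · rcases Finset.mem_union.1 hz with hz | hz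
    · obtain ⟨b, hb1, hb2, hb3⟩ := h2 z hz
      exact ⟨b, hb1, by omega, by rwa [Function.update_of_ne (by omega)]⟩
    · exact ⟨a, hN, by omega, by rw [Function.update_self]; exact (mem_gball.1 hz).2⟩
  · have hdis : Disjoint Z (gball n G x (σ / 2)) := by
      rw [Finset.disjoint_left]
      intro z hz hz'
      obtain ⟨b, hb1, hb2, hb3⟩ := h2 z hz
      rw [mem_gball] at hz'
      have h5 := hfar b hb1 hb2
      have h6 := gdist_triangle hc (hsrc b hb2) hz'.1 hx
      rw [gdist_comm n G z x] at h6
      omega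
    rw [Finset.card_union_of_disjoint hdis]
    have := le_gball_card hc hx hσ
    rw [show a + 1 - N - 1 = (a - N - 1) + 1 by omega, Nat.add_mul]
    omega

theorem Packed.le {G : List Edge} {σ h B N a w : ℕ} {xs : ℕ → ℕ} (hP : Packed n G σ h B N a w xs) :
    a - N - 1 ≤ B / (σ / 2 + 1) := by
  obtain ⟨Z, -, -, h3, h4⟩ := hP
  exact (Nat.le_div_iff_mul_le (by omega)).2 (h3.trans h4)

theorem Packed.start {G : List Edge} {σ h B N w : ℕ} {xs : ℕ → ℕ} : Packed n G σ h B N (N + 1) w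
  xs := ⟨∅, by simp, by simp, by simp, by simp⟩

end rounds

/-! ### Invariants of a round -/

/-- A bound on the time spent beyond what the runs of the black box have paid for, together with the
time reserved for moving the pointers and for giving up the representative. -/
def pot (n : ℕ) (v : View) : ℤ := v.vt + 50 * ∑ b ∈ Finset.range (v.var .a), ((n - v.arr 6 b : ℕ) :
  ℤ) + if v.var .w < n then 200 * (n : ℤ) else 0

/-- What holds at time `τ` during the round `R`, when `a` runs with sources `xs` are in use, and `w`
is the representative (`n` if there is none). -/
structure Core (E : Env) (n p q : ℕ) (l U : List Edge) (R : Round) (xs : ℕ → ℕ) (a w τ : ℕ) (v :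
    View) : Prop where
  params : Params n p q R.r v
  a' : v.var .a = a
  w' : v.var .w = w
  used : v.used = 2 * n * (R.g + 1)
  sample : ∀ i < n, v.arr 3 i = R.src E n i
  word : ∀ i < n, v.arr 4 i = R.word E n i
  flags : Flags n (R.Reached E n p q l U τ) (fun y => w < n ∧ gdist n (graphAt E l U τ) w y ≤ R.r /
    2 - slack p q R.r) (fun y => ∃ b, sampleSize n R.r < b ∧ b < a ∧ gdist n (graphAt E l U τ) (xs
    b) y ≤ 2 * slack p q R.r) v
  src_lt : ∀ b < a, xs b < n
  src_eq : ∀ b < a, b < sampleSize n R.r → xs b = R.src E n b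
  sid_lt : ∀ b < a, ∀ b' < b, v.arr 5 b' < v.arr 5 b
  sid_eq : ∀ b < a, b < sampleSize n R.r → v.arr 5 b = R.base + b
  acc : v.var .acc ≠ 0 → grad n (graphAt E l U τ) ≤ threshold p q R.r + slack p q R.r

/-- All runs in use are up to date. -/
def AllTracked (E : Env) (n p q : ℕ) (l U : List Edge) (R : Round) (xs : ℕ → ℕ) (a τ : ℕ) (v :
    View) : Prop := ∀ b < a, Tracked E n p q l (U.take τ) R.r b (xs b) v

section specs

variable {E : Env} {b n p q : ℕ} {l U : List Edge} {Q : View → Prop} {v : View} {R : Round}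
  {xs : ℕ → ℕ} {a w τ : ℕ}

theorem Core.frame {u : View} {X : List Var} {J : List ℕ} (h : Core E n p q l U R xs a w τ v) (hf :
    Frame v u X J) (hu : u.used = v.used) (hX : ∀ x ∈ [Var.r, .sg, .hS, .hA, .thr, .k, .N, .a, .w,
    .cnt, .cand, .acc], x ∉ X := by simp) (hJ : ∀ j ∈ [2, 3, 4, 5, 7], j ∉ J := by simp) :
    Core E n p q l U R xs a w τ u where
  params := h.params.frame hf fun x hx => hX x (by revert hx; simp; tauto)
  a' := by rw [hf.off hX, h.a']
  w' := by rw [hf.off hX, h.w']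
  used := hu.trans h.used
  sample := by rw [hf.offArr hJ]; exact h.sample
  word := by rw [hf.offArr hJ]; exact h.word
  flags := h.flags.congr (hf.offArr hJ) (hf.offArr hJ) (hf.off hX) (hf.off hX)
  src_lt := h.src_lt
  src_eq := h.src_eq
  sid_lt := by rw [hf.offArr hJ]; exact h.sid_lt
  sid_eq := by rw [hf.offArr hJ]; exact h.sid_eq
  acc := by rw [hf.off hX]; exact h.acc

theorem AllTracked.frame {u : View} {X : List Var} {J : List ℕ}
    (h : AllTracked E n p q l U R xs a τ v) (hf : Frame v u X J) (hs : u.sess = v.sess)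
    (hX : Var.acc ∉ X := by simp) (hJ : ∀ j ∈ [2, 5, 6, 7], j ∉ J := by simp) : AllTracked E n p q l U R xs a τ u :=
  fun b hb => (h b hb).congr (by rw [hf.offArr hJ]) (by rw [hf.offArr hJ])
    (by rw [hs]) (by rw [hf.var _ hX]; exact id)
    (Grows.of_eq (hf.offArr hJ) (hf.offArr hJ))

theorem pot_frame {u : View} {X : List Var} {J : List ℕ} (hf : Frame v u X J) (hX : ∀ x ∈ [Var.a,
    .w], x ∉ X := by simp) (hJ : 6 ∉ J := by simp) : pot n u = pot n v + (u.vt - v.vt) := by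
  unfold pot
  rw [hf.off hX, hf.off hX, hf.arr _ hJ]
  ring

/-- What the estimate of the run with index `b` means. -/
theorem IncCtx.allowed (hI : IncCtx E n p q l U) {r : ℕ} (hg : grad n (graphAt E l U τ) ≤ 8 * r) {x
    : ℕ} (hx : x < n) {id B y : ℕ} (hy : y < n) (he : wordEst E id ⟨n, l, x, 16 * r, p, 256 * q⟩
    (U.take τ) y ≤ noteRadius n p q r B) : (B = sampleSize n r → gdist n (graphAt E l U τ) x y ≤ r /
    2 - slack p q r) ∧ (sampleSize n r < B → gdist n (graphAt E l U τ) x y ≤ 2 * slack p q r) := by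
  have h1 := (hI.est_close hg hx id y hy).2
  have hσ := slack_le (r := r) hI.ctx.p_lt
  unfold noteRadius at he
  grind

/-- Run numbers matter because different runs of the black box may behave differently. In a round
the run of sample vertex number `i` has number `R.base + i`, which makes the definition of
`Round.Reached` agree with the estimates actually seen. -/
theorem Cmd.launch_core (hI : IncCtx E n p q l U) (hb : b = 2 * l.length) (hS : Static n p q l
    (U.take τ) v) (hr : R.r ≤ 10 * n) (hg : grad n (graphAt E l U τ) ≤ 8 * R.r) (hK : Core E n p q l
    U R xs a w τ v) (hT : AllTracked E n p q l U R xs a τ v) (haN : a < 3 * n) {x : ℕ} (hx :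
    v.var .x = x) (hxn : x < n) (ht0 : R.t0 ≤ τ) (h0 : a < sampleSize n R.r → x = R.src E n a ∧
    v.sess.length = R.base + a) (h1 : a = sampleSize n R.r → x = w) (hlen : v.sess.length < 2 ^ E.w)
    (hQ : ∀ u, Frame v u [.cur, .j, .a1, .a2, .b, .a, .y, .e, .cnt, .cand, .t, .acc] [2, 5, 6, 7] →
    u.sess = v.sess ++ [⟨⟨n, l, x, 16 * R.r, p, 256 * q⟩, U.take τ, []⟩] → Core E n p q l U R
    (Function.update xs a x) (a + 1) w τ u → AllTracked E n p q l U R (Function.update xs a x) (a +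
    1) τ u → Grows n v u → pot n u ≤ pot n v + 600 + 50 * n - 10000 * (n + l.length) → Q u) :
    launch.WP E b Q v := by
  have hcov : ∀ y, (∃ b, sampleSize n R.r < b ∧ b < a ∧ gdist n (graphAt E l U τ) (xs b) y ≤ 2 *
      slack p q R.r) → ∃ b, sampleSize n R.r < b ∧ b < a + 1 ∧ gdist n (graphAt E l U τ)
      (Function.update xs a x b) y ≤ 2 * slack p q R.r := by
    rintro y ⟨b, hb1, hb2, hb3⟩
    exact ⟨b, hb1, by omega, by rwa [Function.update_of_ne (by omega)]⟩
  refine Cmd.launch_spec hI.ctx hb hS (hI.legal_at τ) hK.params hr hK.a' haN hx hxn hlen (f := _)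
    rfl (fun y hy => (hI.est_close hg hxn _ y hy).2) (hK.flags.mono (fun _ _ h => h) (fun _ _ h =>
    h) fun y _ h => hcov y h) ?_ ?_
  · intro y hy he
    obtain ⟨k1, k2⟩ := hI.allowed hg hxn hy he
    refine ⟨fun h => ?_, fun h => ?_, fun h => ⟨a, h, by omega, by rw [Function.update_self]; exact k2 h⟩⟩
    · refine ⟨τ, ht0, le_rfl, a, h, ?_⟩
      rw [← (h0 h).2, ← (h0 h).1]
      unfold noteRadius at he
      rwa [if_pos h] at he
    · grind
  · intro u uf us' uu ua u5 u6 uacc uacc' uT uF uG ut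
    have hne : ∀ b < a, b ≠ a := fun b hb => by omega
    refine hQ u uf us' ?_ ?_ uG ?_
    · refine ⟨hK.params.frame uf (by simp), ua, ?_, uu.trans hK.used, ?_, ?_, uF, ?_, ?_, ?_, ?_, ?_⟩
      · rw [uf.get _, hK.w']
      · rw [uf.mem _]; exact hK.sample
      · rw [uf.mem _]; exact hK.word
      · intro b hb
        rcases Nat.lt_succ_iff_lt_or_eq.1 hb with h | rfl
        · rw [Function.update_of_ne (hne b h)]; exact hK.src_lt b h
        · grind
      · intro b hb hbN
        rcases Nat.lt_succ_iff_lt_or_eq.1 hb with h | rfl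
        · rw [Function.update_of_ne (hne b h)]; exact hK.src_eq b h hbN
        · grind
      · intro b hb b' hb'
        rw [u5]
        rcases Nat.lt_succ_iff_lt_or_eq.1 hb with h | rfl
        · rw [Function.update_of_ne (hne b h), Function.update_of_ne (by omega)]
          exact hK.sid_lt b h b' hb'
        · rw [Function.update_self, Function.update_of_ne (by omega)]
          exact (List.getElem?_eq_some_iff.1 (hT b' hb').run).1
      · intro b hb hbN
        rw [u5]
        rcases Nat.lt_succ_iff_lt_or_eq.1 hb with h | rfl
        · rw [Function.update_of_ne (hne b h)]; exact hK.sid_eq b h hbN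
        · grind
      · intro h
        rcases uacc' h with h | h
        · exact hK.acc h
        · exact _root_.grad_le (hI.conn_at τ) hxn h
    · intro b hb
      rcases Nat.lt_succ_iff_lt_or_eq.1 hb with h | rfl
      · rw [Function.update_of_ne (hne b h)]
        have hsl := (List.getElem?_eq_some_iff.1 (hT b h).run).1
        refine (hT b h).congr ?_ (u6 b (hne b h)) ?_ uacc uG
        · simp_all
        · grind
      · grind
    · unfold pot
      rw [ua, hK.a', Finset.sum_range_succ, uf.get .w]
      have : ∑ b ∈ Finset.range a, ((n - u.arr 6 b : ℕ) : ℤ) = ∑ b ∈ Finset.range a, ((n - v.arr 6 b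
        : ℕ) : ℤ) := Finset.sum_congr rfl fun b hb => by rw [u6 b (hne b (Finset.mem_range.1 hb))]
      grind

end specs

/-- The guessed radii, from `ρ` downwards. -/
def descent (p q ρ : ℕ) : ℕ → ℕ
  | 0 => ρ
  | g + 1 => descent p q ρ g - (1 + p * descent p q ρ g / (32 * q))

namespace Cmd

/-- Choose a new representative among the vertices that are not excluded, if there are any. -/
def rechoose : Cmd := .set .a ↟.N ;; clear ;; .set .cand 0 ;; .ite ↟.cnt (.set .z (.arr 4 ↟.idx -
  .arr 4 ↟.idx / ↟.cnt * ↟.cnt) ;; pick ;; .set .w ↟.x ;; .set .idx (↟.idx + 1) ;; launch) (.set .w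
  ↟.n)

/-- Start runs at candidates until all of them are marked. -/
def cover : Cmd := .whil ↟.cand (findUnmarked ;; launch)

end Cmd

theorem descent_le (p q ρ g : ℕ) : descent p q ρ g ≤ ρ - g := by
  induction g with
  | zero => exact le_rfl
  | succ g ih =>
    have := Nat.sub_le_sub_left (Nat.le_add_right 1 (p * descent p q ρ g / (32 * q))) (descent p q ρ g)
    simp only [descent]; omega

/-- How many runs may be started for the guess `r`, if `K` representatives suffice and balls that are
not hit have at most `B` elements. -/
noncomputable def roundBound (n p q K B r : ℕ) : ℕ := sampleSize n r + K * (1 + B / (slack p q r / 2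
  + 1))

/-- The standing assumptions on the rounds: the first guess that was accepted is `ρ`, found after `D`
runs of the black box. -/
structure IncPar (E : Env) (n p q : ℕ) (l U : List Edge) (K : ℕ) (B : ℕ → ℕ) (ρ D : ℕ) :
    Prop extends IncCtx E n p q l U where
  K_le : K ≤ n
  B_le : ∀ r, B r ≤ n
  ρ_le : ρ ≤ 10 * n
  D_le : D ≤ n
  good : ∀ R : Round, R.g < 10 * n → 0 < R.r → R.r ≤ 10 * n → R.base ≤ 40 * (n * n * n) →
    R.t0 ≤ U.length → R.Good E n p q l U K (B R.r)

/-- The part of the state that does not concern the runs in use, when `j` runs have been started in the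
`g + 1`-st round. -/
structure IncBase (E : Env) (n p q : ℕ) (l U : List Edge) (K : ℕ) (B : ℕ → ℕ) (ρ D g j τ : ℕ) (v :
    View) : Prop where
  static : Static n p q l (U.take τ) v
  out : v.var .out = threshold p q (descent p q ρ g) + slack p q (descent p q ρ g)
  le_out : grad n (graphAt E l U τ) ≤ threshold p q (descent p q ρ g) + slack p q (descent p q ρ g)
  cost : ∀ F : ℕ → ℝ, (∀ k, 0 ≤ F k) → sessCost F v.sess ≤ ∑ i ∈ Finset.range D, F (16 * (2 ^ (i +
    1) - 1)) + ∑ i ∈ Finset.range g, roundBound n p q K (B (descent p q ρ (i + 1))) (descent p q ρ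
    (i + 1)) * F (16 * descent p q ρ (i + 1)) + j * F (16 * descent p q ρ (g + 1))
  sessions : SessionsOK n p q l (U.take τ) v.sess

/-- The progress of the round `R`. -/
structure Staged (E : Env) (n p q : ℕ) (l U : List Edge) (R : Round) (K B : ℕ) (xs : ℕ →
    ℕ) (a w τ j : ℕ) (v : View) : Prop where
  le : R.t0 ≤ τ
  full : ∀ y < n, R.Reached E n p q l U τ y → v.arr 7 y ≠ 0
  stage : (w = n ∧ a = sampleSize n R.r ∧ v.var .cand = 0 ∧ v.var .cnt = 0 ∧ j ≤ roundBound n p q K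
      B R.r) ∨ (w < n ∧ sampleSize n R.r < a ∧ xs (sampleSize n R.r) = w ∧ ¬ R.Reached E n p q l U τ
      w ∧ ∃ k < K, v.var .idx = k + 1 ∧ R.rest E n p q l U τ ⊆ R.left E n p q l U k ∧
      w = choice (R.left E n p q l U k) (R.word E n k) ∧ Packed n (graphAt E l U τ) (slack p q R.r)
      (R.r / 2) B (sampleSize n R.r) a w xs ∧ j + sampleSize n R.r ≤ roundBound n p q k B R.r + a)

section specs

variable {E : Env} {b n p q : ℕ} {l U : List Edge} {Q : View → Prop} {v u : View} {K : ℕ}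
  {B : ℕ → ℕ} {ρ D g j : ℕ} {R : Round} {xs : ℕ → ℕ} {a w τ : ℕ}

theorem IncBase.frame {X : List Var} {J : List ℕ} (h : IncBase E n p q l U K B ρ D g j τ v) (hf :
    Frame v u X J) (hs : u.sess = v.sess) (hX : ∀ x ∈ [Var.n, .p, .q, .m, .den, .U, .out],
    x ∉ X := by simp) (hJ : ∀ j ∈ [0, 1], j ∉ J := by simp) : IncBase E n p q l U K B ρ D g j τ u
    where
  static := h.static.frame hf (fun x hx => hX x (by revert hx; simp; tauto)) hJ
  out := by rw [hf.off hX, h.out]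
  le_out := h.le_out
  cost := by rw [hs]; exact h.cost
  sessions := by rw [hs]; exact h.sessions

theorem IncBase.launch {X : List Var} {J : List ℕ} (h : IncBase E n p q l U K B ρ D g j τ v) (hf :
    Frame v u X J) {x : ℕ} (hx : x < n) (hs : u.sess = v.sess ++ [⟨⟨n, l, x, 16 * descent p q ρ (g +
    1), p, 256 * q⟩, U.take τ, []⟩]) (hX : ∀ x ∈ [Var.n, .p, .q, .m, .den, .U, .out],
    x ∉ X := by simp) (hJ : ∀ j ∈ [0, 1], j ∉ J := by simp) : IncBase E n p q l U K B ρ D g (j + 1)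
    τ u where
  static := h.static.frame hf (fun x hx => hX x (by revert hx; simp; tauto)) hJ
  out := by rw [hf.off hX, h.out]
  le_out := h.le_out
  cost := by
    intro F hF
    have := h.cost F hF
    rw [hs, sessCost_append]
    push_cast
    linarith
  sessions := by
    intro c hc
    rw [hs, List.mem_append, List.mem_singleton] at hc
    rcases hc with hc | rfl
    · exact h.sessions c hc
    · grind

theorem roundBound_le (h : IncPar E n p q l U K B ρ D) {r : ℕ} (hr : 0 < r) : roundBound n p q K (B
    r) r ≤ 2 * n + n * n := by
  have h1 := sampleSize_le (n := n) hr
  have h2 := (Nat.div_le_self (B r) (slack p q r / 2 + 1)).trans (h.B_le r)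
  have h3 : K * (1 + B r / (slack p q r / 2 + 1)) ≤ n * (1 + n) := Nat.mul_le_mul h.K_le (by omega)
  unfold roundBound
  nlinarith

theorem IncPar.lt_of_pos (h : IncPar E n p q l U K B ρ D) (hr : 0 < descent p q ρ (g + 1)) :
    g + 1 < 10 * n ∧ descent p q ρ (g + 1) ≤ 10 * n := by
  have h1 := descent_le p q ρ (g + 1)
  have h2 := h.ρ_le
  omega

theorem IncBase.length_le (h : IncPar E n p q l U K B ρ D) (hB : IncBase E n p q l U K B ρ D g j τ
    v) (hr : 0 < descent p q ρ (g + 1)) (hj : j ≤ 2 * n + n * n) : v.sess.length ≤ 40 * (n * n *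
    n) := by
  have h1 := hB.cost (fun _ => 1) (fun _ => zero_le_one)
  have h2 := h.lt_of_pos hr
  have hn := h.ctx.two_le
  have hD := h.D_le
  obtain ⟨b1, b2, -⟩ := h.ctx.bounds
  simp only [sessCost_one, mul_one, Finset.sum_const, Finset.card_range, nsmul_eq_mul] at h1
  have h4 : ∑ i ∈ Finset.range g, roundBound n p q K (B (descent p q ρ (i + 1))) (descent p q ρ (i +
      1)) ≤ g * (2 * n + n * n) := by
    refine (Finset.sum_le_card_nsmul _ _ (2 * n + n * n) fun i hi => roundBound_le h ?_).trans (by simp)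
    have hanti : Antitone (descent p q ρ) := antitone_nat_of_succ_le fun k => by simp [descent]
    exact hr.trans_le (hanti (by have := Finset.mem_range.1 hi; omega))
  have h5 : v.sess.length ≤ D + ∑ i ∈ Finset.range g, roundBound n p q K (B (descent p q ρ (i + 1)))
      (descent p q ρ (i + 1)) + j := by
    exact_mod_cast h1
  have h6 : (g + 1) * (2 * n + n * n) ≤ 10 * n * (2 * n + n * n) := Nat.mul_le_mul_right _ (by omega)
  grind

theorem Staged.le_roundBound (h : Staged E n p q l U R K (B R.r) xs a w τ j v) : j ≤ roundBound n p
    q K (B R.r) R.r := by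
  rcases h.stage with ⟨-, -, -, -, h⟩ | ⟨-, h1, -, -, k, hk, -, -, -, hP, h2⟩
  · exact h
  · have h3 := hP.le
    have h4 : (k + 1) * (1 + B R.r / (slack p q R.r / 2 + 1)) ≤ K * (1 + B R.r / (slack p q R.r / 2
        + 1)) := Nat.mul_le_mul_right _ hk
    unfold roundBound at h2 ⊢
    rw [Nat.add_mul, one_mul] at h4
    omega

theorem Staged.a_lt (h : IncPar E n p q l U K B ρ D) (hr : 0 < R.r) (hS : Staged E n p q l U R K (B
    R.r) xs a w τ j v) : a < 3 * n := by
  have h1 := sampleSize_le (n := n) hr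
  have h2 := (Nat.div_le_self (B R.r) (slack p q R.r / 2 + 1)).trans (h.B_le R.r)
  have hn := h.ctx.two_le
  rcases hS.stage with ⟨-, h4, -⟩ | ⟨-, h4, -, -, k, hk, -, -, -, hP, -⟩
  · omega
  · have := hP.le
    omega

/-- One step of the descent is small, so acceptance of the previous guess bounds the radius by `8 r`
for the next positive guess. Then all distances are at most `16 r`, and estimates are accurate
everywhere from the start of the round on. -/
theorem descent_succ_ge {p q ρ g : ℕ} (hpq : p < q) (hr : 0 < descent p q ρ (g + 1)) :
    threshold p q (descent p q ρ g) + slack p q (descent p q ρ g) ≤ 8 * descent p q ρ (g + 1) := by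
  have h1 := slack_le (r := descent p q ρ g) hpq
  have h2 := slack_le (r := descent p q ρ g) (p := p) (q := 2 * q) (by omega)
  have h3 : p * descent p q ρ g / (32 * q) * 2 ≤ slack p q (descent p q ρ g) := by
    unfold slack
    rw [show 32 * q = 16 * q * 2 by ring, ← Nat.div_div_eq_div_mul]
    grind
  simp only [descent] at hr ⊢
  unfold threshold
  omega

theorem IncBase.grad_le (h : IncPar E n p q l U K B ρ D) (hB : IncBase E n p q l U K B ρ D g j τ v)
    (hr : 0 < descent p q ρ (g + 1)) : grad n (graphAt E l U τ) ≤ 8 * descent p q ρ (g + 1) :=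
  hB.le_out.trans (descent_succ_ge h.ctx.p_lt hr)

/-- The runs beyond the sample are dropped, and the next random word selects a representative among
the vertices not excluded. As the excluded vertices are exactly the reached ones, this is one step
of the process `remains`. The passes over the vertices are paid by the `200 n` reserved in `pot`
when there was a representative. -/
theorem Cmd.rechoose_spec (hI : IncPar E n p q l U K B ρ D) (hb : b = 2 * l.length) (hR :
    R.r = descent p q ρ (R.g + 1)) (hr : 0 < R.r) (hB : IncBase E n p q l U K B ρ D R.g j τ v) (hK :
    Core E n p q l U R xs a w τ v) (hT : AllTracked E n p q l U R xs a τ v) (haN : sampleSize n R.r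
    ≤ a) (ht0 : R.t0 ≤ τ) (hfull : ∀ y < n, R.Reached E n p q l U τ y → v.arr 7 y ≠ 0) (hG :
    R.Good E n p q l U K (B R.r)) {k : ℕ} (hk : v.var .idx = k) (hkK : k ≤ K) (hleft :
    R.left E n p q l U k = R.rest E n p q l U τ) (hj : j ≤ roundBound n p q k (B R.r) R.r) (hQ :
    ∀ u xs' a' w' j', IncBase E n p q l U K B ρ D R.g j' τ u → Core E n p q l U R xs' a' w' τ u →
    AllTracked E n p q l U R xs' a' τ u → Staged E n p q l U R K (B R.r) xs' a' w' τ j' u → (w < n →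
    pot n u ≤ pot n v + 200) → pot n u ≤ pot n v + 200 * n + 200 → Q u) : rechoose.WP E b Q v := by
  obtain ⟨h1, h2, h3, h4, h5, h6, hn2⟩ := hI.ctx.bounds
  have hr10 : R.r ≤ 10 * n := hR ▸ (hI.lt_of_pos (hR ▸ hr)).2
  have hjK : roundBound n p q k (B R.r) R.r ≤ roundBound n p q K (B R.r) R.r := by
    unfold roundBound
    exact Nat.add_le_add_left (Nat.mul_le_mul_right _ hkK) _
  have hjn := hj.trans (hjK.trans (roundBound_le hI hr))
  have hlen := hB.length_le hI (hR ▸ hr) hjn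
  have hNn := sampleSize_le (n := n) hr
  set N := sampleSize n R.r with hN
  unfold rechoose
  simp only [Cmd.WP, View.assign, Expr.rules, hK.params.N', true_and]
  refine Cmd.clear_spec hI.ctx hb (by simpa using hB.static.n') ?_
  intro u uf us uu ut u2 u2n
  have hvu : Frame v u [.a, .i] [2] := uf.of_assign.weaken
  have ecnt : u.var .cnt = zeros n (v.arr 7) := by rw [hvu.get _, hK.flags.cnt]
  have earr : ∀ j, j ≠ 2 → u.arr j = v.arr j := fun j hj => hvu.arr j (by simpa using hj)
  have hrest : ∀ y, y ∈ R.rest E n p q l U τ ↔ y < n ∧ v.arr 7 y = 0 := by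
    intro y
    rw [Round.mem_rest]
    refine and_congr_right fun hy => ⟨fun h => ?_, fun h h' => hfull y hy h' h⟩
    by_contra h'
    exact h (hK.flags.out y hy h')
  have hcard : zeros n (v.arr 7) = (R.rest E n p q l U τ).card := by
    unfold zeros
    congr 1
    ext y
    simp [hrest]
  have hz2 : zeros n (u.arr 2) = 0 := by
    by_contra h
    obtain ⟨y, hy, h⟩ := zeros_pos.1 h
    rw [u2 y hy] at h
    omega
  have hflags : ∀ (z : View) (near cov : ℕ → Prop), Frame u z [.z, .x, .w, .idx, .cand] [] →
      z.var .cand = 0 → Flags n (R.Reached E n p q l U τ) near cov z := by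
    intro z near cov zf zc
    have z2 : z.arr 2 = u.arr 2 := zf.mem _
    have z7 : z.arr 7 = v.arr 7 := by rw [zf.mem _, earr 7 (by simp)]
    constructor
    · rw [z7]; exact hK.flags.out
    · grind
    · grind
    · grind
    · rw [zf.get _, ecnt, z7]
    · grind
    · rw [z2, u2n]; exact hK.flags.sent2
    · rw [z7]; exact hK.flags.sent7
  have hcore : ∀ (z : View) (w' : ℕ), Frame u z [.z, .x, .w, .idx, .cand] [] → z.var .cand = 0 →
      z.var .w = w' → z.used = u.used → Core E n p q l U R xs N w' τ z := by
    intro z w' zf zc zw zu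
    have hvz : Frame v z [.a, .i, .z, .x, .w, .idx, .cand] [2] := (hvu.weaken).trans zf
    have z5 : z.arr 5 = v.arr 5 := hvz.mem _
    refine ⟨hK.params.frame hvz (by simp), ?_, zw, (zu.trans uu).trans hK.used, ?_, ?_, hflags z _ _ zf zc,
      fun b hb => hK.src_lt b (by omega), fun b hb => hK.src_eq b (by omega), ?_, ?_, ?_⟩
    · rw [zf.get _, uf.get _]
      simp [hN]
    · rw [hvz.mem _]; exact hK.sample
    · rw [hvz.mem _]; exact hK.word
    · rw [z5]; exact fun b hb => hK.sid_lt b (by omega)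
    · rw [z5]; exact fun b hb => hK.sid_eq b (by omega)
    · rw [hvz.get _]; exact hK.acc
  have htrack : ∀ z : View, Frame u z [.z, .x, .w, .idx, .cand] [] → z.sess = u.sess →
      AllTracked E n p q l U R xs N τ z := by
    intro z zf zs b hb
    have hvz : Frame v z [.a, .i, .z, .x, .w, .idx, .cand] [2] := (hvu.weaken).trans zf
    have hTb := hT b (by omega)
    have z5 : z.arr 5 = v.arr 5 := hvz.mem _
    have z6 : z.arr 6 = v.arr 6 := hvz.mem _
    have z7 : z.arr 7 = v.arr 7 := hvz.mem _
    have zs' : z.sess = v.sess := zs.trans us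
    constructor
    · rw [z5, zs']; exact hTb.run
    · rw [z6]; exact hTb.ptr_le
    · rw [z6]; exact hTb.ptr
    · rw [z6, hvz.get _]; exact hTb.acc
    · rw [z5, z6]; exact hTb.halt
    · intro y hy hle
      rw [z5] at hle
      exact ⟨fun h => z7 ▸ (hTb.noted y hy hle).1 h, fun h => by omega, fun h => by omega⟩
  have hbase : ∀ z : View, Frame u z [.z, .x, .w, .idx, .cand] [] → z.sess = u.sess →
      IncBase E n p q l U K B ρ D R.g j τ z := fun z zf zs =>
    hB.frame ((hvu.weaken (X' := [.a, .i, .z, .x, .w, .idx, .cand]) (J' := [2]) (by simp)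
      (by simp)).trans zf (by simp) (by simp)) (zs.trans us)
  -- Dropping runs and giving up the old representative can only release reserved time.
  have hpot : ∀ z : View, Frame u z [.z, .x, .w, .idx, .cand] [] → pot n z + (if w < n then 200 * (n
      : ℤ) else 0) ≤ pot n v + (z.vt - v.vt) + if z.var .w < n then 200 * (n : ℤ) else 0 := by
    intro z zf
    have ea : z.var .a = N := by rw [zf.get _, uf.get _]; simp [hN]
    unfold pot
    rw [ea, hK.a', hK.w', zf.mem 6, earr 6 (by simp)]
    have : ∑ b ∈ Finset.range N, ((n - v.arr 6 b : ℕ) : ℤ) ≤ ∑ b ∈ Finset.range a, ((n - v.arr 6 b : ℕ) : ℤ) :=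
      Finset.sum_le_sum_of_subset_of_nonneg (by simpa using haN) fun _ _ _ => by positivity
    linarith
  have en : u.var .n = n := by rw [hvu.get _, hB.static.n']
  have eidx : u.var .idx = k := by rw [hvu.get _, hk]
  simp only [View.pay, ne_eq, reduceCtorEq, not_false_eq_true, Function.update_of_ne]
  refine ⟨by omega, fun hne => ?_, fun he => ?_⟩
  · have hF0 : 0 < (R.rest E n p q l U τ).card := by omega
    have hkK' : k < K := hG.lt (by rw [hleft]; exact Finset.card_pos.1 hF0)
    have hkn : k < n := hkK'.trans_le hI.K_le
    have eword : u.arr 4 k = R.word E n k := by rw [earr 4 (by simp), hK.word k hkn]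
    have hword : R.word E n k < 2 ^ E.w := Fin.is_lt _
    have hdiv := Nat.div_mul_le_self (R.word E n k) (R.rest E n p q l U τ).card
    have hmod : R.word E n k - R.word E n k / (R.rest E n p q l U τ).card * (R.rest E n p q l U
        τ).card = R.word E n k % (R.rest E n p q l U τ).card := by
      have := Nat.mod_add_div' (R.word E n k) (R.rest E n p q l U τ).card
      omega
    simp only [eidx, eword, ecnt, hcard, hmod]
    refine ⟨⟨⟨by norm_num, by omega⟩, ⟨⟨by norm_num, by omega⟩, trivial⟩, by omega⟩, ?_⟩
    refine Cmd.pick_spec hI.ctx hb ?_ (F := R.rest E n p q l U τ) (Z := R.word E n k % (R.rest E n p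
      q l U τ).card) ?_ (by simp) (Nat.mod_lt _ hF0) ?_
    · rw [earr 7 (by simp)]; exact hK.flags.sent7
    · grind
    intro z zf zs zu zt zx
    have hx : z.var .x = choice (R.left E n p q l U k) (R.word E n k) := by rw [zx, hleft]; rfl
    set x := choice (R.left E n p q l U k) (R.word E n k) with hxdef
    have hxr : x ∈ R.rest E n p q l U τ := hleft ▸ choice_mem (hleft ▸ Finset.card_pos.1 hF0) _
    have hxn := (Round.mem_rest.1 hxr).1
    have huz : Frame u z [.cand, .z, .x] [] := ((Frame.of_assign (v :=
      { u with var := Function.update u.var .cand 0 }) zf).of_assign (v := u) (t := u.vt)).weaken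
      (by simp) (by simp)
    have hc0 : z.var .cand = 0 := by rw [zf.get _]; simp
    have zidx : z.var .idx = k := by rw [huz.get _, eidx]
    simp only [hx, zidx]
    refine ⟨⟨by omega, by omega⟩, ?_⟩
    have hfr : ∀ t : ℤ, Frame u { z with
        var := Function.update (Function.update z.var .w x) .idx (k + 1), vt := t }
        [.z, .x, .w, .idx, .cand] [] := by
      intro t
      have := huz.weaken (X' := [.z, .x, .w, .idx, .cand]) (J' := [])
      simp +contextual [Frame.iff, this.all]
    refine Cmd.launch_core hI.toIncCtx hb (hbase _ (hfr _) zs).static hr10 (hR ▸ hB.grad_le hI (hR ▸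
      hr)) (hcore _ x (hfr _) (by simpa using hc0) (by simp) zu) (htrack _ (hfr _) zs) (by omega)
      (x := x) (by simpa using hx) hxn ht0 (fun h => absurd h (lt_irrefl _)) (fun _ => rfl)
      (by simp only [zs]; rw [us]; simp only; omega) ?_
    intro y yf ys yK yT yG yp
    have hp := hpot _ (hfr (z.vt + 20))
    simp only [ne_eq, reduceCtorEq, not_false_eq_true, Function.update_of_ne, Function.update_self,
      hxn, if_true] at hp
    have hpp : ∀ t, pot n { z with
        var := Function.update (Function.update z.var .w x) .idx (k + 1), vt := t } =
        pot n { z with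
        var := Function.update (Function.update z.var .w x) .idx (k + 1), vt := z.vt + 20 } + (t - z.vt - 20) := by
      intro t; unfold pot; simp only; ring
    rw [hpp] at yp
    have hzt : z.vt ≤ v.vt + 200 * n + 400 := by grind
    have hw0 : (0 : ℤ) ≤ if w < n then 200 * (n : ℤ) else 0 := by split_ifs <;> positivity
    have hfin : pot n y ≤ pot n v + 200 := by grind
    refine hQ y _ (N + 1) x (j + 1) ((hbase _ (hfr _) zs).launch yf hxn (by rw [← hR]; exact ys) (by simp) (by simp))
      yK yT ⟨ht0, fun a ha h => ?_, Or.inr ⟨hxn, by omega, Function.update_self _ _ _, (Round.mem_rest.1 hxr).2,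
        k, hkK', ?_, hleft ▸ Finset.Subset.refl _, rfl, Packed.start, by omega⟩⟩ (fun _ => hfin) (by omega)
    · refine yG.out a ha ?_
      have : z.arr 7 = v.arr 7 := by rw [zf.mem _]; exact earr 7 (by simp)
      grind
    · rw [yf.get _]; simp
  · have hf : ∀ t : ℤ, Frame u { u with
        var := Function.update (Function.update u.var .cand 0) .w n, vt := t }
        [.z, .x, .w, .idx, .cand] [] := by
      intro t
      simp +contextual [Frame.iff]
    have hp : ∀ t, pot n { u with
        var := Function.update (Function.update u.var .cand 0) .w n, vt := t } +
          (if w < n then 200 * (n : ℤ) else 0) ≤ pot n v + (t - v.vt) := by grind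
    have hw0 : (0 : ℤ) ≤ if w < n then 200 * (n : ℤ) else 0 := by split_ifs <;> positivity
    simp only [ en]
    refine hQ _ xs N n j (hbase _ (hf _) rfl) (hcore _ n (hf _) (by simp) (by simp) rfl) (htrack _
      (hf _) rfl) ⟨ht0, ?_, Or.inl ⟨rfl, rfl, by simp, by simpa using he, hj.trans hjK⟩⟩ (fun hw =>
      ?_) ?_
    · grind
    · grind
    · grind

end specs

namespace Cmd

/-- Start runs at all sampled vertices. -/
def sample : Cmd := .whil (↟.N - ↟.a) (.set .x (.arr 3 ↟.a) ;; launch)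

/-- Pass from an accepted guess for the radius to the next smaller one. -/
def nextGuess : Cmd := .set .out (↟.thr + ↟.sg) ;; .set .r (↟.r - (1 + ↟.p * ↟.r / (32 * ↟.q))) ;;
  .set .a 0 ;; .set .acc 0 ;; .set .w ↟.n ;; .set .cand 0 ;; .ite ↟.r (params ;; draw ;; clear ;;
  .set .cnt ↟.n ;; .set .idx 0 ;; sample ;; rechoose ;; cover) .skip

/-- Lower the guess as long as it is accepted. -/
def lower : Cmd := .whil ↟.acc nextGuess

end Cmd

/-- The `g`-th guess has been accepted. -/
structure Accepted (E : Env) (n p q : ℕ) (l U : List Edge) (K : ℕ) (B : ℕ → ℕ) (ρ D g τ : ℕ) (v :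
    View) : Prop where
  static : Static n p q l (U.take τ) v
  params : Params n p q (descent p q ρ g) v
  used : v.used = 2 * n * g
  le_out : grad n (graphAt E l U τ) ≤ threshold p q (descent p q ρ g) + slack p q (descent p q ρ g)
  cost : ∀ F : ℕ → ℝ, (∀ k, 0 ≤ F k) → sessCost F v.sess ≤ ∑ i ∈ Finset.range D, F (16 * (2 ^ (i +
    1) - 1)) + ∑ i ∈ Finset.range g, roundBound n p q K (B (descent p q ρ (i + 1))) (descent p q ρ
    (i + 1)) * F (16 * descent p q ρ (i + 1))
  sessions : SessionsOK n p q l (U.take τ) v.sess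
  sent2 : v.arr 2 n = 0
  sent7 : v.arr 7 n = 0

/-- What holds in the `g + 1`-st round after all runs have been brought up to date. -/
def Settled (E : Env) (n p q : ℕ) (l U : List Edge) (K : ℕ) (B : ℕ → ℕ) (ρ D g τ : ℕ) (v : View) :
  Prop := v.var .r = descent p q ρ (g + 1) ∧ ∃ j, IncBase E n p q l U K B ρ D g j τ v ∧
  v.var .cand = 0 ∧ ((descent p q ρ (g + 1) = 0 ∧ v.var .a = 0 ∧ v.var .w = n ∧ v.var .acc = 0 ∧
  v.arr 7 n = 0 ∧ j = 0) ∨ ∃ (R : Round) (xs : ℕ → ℕ) (a w : ℕ), R.g = g ∧ R.r = descent p q ρ (g +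
  1) ∧ 0 < R.r ∧ R.base ≤ 40 * (n * n * n) ∧ R.t0 ≤ U.length ∧ grad n (graphAt E l U R.t0) ≤ 8 * R.r
  ∧ Core E n p q l U R xs a w τ v ∧ AllTracked E n p q l U R xs a τ v ∧ Staged E n p q l U R K (B
  R.r) xs a w τ j v)

section specs

variable {E : Env} {b n p q : ℕ} {l U : List Edge} {Q : View → Prop} {v u : View} {K : ℕ}
  {B : ℕ → ℕ} {ρ D g j : ℕ} {R : Round} {xs : ℕ → ℕ} {a w τ : ℕ}

theorem Staged.frame {X : List Var} {J : List ℕ} {B : ℕ} (h : Staged E n p q l U R K B xs a w τ j v)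
    (hf : Frame v u X J) (hX : ∀ x ∈ [Var.cand, .cnt, .idx], x ∉ X := by simp) (hJ :
    7 ∉ J := by simp) : Staged E n p q l U R K B xs a w τ j u where
  le := h.le
  full := by rw [hf.arr _ hJ]; exact h.full
  stage := by
    rw [hf.off hX, hf.off hX, hf.off hX]
    exact h.stage

theorem IncPar.good_round (hI : IncPar E n p q l U K B ρ D) (hR : R.r = descent p q ρ (R.g + 1))
    (hr : 0 < R.r) (hbase : R.base ≤ 40 * (n * n * n)) (ht0 : R.t0 ≤ U.length) :
    R.Good E n p q l U K (B R.r) :=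
  hI.good R (by have := (hI.lt_of_pos (hR ▸ hr)).1; omega) hr (hR ▸ (hI.lt_of_pos (hR ▸ hr)).2) hbase ht0

theorem Settled.accepted (hI : IncPar E n p q l U K B ρ D) (h : Settled E n p q l U K B ρ D g τ v)
    (hacc : v.var .acc ≠ 0) : Accepted E n p q l U K B ρ D (g + 1) τ v ∧ 0 < descent p q ρ (g +
    1) := by
  obtain ⟨hr, j, hB, -, ⟨-, -, -, h0, -⟩ | ⟨R, xs, a, w, hg, hR, hr0, -, -, -, hK, hT, hS⟩⟩ := h
  · grind
  have hj := hS.le_roundBound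
  subst hg
  refine ⟨⟨hB.static, hR ▸ hK.params, by rw [hK.used], hR ▸ hK.acc hacc, fun F hF => ?_,
    hB.sessions, hK.flags.sent2, hK.flags.sent7⟩, hR ▸ hr0⟩
  have h1 := hB.cost F hF
  rw [Finset.sum_range_succ, ← add_assoc, ← hR]
  rw [← hR] at h1
  have h2 : (j : ℝ) * F (16 * R.r) ≤ roundBound n p q K (B R.r) R.r * F (16 * R.r) :=
    mul_le_mul_of_nonneg_right (by exact_mod_cast hj) (hF _)
  linarith

/-- Each new source marks at least itself, so the number of unmarked vertices decreases. For the
count of sources the packing is used: a candidate that still needs a source is farther than `σ` from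
all previous sources around `w`. -/
theorem Cmd.cover_spec (hI : IncPar E n p q l U K B ρ D) (hb : b = 2 * l.length) (hR :
    R.r = descent p q ρ (R.g + 1)) (hr : 0 < R.r) (hτ : τ ≤ U.length) (hB : IncBase E n p q l U K B
    ρ D R.g j τ v) (hK : Core E n p q l U R xs a w τ v) (hT : AllTracked E n p q l U R xs a τ v) (hS
    : Staged E n p q l U R K (B R.r) xs a w τ j v) (hG : R.Good E n p q l U K (B R.r)) (hQ :
    ∀ u xs' a' j', IncBase E n p q l U K B ρ D R.g j' τ u → Core E n p q l U R xs' a' w τ u →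
    AllTracked E n p q l U R xs' a' τ u → Staged E n p q l U R K (B R.r) xs' a' w τ j' u →
    u.var .cand = 0 → pot n u ≤ pot n v + 10 → Q u) : cover.WP E b Q v := by
  obtain ⟨h1, h2, h3, h4, h5, h6, hn2⟩ := hI.ctx.bounds
  have hr10 : R.r ≤ 10 * n := hR ▸ (hI.lt_of_pos (hR ▸ hr)).2
  have hσ := slack_le (r := R.r) hI.ctx.p_lt
  refine ⟨fun u => (∃ xs a j, IncBase E n p q l U K B ρ D R.g j τ u ∧ Core E n p q l U R xs a w τ u ∧
      AllTracked E n p q l U R xs a τ u ∧ Staged E n p q l U R K (B R.r) xs a w τ j u) ∧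
      pot n u ≤ pot n v, fun u => ((Finset.range n).filter fun y => u.arr 2 y ≠ 2).card,
    ⟨⟨xs, a, j, hB, hK, hT, hS⟩, le_rfl⟩, ?_⟩
  rintro u ⟨⟨xs, a, j, uB, uK, uT, uS⟩, up⟩
  have hf0 : Frame u (u.pay 3) [] [] := ⟨fun _ _ => rfl, fun _ _ => rfl, rfl, rfl⟩
  refine ⟨trivial, fun hc => ?_, fun hc => ?_⟩
  · simp only [Expr.rules, uK.flags.cand] at hc
    obtain ⟨y, hy, hy0⟩ := zeros_pos.1 hc
    refine Cmd.findUnmarked_spec hI.ctx hb uK.flags.sent2 ?_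
    intro z zf zs zu zt zxn zx0 zmin
    have hxn : z.var .x < n := by
      by_contra h
      exact zmin y (by omega) hy0
    have huz : Frame u z [.x] [] := (hf0.weaken).trans zf
    have zs' : z.sess = u.sess := zs
    have zB := uB.frame huz zs'
    have zK := uK.frame huz zu
    have zT := uT.frame huz zs'
    have zS := uS.frame huz
    have haN := zS.a_lt hI hr
    have hlen := zB.length_le hI (hR ▸ hr) (zS.le_roundBound.trans (roundBound_le hI hr))
    have hgr := hR ▸ zB.grad_le hI (hR ▸ hr)
    have z2 : z.arr 2 = u.arr 2 := huz.mem _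
    rcases zS.stage with ⟨hw, -, h8, -⟩ | ⟨hw, hNa, hxN, hnR, k, hk, hidx, hsub, hwk, hP, hj⟩
    · rw [huz.get _, uK.flags.cand] at h8
      exact absurd h8 hc
    set x := z.var .x with hx
    have hnear : gdist n (graphAt E l U τ) w x ≤ R.r / 2 - slack p q R.r := (zK.flags.near x hxn (by rw [z2]; exact zx0)).2
    refine Cmd.launch_core hI.toIncCtx hb zB.static hr10 hgr zK zT haN hx.symm hxn zS.le (fun h =>
      by omega) (fun h => by omega) (by omega) ?_
    intro y yf ys yK yT yG yp
    refine ⟨⟨⟨_, _, j + 1, zB.launch yf hxn (hR ▸ ys), yK, yT, ⟨zS.le, fun a ha h => yG.out a ha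
      (zS.full a ha h), Or.inr ⟨hw, by omega, ?_, hnR, k, hk, ?_, hsub, hwk, ?_, by omega⟩⟩⟩, ?_⟩,
      ?_⟩
    · grind
    · rw [yf.get _, hidx]
    -- A source within `σ` would have set the mark of the candidate. The ball of `w` is small
    -- because `w` has not been reached, so all sample vertices are farther than `r/2` from it.
    · refine hP.insert (hI.conn_at τ) hw hxn hNa ?_ ?_ zK.src_lt (fun b hb1 hb2 => ?_) ?_
      · omega
      · omega
      · by_contra hle
        have he := (hI.est_close hgr (zK.src_lt b hb2) (z.arr 5 b) x hxn).1
        have := ((zT b hb2).noted x hxn (by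
          unfold noteRadius
          rw [if_neg (by omega), if_neg (by omega)]
          omega)).2.2 hb1
        rw [z2, show u.arr 2 x = 0 from zx0] at this
        omega
      · refine hG.hit τ hτ w hw fun i hi => ?_
        have he := (hI.est_close hgr (x := R.src E n i) (Nat.mod_lt _ (by omega)) (R.base + i) w hw).1
        refine lt_of_lt_of_le ?_ he
        by_contra hle
        exact hnR ⟨τ, zS.le, le_rfl, i, hi, Nat.le_of_not_lt hle⟩
    · have hp := pot_frame (n := n) huz
      simp only [View.pay, Expr.rules] at zt
      push_cast at zt yp
      omega
    -- The estimate of a source for itself is 0.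
    · have hx2 : y.arr 2 x = 2 := by
        have h9 := yT a (by omega)
        rw [Function.update_self] at h9
        refine (h9.noted x hxn ?_).2.2 hNa
        have he := (hI.est_close hgr hxn (y.arr 5 a) x hxn).1
        rw [gdist_self] at he
        omega
      refine Finset.card_lt_card ⟨fun a ha => ?_, fun h => ?_⟩
      · simp only [Finset.mem_filter, Finset.mem_range] at ha ⊢
        exact ⟨ha.1, fun h => ha.2 (yG.mark a ha.1 (by rw [z2]; exact h))⟩
      · have := h (Finset.mem_filter.2 ⟨Finset.mem_range.2 hxn, by
          have : u.arr 2 x = 0 := zx0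
          omega⟩)
        exact (Finset.mem_filter.1 this).2 hx2
  · have hp := pot_frame (n := n) hf0
    refine hQ _ xs a j (uB.frame hf0 rfl) (uK.frame hf0 rfl) (uT.frame hf0 rfl) (uS.frame hf0) hc ?_
    simp only [View.pay] at hp
    simp only [View.pay, Expr.rules]
    push_cast at *
    omega

/-- There is at least one sample vertex, and starting its run releases several thousand units for
each vertex, enough for setting up the round. -/
theorem Cmd.sample_spec (hI : IncPar E n p q l U K B ρ D) (hb : b = 2 * l.length) (hR :
    R.r = descent p q ρ (R.g + 1)) (hr : 0 < R.r) (ht0 : R.t0 = τ) (hB : IncBase E n p q l U K B ρ D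
    R.g 0 τ v) (hK : Core E n p q l U R (R.src E n) 0 n τ v) (hlen : v.sess.length = R.base) (hQ :
    ∀ u, IncBase E n p q l U K B ρ D R.g (sampleSize n R.r) τ u → Core E n p q l U R (R.src E n)
    (sampleSize n R.r) n τ u → AllTracked E n p q l U R (R.src E n) (sampleSize n R.r) τ u →
    u.var .idx = v.var .idx → pot n u + 5000 * n ≤ pot n v + 10 → Q u) : sample.WP E b Q v := by
  obtain ⟨h1, h2, h3, h4, h5, h6, hn2⟩ := hI.ctx.bounds
  have hr10 : R.r ≤ 10 * n := hR ▸ (hI.lt_of_pos (hR ▸ hr)).2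
  have hNn := sampleSize_le (n := n) hr
  have hN0 := sampleSize_pos (n := n) (by omega) hr
  set N := sampleSize n R.r with hN
  refine ⟨fun u => ∃ i ≤ N, IncBase E n p q l U K B ρ D R.g i τ u ∧ Core E n p q l U R (R.src E n) i
      n τ u ∧ AllTracked E n p q l U R (R.src E n) i τ u ∧ u.sess.length = R.base + i ∧
      u.var .idx = v.var .idx ∧ pot n u + 5000 * (n * i) ≤ pot n v, fun u => N - u.var .a, ⟨0,
      by omega, hB, hK, fun b hb => absurd hb (Nat.not_lt_zero b), hlen, rfl, by simp⟩, ?_⟩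
  rintro u ⟨i, hi, uB, uK, uT, ul, ui, up⟩
  have hlen' := uB.length_le hI (hR ▸ hr) (by omega)
  simp only [Cmd.WP, View.pay, View.assign, Expr.rules, uK.params.N', uK.a', ← hN, true_and]
  refine ⟨fun hne => ⟨⟨by norm_num, by omega⟩, ?_⟩, fun he => ?_⟩
  · have hf : ∀ t : ℤ, Frame u { u with var := Function.update u.var .x (u.arr 3 i), vt := t } [.x] [] := by
      intro t
      simp +contextual [Frame.iff]
    rw [uK.sample i (by omega)] at hf ⊢
    refine Cmd.launch_core hI.toIncCtx hb (uB.frame (hf _) rfl).static hr10 (hR ▸ uB.grad_le hI (hR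
      ▸ hr)) (uK.frame (hf _) rfl) (uT.frame (hf _) rfl) (by omega) (x := R.src E n i) (by simp)
      (Nat.mod_lt _ (by omega)) ht0.le (fun _ => ⟨rfl, ul⟩) (fun h => by omega)
      (by simp only; omega) ?_
    intro y yf ys yK yT yG yp
    rw [Function.update_eq_self] at yK yT
    refine ⟨⟨i + 1, by omega, (uB.frame (hf (u.vt + (2 + 2 + 1 + 1) + (2 + 6 + 2))) rfl).launch
      (j := i) (X := [.cur, .j, .a1, .a2, .b, .a, .y, .e, .cnt, .cand, .t, .acc]) (J := [2, 5, 6,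
      7]) ?_ (Nat.mod_lt _ (by omega)) (hR ▸ ys) (by simp) (by simp), yK, yT, ?_, ?_, ?_⟩, ?_⟩
    · grind
    · grind
    · rw [yf.get _]; simpa using ui
    · rw [pot_frame (hf _)] at yp
      push_cast at yp ⊢
      rw [mul_add]
      omega
    · rw [yK.a']; omega
  · have hf : ∀ t : ℤ, Frame u { u with vt := t } [] [] := fun t => ⟨fun _ _ => rfl, fun _ _ => rfl, rfl, rfl⟩
    have hiN : i = N := by omega
    subst hiN
    refine hQ _ (uB.frame (hf _) rfl) (uK.frame (hf _) rfl) (uT.frame (hf _) rfl) ui ?_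
    rw [pot_frame (hf _)]
    have : (n : ℤ) ≤ n * N := le_mul_of_one_le_right (by positivity) (by exact_mod_cast hN0)
    push_cast
    omega

/-- Acceptance has made the old guess an upper bound, so its threshold is what may be shown from now
on. When the guess reaches 0 no runs are needed: a connected graph on at least two vertices has
positive radius. -/
theorem Cmd.nextGuess_spec (hI : IncPar E n p q l U K B ρ D) (hb : b = 2 * l.length) (hτ :
    τ ≤ U.length) (h : Accepted E n p q l U K B ρ D g τ v) (hg0 : 0 < descent p q ρ g) (hQ : ∀ u,
    Settled E n p q l U K B ρ D g τ u → pot n u ≤ pot n v + 300 → (0 < descent p q ρ (g + 1) →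
    pot n u + 10 ≤ pot n v) → Q u) :
    nextGuess.WP E b Q v := by
  obtain ⟨h1, h2, h3, h4, h5, h6, hn2⟩ := hI.ctx.bounds
  have hr10 : descent p q ρ g ≤ 10 * n := (descent_le p q ρ g).trans (by have := hI.ρ_le; omega)
  have hpr : p * descent p q ρ g ≤ 10 * (n * q) := by
    calc p * descent p q ρ g ≤ q * (10 * n) := Nat.mul_le_mul hI.ctx.p_lt.le hr10
      _ = 10 * (n * q) := by ring
  have hσ := slack_le (r := descent p q ρ g) hI.ctx.p_lt
  have hd := Nat.div_le_self (p * descent p q ρ g) (32 * q)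
  have hthr : threshold p q (descent p q ρ g) ≤ 50 * n := by unfold threshold; omega
  have hq0 : 0 < q := hI.ctx.p_pos.trans hI.ctx.p_lt
  have hsucc : descent p q ρ g - (1 + p * descent p q ρ g / (32 * q)) = descent p q ρ (g + 1) := rfl
  simp only [nextGuess, Cmd.WP, View.pay, View.assign, Expr.rules, Function.update_apply,
    reduceCtorEq, if_false, if_true, true_and, h.params.thr', h.params.sg', h.params.r',
    h.static.n', h.static.p', h.static.q', hsucc]
  refine ⟨by omega, ⟨by omega, ⟨by omega, by omega, by omega⟩, by omega⟩, by omega, by omega, by omega, ?_⟩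
  suffices H : ∀ z : View, Frame v z [.out, .r, .a, .acc, .w, .cand] [] → z.sess = v.sess →
      z.used = v.used → z.var .out = threshold p q (descent p q ρ g) + slack p q (descent p q ρ g) →
      z.var .r = descent p q ρ (g + 1) → z.var .a = 0 → z.var .acc = 0 → z.var .w = n → z.var .cand = 0 →
      z.vt ≤ v.vt + 50 → (descent p q ρ (g + 1) ≠ 0 → params.WP E b (draw.WP E b (clear.WP E b fun u =>
        0 < 2 ^ E.w ∧ sample.WP E b (rechoose.WP E b (cover.WP E b Q))
          { u with var := Function.update (Function.update u.var .cnt (u.var .n)) .idx 0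
                   vt := u.vt + ((2 : ℕ) + 2) + ((1 : ℕ) + 2) })) z) ∧
      (descent p q ρ (g + 1) = 0 → Q z) by
    have hfr : ∀ t : ℤ, Frame v { v with
        var := Function.update (Function.update (Function.update (Function.update (Function.update
          (Function.update v.var .out (threshold p q (descent p q ρ g) + slack p q (descent p q ρ g)))
          .r (descent p q ρ (g + 1))) .a 0) .acc 0) .w n) .cand 0, vt := t }
        [.out, .r, .a, .acc, .w, .cand] [] := by
      intro t
      simp +contextual [Frame.iff]
    refine ⟨(H _ (hfr _) rfl rfl ?_ ?_ ?_ ?_ ?_ ?_ ?_).1, (H _ (hfr _) rfl rfl ?_ ?_ ?_ ?_ ?_ ?_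
      ?_).2⟩ <;> simp only [Function.update_self, Function.update_of_ne, ne_eq, reduceCtorEq,
      not_false_eq_true] <;> (push_cast; omega)
  intro z zf zs zu zout zr za zacc zw zcand zt
  have hnn : (0 : ℤ) ≤ ∑ b ∈ Finset.range (v.var .a), ((n - v.arr 6 b : ℕ) : ℤ) := Finset.sum_nonneg
    fun _ _ => by positivity
  have hnw : (0 : ℤ) ≤ if v.var .w < n then 200 * (n : ℤ) else 0 := by split_ifs <;> positivity
  have hpv : v.vt ≤ pot n v := by unfold pot; omega
  have hp0 : ∀ u : View, u.var .a = 0 → u.var .w = n → pot n u = u.vt := by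
    intro u h1 h2
    simp [pot, h1, h2]
  have hbase : ∀ u : View, Frame v u [.out, .r, .a, .acc, .w, .cand, .sg, .hS, .hA, .thr, .k, .N, .i, .y, .cnt, .idx]
      [2, 3, 4, 7] → u.sess = v.sess → u.var .out = z.var .out → IncBase E n p q l U K B ρ D g 0 τ u := by
    intro u uf us uo
    refine ⟨h.static.frame uf, uo.trans zout, h.le_out, fun F hF => ?_, us ▸ h.sessions⟩
    rw [us]
    simpa using h.cost F hF
  refine ⟨fun hne => ?_, fun he => ?_⟩
  · have hr0 : 0 < descent p q ρ (g + 1) := by omega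
    have hrn := (hI.lt_of_pos hr0).2
    refine Cmd.params_spec hI.ctx (by rw [zf.get _, h.static.n']) (by rw [zf.get _, h.static.p'])
      (by rw [zf.get _, h.static.q']) zr hr0 hrn ?_
    intro u uf us uu ut uP
    refine Cmd.draw_spec hI.ctx hb (by rw [uf.get _, zf.get _, h.static.n']) ?_
    intro x xf xs' xu xt xn xo
    refine Cmd.clear_spec hI.ctx hb (by rw [xf.get _, uf.get _, zf.get _, h.static.n']) ?_
    intro y yf ys yu yt y2 y2n
    refine ⟨by omega, ?_⟩
    have hzx : Frame z x [.sg, .hS, .hA, .thr, .k, .N, .i, .y] [2, 3, 4, 7] := (uf.weaken).trans xf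
    have hzy : Frame z y [.sg, .hS, .hA, .thr, .k, .N, .i, .y] [2, 3, 4, 7] := hzx.trans yf
    have hvy : Frame v y [.out, .r, .a, .acc, .w, .cand, .sg, .hS, .hA, .thr, .k, .N, .i, .y] [2, 3,
      4, 7] := (zf.weaken).trans hzy
    have hxy : ∀ j, j ≠ 2 → y.arr j = x.arr j := fun j hj => yf.arr j (by simpa using hj)
    have en : y.var .n = n := by rw [hvy.get _, h.static.n']
    have hused : x.used = 2 * n * (g + 1) ∧ u.used = 2 * n * g := by
      have h9 := h.used
      grind
    have husess : y.sess = v.sess := by rw [ys, xs', us, zs]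
    simp only [en]
    set o : View := { y with var := Function.update (Function.update y.var .cnt n) .idx 0, vt := y.vt + ((2 : ℕ) + 2) + ((1 : ℕ) + 2) } with ho
    have hyo : Frame y o [.cnt, .idx] [] := by
      exact Frame.iff.2 (by simp +contextual)
    have hvo : Frame v o [.out, .r, .a, .acc, .w, .cand, .sg, .hS, .hA, .thr, .k, .N, .i, .y, .cnt,
        .idx] [2, 3, 4, 7] := (hvy.weaken).trans hyo
    have oB := hbase o hvo husess (by rw [hyo.get _, hzy.get _])
    let R : Round := ⟨g, descent p q ρ (g + 1), v.sess.length, τ⟩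
    have o7 : ∀ a < n, o.arr 7 a = 0 := fun a ha => by
      show y.arr 7 a = 0
      grind
    have o2 : ∀ a < n, o.arr 2 a = 1 := y2
    have hz7 : zeros n (o.arr 7) = n := by
      unfold zeros
      rw [Finset.filter_true_of_mem fun a ha => o7 a (Finset.mem_range.1 ha), Finset.card_range]
    have hz2 : zeros n (o.arr 2) = 0 := by
      by_contra h
      obtain ⟨y, hy, h⟩ := zeros_pos.1 h
      rw [o2 y hy] at h
      omega
    have hva : ∀ i, n ≤ i → x.arr 2 i = v.arr 2 i ∧ x.arr 7 i = v.arr 7 i := by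
      intro i hi
      rw [(xo i hi).1, (xo i hi).2, uf.mem _, uf.mem _, zf.mem _, zf.mem _]
      exact ⟨rfl, rfl⟩
    have oK : Core E n p q l U R (R.src E n) 0 n τ o := by
      refine ⟨(uP.frame xf (by simp)).frame (u := o) ((yf.weaken (X' := [.i, .cnt,
        .idx]) (J' := [2]) (by simp) (by simp)).trans hyo (by simp) (by simp)) (by simp), ?_, ?_,
        ?_, ?_, ?_, ?_, by simp, by simp, by simp, by simp, fun h9 => absurd ?_ h9⟩
      · rw [hyo.get _, hzy.get _, za]
      · rw [hyo.get _, hzy.get _, zw]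
      · grind
      · intro i hi
        show y.arr 3 i = _
        rw [hxy 3 (by simp), (xn i hi).1, hused.2]
        rfl
      · intro i hi
        show y.arr 4 i = _
        rw [hxy 4 (by simp), (xn i hi).2.1, hused.2]
        rfl
      · constructor
        · grind
        · grind
        · grind
        · grind
        · grind
        · rw [hz2, hyo.get _, hzy.get _, zcand]
        · exact (y2n.trans (hva n le_rfl).1).trans h.sent2
        · show y.arr 7 n = 0
          rw [hxy 7 (by simp)]
          exact (hva n le_rfl).2.trans h.sent7
      · rw [hyo.get _, hzy.get _, zacc]
    have hbaseR : R.base ≤ 40 * (n * n * n) := by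
      have := oB.length_le hI hr0 (by omega)
      grind
    refine Cmd.sample_spec (R := R) hI hb rfl hr0 rfl oB oK (congrArg _ husess) ?_
    intro a aB aK aT aidx ap
    have hfull : ∀ y < n, R.Reached E n p q l U τ y → a.arr 7 y ≠ 0 := by
      rintro y hy ⟨t, ht1, ht2, i, hi, hle⟩
      have htt : t = τ := le_antisymm ht2 ht1
      subst htt
      refine ((aT i hi).noted y hy ?_).1 hi
      rw [aK.sid_eq i hi hi]
      unfold noteRadius
      rwa [if_pos hi]
    have hG := hI.good_round (R := R) rfl hr0 hbaseR hτ
    refine Cmd.rechoose_spec (R := R) hI hb rfl hr0 aB aK aT le_rfl le_rfl hfull hG (k := 0) ?_ (Nat.zero_le _) rfl ?_ ?_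
    · grind
    · unfold roundBound; omega
    intro c xs'' a' w' j' cB cK cT cS _ cp
    refine Cmd.cover_spec (R := R) hI hb rfl hr0 hτ cB cK cT cS hG ?_
    intro d xs3 a3 j3 dB dK dT dS dc dp
    have hop : pot n o ≤ pot n v + 350 * n + 400 := by
      rw [hp0 o oK.a' oK.w']
      show y.vt + ((2 : ℕ) + 2) + ((1 : ℕ) + 2) ≤ _
      push_cast at *
      omega
    have hfin : pot n d + 10 ≤ pot n v := by omega
    refine hQ d ⟨dK.params.r', j3, dB, dc, Or.inr ⟨R, xs3, a3, w', rfl, rfl, hr0, hbaseR, hτ,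
      dB.grad_le hI hr0, dK, dT, dS⟩⟩ (by omega) fun _ => hfin
  · refine hQ z ⟨zr, 0, hbase z (zf.weaken) zs rfl, zcand, Or.inl ⟨he, za, zw, zacc,
      by rw [zf.mem _]; exact h.sent7, rfl⟩⟩ ?_ (fun h => by omega)
    rw [hp0 z za zw]
    omega

/-- The guess itself is the variant. A round with a positive guess saves time; only the step to the
guess 0 adds a constant, and it can happen just once, which is why the potential is bounded
separately for nonzero guesses. -/
theorem Cmd.lower_spec (hI : IncPar E n p q l U K B ρ D) (hb : b = 2 * l.length) (hτ :
    τ ≤ U.length) (h : Settled E n p q l U K B ρ D g τ v) (hQ : ∀ u g', g ≤ g' → Settled E n p q l U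
    K B ρ D g' τ u → u.var .acc = 0 → pot n u ≤ pot n v + 310 → Q u) : lower.WP E b Q v := by
  refine ⟨fun u => (∃ g', g ≤ g' ∧ Settled E n p q l U K B ρ D g' τ u) ∧ pot n u ≤ pot n v + 303 ∧
      (u.var .r ≠ 0 → pot n u ≤ pot n v), fun u => u.var .r, ⟨⟨g, le_rfl, h⟩, by omega, fun _ => le_rfl⟩, ?_⟩
  rintro u ⟨⟨g', hg, uS⟩, up, up'⟩
  have hf0 : Frame u (u.pay 3) [] [] := ⟨fun _ _ => rfl, fun _ _ => rfl, rfl, rfl⟩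
  have hp : pot n (u.pay ((↟.acc : Expr).cost + 1)) = pot n u + 3 := by
    have := pot_frame (n := n) (u := u.pay ((↟.acc : Expr).cost + 1)) (v := u) (X := []) (J := [])
      ⟨fun _ _ => rfl, fun _ _ => rfl, rfl, rfl⟩ (by simp) (by simp)
    rw [this]
    simp [View.pay]
  have uS' : Settled E n p q l U K B ρ D g' τ (u.pay 3) := by
    obtain ⟨hr, j, hB, hc, hh⟩ := uS
    refine ⟨hr, j, hB.frame hf0 rfl, hc, hh.imp (fun h => h) ?_⟩
    rintro ⟨R, xs, a, w, e1, e2, e3, e4, e5, e6, hK, hT, hS⟩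
    exact ⟨R, xs, a, w, e1, e2, e3, e4, e5, e6, hK.frame hf0 rfl, hT.frame hf0 rfl, hS.frame hf0⟩
  refine ⟨trivial, fun hacc => ?_, fun hacc => ?_⟩
  · obtain ⟨hA, hr0⟩ := uS'.accepted hI hacc
    refine Cmd.nextGuess_spec hI hb hτ hA hr0 ?_
    intro z zS zp zp'
    have hur : u.var .r = descent p q ρ (g' + 1) := uS.1
    have hup := up' (by omega)
    refine ⟨⟨⟨g' + 1, by omega, zS⟩, by omega, fun h => ?_⟩, ?_⟩
    · have := zp' (by have := zS.1; omega)
      omega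
    · change z.var .r < u.var .r
      have h1 : z.var .r = descent p q ρ (g' + 1) - (1 + p * descent p q ρ (g' + 1) / (32 * q)) := zS.1
      grind
  · refine hQ _ g' hg uS' hacc ?_
    omega

end specs

namespace Cmd

/-- Pass the update to the runs with indices below `b`. -/
def refresh : Cmd := .whil ↟.b (.set .b (↟.b - 1) ;; .set .cur (.arr 5 ↟.b) ;; .tell .cur .a1 .a2 ;;
  settle)

/-- Process an insertion. -/
def insertion : Cmd := .inp .a1 ;; .inp .a2 ;; .aset 0 ↟.U ↟.a1 ;; .aset 1 ↟.U ↟.a2 ;; .set .U (↟.U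
  + 1) ;; .set .b ↟.a ;; refresh ;; .ite (.arr 7 ↟.w) rechoose .skip ;; cover ;; lower

end Cmd

section specs

variable {E : Env} {b n p q : ℕ} {l U : List Edge} {Q : View → Prop} {v u : View} {K : ℕ}
  {B : ℕ → ℕ} {ρ D g j : ℕ} {R : Round} {xs : ℕ → ℕ} {a w τ : ℕ}

theorem pot_settle {c t : ℕ} {v u : View} (hc : c < t) (ha : u.var .a = t) (ha' : v.var .a = t) (hw
    : u.var .w = v.var .w) (h6 : ∀ b, b ≠ c → u.arr 6 b = v.arr 6 b) {d : ℤ} (hvt : u.vt + 50 * (n -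
    u.arr 6 c : ℕ) ≤ v.vt + 50 * (n - v.arr 6 c : ℕ) + d) : pot n u ≤ pot n v + d := by
  unfold pot
  rw [ha, ha', hw, ← Finset.add_sum_erase (Finset.range t) _ (Finset.mem_range.2 hc),
    ← Finset.add_sum_erase (Finset.range t) (fun b => ((n - v.arr 6 b : ℕ) : ℤ)) (Finset.mem_range.2
    hc), Finset.sum_congr rfl fun b hb => by rw [h6 b (Finset.ne_of_mem_erase hb)]]
  grind

/-- In the loop the runs with index at least `c` know the insertion and the others do not yet. Flags
set in between remain right, as they refer to distances in the new graph, which are not larger than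
the old ones. -/
theorem Cmd.refresh_spec (hI : IncPar E n p q l U K B ρ D) (hb : b = 2 * l.length) (hR :
    R.r = descent p q ρ (R.g + 1)) (hr : 0 < R.r) (hτ : τ < U.length) (h1 : v.var .a1 = U[τ].1) (h2
    : v.var .a2 = U[τ].2) (hvb : v.var .b = a) (ha : a ≤ 3 * n) (ht0 : R.t0 ≤ τ + 1) (hw : ∀ c < a,
    c = sampleSize n R.r → xs c = w) (hB : IncBase E n p q l U K B ρ D R.g j (τ + 1) v) (hK :
    Core E n p q l U R xs a w (τ + 1) v) (hT : AllTracked E n p q l U R xs a τ v) (hQ : ∀ u,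
    IncBase E n p q l U K B ρ D R.g j (τ + 1) u → Core E n p q l U R xs a w (τ + 1) u →
    AllTracked E n p q l U R xs a (τ + 1) u → Grows n v u → u.var .idx = v.var .idx →
    pot n u ≤ pot n v + 10 → Q u) : refresh.WP E b Q v := by
  obtain ⟨b1, b2, b3, b4, b5, b6, hn2⟩ := hI.ctx.bounds
  have hr10 : R.r ≤ 10 * n := hR ▸ (hI.lt_of_pos (hR ▸ hr)).2
  have hgr : grad n (graphAt E l U (τ + 1)) ≤ 8 * R.r := hR ▸ hB.grad_le hI (hR ▸ hr)
  have hte : U.take (τ + 1) = U.take τ ++ [U[τ]] := (List.take_concat_get' U τ hτ).symm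
  refine ⟨fun u => ∃ c ≤ a, u.var .b = c ∧ u.var .a1 = U[τ].1 ∧ u.var .a2 = U[τ].2 ∧
      IncBase E n p q l U K B ρ D R.g j (τ + 1) u ∧ Core E n p q l U R xs a w (τ + 1) u ∧
      (∀ b, c ≤ b → b < a → Tracked E n p q l (U.take (τ + 1)) R.r b (xs b) u) ∧
      (∀ b < c, Tracked E n p q l (U.take τ) R.r b (xs b) u) ∧ Grows n v u ∧
      u.var .idx = v.var .idx ∧ pot n u ≤ pot n v, fun u => u.var .b,
    ⟨a, le_rfl, hvb, h1, h2, hB, hK, fun b hb hb' => by omega, hT, Grows.of_eq rfl rfl, rfl, le_rfl⟩, ?_⟩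
  rintro u ⟨c, hc, uc, u1, u2, uB, uK, uT, uT', uG, ui, up⟩
  have hf0 : ∀ t : ℤ, Frame u { u with vt := t } [] [] := fun t => ⟨fun _ _ => rfl, fun _ _ => rfl, rfl, rfl⟩
  simp only [Cmd.WP, View.pay, View.assign, Expr.rules, uc, true_and, Function.update_self, ne_eq,
    reduceCtorEq, not_false_eq_true, Function.update_of_ne, u1, u2]
  refine ⟨fun hne => ⟨by omega, ⟨by norm_num, by omega⟩, ?_⟩, fun hc0 => ?_⟩
  · obtain ⟨d, rfl⟩ : ∃ d, c = d + 1 := ⟨c - 1, by omega⟩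
    simp only [Nat.add_sub_cancel]
    have hTd := uT' d (by omega)
    have hxd := uK.src_lt d (by omega)
    have hleg := hI.legal_at (τ + 1)
    rw [hte] at hleg
    have hupd := ((legalSeq_append _ _ _ _ _).1 hleg).2
    set id := u.arr 5 d with hid
    set I : SSSPInput := ⟨n, l, xs d, 16 * R.r, p, 256 * q⟩ with hIdef
    have hval : I.Valid := ⟨hI.ctx.edges, hxd, hI.ctx.p_pos, by
      have := hI.ctx.p_lt; simp only [hIdef]; omega⟩
    have hlen : id < u.sess.length := (List.getElem?_eq_some_iff.1 hTd.run).1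
    refine ⟨_, hTd.run, hval, hleg, hupd, ?_⟩
    simp only [Prod.mk.eta, List.nil_append]
    suffices H : ∀ t : ℤ, t ≤ u.vt - 9900 → settle.WP E b (fun x => (∃ c ≤ a, x.var .b = c ∧ x.var
        .a1 = U[τ].1 ∧ x.var .a2 = U[τ].2 ∧ IncBase E n p q l U K B ρ D R.g j (τ + 1) x ∧ Core E n p
        q l U R xs a w (τ + 1) x ∧ (∀ b, c ≤ b → b < a → Tracked E n p q l (U.take (τ + 1)) R.r b
        (xs b) x) ∧ (∀ b < c, Tracked E n p q l (U.take τ) R.r b (xs b) x) ∧ Grows n v x ∧ x.var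
        .idx = v.var .idx ∧ pot n x ≤ pot n v) ∧ x.var .b < d + 1) { u with
          var := Function.update (Function.update u.var .b d) .cur id
          sess := u.sess.set id ⟨I, U.take τ ++ [U[τ]], E.box.changed id I (U.take τ ++ [U[τ]])⟩
          vt := t } from H _ (by push_cast; omega)
    intro t ht
    set z : View := { u with
          var := Function.update (Function.update u.var .b d) .cur id
          sess := u.sess.set id ⟨I, U.take τ ++ [U[τ]], E.box.changed id I (U.take τ ++ [U[τ]])⟩
          vt := t } with hz
    have hzf : Frame u z [.b, .cur] [] := by
      exact Frame.iff.2 (by simp +contextual)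
    have zd : z.arr 5 d = id := rfl
    have zF := uK.flags.congr (u := z) rfl rfl (hzf.get _) (hzf.get _)
    refine Cmd.settle_spec hI.ctx hb (by rw [hzf.get _, uB.static.n']) (uK.params.frame hzf
      (by simp)) hr10 (B := d) (x := xs d) (us := U.take (τ + 1)) (by simp [hz]) (by omega) (un :=
      E.box.changed id I (U.take τ ++ [U[τ]])) ?_ (hI.ctx.box.changed_lt _ I _ hval hleg) (f := _)
      rfl ?_ (fun y hy => (hI.est_close hgr hxd _ y hy).2) hTd.ptr_le (fun y hy => (hI.gdist_le
      (Nat.le_succ τ) _ _).trans (hTd.ptr y hy)) zF ?_ ?_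
    · grind
    · intro y hy hun he
      rw [zd] at he
      have heq : wordEst E id I (U.take (τ + 1)) y = wordEst E id I (U.take τ) y := by
        unfold wordEst
        rw [hte, show E.box.est id I (U.take τ ++ [U[τ]]) y = E.box.est id I (U.take τ) y from by
          by_contra hne
          exact hun (hI.ctx.box.mem_changed_update _ I _ _ hval hleg y hy hne)]
      rw [← hIdef, heq] at he
      exact hTd.noted y hy he
    · intro y hy he
      rw [zd] at he
      obtain ⟨k1, k2⟩ := hI.allowed hgr hxd hy he
      refine ⟨fun h => ?_, fun h => ?_, fun h => ⟨d, h, by omega, k2 h⟩⟩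
      · refine ⟨τ + 1, ht0, le_rfl, d, h, ?_⟩
        rw [← uK.src_eq d (by omega) h, ← uK.sid_eq d (by omega) h]
        unfold noteRadius at he
        rwa [if_pos h] at he
      · grind
    · intro x xf xs' xu x6 xacc xacc' xT xF xG xt
      rw [zd] at xs'
      have xs'' : x.sess = u.sess.set id ⟨I, U.take (τ + 1), []⟩ := by simp_all
      have hux : Frame u x [.b, .cur, .y, .e, .cnt, .cand, .t, .acc] [2, 6, 7] := (hzf.weaken).trans
        xf
      have x5 : x.arr 5 = u.arr 5 := hux.mem _
      have hoth : ∀ c < a, c ≠ d → ∀ us, Tracked E n p q l us R.r c (xs c) u → Tracked E n p q l us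
          R.r c (xs c) x := by
        intro c hca hcd us h
        refine h.congr (by rw [x5]) (x6 c hcd) ?_ (fun h => xacc (by rwa [hzf.get _])) ?_
        -- Run numbers increase strictly with the index, so changing one run leaves the others
        -- untouched.
        · rw [xs'', List.getElem?_set_ne]
          rcases Nat.lt_or_gt_of_ne hcd with h | h
          · have := uK.sid_lt d (by omega) c h; omega
          · have := uK.sid_lt c hca d h; omega
        · exact ⟨xG.out, xG.mark, xG.near⟩
      have hpx := pot_settle (n := n) (c := d) (t := a) (d := 300) (u := x) (v := z) (by omega)
        (by rw [hux.get _, uK.a']) (by rw [hzf.get _, uK.a']) (xf.get _) x6 xt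
      have hpz := pot_frame (n := n) hzf
      have hzt : z.vt = t := rfl
      refine ⟨⟨d, by omega, by rw [xf.get _]; simp [hz], by rw [hux.get _, u1],
        by rw [hux.get _, u2], ?_, ?_, ?_, ?_, ?_, by rw [hux.get _, ui], by omega⟩,
        by rw [xf.get _]; simp [hz]⟩
      · refine ⟨uB.static.frame hux, by rw [hux.get _, uB.out], uB.le_out, fun F hF => ?_, ?_⟩
        · rw [xs'', sessCost_set F u.sess id _ ⟨I, U.take (τ + 1), []⟩ hTd.run rfl]
          exact uB.cost F hF
        · rw [xs'']
          exact uB.sessions.set hTd.run rfl List.prefix_rfl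
      · refine ⟨uK.params.frame hux (by simp), by rw [hux.get _, uK.a'], by rw [hux.get _, uK.w'],
          xu.trans uK.used, ?_, ?_, xF, uK.src_lt, uK.src_eq, ?_, ?_, ?_⟩
        · rw [hux.mem _]; exact uK.sample
        · rw [hux.mem _]; exact uK.word
        · rw [x5]; exact uK.sid_lt
        · rw [x5]; exact uK.sid_eq
        · intro h
          rcases xacc' h with h | h
          · exact uK.acc (by rwa [hzf.get _] at h)
          · exact _root_.grad_le (hI.conn_at _) hxd h
      · grind
      · grind
      · exact ⟨fun y hy h => xG.out y hy (uG.out y hy h), fun y hy h => xG.mark y hy (uG.mark y hy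
          h), fun y hy h => xG.near y hy (uG.near y hy h)⟩
  · subst hc0
    have hp := pot_frame (n := n) (hf0 (u.vt + (((1 : ℕ) : ℤ) + 1)))
    refine hQ _ (uB.frame (hf0 _) rfl) (uK.frame (hf0 _) rfl) (AllTracked.frame (fun b hb => uT b
      (Nat.zero_le b) hb) (hf0 _) rfl) ?_ ui ?_
    · exact ⟨uG.out, uG.mark, uG.near⟩
    · rw [pot_frame (hf0 _)]
      push_cast
      omega

end specs

section specs

variable {E : Env} {b n p q : ℕ} {l U : List Edge} {Q : View → Prop} {v u : View} {K : ℕ}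
  {B : ℕ → ℕ} {ρ D g j : ℕ} {R : Round} {xs : ℕ → ℕ} {a w τ : ℕ}

theorem Settled.set_inp (h : Settled E n p q l U K B ρ D g τ v) (L : List ℕ) : Settled E n p q l U K
    B ρ D g τ { v with inp := L } := by
  obtain ⟨hr, j, ⟨⟨a1, a2, a3, a4, a5, a6, a7, a8⟩, b2, b3, b4, b5⟩, hc, hh⟩ := h
  refine ⟨hr, j, ⟨⟨a1, a2, a3, a4, a5, a6, a7, a8⟩, b2, b3, b4, b5⟩, hc, hh.imp id ?_⟩
  rintro ⟨R, xs, a, w, e1, e2, e3, e4, e5, e6, ⟨⟨c1, c2, c3, c4, c5, c6, c7⟩, d2, d3, d4, d5, d6,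
    ⟨f1, f2, f3, f4, f5, f6, f7, f8⟩, d8, d9, d10, d11, d12⟩, hT, ⟨s1, s2, s3⟩⟩
  exact ⟨R, xs, a, w, e1, e2, e3, e4, e5, e6, ⟨⟨c1, c2, c3, c4, c5, c6, c7⟩, d2, d3, d4, d5, d6,
    ⟨f1, f2, f3, f4, f5, f6, f7, f8⟩, d8, d9, d10, d11, d12⟩, fun b hb => ⟨(hT b hb).run,
    (hT b hb).ptr_le, (hT b hb).ptr, (hT b hb).acc, (hT b hb).halt, (hT b hb).noted⟩, ⟨s1, s2, s3⟩⟩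

theorem Core.next (hI : IncCtx E n p q l U) (h : Core E n p q l U R xs a w τ v) : Core E n p q l U R
    xs a w (τ + 1) v := { h with
    flags := h.flags.mono (fun _ _ h => h.mono (Nat.le_succ _)) (fun _ _ h => ⟨h.1, (hI.gdist_le
      (Nat.le_succ τ) _ _).trans h.2⟩) fun _ _ ⟨b, h1, h2, h3⟩ => ⟨b, h1, h2, (hI.gdist_le
      (Nat.le_succ τ) _ _).trans h3⟩
    acc := fun h' => (hI.grad_le (Nat.le_succ τ)).trans (h.acc h') }

theorem Cmd.whil_of_zero {e : Expr} {P : Cmd} (h : e.ok E b v) (h0 : e.eval E v = 0)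
    (hQ : Q (v.pay (e.cost + 1))) : (whil e P).WP E b Q v :=
  ⟨(· = v), fun _ => 0, rfl, by rintro u rfl; exact ⟨h, fun h => absurd h0 h, fun _ => hQ⟩⟩

/-- All runs have to be refreshed before the representative is judged, since only then do the
exclusion flags tell exactly which vertices have been reached. After a replacement or new candidates
the sources are completed, and an accepted source lowers the guess. -/
theorem Cmd.insertion_spec (hI : IncPar E n p q l U K B ρ D) (hb : b = 2 * l.length) (hτ :
    τ < U.length) (h : Settled E n p q l U K B ρ D g τ v) (hacc : v.var .acc = 0) (hin :
    v.inp = [U[τ].1, U[τ].2]) (hQ : ∀ u g', g ≤ g' → Settled E n p q l U K B ρ D g' (τ + 1) u →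
    u.var .acc = 0 → pot n u ≤ pot n v + 1000 → Q u) : insertion.WP E b Q v := by
  obtain ⟨b1, b2, b3, b4, b5, b6, hn2⟩ := hI.ctx.bounds
  have hUn := hI.length_le
  have hte : U.take (τ + 1) = U.take τ ++ [U[τ]] := (List.take_concat_get' U τ hτ).symm
  have he := hI.legal.isEdge hI.ctx.edges U[τ] (List.getElem_mem hτ)
  have he1 : U[τ].1 < U[τ].2 := he.1
  have he2 : U[τ].2 < n := he.2
  have m1 : U[τ].1 % 2 ^ E.w = U[τ].1 := Nat.mod_eq_of_lt (by omega)
  have m2 : U[τ].2 % 2 ^ E.w = U[τ].2 := Nat.mod_eq_of_lt (by omega)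
  have h' := h.set_inp []
  set v₀ : View := { v with inp := [] } with hv₀
  have hp0 : pot n v₀ = pot n v := rfl
  obtain ⟨hr, j, hB, hc, hh⟩ := h'
  have hlen : (U.take τ).length = τ := by simp; omega
  have hU := hB.static.U'
  rw [hlen] at hU
  have hU' : v.var .U = τ := hU
  suffices H : ∀ z : View, Frame v₀ z [.a1, .a2, .U, .b] [0, 1] → z.sess = v.sess → z.used = v.used
      → z.var .a1 = U[τ].1 → z.var .a2 = U[τ].2 → z.var .U = τ + 1 → z.var .b = v.var .a → z.arr 0 =
      Function.update (v.arr 0) τ U[τ].1 → z.arr 1 = Function.update (v.arr 1) τ U[τ].2 → z.vt ≤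
      v.vt + 100 → (refresh ;; .ite (.arr 7 ↟.w) rechoose .skip ;; cover ;; lower).WP E b Q z by
    unfold insertion
    generalize (refresh ;; .ite (.arr 7 ↟.w) rechoose .skip ;; cover ;; lower) = P at H
    simp only [Cmd.WP, View.assign, Expr.rules, Function.update_apply, reduceCtorEq, if_false, if_true,
    true_and, hin, List.headD_cons, List.tail_cons, m1, m2, hU']
    refine ⟨by omega, by omega, by omega, by omega, by omega, H _ ?_ rfl rfl ?_ ?_ ?_ ?_ ?_ ?_ (by grind)⟩
    · exact Frame.iff.2 (by simp +contextual [hv₀])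
    all_goals simp
  intro z zf zs zu z1 z2 zU zb za0 za1 zt
  have zB : IncBase E n p q l U K B ρ D g j (τ + 1) z := by
    refine ⟨?_, by rw [zf.get _, hB.out], (hI.grad_le (Nat.le_succ τ)).trans hB.le_out, zs ▸ hB.cost, ?_⟩
    · rw [hte]
      refine (hB.static.append (u := { z with var := Function.update z.var .b (v.var .b) }) (e := U[τ])
        (fun x h1 h2 h3 => ?_) (by simp [zU, hlen]) zf.low (by rw [hlen]; exact za0)
        (by rw [hlen]; exact za1)).frame (X := [.b]) (J := []) (Frame.iff.2 (by simp +contextual)) (by simp) (by simp)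
      by_cases h4 : x = .b
      · grind
      · simpa [h4] using zf.var x (by simp [h1, h2, h3, h4])
    · intro c hc
      rw [zs] at hc
      obtain ⟨c1, c2, c3, c4, c5, c6⟩ := hB.sessions c hc
      grind
  have hpz := pot_frame (n := n) zf
  have hvt0 : v₀.vt = v.vt := rfl
  simp only [Cmd.WP]
  rcases hh with ⟨h1, h2, h3, h4, h5, h6⟩ | ⟨R, xs, a, w, rfl, e2, e3, e4, e5, e6, hK, hT, hS⟩
  -- The guess is 0 and there are no runs. The index `n` stands for a missing representative, and
  -- the sentinel in array 7 makes it count as not excluded, so all the loops are empty.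
  · have zw : z.var .w = n := by rw [zf.get _, h3]
    refine Cmd.whil_of_zero trivial (zb.trans h2) ?_
    simp only [Expr.rules, View.pay, zw, show z.arr 7 n = 0 by rw [zf.mem _, h5]]
    refine ⟨⟨trivial, by norm_num, by omega⟩, fun h => absurd rfl h, fun _ => ?_⟩
    refine Cmd.whil_of_zero trivial ((zf.get .cand).trans hc) ?_
    refine Cmd.whil_of_zero trivial ((zf.get .acc).trans h4) ?_
    simp only [View.pay, Expr.rules]
    have hf : ∀ t : ℤ, Frame z { z with vt := t } [] [] := fun t => ⟨fun _ _ => rfl, fun _ _ => rfl, rfl, rfl⟩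
    refine hQ _ g le_rfl ⟨(zf.get .r).trans hr, j, zB.frame (hf _) rfl, (zf.get .cand).trans hc,
      Or.inl ⟨h1, (zf.get .a).trans h2, zw, (zf.get .acc).trans h4,
      by rw [← h5]; exact congrFun (zf.mem 7) n, h6⟩⟩ ((zf.get .acc).trans h4) ?_
    rw [pot_frame (n := n) (hf _)]
    push_cast
    omega
  · have hNn := sampleSize_le (n := n) e3
    have haN : sampleSize n R.r ≤ a := by rcases hS.stage with h | h <;> omega
    have ha3 := hS.a_lt hI e3
    have zK := (hK.frame zf zu).next hI.toIncCtx
    have zT := hT.frame zf zs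
    have hxw : ∀ c < a, c = sampleSize n R.r → xs c = w := by
      rintro c hca rfl
      rcases hS.stage with h | h
      · omega
      · grind
    refine Cmd.refresh_spec hI hb e2 e3 hτ z1 z2 (zb.trans hK.a') ha3.le (hS.le.trans (Nat.le_succ _)) hxw zB zK zT ?_
    intro u uB uK uT uG ui up
    have hfull : ∀ y < n, R.Reached E n p q l U (τ + 1) y → u.arr 7 y ≠ 0 := by
      rintro y hy ⟨t, ht1, ht2, i, hi, hle⟩
      rcases Nat.lt_or_eq_of_le ht2 with h | rfl
      · refine uG.out y hy ?_
        rw [zf.mem _]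
        exact hS.full y hy ⟨t, ht1, by omega, i, hi, hle⟩
      · refine ((uT i (by omega)).noted y hy ?_).1 hi
        rw [uK.sid_eq i (by omega) hi, uK.src_eq i (by omega) hi]
        unfold noteRadius
        rwa [if_pos hi]
    have hG := hI.good_round e2 e3 e4 e5
    have hfin : ∀ (s : View) xs a w j, IncBase E n p q l U K B ρ D R.g j (τ + 1) s → Core E n p q l
        U R xs a w (τ + 1) s → AllTracked E n p q l U R xs a (τ + 1) s → Staged E n p q l U R K (B
        R.r) xs a w (τ + 1) j s → pot n s ≤ pot n v + 500 → cover.WP E b (lower.WP E b Q) s := by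
      intro s xs a w j sB sK sT sS sp
      refine Cmd.cover_spec hI hb e2 e3 hτ sB sK sT sS hG ?_
      intro c xs' a' j' cB cK cT cS cc cp
      refine Cmd.lower_spec hI hb hτ (g := R.g) ⟨cK.params.r'.trans e2, j', cB, cc, Or.inr ⟨R, xs',
        a', w, rfl, e2, e3, e4, e5, e6, cK, cT, cS⟩⟩ ?_
      grind
    have uw : u.var .w = w := uK.w'
    have hwn : w ≤ n := by rcases hS.stage with h | h <;> omega
    have hf : ∀ t : ℤ, Frame u { u with vt := t } [] [] := fun t => ⟨fun _ _ => rfl, fun _ _ => rfl, rfl, rfl⟩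
    simp only [Expr.rules, View.pay, uw]
    refine ⟨⟨trivial, by norm_num, by omega⟩, fun hne => ?_, fun he => ?_⟩
    · have hw : w < n := by
        rcases Nat.lt_or_eq_of_le hwn with h | rfl
        · exact h
        · exact absurd uK.flags.sent7 hne
      rcases hS.stage with h | ⟨_, hNa, hxN, hnR, k, hk, hidx, hsub, hwk, hP, hj⟩
      · omega
      have hPl := hP.le
      refine Cmd.rechoose_spec hI hb e2 e3 (uB.frame (hf _) rfl) (uK.frame (hf _) rfl) (uT.frame
        (hf _) rfl) haN (hS.le.trans (Nat.le_succ _)) hfull hG (k := k + 1) ?_ hk (Round.left_succ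
        hwk hnR (uK.flags.out w hw hne) hsub) ?_ ?_
      · exact ui.trans ((zf.get .idx).trans hidx)
      · unfold roundBound at hj ⊢
        rw [Nat.add_mul, one_mul]
        omega
      · intro s xs' a' w' j' sB sK sT sS sp _
        refine hfin s xs' a' w' j' sB sK sT sS ?_
        have := sp hw
        rw [pot_frame (n := n) (hf _)] at this
        push_cast at this
        omega
    · refine hfin _ xs a w j (uB.frame (hf _) rfl) (uK.frame (hf _) rfl) (uT.frame (hf _) rfl)
        ⟨hS.le.trans (Nat.le_succ _), hfull, ?_⟩ ?_
      · rcases hS.stage with ⟨h1, h2, h3, h4, h5⟩ | ⟨h1, hNa, hxN, hnR, k, hk, hidx, hsub, hwk, hP, hj⟩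
        · refine Or.inl ⟨h1, h2, ?_, ?_, h5⟩
          · show u.var .cand = 0
            rw [uK.flags.cand]
            by_contra h
            obtain ⟨y, hy, h⟩ := zeros_pos.1 h
            have := (uK.flags.near y hy h).1
            omega
          · show u.var .cnt = 0
            rw [uK.flags.cnt]
            by_contra h
            obtain ⟨y, hy, h⟩ := zeros_pos.1 h
            refine uG.out y hy (fun h' => ?_) h
            have h6 : zeros n (z.arr 7) ≠ 0 := zeros_pos.2 ⟨y, hy, h'⟩
            rw [zf.mem _, ← hK.flags.cnt] at h6
            exact h6 h4
        · refine Or.inr ⟨h1, hNa, hxN, fun h => hfull w h1 h he, k, hk, ui.trans ((zf.get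
            .idx).trans hidx), fun y hy => hsub ?_, hwk, hP.mono (hI.gdist_le (Nat.le_succ τ)), hj⟩
          rw [Round.mem_rest] at hy ⊢
          exact ⟨hy.1, fun h => hy.2 (h.mono (Nat.le_succ _))⟩
      · rw [pot_frame (n := n) (hf _)]
        push_cast
        omega

end specs

namespace Cmd

/-- Find the order of magnitude of the radius. -/
def seek : Cmd := .set .x 0 ;; .set .a 0 ;; .set .w ↟.n ;; .set .vb 1 ;; .whil ↟.vb (.set .r (2 *
  ↟.r + 1) ;; params ;; .set .bad 0 ;; .set .vb 0 ;; newSession ;; check) ;; .set .r (5 * ↟.r) ;;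
  params

end Cmd

section specs

variable {E : Env} {b n p q : ℕ} {l U : List Edge} {Q : View → Prop} {v u : View} {K : ℕ}
  {B : ℕ → ℕ} {ρ D g j : ℕ} {R : Round} {xs : ℕ → ℕ} {a w τ : ℕ}

/-- Runs from vertex 0 probe `r = 2 ^ i - 1`. An estimate above `4 r` shows `R > 2 r`, hence the
next probe `2 r + 1` is at most `R`; otherwise `R ≤ 4 r + σ ≤ 5 r`. So the search never uses a
distance bound much larger than the radius, and `5 r` is a first guess that is accepted without any
source. -/
theorem Cmd.seek_spec (hC : Ctx E n p q l) (hb : b = 2 * l.length) (hcon : (graphOf n l).Connected)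
    (hS : Static n p q l [] v) (hr : v.var .r = 0) (h2 : v.arr 2 n = 0) (h7 : v.arr 7 n = 0) (hu :
    v.used = 0) (hs : v.sess = []) (ht : v.vt ≤ 100 * l.length + 300) (hQ : ∀ u ρ D, ρ ≤ 5 * grad n
    l → 0 < ρ → D ≤ n → (∀ i < D, 2 ^ (i + 1) - 1 ≤ grad n l) → (∀ (U : List Edge) K B,
    Accepted E n p q l U K B ρ D 0 0 u) → pot n u ≤ 1000 → Q u) : seek.WP E b Q v := by
  obtain ⟨b1, b2, b3, b4, b5, b6, hn2⟩ := hC.bounds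
  have hgp := grad_pos hcon hn2
  have hgn := grad_lt hcon (by omega)
  unfold seek
  simp only [Cmd.WP, View.pay, View.assign, Expr.rules, Function.update_apply, reduceCtorEq,
    if_false, true_and, hS.n']
  refine ⟨by omega, by omega, by omega, fun u => ∃ i, u.var .r = 2 ^ i - 1 ∧ Frame v u [.x, .a, .w,
    .vb, .r, .sg, .hS, .hA, .thr, .k, .N, .bad, .cur, .j, .a1, .a2, .y] [] ∧ u.var .x = 0 ∧
    u.var .a = 0 ∧ u.var .w = n ∧ u.used = 0 ∧ SessionsOK n p q l [] u.sess ∧ (∀ F : ℕ → ℝ,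
    sessCost F u.sess = ∑ i ∈ Finset.range i, F (16 * (2 ^ (i + 1) - 1))) ∧ (∀ j < i,
    2 ^ (j + 1) - 1 ≤ grad n l) ∧ (u.var .vb ≠ 0 → 2 ^ (i + 1) - 1 ≤ grad n l) ∧ (u.var .vb = 0 →
    0 < i ∧ grad n l ≤ 5 * (2 ^ i - 1)) ∧ u.vt + (if i = 0 then 0 else 1000 * ((n : ℤ) + l.length))
    ≤ v.vt + 20, fun u => if u.var .vb = 0 then 0 else n + 1 - u.var .r, ⟨0, ?_⟩, ?_⟩
  · refine ⟨by simpa using hr, by simp +contextual [Frame.iff], by simp, by simp, by simp, hu, by simp [hs, SessionsOK],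
      by simp [hs, sessCost], by simp, fun _ => by simpa using Nat.succ_le_of_lt hgp, by simp, by grind⟩
  rintro u ⟨i, ur, uf, ux, ua, uw, uu, us, uF, uD, uv1, uv0, ut⟩
  have hbase : ∀ z : View, Frame u z [.x, .a, .w, .vb, .r, .sg, .hS, .hA, .thr, .k, .N, .bad, .cur, .j, .a1, .a2, .y] [] →
      Static n p q l [] z ∧ Frame v z [.x, .a, .w, .vb, .r, .sg, .hS, .hA, .thr, .k, .N, .bad, .cur, .j, .a1, .a2, .y] [] :=
    fun z zf => ⟨hS.frame (uf.trans zf), uf.trans zf⟩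
  have hi1 : 1 ≤ 2 ^ i := Nat.one_le_two_pow
  have hi2 : 2 ^ (i + 1) = 2 * 2 ^ i := pow_succ' 2 i
  simp only
  refine ⟨fun hvb => ?_, fun hvb => ?_⟩
  · have hrg := uv1 hvb
    simp only [ur]
    refine ⟨⟨by omega, by omega, by omega⟩, ?_⟩
    have e1 : 2 * (2 ^ i - 1) + 1 = 2 ^ (i + 1) - 1 := by omega
    rw [e1]
    set r := 2 ^ (i + 1) - 1 with hrd
    have hf : ∀ t : ℤ, Frame u { u with var := Function.update u.var .r r, vt := t } [.r] [] := fun t => by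
      simp +contextual [Frame.iff]
    have hf' := fun t => ((hbase _ ((hf t).weaken (by simp) (by simp))).1)
    refine Cmd.params_spec hC (hf' _).n' (hf' _).p' (hf' _).q' (r := r) (by simp) (by omega) (by omega) ?_
    intro z zf zs zu zt zP
    refine ⟨by omega, by omega, ?_⟩
    have huz : ∀ t : ℤ, Frame u { z with var := Function.update (Function.update z.var .bad 0) .vb 0, vt := t }
        [.r, .sg, .hS, .hA, .thr, .k, .N, .bad, .vb, .cur, .j, .a1, .a2, .y] [] := fun t => by
      have := ((hf _).weaken (X' := [.r, .sg, .hS, .hA, .thr, .k, .N]) (J' := []) (by simp)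
        (by simp)).trans zf (by simp) (by simp)
      simp +contextual [Frame.iff, this.all]
    refine Cmd.newSession_spec hC hb (hbase _ ((huz _).weaken (by simp) (by simp))).1 trivial (x :=
      0) (k := 16 * r) ?_ (by omega) (by simpa using zP.k') ?_ ?_
    · rw [(huz _).get _, ux]
    · have := uF fun _ => 1
      simp only [sessCost_one, Finset.sum_const, Finset.card_range, nsmul_eq_mul, mul_one] at this
      have h3 : u.sess.length = i := by exact_mod_cast this
      have := Nat.lt_two_pow_self (n := i)
      simp only [zs, h3]
      omega
    intro x un xf xs xcur xu xt xn1 xn2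
    have hux := (huz (z.vt + ((1 : ℕ) + 2) + ((1 : ℕ) + 2))).trans xf (by simp) (by simp)
    have xx : x.var .x = 0 := by rw [hux.get _, ux]
    have xr : x.var .r = r := by rw [xf.get _]; simpa using zP.r'
    simp only [zs] at xs xcur
    refine Cmd.check_spec hC (us := []) (r := r) (by omega) xr
      (by rw [xf.get _]; simpa using zP.thr') (un := un) (by rw [xs, xcur, xx]; simp) (by omega) xn1
      (by rw [xf.get _]; simp) (by rw [xf.get _]; simp) (fun a ha h => absurd (xn2 a ha) h) ?_
    intro y yf ys yu yt yW
    have huy := hux.trans yf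
    have ysess : y.sess = u.sess ++ [⟨⟨n, l, 0, 16 * r, p, 256 * q⟩, [], []⟩] := by simp_all
    have yx : y.var .x = 0 := by rw [huy.get _, ux]
    have yr : y.var .r = r := by rw [yf.get _, xr]
    have hacc := yW.accurate hC (us := []) trivial hcon
    have hσ := slack_le (r := r) hC.p_lt
    rw [yx] at hacc
    refine ⟨⟨i + 1, yr, (hbase y (huy.weaken)).2, yx, by rw [huy.get _, ua], by rw [huy.get _, uw],
      ?_, ?_, fun F => ?_, fun j hj => ?_, fun h => ?_, fun h => ⟨by omega, ?_⟩, ?_⟩, ?_⟩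
    · grind
    · intro c hc
      rw [ysess, List.mem_append, List.mem_singleton] at hc
      rcases hc with hc | rfl
      · exact us c hc
      · grind
    · rw [ysess, sessCost_append, uF, Finset.sum_range_succ]
    · grind
    · obtain ⟨a, ha, h4⟩ := yW.vb.1 h
      rw [yx] at h4
      have h5 := hacc.lt_gdist ha (by omega) h4
      have h6 := gdist_le_two_grad hcon (show 0 < n by omega) ha
      have h8 : 2 ^ (i + 1 + 1) = 2 * 2 ^ (i + 1) := pow_succ' 2 _
      change 4 * r < gdist n l 0 a at h5
      omega
    · have h5 := hacc.gdist_le hcon (by omega) (h := 4 * r) (by omega) fun a ha => by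
        by_contra h'
        exact yW.vb.2 ⟨a, ha, by rw [yx]; omega⟩ h
      exact (grad_le hcon (by omega) h5).trans (by omega)
    · grind
    · rw [if_neg hvb, yr]
      split_ifs <;> omega
  · obtain ⟨hi0, hg5⟩ := uv0 hvb
    have hDi := uD (i - 1) (by omega)
    rw [Nat.sub_add_cancel hi0] at hDi
    simp only [ur]
    refine ⟨⟨by omega, by omega⟩, ?_⟩
    have hf : ∀ t : ℤ, Frame u { u with var := Function.update u.var .r (5 * (2 ^ i - 1)), vt := t } [.r] [] := fun t => by
      simp +contextual [Frame.iff]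
    have hf' := fun t => ((hbase _ ((hf t).weaken (by simp) (by simp))).1)
    have h3 : 2 ≤ 2 ^ i := (Nat.pow_le_pow_right (by norm_num) hi0 : 2 ^ 1 ≤ 2 ^ i)
    refine Cmd.params_spec hC (hf' _).n' (hf' _).p' (hf' _).q' (r := 5 * (2 ^ i - 1)) (by simp) (by omega) (by omega) ?_
    intro z zf zs zu zt zP
    have huz := ((hf _).weaken (X' := [.r, .sg, .hS, .hA, .thr, .k, .N]) (J' := []) (by simp)
        (by simp)).trans zf (by simp) (by simp)
    obtain ⟨zS, zvf⟩ := hbase z (huz.weaken)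
    refine hQ z (5 * (2 ^ i - 1)) i (by omega) (by omega) ?_ uD (fun U K B => ⟨zS, zP, zu.trans uu,
      ?_, fun F hF => ?_, ?_, ?_, ?_⟩) ?_
    · have := Nat.lt_two_pow_self (n := i)
      omega
    · show grad n l ≤ threshold p q (5 * (2 ^ i - 1)) + slack p q (5 * (2 ^ i - 1))
      unfold threshold
      omega
    · simp_all
    · grind
    · rw [zvf.mem _, h2]
    · rw [zvf.mem _, h7]
    · have za : z.var .a = 0 := by rw [huz.get _, ua]
      have zw : z.var .w = n := by rw [huz.get _, uw]
      rw [if_neg (by omega)] at ut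
      simp only at zt
      simp only [pot, za, zw, Finset.range_zero, Finset.sum_empty, lt_irrefl, if_false]
      push_cast at zt ⊢
      omega

end specs

/-- The algorithm for edge insertions. -/
def incAlg : DynAlg := ⟨(Cmd.seek ;; Cmd.nextGuess ;; Cmd.lower).boot, Cmd.insertion.code, 20⟩

/-! ### Correctness of the algorithm for edge insertions -/

section inc

variable {E : Env} {n p q : ℕ} {l U : List Edge} {v : View} {K : ℕ} {B : ℕ → ℕ} {ρ D g τ : ℕ}

/-- A guess that has not been accepted is too small. -/
theorem Settled.lt_grad (hI : IncPar E n p q l U K B ρ D) (h : Settled E n p q l U K B ρ D g τ v)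
    (hacc : v.var .acc = 0) : descent p q ρ (g + 1) < grad n (graphAt E l U τ) := by
  have hn2 := hI.ctx.two_le
  have hcon := hI.conn_at τ
  obtain ⟨-, j, hB, hc, ⟨h0, -⟩ | ⟨R, xs, a, w, rfl, e2, e3, e4, e5, e6, hK, hT, hS⟩⟩ := h
  · exact h0 ▸ grad_pos hcon hn2
  have hgr : grad n (graphAt E l U τ) ≤ 8 * R.r := e2 ▸ hB.grad_le hI (e2 ▸ e3)
  rw [← e2]
  by_contra hle
  obtain ⟨c, hcn, hcc⟩ := exists_center hcon (by omega)
  -- No run has been accepted, so each pointer has stopped at a vertex with estimate above the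
  -- threshold; estimates are not larger than distances.
  have hfail : ∀ b < a, ∃ y < n, threshold p q R.r < gdist n (graphAt E l U τ) (xs b) y := by
    intro b hb
    have hlt := lt_of_le_of_ne (hT b hb).ptr_le fun h => (hT b hb).acc h hacc
    exact ⟨_, hlt, ((hT b hb).halt hlt).trans_le (hI.est_close hgr (hK.src_lt b hb) _ _ hlt).1⟩
  have hclose : ∀ b < a, gdist n (graphAt E l U τ) (xs b) c + R.r ≤ threshold p q R.r → False := by
    intro b hb h
    obtain ⟨y, hy, h'⟩ := hfail b hb
    have h1 := gdist_triangle hcon (hK.src_lt b hb) hcn hy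
    grind
  have hth : threshold p q R.r = R.r + (R.r + 1) / 2 + 4 * slack p q R.r := rfl
  rcases hS.stage with ⟨h1, h2, h3, h4, h5⟩ | ⟨h1, hNa, hxN, hnR, -⟩
  -- There is no representative, so all vertices are excluded, in particular the centre. At some
  -- time it was within `r/2 + σ` of a sample vertex, and it still is.
  · have hc7 : v.arr 7 c ≠ 0 := fun h' => by
      have : zeros n (v.arr 7) ≠ 0 := zeros_pos.2 ⟨c, hcn, h'⟩
      rw [← hK.flags.cnt] at this
      exact this h4
    obtain ⟨t, ht1, ht2, i, hi, hle'⟩ := hK.flags.out c hcn hc7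
    have h6 := (hI.est_close ((hI.grad_le ht1).trans e6) (x := R.src E n i) (Nat.mod_lt _ (by omega)) (R.base + i) c hcn).2
    have h7 := hI.gdist_le ht2 (R.src E n i) c
    refine hclose i (by omega) ?_
    rw [hK.src_eq i (by omega) hi]
    omega
  -- On the way from the representative to the centre, `z` is at distance `r/2 - 2σ`, or is the
  -- centre if that is closer. It is a candidate and therefore marked, so some source is within `2σ`
  -- of it and within `⌈r/2⌉ + 4σ` of the centre.
  · obtain ⟨z, hz, hz1, hz2⟩ := exists_gdist_between hcon h1 hcn (j := min (gdist n (graphAt E l U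
      τ) w c) (R.r / 2 - 2 * slack p q R.r)) (min_le_left _ _)
    have hne : v.arr 2 z ≠ 1 := ((hT _ hNa).noted z hz (by
      have := (hI.est_close hgr (hK.src_lt _ hNa) (v.arr 5 (sampleSize n R.r)) z hz).1
      rw [hxN] at this ⊢
      unfold noteRadius
      rw [if_neg (by omega), if_pos rfl]
      omega)).2.1 rfl
    have hn0 : v.arr 2 z ≠ 0 := fun h' => by
      have : zeros n (v.arr 2) ≠ 0 := zeros_pos.2 ⟨z, hz, h'⟩
      rw [← hK.flags.cand] at this
      exact this hc
    have := hK.flags.le z hz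
    obtain ⟨b, hb1, hb2, hb3⟩ := hK.flags.cov z hz (by omega)
    refine hclose b hb2 ?_
    have h4 := gdist_triangle hcon (hK.src_lt b hb2) hz hcn
    have h5 := hcc w h1
    rw [gdist_comm] at h5
    grind

/-- The next guess is below `R`, so the accepted one satisfies `a (1 - ε/32) ≤ R`; the factor `3/2 +
5ε/16` of the shown value is at most `(1 - ε/32) (1 + ε) (3/2)`. -/
theorem descent_bounds {p q ρ R g : ℕ} (hp : 0 < p) (hpq : p < q) (h : descent p q ρ (g + 1) < R) :
    ((threshold p q (descent p q ρ g) + slack p q (descent p q ρ g) : ℕ) : ℝ) ≤ (1 + (p :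
    ℝ) / q) * (3 / 2 * R + 1 / 2) := by
  have hq : (0 : ℝ) < q := by exact_mod_cast (by omega : 0 < q)
  set a := descent p q ρ g with ha
  have h1 : a ≤ R + p * a / (32 * q) := by
    change a - (1 + p * a / (32 * q)) < R at h
    omega
  have h2 : ((p * a / (32 * q) : ℕ) : ℝ) ≤ (p : ℝ) / q * a / 32 := Nat.cast_div_le.trans_eq
    (by push_cast; field_simp)
  have h3 : (slack p q a : ℝ) ≤ (p : ℝ) / q * a / 16 := Nat.cast_div_le.trans_eq
    (by push_cast; field_simp)
  have h4 : (((a + 1) / 2 : ℕ) : ℝ) ≤ (a + 1) / 2 := Nat.cast_div_le.trans_eq (by push_cast; rfl)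
  have h5 : (a : ℝ) ≤ R + ((p * a / (32 * q) : ℕ) : ℝ) := by exact_mod_cast h1
  set ε : ℝ := (p : ℝ) / q with hε
  have hε0 : 0 < ε := by positivity
  have hε1 : ε < 1 := by rw [hε, div_lt_one hq]; exact_mod_cast hpq
  have ha0 : (0 : ℝ) ≤ a := by positivity
  have h6 : (a : ℝ) * (1 - ε / 32) ≤ R := by linarith
  have h7 : (a : ℝ) * (3 / 2 + 5 / 16 * ε) ≤ a * ((1 - ε / 32) * ((1 + ε) * (3 / 2))) :=
    mul_le_mul_of_nonneg_left (by nlinarith) ha0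
  have h8 := mul_le_mul_of_nonneg_right h6 (show 0 ≤ (1 + ε) * (3 / 2) by positivity)
  unfold threshold
  push_cast
  nlinarith

/-- The estimate that is shown is correct. -/
theorem Settled.correct (hI : IncPar E n p q l U K B ρ D) (h : Settled E n p q l U K B ρ D g τ v)
    (hacc : v.var .acc = 0) : (grad n (graphAt E l U τ) : ℝ) ≤ v.var .out ∧ (v.var .out :
    ℝ) ≤ (1 + (p : ℝ) / q) * (3 / 2 * grad n (graphAt E l U τ) + 1 / 2) := by
  have h1 := h.lt_grad hI hacc
  obtain ⟨-, j, hB, -⟩ := h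
  rw [hB.out]
  exact ⟨by exact_mod_cast hB.le_out, descent_bounds hI.ctx.p_pos hI.ctx.p_lt h1⟩

theorem inc_start (hC : IncCtx E n p q l U) (hI : ∀ ρ D, ρ ≤ 10 * n → D ≤ n → IncPar E n p q l U K B
    ρ D) : ∃ s v ρ D g, Exec E incAlg.setup (startState n p q l) s ∧ SeenAs E (2 * l.length) s v ∧
    Settled E n p q l U K B ρ D g 0 v ∧ v.var .acc = 0 ∧ pot n v ≤ 2000 ∧ IncPar E n p q l U K B ρ D
    ∧ ρ ≤ 5 * grad n l ∧ ∀ i < D, 2 ^ (i + 1) - 1 ≤ grad n l := by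
  have hn2 := hC.ctx.two_le
  have hcon : (graphOf n l).Connected := hC.conn_at 0
  have hgn := grad_lt hcon (by omega)
  obtain ⟨s, v, h1, h2, ρ, D, g, h3⟩ := Cmd.boot_sound hC.ctx (c := Cmd.seek ;; Cmd.nextGuess ;; Cmd.lower)
    (Q := fun v => ∃ ρ D g, Settled E n p q l U K B ρ D g 0 v ∧ v.var .acc = 0 ∧ pot n v ≤ 2000 ∧
      IncPar E n p q l U K B ρ D ∧ ρ ≤ 5 * grad n l ∧ ∀ i < D, 2 ^ (i + 1) - 1 ≤ grad n l) (by
    intro v hS hr harr hu hs ht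
    refine Cmd.seek_spec hC.ctx rfl hcon hS hr (by rw [harr]) (by rw [harr]) hu hs ht ?_
    intro u ρ D hρ hρ0 hD hDg hA up
    have hI' := hI ρ D (by omega) hD
    refine Cmd.nextGuess_spec hI' rfl (Nat.zero_le _) (hA U K B) hρ0 ?_
    intro x xS xp _
    refine Cmd.lower_spec hI' rfl (Nat.zero_le _) xS ?_
    intro y g _ yS ya yp
    exact ⟨ρ, D, g, yS, ya, by omega, hI', hρ, hDg⟩)
  exact ⟨s, v, ρ, D, g, h1, h2, h3⟩

theorem inc_update (hI : IncPar E n p q l U K B ρ D) (hτ : τ < U.length) {s : State} (hs : SeenAs E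
    (2 * l.length) s v) (hv : Settled E n p q l U K B ρ D g τ v) (hacc : v.var .acc = 0) : ∃ s' v'
    g', Exec E incAlg.update { s with inp := [U[τ].1, U[τ].2] } s' ∧ SeenAs E (2 * l.length) s' v' ∧
    Settled E n p q l U K B ρ D g' (τ + 1) v' ∧ v'.var .acc = 0 ∧ pot n v' ≤ pot n v + 1000 := by
  obtain ⟨s', v', r1, r2, g', r3⟩ := Cmd.sound hI.ctx.box Cmd.insertion (fun v' => ∃ g',
    Settled E n p q l U K B ρ D g' (τ + 1) v' ∧ v'.var .acc = 0 ∧ pot n v' ≤ pot n v + 1000)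
    _ _ (hs.set_inp [U[τ].1, U[τ].2])
    (Cmd.insertion_spec hI rfl hτ (hv.set_inp _) hacc rfl fun u g' _ uS ua up => ⟨g', uS, ua, up⟩)
  exact ⟨s', v', g', r1, r2, r3⟩

end inc

section inc

variable {E : Env} {A : BlackBox} {T : ℕ → ℕ → ℕ → ℝ → ℝ} {n p q c w : ℕ} {l U us : List Edge}
  {v : View} {K : ℕ} {C : ℝ} {B : ℕ → ℕ} {ρ D g j τ : ℕ} {adv : Adversary}

theorem Round.left_eq_empty (R : Round) : R.left E n p q l U n = ∅ := Finset.card_eq_zero.1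
  (Nat.le_zero.1 ((card_remains_le n).trans (by
    have := R.card_rest_le (E := E) (n := n) (p := p) (q := q) (l := l) (U := U) R.t0; omega)))

theorem card_gball_le (G : List Edge) (v h : ℕ) : (gball n G v h).card ≤ n :=
  (Finset.card_filter_le _ _).trans (by simp)

/-- With the bounds `n` on balls and representatives every round is good for trivial reasons, each
choice removing at least the chosen vertex. So the invariant holds whatever the random words are. -/
theorem incAlg_maintainsRadius : incAlg.MaintainsRadius .incremental := by
  intro B hB n p q l h2 hp hpq hl us hus hcon coins outs s hrun
  have hC : IncCtx ⟨.incremental, B, incAlg.wordLength n q, coins⟩ n p q l us := ⟨ctx_of hB h2 hp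
    hpq hl coins, rfl, hus, hcon⟩
  obtain ⟨s₀, v₀, ρ, D, g₀, a1, a2, a3, a4, -, hI, -⟩ := inc_start (K := n) (B := fun _ => n) hC
    fun ρ D h h' => ⟨hC, le_rfl, fun _ => le_rfl, h, h', fun R _ _ _ _ _ =>
      ⟨R.left_eq_empty, fun _ _ _ _ _ => card_gball_le _ _ _⟩⟩
  have key : ∀ us' outs s, incAlg.Run ⟨.incremental, B, incAlg.wordLength n q, coins⟩ n p q l us'
      outs s → us' <+: us → ∃ v g, SeenAs ⟨.incremental, B, incAlg.wordLength n q, coins⟩ (2 *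
      l.length) s v ∧ Settled ⟨.incremental, B, incAlg.wordLength n q, coins⟩ n p q l us n (fun _ =>
      n) ρ D g us'.length v ∧ v.var .acc = 0 := by
    intro us' outs s hr
    induction hr with
    | start h => exact fun _ => by cases h.det a1; exact ⟨v₀, g₀, a2, a3, a4⟩
    | @update us' outs s s' e h1 h2 ih =>
      intro hp
      obtain ⟨v, g, v1, v2, v3⟩ := ih ((List.prefix_append _ _).trans hp)
      have hlt : us'.length < us.length := by simpa using hp.length_le
      have he : us[us'.length] = e := by
        obtain ⟨t, rfl⟩ := hp; simp
      obtain ⟨s'', v', g', r1, r2, r3, r4, -⟩ := inc_update hI hlt v1 v2 v3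
      rw [he] at r1
      cases h2.det r1
      exact ⟨v', g', r2, by simpa using r3, r4⟩
  obtain ⟨v, g, v1, v2, v3⟩ := key us outs s hrun List.prefix_rfl
  have := v2.correct hI v3
  rw [← show s.reg 0 = v.var .out from v1.var .out, graphAt, List.take_length] at this
  exact this

/-! ## The time for edge insertions -/

/-- How many representatives suffice with high probability. -/
noncomputable def repBound (c n : ℕ) : ℕ := min n ⌈3 * (c + 25) * Real.log n⌉₊

/-- The random words for which some round needs too many representatives or misses a large ball. -/
noncomputable def incMiss (A : BlackBox) (n p q w : ℕ) (l U : List Edge) (c : ℕ) : Set (ℕ → Fin (2 ^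
    w)) := (⋃ z ∈ (Finset.range (10 * n) ×ˢ Finset.range (10 * n + 1)) ×ˢ (Finset.range (40 * (n * n
    * n) + 1) ×ˢ Finset.range (n * n + 1)), {ω | ((⟨z.1.1, z.1.2, z.2.1, z.2.2⟩ : Round).left
    ⟨.incremental, A, w, ω⟩ n p q l U (repBound c n)).Nonempty}) ∪ ⋃ z ∈ (Finset.range (10 * n) ×ˢ
    Finset.Ioc 0 (10 * n)) ×ˢ (Finset.range (n * n + 1) ×ˢ Finset.range n), {ω | ballBound (c + 16)
    n z.1.2 < (gball n (afterUpdates .incremental l (U.take z.2.1)) z.2.2 (z.1.2 / 2)).card ∧ ∀ i <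
    sampleSize n z.1.2, (ω (2 * n * z.1.1 + 2 * i) : ℕ) % n ∉ gball n (afterUpdates .incremental l
    (U.take z.2.1)) z.2.2 (z.1.2 / 2)}

theorem Round.good_of_notMem {ω : ℕ → Fin (2 ^ w)} (hω : ω ∉ incMiss A n p q w l U c) {R : Round}
    (h1 : R.g < 10 * n) (h2 : 0 < R.r) (h3 : R.r ≤ 10 * n) (h4 : R.base ≤ 40 * (n * n * n)) (h5 :
    R.t0 ≤ U.length) (hU : U.length ≤ n * n) : R.Good ⟨.incremental, A, w, ω⟩ n p q l U (repBound c
    n) (ballBound (c + 16) n R.r) := by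
  simp only [incMiss, Set.mem_union, not_or] at hω
  refine ⟨?_, fun τ hτ v hv hmiss => ?_⟩
  · by_contra h
    refine hω.1 (Set.mem_biUnion (x := ((R.g, R.r), (R.base, R.t0))) ?_ (Finset.nonempty_iff_ne_empty.2 h))
    grind
  · by_contra hlt
    refine hω.2 (Set.mem_biUnion (x := ((R.g, R.r), (τ, v))) ?_ ⟨Nat.lt_of_not_le hlt, fun i hi h => ?_⟩)
    · grind
    · have h1 := hmiss i hi
      have h2 := (mem_gball.1 h).2
      rw [gdist_comm] at h2
      exact absurd h2 (Nat.not_le_of_lt h1)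

/-- For fixed data of a round, which vertices have been reached by when depends only on the words at
even positions, and representatives are chosen by words at odd positions. With `k ≥ 3 (c + 25) log
n` choices, `n (2/3)^k ≤ n exp (-k/3)` is at most `n ^ (-(c + 24))`. -/
theorem measure_left_le (hn : 2 ≤ n) (hw : 3 * n ≤ 2 ^ w) (R : Round) :
    coinLaw w {ω | (R.left ⟨.incremental, A, w, ω⟩ n p q l U (repBound c n)).Nonempty} ≤
    ENNReal.ofReal (1 / (n : ℝ) ^ (c + 24)) := by
  rcases le_total n ⌈3 * (c + 25) * Real.log n⌉₊ with h | h
  · simp [repBound, min_eq_left h, Round.left_eq_empty]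
  have hR : ∀ (ω ω' : ℕ → Fin (2 ^ w)), (∀ i < sampleSize n R.r, ω (2 * n * R.g + 2 * i) = ω' (2 * n * R.g + 2 * i)) →
      R.Reached ⟨.incremental, A, w, ω⟩ n p q l U = R.Reached ⟨.incremental, A, w, ω'⟩ n p q l U := by
    intro ω ω' h
    funext τ u
    refine propext (exists_congr fun t => and_congr_right fun _ => and_congr_right fun _ =>
      exists_congr fun i => and_congr_right fun hi => ?_)
    simp only [Round.src, h i hi, wordEst]
  have hC : ∀ ω ω' : ℕ → Fin (2 ^ w), R.Reached ⟨.incremental, A, w, ω⟩ n p q l U = R.Reached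
      ⟨.incremental, A, w, ω'⟩ n p q l U → R.rest ⟨.incremental, A, w, ω⟩ n p q l U R.t0 = R.rest
      ⟨.incremental, A, w, ω'⟩ n p q l U R.t0 := fun ω ω' h => by ext; simp only [Round.mem_rest, h]
  refine (measure_remains_le (M := 2 * n * R.g) (L := 2 * n * R.g + 2 * sampleSize n R.r) hw (P :=
    fun ω => R.Reached ⟨.incremental, A, w, ω⟩ n p q l U) (C := fun ω => R.rest ⟨.incremental, A, w,
    ω⟩ n p q l U R.t0) (fun ω u τ τ' hτ h => Round.Reached.mono h hτ) (fun ω => R.card_rest_le _)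
    (fun ω ω' h => ?_) (fun ω k x => ?_) (repBound c n)).trans (ENNReal.ofReal_le_ofReal ?_)
  · grind
  · grind
  · rw [repBound, min_eq_right h]
    have hn' : (0 : ℝ) < n := by exact_mod_cast (by omega : 0 < n)
    set k := ⌈3 * (c + 25) * Real.log n⌉₊
    have h1 : 3 * (c + 25) * Real.log n ≤ k := Nat.le_ceil _
    have h2 : (2 / 3 : ℝ) ≤ Real.exp (-1 / 3) := by
      have := Real.add_one_le_exp (-1 / 3 : ℝ); linarith
    have h3 : (2 / 3 : ℝ) ^ k ≤ 1 / (n : ℝ) ^ (c + 25) := by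
      refine (pow_le_pow_left₀ (by norm_num) h2 k).trans ?_
      rw [← Real.exp_nat_mul, ← Real.exp_log (pow_pos hn' (c + 25)), one_div, ← Real.exp_neg,
        Real.log_pow, Real.exp_le_exp]
      push_cast
      linarith
    refine (mul_le_mul_of_nonneg_left h3 hn'.le).trans_eq ?_
    rw [pow_succ]
    field_simp

/-- The guess, the first run number and the starting time of a round depend on earlier random words,
so the union runs over all their possible values; the update sequence `U` is fixed, the adversary
being oblivious. There are at most `n²⁴` events. -/
theorem measure_incMiss_le (hn : 2 ≤ n) (hw : 3 * n ≤ 2 ^ w) (c : ℕ) : coinLaw w (incMiss A n p q w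
    l U c) ≤ ENNReal.ofReal (1 / (n : ℝ) ^ c) := by
  have hn' : (0 : ℝ) < n := by exact_mod_cast (by omega : 0 < n)
  refine (measure_union_le _ _).trans ?_
  refine (add_le_add (measure_biUnion_finset_le _ _) (measure_biUnion_finset_le _ _)).trans ?_
  refine (add_le_add (Finset.sum_le_card_nsmul _ _ (ENNReal.ofReal (1 / (n : ℝ) ^ (c + 24))) ?_)
    (Finset.sum_le_card_nsmul _ _ (ENNReal.ofReal (1 / (n : ℝ) ^ (c + 24))) ?_)).trans ?_
  · exact fun z _ => measure_left_le hn hw _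
  · rintro ⟨⟨g, r⟩, τ, v⟩ hz
    simp only [Finset.mem_product, Finset.mem_Ioc] at hz
    exact measure_miss_ballBound (c + 16) (by omega) (by omega) hz.1.2.1 (fun _ =>
      Finset.filter_subset _ _) fun _ _ _ => rfl
  · rw [← ENNReal.ofReal_nsmul, ← ENNReal.ofReal_nsmul, ← ENNReal.ofReal_add (by positivity) (by positivity)]
    refine ENNReal.ofReal_le_ofReal ?_
    simp only [Finset.card_product, Finset.card_range, nsmul_eq_mul, Nat.card_Ioc, ← add_mul]
    have h1 : 10 * n * (10 * n + 1) * ((40 * (n * n * n) + 1) * (n * n + 1)) + 10 * n * (10 * n - 0)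
        * ((n * n + 1) * n) ≤ n ^ 24 := by
      have a1 : 10 * n ≤ n ^ 5 := by
        calc 10 * n ≤ 2 ^ 4 * n := by omega
          _ ≤ n ^ 4 * n := Nat.mul_le_mul_right _ (Nat.pow_le_pow_left hn 4)
          _ = n ^ 5 := by ring
      have a2 : n * n + 1 ≤ n ^ 3 := by nlinarith [Nat.mul_le_mul hn hn]
      have a3 : 40 * (n * n * n) + 1 ≤ n ^ 9 := by
        calc 40 * (n * n * n) + 1 ≤ 2 ^ 6 * (n * n * n) := by grind
          _ ≤ n ^ 6 * (n * n * n) := Nat.mul_le_mul_right _ (Nat.pow_le_pow_left hn 6)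
          _ = n ^ 9 := by ring
      have a4 : 10 * n + 1 ≤ n ^ 6 := by
        have : n ^ 5 * 2 ≤ n ^ 5 * n := Nat.mul_le_mul_left _ hn
        grind
      have a5 : n ≤ n ^ 9 := Nat.le_self_pow (by norm_num) n
      calc _ ≤ n ^ 5 * n ^ 6 * (n ^ 9 * n ^ 3) + n ^ 5 * n ^ 6 * (n ^ 3 * n ^ 9) := Nat.add_le_add
            (Nat.mul_le_mul (Nat.mul_le_mul a1 a4) (Nat.mul_le_mul a3 a2)) (Nat.mul_le_mul
            (Nat.mul_le_mul a1 (by omega)) (Nat.mul_le_mul a2 a5))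
        _ = 2 * n ^ 23 := by ring
        _ ≤ n * n ^ 23 := Nat.mul_le_mul_right _ hn
        _ = n ^ 24 := by ring
    rw [pow_add, mul_one_div, div_le_div_iff₀ (by positivity) (by positivity)]
    have h3 : (0 : ℝ) < (n : ℝ) ^ c := by positivity
    have h2 := Nat.cast_le (α := ℝ).2 h1
    push_cast at h2 ⊢
    nlinarith

end inc

section inc

variable {E : Env} {A : BlackBox} {T : ℕ → ℕ → ℕ → ℝ → ℝ} {n p q c w : ℕ} {l U us : List Edge}
  {v : View} {K : ℕ} {C : ℝ} {B : ℕ → ℕ} {ρ D g j τ : ℕ} {adv : Adversary}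

theorem descent_le_pow (hq : 0 < q) (hpq : p < q) (g : ℕ) : (descent p q ρ g : ℝ) ≤ ρ * (1 - (p :
    ℝ) / q / 32) ^ g := by
  have hq' : (0 : ℝ) < q := by exact_mod_cast hq
  have h1 : (p : ℝ) / q < 1 := by rw [div_lt_one hq']; exact_mod_cast hpq
  induction g with
  | zero => simp [descent]
  | succ g ih =>
    set a := descent p q ρ g with ha
    have h2 : p * a < 32 * q * (p * a / (32 * q) + 1) := Nat.lt_mul_div_succ (p * a) (by omega)
    have h3 : (p : ℝ) * a < 32 * q * ((p * a / (32 * q) : ℕ) + 1) := by exact_mod_cast h2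
    have h4 : (p : ℝ) / q / 32 * a ≤ (p * a / (32 * q) : ℕ) + 1 := by
      rw [div_div, div_mul_eq_mul_div, div_le_iff₀ (by positivity)]
      linarith
    have h5 : (descent p q ρ (g + 1) : ℝ) ≤ a * (1 - (p : ℝ) / q / 32) := by
      change ((a - (1 + p * a / (32 * q)) : ℕ) : ℝ) ≤ _
      rcases le_total (1 + p * a / (32 * q)) a with h | h
      · rw [Nat.cast_sub h]; push_cast at h4 ⊢; linarith
      · rw [Nat.sub_eq_zero_of_le h, Nat.cast_zero]
        exact mul_nonneg (Nat.cast_nonneg _) (by linarith)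
    rw [pow_succ, ← mul_assoc]
    exact h5.trans (mul_le_mul_of_nonneg_right ih (by linarith))

/-- A positive guess after `g` steps gives `1 ≤ ρ (1 - ε/32)^g ≤ n⁴ exp (-g ε/32)`. -/
theorem descent_count (hn : 2 ≤ n) (hp : 0 < p) (hpq : p < q) (hρ : ρ ≤ 5 * n) (h : 0 < descent p q
    ρ g) : (g + 1 : ℝ) ≤ 130 * Real.log n / ((p : ℝ) / q) := by
  obtain ⟨hq, hp', hε0, h1⟩ := eps_bounds hp hpq
  have hlog := log_pos' hn
  have h2 := descent_le_pow (ρ := ρ) (by omega : 0 < q) hpq g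
  set ε : ℝ := (p : ℝ) / q with hε
  have h3 : (1 - ε / 32) ^ g ≤ Real.exp (-(g * (ε / 32))) := by
    rw [neg_mul_eq_mul_neg, Real.exp_nat_mul]
    exact pow_le_pow_left₀ (by linarith) (by have := Real.add_one_le_exp (-(ε / 32)); linarith) g
  have h4 : (ρ : ℝ) ≤ (n : ℝ) ^ 4 := by
    have : 2 ^ 3 * n ≤ n ^ 3 * n := Nat.mul_le_mul_right _ (Nat.pow_le_pow_left hn 3)
    have h5 : ρ ≤ n ^ 4 := by rw [pow_succ]; omega
    exact_mod_cast h5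
  have h5 : (1 : ℝ) ≤ descent p q ρ g := by exact_mod_cast h
  have h6 : 1 ≤ (n : ℝ) ^ 4 * Real.exp (-(g * (ε / 32))) := (h5.trans h2).trans (mul_le_mul h4 h3
    (pow_nonneg (by linarith) _) (by positivity))
  rw [Real.exp_neg, ← div_eq_mul_inv, one_le_div (Real.exp_pos _), ← Real.le_log_iff_exp_le
    (by positivity), Real.log_pow] at h6
  rw [le_div_iff₀ hε0]
  grind

theorem descent_anti : Antitone (descent p q ρ) := antitone_nat_of_succ_le fun k => by simp [descent]

theorem repBound_pos (hn : 2 ≤ n) : 1 ≤ repBound c n := by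
  have := log_pos' hn
  exact le_min (by omega) (Nat.one_le_ceil_iff.2 (by positivity))

theorem repBound_le (hn : 2 ≤ n) : (repBound c n : ℝ) ≤ 4 * (c + 25) * Real.log n := by
  have h := log_pos' hn
  have h1 : (repBound c n : ℝ) ≤ (⌈3 * (c + 25) * Real.log n⌉₊ : ℕ) := Nat.cast_le.2 (min_le_right _ _)
  have h2 := (Nat.ceil_lt_add_one (show (0 : ℝ) ≤ 3 * (c + 25) * Real.log n by positivity)).le
  have h3 : (0 : ℝ) ≤ c * Real.log n := by positivity
  nlinarith

theorem Settled.toIncBase (h : Settled E n p q l U K B ρ D g τ v) : IncBase E n p q l U K B ρ D g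
    (if descent p q ρ (g + 1) = 0 then 0 else
      roundBound n p q K (B (descent p q ρ (g + 1))) (descent p q ρ (g + 1))) τ v := by
  obtain ⟨-, j, hB, -, ⟨h0, -, -, -, -, rfl⟩ | ⟨R, xs, a, w', rfl, e2, e3, -, -, -, -, -, hS⟩⟩ := h
  · grind
  · have hj := hS.le_roundBound
    rw [e2] at e3 hj
    rw [if_neg e3.ne']
    exact ⟨hB.static, hB.out, hB.le_out, fun F hF => (hB.cost F hF).trans (add_le_add_right
      (mul_le_mul_of_nonneg_right (Nat.cast_le.2 hj) (hF _)) _), hB.sessions⟩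

/-- A round uses the sample and, for each of `O(log n)` representatives, a packing. As before the
guess is clamped to the range of the radius, from which it differs by a constant factor. -/
theorem round_cost_le (hbox : IsTruncatedSSSP .incremental A) (hT : RunsInTotalTime .incremental A
    T) (hK : PolyGrowth C T) (h2 : 2 ≤ n) (hp : 0 < p) (hpq : p < q) (hl : IsEdgeList n l) (hus :
    LegalSeq .incremental n l U) {r : ℕ} (hr : 0 < r) (hr0 : r ≤ 5 * grad n l) (hr10 :
    r ≤ 10 * n) (hrf : grad n (afterUpdates .incremental l U) ≤ 8 * r) (hf :
    0 < grad n (afterUpdates .incremental l U)) (hgr : grad n (afterUpdates .incremental l U) ≤ grad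
    n l) : roundBound n p q (repBound c n) (ballBound (c + 16) n r) r * T n (maxEdges .incremental l
    U) (16 * r) ((p : ℝ) / q / 256) ≤ 1200 * (c + 25) ^ 2 * Real.log n ^ 2 * C ^ 8 * ((p :
    ℝ) / q) * radiusTimeBound .incremental T n l U ((p : ℝ) / q) := by
  obtain ⟨hq', hp', hε0, -⟩ := eps_bounds hp hpq
  have hlog := log_pos' h2
  obtain ⟨R, hR1, hR2, hR3, hR4⟩ : ∃ R, grad n (afterUpdates .incremental l U) ≤ R ∧ R ≤ grad n l ∧
      r ≤ 5 * R ∧ R ≤ 8 * r := ⟨max (grad n (afterUpdates .incremental l U)) (min r (grad n l)), by omega⟩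
  refine cost_le hbox hT hK h2 hp hpq hl hus (R := R) (by omega) (by positivity) (Finset.mem_uIcc.2
    ⟨(min_le_right _ _).trans hR1, hR2.trans (le_max_left _ _)⟩) ?_
  have h8 := tries_le (c + 16) (R := R) h2 hp hpq hr hr10 (by omega) (by omega)
  have h9 : roundBound n p q (repBound c n) (ballBound (c + 16) n r) r ≤ repBound c n * (sampleSize
      n r + 2 + ballBound (c + 16) n r / (slack p q r / 2 + 1)) := by
    have := Nat.mul_le_mul_right (sampleSize n r) (repBound_pos (c := c) h2)
    unfold roundBound
    nlinarith
  refine (Nat.cast_le.2 h9).trans ?_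
  rw [Nat.cast_mul]
  refine (mul_le_mul (repBound_le h2) h8 (Nat.cast_nonneg _) (by positivity)).trans ?_
  rw [← mul_div_assoc]
  refine div_le_div_of_nonneg_right ?_ hε0.le
  have hS := Real.sqrt_nonneg ((n : ℝ) / R)
  have : 0 ≤ 1200 * (c + 25) * Real.log n ^ 2 * √((n : ℝ) / R) := by positivity
  push_cast
  nlinarith

/-- All probes are at most the initial radius and double each time, so there are at most `log₂ n` of
them, each charged to the initial radius. -/
theorem seek_cost_le (hbox : IsTruncatedSSSP .incremental A) (hT : RunsInTotalTime .incremental A T)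
    (hK : PolyGrowth C T) (h2 : 2 ≤ n) (hp : 0 < p) (hpq : p < q) (hl : IsEdgeList n l) (hus :
    LegalSeq .incremental n l U) (hc0 : (graphOf n l).Connected) (hD : ∀ i < D, 2 ^ (i + 1) - 1 ≤
    grad n l) : ∑ i ∈ Finset.range D, T n (maxEdges .incremental l U) (16 * (2 ^ (i + 1) - 1)) ((p :
    ℝ) / q / 256) ≤ 8 * Real.log n * C ^ 8 * ((p : ℝ) / q) * radiusTimeBound .incremental T n l U
    ((p : ℝ) / q) := by
  obtain ⟨hq', hp', hε0, hε1⟩ := eps_bounds hp hpq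
  have hR0 := grad_pos hc0 h2
  have hR0n := grad_lt hc0 (by omega)
  have h4 : ∀ k ≤ 256 * (2 * grad n l), 1 * T n (maxEdges .incremental l U) k ((p : ℝ) / q / 256) ≤
      4 * C ^ 8 * ((p : ℝ) / q) * radiusTimeBound .incremental T n l U ((p : ℝ) / q) := fun k hk =>
    cost_le hbox hT hK h2 hp hpq hl hus hk (by norm_num) Finset.left_mem_uIcc (by
      rw [le_div_iff₀ hε0]
      have := one_le_sqrt (n := n) (r := grad n l) hR0 (by omega)
      linarith)
  have hDn : (D : ℝ) ≤ 2 * Real.log n := by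
    have h3 : 2 ^ D ≤ n := by
      cases D with
      | zero => simp; omega
      | succ D => have := hD D (Nat.lt_succ_self _); omega
    have h4 : (D : ℝ) * Real.log 2 ≤ Real.log n := by
      rw [← Real.log_pow]
      exact Real.log_le_log (by positivity) (by exact_mod_cast h3)
    have := Real.log_two_gt_d9
    have h5 : (0 : ℝ) ≤ D := Nat.cast_nonneg _
    nlinarith
  have h5 := Finset.sum_le_card_nsmul (Finset.range D) _ _ fun i hi => (one_mul _).symm.trans_le (h4
    (16 * (2 ^ (i + 1) - 1)) (by have := hD i (Finset.mem_range.1 hi); omega))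
  rw [Finset.card_range, nsmul_eq_mul] at h5
  have h6 := (le_bound hbox hT h2 hp hpq hl hus 0).trans ((one_mul _).symm.trans_le (h4 0 (Nat.zero_le _)))
  refine h5.trans ((mul_le_mul_of_nonneg_right hDn ((Nat.cast_nonneg _).trans h6)).trans_eq (by ring))

/-- The radius bound at the last accepted guess, together with monotonicity of the thresholds, shows
that every round has a guess of at least one eighth of the final radius. So all rounds can be
charged, and there are `O(log n / ε)` of them. -/
theorem Settled.cost_le {ω : ℕ → Fin (2 ^ w)} (hI : IncPar ⟨.incremental, A, w,
      ω⟩ n p q l U (repBound c n) (ballBound (c + 16) n) ρ D) (hT : RunsInTotalTime .incremental A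
      T) (hK : PolyGrowth C T) (hρ : ρ ≤ 5 * grad n l) (hD : ∀ i < D, 2 ^ (i + 1) - 1 ≤ grad n l) (h
      : Settled ⟨.incremental, A, w, ω⟩ n p q l U (repBound c n) (ballBound (c + 16) n) ρ D g
      U.length v) : SessionsOK n p q l U v.sess ∧ sessCost (fun k => T n (maxEdges .incremental l U)
      k ((p : ℝ) / q / 256)) v.sess ≤ 200000 * (c + 25) ^ 2 * C ^ 8 * Real.log n ^ 3 *
      radiusTimeBound .incremental T n l U ((p : ℝ) / q) := by
  have hB := h.toIncBase
  have hbox : IsTruncatedSSSP .incremental A := hI.ctx.box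
  have h2 := hI.ctx.two_le
  have hpq := hI.ctx.p_lt
  have hp := hI.ctx.p_pos
  have hl := hI.ctx.edges
  have hus : LegalSeq .incremental n l U := hI.legal
  have hc0 : (graphOf n l).Connected := hI.conn_at 0
  have hR0n := grad_lt hc0 (by omega)
  have hle := hB.le_out
  have hgr := hI.grad_le (Nat.zero_le U.length)
  have hgf := grad_pos (hI.conn_at U.length) h2
  have hcost := hB.cost
  have hsess := hB.sessions
  rw [List.take_length] at hsess
  simp only [graphAt, List.take_length, List.take_zero, show afterUpdates .incremental l [] = l from rfl] at hle hgr hgf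
  refine ⟨hsess, ?_⟩
  have hFpos : ∀ k, 0 ≤ T n (maxEdges .incremental l U) k ((p : ℝ) / q / 256) := fun k =>
    (Nat.cast_nonneg _).trans (le_bound hbox hT h2 hp hpq hl hus k)
  have s4 := hcost _ hFpos
  obtain ⟨hq', hp', hε0, hε1⟩ := eps_bounds hp hpq
  have hlog := log_pos' h2
  -- The threshold and the slack for 0 are 0, which cannot bound the positive radius.
  have hgpos : 0 < descent p q ρ g := by
    by_contra h
    rw [Nat.eq_zero_of_not_pos h] at hle
    simp [threshold, slack] at hle
    omega
  have key : ∀ i ≤ g, 0 < descent p q ρ (i + 1) → roundBound n p q (repBound c n) (ballBound (c +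
      16) n (descent p q ρ (i + 1))) (descent p q ρ (i + 1)) * T n (maxEdges .incremental l U) (16 *
      descent p q ρ (i + 1)) ((p : ℝ) / q / 256) ≤ 1200 * (c + 25) ^ 2 * Real.log n ^ 2 * C ^ 8 *
      ((p : ℝ) / q) * radiusTimeBound .incremental T n l U ((p : ℝ) / q) := by
    intro i hi hr
    have h3 := descent_succ_ge hpq hr
    have h4 := descent_anti (p := p) (q := q) (ρ := ρ) hi
    have h5 : slack p q (descent p q ρ g) ≤ slack p q (descent p q ρ i) := Nat.div_le_div_right
      (Nat.mul_le_mul_left _ h4)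
    have h6 := descent_le p q ρ (i + 1)
    have h7 : threshold p q (descent p q ρ g) ≤ threshold p q (descent p q ρ i) := by unfold threshold; omega
    exact round_cost_le hbox hT hK h2 hp hpq hl hus hr (by omega) (by omega) (by omega) hgf hgr
  have s1 := seek_cost_le hbox hT hK h2 hp hpq hl hus hc0 hD
  have hX0 : 0 ≤ C ^ 8 * radiusTimeBound .incremental T n l U ((p : ℝ) / q) := by
    have h1 := base_cost_le hbox hT hK h2 hp hpq hl hus hc0
    by_contra h
    have h3 : (0 : ℝ) ≤ U.length := Nat.cast_nonneg _
    nlinarith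
  generalize radiusTimeBound .incremental T n l U ((p : ℝ) / q) = X at *
  have hX1 : 0 ≤ 1200 * (c + 25) ^ 2 * Real.log n ^ 2 * C ^ 8 * ((p : ℝ) / q) * X := by
    have : 0 ≤ 1200 * (c + 25) ^ 2 * Real.log n ^ 2 * ((p : ℝ) / q) * (C ^ 8 * X) := by positivity
    linarith
  have s2 := Finset.sum_le_card_nsmul (Finset.range g) _ _ fun i hi => key i (Finset.mem_range.1
    hi).le (hgpos.trans_le (descent_anti (Finset.mem_range.1 hi)))
  have s3 : ((if descent p q ρ (g + 1) = 0 then 0 else roundBound n p q (repBound c n) (ballBound (c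
      + 16) n (descent p q ρ (g + 1))) (descent p q ρ (g + 1)) : ℕ) : ℝ) * T n (maxEdges
      .incremental l U) (16 * descent p q ρ (g + 1)) ((p : ℝ) / q / 256) ≤ 1200 * (c + 25) ^ 2 *
      Real.log n ^ 2 * C ^ 8 * ((p : ℝ) / q) * X := by
    split_ifs with h0
    · grind
    · grind
  rw [Finset.card_range, nsmul_eq_mul] at s2
  have h7 := mul_le_mul_of_nonneg_right (descent_count h2 hp hpq (by omega) hgpos) hX1
  have h8 : 130 * Real.log n / ((p : ℝ) / q) * (1200 * (c + 25) ^ 2 * Real.log n ^ 2 * C ^ 8 * ((p :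
      ℝ) / q) * X) = 156000 * ((c + 25) ^ 2 * Real.log n ^ 3 * (C ^ 8 * X)) := by field_simp; ring
  have h9 : 8 * Real.log n * C ^ 8 * ((p : ℝ) / q) * X ≤ 32 * ((c + 25) ^ 2 * Real.log n ^ 3 * (C ^ 8 * X)) := by
    have e2 : Real.log n ≤ 4 * Real.log n ^ 3 := by nlinarith [mul_nonneg (sub_nonneg.2 hlog) (sub_nonneg.2 hlog)]
    have e3 : Real.log n * ((p : ℝ) / q) ≤ 4 * ((c + 25) ^ 2 * Real.log n ^ 3) := by
      have h3 : (1 : ℝ) ≤ (c + 25) ^ 2 := by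
        have : (0 : ℝ) ≤ c := Nat.cast_nonneg _
        nlinarith
      have h4 := mul_le_mul_of_nonneg_right h3 (show 0 ≤ Real.log n ^ 3 by positivity)
      have h5 := mul_le_mul_of_nonneg_left hε1.le (show 0 ≤ Real.log n by linarith)
      linarith
    have := mul_le_mul_of_nonneg_right e3 hX0
    linarith
  have h12 : 0 ≤ (c + 25 : ℝ) ^ 2 * Real.log n ^ 3 * (C ^ 8 * X) := by positivity
  grind

/-- The adversary is fed with arbitrary values until it stops. For an oblivious one this produces
its only update sequence, independently of the algorithm. -/
theorem Adversary.IsLegal.exists_full (hadv : adv.IsLegal .incremental n l) (hl : IsEdgeList n l) :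
    ∃ U outs, adv.Plays U outs ∧ adv outs = none := by
  by_contra! H
  have key : ∀ k, ∃ U outs, adv.Plays U outs ∧ U.length = k := by
    intro k
    induction k with
    | zero => exact ⟨[], [0], ⟨rfl, by simp⟩, rfl⟩
    | succ k ih =>
      obtain ⟨U, outs, h1, h2⟩ := ih
      obtain ⟨e, he⟩ := Option.ne_none_iff_exists'.1 (H U outs h1)
      exact ⟨U ++ [e], outs ++ [0], h1.append he 0, by simp [h2]⟩
  obtain ⟨U, outs, h1, h2⟩ := key (n * n + 1)
  have h3 := (hadv U outs h1).1
  have := h3.length_after.1.trans (h3.maxEdges_le hl)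
  omega

theorem incAlg_time {ω : ℕ → Fin (2 ^ incAlg.wordLength n q)} (hB : IsTruncatedSSSP .incremental A)
    (hT : RunsInTotalTime .incremental A T) (hK : PolyGrowth C T) (h2 : 2 ≤ n) (hp : 0 < p) (hpq :
    p < q) (hl : IsEdgeList n l) (hadv : adv.IsLegal .incremental n l) (hob : adv.IsOblivious)
    {outs : List ℕ} (hU : adv.Plays U outs) (hUn : adv outs = none) (hω : ω ∉ incMiss A n p q
    (incAlg.wordLength n q) l U c) : ω ∈ incAlg.FinishesWithin .incremental A n p q l adv fun us =>
      (10001 * 200000 * (c + 25) ^ 2 + 64000) * C ^ 8 * Real.log n ^ 3 * radiusTimeBound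
        .incremental T n l us ((p : ℝ) / q) := by
  obtain ⟨hl1, hl2⟩ := hadv U outs hU
  have hC : IncCtx ⟨.incremental, A, incAlg.wordLength n q, ω⟩ n p q l U := ⟨ctx_of hB h2 hp hpq hl
    ω, rfl, hl1, hl2⟩
  obtain ⟨s₀, v₀, ρ, D, g₀, a1, a2, a3, a4, a5, hI, hρ, hD⟩ := inc_start (K := repBound c n) (B :=
    ballBound (c + 16) n) hC fun ρ D h h' => ⟨hC, min_le_left _ _, ballBound_le _ _, h, h',
    fun R h1 h3 h4 h5 h6 => R.good_of_notMem hω h1 h3 h4 h5 h6 hC.length_le⟩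
  obtain ⟨us, outs', s, r1, r2, r3, r4, v, g, i1, i2, i3, i4⟩ := exists_run (E := ⟨.incremental, A,
    incAlg.wordLength n q, ω⟩) (A := incAlg) (p := p) (q := q) (I := fun us _ s => us <+: U ∧ ∃ v g,
    SeenAs ⟨.incremental, A, incAlg.wordLength n q, ω⟩ (2 * l.length) s v ∧ Settled ⟨.incremental,
    A, incAlg.wordLength n q, ω⟩ n p q l U (repBound c n) (ballBound (c + 16) n) ρ D g us.length v ∧
    v.var .acc = 0 ∧ pot n v ≤ 2000 + 1000 * us.length) (mode := .incremental) rfl hadv hl ⟨s₀, a1,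
    List.nil_prefix, v₀, g₀, a2, a3, a4, by simpa using a5⟩ (by
    rintro us outs' s e b1 b2 ⟨b3, v, g, i1, i2, i3, i4⟩ b4 b5 b6
    have hlt : us.length < U.length := by
      by_contra h
      have := b3.eq_of_length (le_antisymm b3.length_le (Nat.le_of_not_lt h))
      subst this
      rw [hob outs' outs (b2.1.trans hU.1.symm), hUn] at b4
      grind
    have he : U[us.length] = e := by
      have := hU.2 us.length hlt
      rw [hob _ outs' (by have := hU.1; have := b2.1; simp; omega), b4, List.getElem?_eq_getElem hlt] at this
      simpa using this.symm
    obtain ⟨s', v', g', r1, r2, r3, r4, r5⟩ := inc_update hI hlt i1 i2 i3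
    rw [he] at r1
    refine ⟨s', r1, ?_, v', g', r2, by simpa using r3, r4, by simp; omega⟩
    rw [List.prefix_iff_eq_take.1 b3, ← he, List.take_concat_get']
    exact List.take_prefix _ _)
  -- The adversary stops at the same number of shown values in the actual run and in the fictitious
  -- one that defines `U`.
  have hus : us = U := by
    refine r4.eq_of_length (le_antisymm r4.length_le ?_)
    by_contra h
    have := hU.2 us.length (Nat.lt_of_not_le h)
    rw [hob _ outs' (by have := hU.1; have := r2.1; simp; omega), r3, List.getElem?_eq_getElem
      (Nat.lt_of_not_le h)] at this
    grind
  subst hus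
  refine ⟨us, outs', s, r1, r2, r3, ?_⟩
  obtain ⟨t4', t4⟩ := i2.cost_le hI hT hK hρ hD
  have t1 : (s.time : ℝ) ≤ (v.vt : ℝ) + (credit A v.sess : ℝ) := by exact_mod_cast i1.time
  have t2 : (v.vt : ℝ) ≤ 2000 + 1000 * us.length := by
    have h1 : v.vt ≤ pot n v := by
      have : 0 ≤ ∑ b ∈ Finset.range (v.var .a), ((n - v.arr 6 b : ℕ) : ℤ) := Finset.sum_nonneg fun _ _ => by positivity
      unfold pot
      split_ifs <;> omega
    exact_mod_cast h1.trans i4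
  have t3 := credit_le hT hK h2 hp hpq hl hl1 t4'
  have t5 := base_cost_le hB hT hK h2 hp hpq hl hl1 (hC.conn_at 0)
  have t6 := log_pos' h2
  set X := radiusTimeBound .incremental T n l us ((p : ℝ) / q)
  have t8 : (0 : ℝ) ≤ us.length := Nat.cast_nonneg _
  have t7 : 8 * C ^ 8 * Real.log n * X ≤ 32 * C ^ 8 * Real.log n ^ 3 * X := by
    have h1 : 0 ≤ 8 * C ^ 8 * Real.log n * X := le_trans (by positivity) t5
    have h2 : 0 ≤ 4 * Real.log n ^ 2 - 1 := by nlinarith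
    nlinarith [mul_nonneg h1 h2]
  grind

end inc

theorem mul_le_two_pow_wordLength {A : DynAlg} (h : A.wordConst = 20) {n q : ℕ} (hn : 2 ≤ n) :
    3 * n ≤ 2 ^ A.wordLength n q := by
  have h1 : n + q < 2 ^ Nat.size (n + q) := Nat.lt_size_self _
  have h2 : 4 ≤ 2 ^ (19 * Nat.size (n + q)) := by
    have : 1 ≤ Nat.size (n + q) := Nat.size_pos.2 (by omega)
    calc 4 = 2 ^ 2 := rfl
      _ ≤ _ := Nat.pow_le_pow_right (by norm_num) (by omega)
  rw [DynAlg.wordLength, h, show 20 * Nat.size (n + q) = 19 * Nat.size (n + q) + Nat.size (n + q) by ring, pow_add]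
  nlinarith

theorem mainTheorem9 (mode : UpdateMode) :
    ∃ (A : DynAlg) (d : ℕ), A.MaintainsRadius mode ∧
      ∀ (c : ℕ) (K : ℝ), ∃ C : ℝ,
        ∀ (B : BlackBox) (T : ℕ → ℕ → ℕ → ℝ → ℝ),
          IsTruncatedSSSP mode B → RunsInTotalTime mode B T → PolyGrowth K T →
        ∀ (n p q : ℕ) (l : List Edge), 2 ≤ n → 0 < p → p < q → IsEdgeList n l →
        ∀ adv : Adversary, adv.IsLegal mode n l →
          (mode = UpdateMode.incremental → adv.IsOblivious) →
          coinLaw (A.wordLength n q)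
              (A.FinishesWithin mode B n p q l adv fun us =>
                C * Real.log n ^ d * radiusTimeBound mode T n l us ((p : ℝ) / q))ᶜ
            ≤ ENNReal.ofReal (1 / (n : ℝ) ^ c) := by
  cases mode with
  | incremental =>
    -- Three logarithms: the number of rounds, the number of representatives in a round, and the
    -- bound on missed balls.
    refine ⟨incAlg, 3, incAlg_maintainsRadius, fun c K => ⟨(10001 * 200000 * (c + 25) ^ 2 + 64000) *
      K ^ 8, fun B T hB hT hK n p q l h2 hp hpq hl adv hadv hob => ?_⟩⟩
    obtain ⟨U, outs, hU, hUn⟩ := hadv.exists_full hl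
    refine (measure_mono ?_).trans (measure_incMiss_le (A := B) (p := p) (q := q) (l := l) (U := U)
      h2 (mul_le_two_pow_wordLength rfl h2) c)
    intro ω hω
    by_contra h
    exact hω (incAlg_time hB hT hK h2 hp hpq hl hadv (hob rfl) hU hUn h)
  | decremental =>
    -- Two logarithms suffice here, as each guess has only one vertex in the role of a
    -- representative.
    refine ⟨delAlg, 2, delAlg_maintainsRadius, fun c K => ⟨(10001 * 10800 * (c + 8) + 32000) * K ^
      8, fun B T hB hT hK n p q l h2 hp hpq hl adv hadv _ => ?_⟩⟩
    refine (measure_mono ?_).trans (measure_delMiss_le (B := B) (p := p) (q := q) (l := l) (adv :=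
      adv) h2 (by have := mul_le_two_pow_wordLength (A := delAlg) (q := q) rfl h2; omega) c)
    intro ω hω
    by_contra h
    exact hω (delAlg_time hB hT hK h2 hp hpq hl hadv h)
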